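/- **Theorem (Homogeneity of the mangrove forcing).** Let $V$ be a transitive (set or class) model of $\mathrm{ZFC}$ or, more generally, of $\mathrm{ZFC}^-$ ($\mathrm{ZFC}$ without Power Set, with Collection and with the well-ordering principle). Let $\kappa$ be an uncountable regular cardinal of $V$ and suppose that in $V$ every ordinal $\alpha<\kappa$ has a power set (this is automatic if $V\models\mathrm{ZFC}$). Let $\mathbb P_\kappa$ be the mangrove forcing at $\kappa$ as defined in $V$ (it may be a proper class of $V$), let $G$ be a $\mathbb P_\kappa$-generic filter over $V$, and let $p\in\mathbb P_\kappa$. Then there is $G'\subseteq V[G]$ such that $G'$ is a $\mathbb P_\kappa$-generic filter over $V$, $p\in G'$, and $V[G']=V[G]$. Here a filter $G$ on $\mathbb P_\kappa$ is generic over $V$ if it meets every dense subclass of $\mathbb P_\kappa$ that is definable over $(V,\in)$ with parameters (if $\mathbb P_\kappa\in V$ and $V\models\mathrm{ZFC}$: every dense $D\in V$), and $V[G]$ is the class of the evaluations by $G$ of the names in $V$. *Morass conditions.* For a pair of ordinals $x=\langle\alpha,\beta\rangle$ put $l(x)=\alpha$, $o(x)=\beta$. "Limit ordinal" means nonzero limit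 ordinal, and $A$ is unbounded in $\gamma$ if every $\delta<\gamma$ is exceeded by an element of $A\cap\gamma$. A $(\kappa,1)$-morass condition consists of a set $\mathcal S\subseteq((\lambda+1)\times\kappa)\cup(\{\kappa\}\times\kappa^+)$ for some $\lambda<\kappa$, a tree order $\prec$ on $\mathcal S$ (a strict partial order in which the predecessors of each element are well ordered), and functions $\pi_{xy}:o(x)+1\to o(y)+1$ for $x\prec y$ in $\mathcal S$, such that: 1. for each $\alpha\le\lambda$, $\theta_\alpha=\{\beta\mid\langle\alpha,\beta\rangle\in\mathcal S\}$ is an ordinal with $0<\theta_\alpha<\kappa$; the set $S=\{\beta\mid\langle\kappa,\beta\rangle\in\mathcal S\}$ contains $0$ and is closed under ordinal successors and predecessors; 2. if $f$ is the order-preserving bijection from the order type $\mathrm{ot}(S)$ to $S$, then $\mathrm{ot}(S)\le\theta_\lambda$ and $\langle\lambda,\nu\rangle\prec\langle\kappa,f(\nu)\rangle$ for all $\nu<\mathrm{ot}(S)$; 3. (Monotonicity) $x\prec y$ implies $l(x)<l(y)$; (Commutativity) $x\prec y\prec z$ implies $\pi_{yz}\circ\pi_{xy}=\pi_{xz}$;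 4. (M.1) if $x\prec y$, then $\pi_{xy}$ is strictly increasing, $\pi_{xy}(0)=0$, $\pi_{xy}(\gamma+1)=\pi_{xy}(\gamma)+1$ for $\gamma<o(x)$, $\pi_{xy}$ maps limit ordinals to limit ordinals, and $\pi_{xy}(o(x))=o(y)$; 5. (M.2) if $x\prec y$, $\nu<o(x)$, $w=\langle l(x),\nu\rangle$ and $z=\langle l(y),\pi_{xy}(\nu)\rangle$, then $w\prec z$ and $\pi_{wz}=\pi_{xy}\upharpoonright(\nu+1)$; 6. (M.3) for all $y\in\mathcal S$, $\{l(x)\mid x\prec y\}$ is closed in $l(y)$; 7. (M.4) for all $y\in\mathcal S$ with $l(y)\le\lambda$ and $o(y)+1\ne\theta_{l(y)}$, $\{l(x)\mid x\prec y\}$ is unbounded in $l(y)$; 8. (M.5) for all $y\in\mathcal S$, if $\{l(x)\mid x\prec y\}$ is unbounded in $l(y)$, then $o(y)=\bigcup_{x\prec y}\pi_{xy}[o(x)]$; 9. (M.6) if $y$ is an immediate $\prec$-successor of $x$, $l(y)\le\lambda$, $o(x)$ is a limit ordinal, $\nu=\sup\pi_{xy}[o(x)]$ and $z=\langle l(y),\nu\rangle$,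 then $x\prec z$ and $\pi_{xz}\upharpoonright o(x)=\pi_{xy}\upharpoonright o(x)$; 10. (M.7) if $y$ is an immediate $\prec$-successor of $x$, $l(y)\le\lambda$, $l(x)<\alpha<l(y)$, $o(x)$ is a limit ordinal, $o(y)=\sup\pi_{xy}[o(x)]$, and for every $\nu<o(x)$ there is $\gamma$ with $\langle\alpha,\gamma\rangle\prec\langle l(y),\pi_{xy}(\nu)\rangle$, then there is $\gamma$ with $\langle\alpha,\gamma\rangle\prec y$. The ordinal $\lambda=\lambda^p$ is determined by the condition $p$; components of $p$ are written $\mathcal S^p,\prec^p,\pi^p_{xy}$. An ordinal $\alpha\le\lambda^p$ is a *mangal* of $p$ if whenever $x\prec^p y$ and $l(x)<\alpha<l(y)$, there is $z\in\mathcal S^p$ with $l(z)=\alpha$ and $x\prec^p z\prec^p y$. *The mangrove forcing.* $\mathbb P_\kappa$ consists of the $(\kappa,1)$-morass conditions together with a maximum element $\mathbf 1$. For conditions, $q\le p$ means: $\mathcal S^p\subseteq\mathcal S^q$; $\mathcal S^p\cap((\lambda^p+1)\times\kappa)=\mathcal S^q\cap((\lambda^p+1)\times\kappa)$; $\prec^p={\prec^q}\upharpoonright\mathcal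 S^p$; $\pi^p_{xy}=\pi^q_{xy}$ whenever $x\prec^p y$; and $\lambda^p$ is a mangal of $q$. -/

import Mathlib

open Set

universe u

/-! ### Transitive models of set theory -/

/-- The only nonlogical symbol of the language of set theory: a binary relation symbol. -/
inductive SetRelSymb : ℕ → Type
  | mem : SetRelSymb 2

/-- The first-order language of set theory. -/
def setLang : FirstOrder.Language.{0, 0} where
  Functions := fun _ => Empty
  Relations := SetRelSymb

/-- A class `M` of sets as a structure for the language of set theory, with the true `∈`. -/
instance setStructure (M : Set ZFSet.{u}) : setLang.Structure M where
  funMap := fun f => Empty.elim f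
  RelMap := fun r => match r with
    | SetRelSymb.mem => fun v => ((v 0 : M) : ZFSet.{u}) ∈ ((v 1 : M) : ZFSet.{u})

/-- `D` is a class of the model `M`: a subclass of `M` that is first-order definable
over `(M, ∈)` with parameters from `M`. -/
def IsClassOf (M D : Set ZFSet.{u}) : Prop :=
  D ⊆ M ∧ (Set.univ : Set M).Definable₁ setLang {x : M | (x : ZFSet.{u}) ∈ D}

/-- `f` is an injective function from `a` to `b`. -/
def IsInjFunc (a b f : ZFSet.{u}) : Prop :=
  ZFSet.IsFunc a b f ∧
    ∀ x y z, ZFSet.pair x z ∈ f → ZFSet.pair y z ∈ f → x = y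

/-- `M` is a transitive class (possibly a set) which is a model of `ZFC⁻`, that is, of `ZFC`
without the Power Set axiom, with the Collection scheme and with Choice in the form
"every set can be well ordered". Extensionality and Foundation hold in every transitive class. -/
structure IsTransitiveModelZFCMinus (M : Set ZFSet.{u}) : Prop where
  transitive : ∀ x ∈ M, ∀ y ∈ x, y ∈ M
  pairing : ∀ x ∈ M, ∀ y ∈ M, ({x, y} : ZFSet.{u}) ∈ M
  union : ∀ x ∈ M, ZFSet.sUnion x ∈ M
  infinity : ZFSet.omega ∈ M
  separation : ∀ D, IsClassOf M D → ∀ a ∈ M, ZFSet.sep (fun x => x ∈ D) a ∈ M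
  collection : ∀ R : Set (M × M), (Set.univ : Set M).Definable₂ setLang R →
    ∀ a ∈ M, (∀ x : M, (x : ZFSet.{u}) ∈ a → ∃ y : M, (x, y) ∈ R) →
      ∃ b ∈ M, ∀ x : M, (x : ZFSet.{u}) ∈ a → ∃ y : M, (y : ZFSet.{u}) ∈ b ∧ (x, y) ∈ R
  choice : ∀ a ∈ M, ∃ α : Ordinal.{u}, α.toZFSet ∈ M ∧ ∃ f ∈ M, IsInjFunc a α.toZFSet f

/-- `M ⊨` "the power set of `a` exists". -/
def HasPowersetIn (M : Set ZFSet.{u}) (a : ZFSet.{u}) : Prop :=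
  ∃ b ∈ M, ∀ x, x ∈ b ↔ x ∈ M ∧ x ⊆ a

/-- `M ⊨` "`κ` is an uncountable regular cardinal": `κ > ω`, and in `M` every function from an
ordinal less than `κ` to `κ` is bounded below `κ`. -/
def IsRegularUncountableIn (M : Set ZFSet.{u}) (κ : Ordinal.{u}) : Prop :=
  κ.toZFSet ∈ M ∧ Ordinal.omega0 < κ ∧
    ∀ α < κ, ∀ f ∈ M, ZFSet.IsFunc α.toZFSet κ.toZFSet f →
      ∃ γ < κ, ∀ ξ η : Ordinal.{u}, ZFSet.pair ξ.toZFSet η.toZFSet ∈ f → η < γ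

/-- `κ⁺` as computed in `M`, as the set of its elements: the ordinals of `M` that `M` can inject
into `κ`. (If `κ` is the largest cardinal of `M`, these are all ordinals of `M`.) -/
def succCardIn (M : Set ZFSet.{u}) (κ : Ordinal.{u}) : Set Ordinal.{u} :=
  {β | β.toZFSet ∈ M ∧ ∃ f ∈ M, IsInjFunc β.toZFSet κ.toZFSet f}

/-! ### Morass conditions -/

/-- A node `⟨α, β⟩`, of level `α` and order `β`. -/
abbrev MorassNode := Ordinal.{u} × Ordinal.{u}

/-- The set coding a node: the Kuratowski pair of two von Neumann ordinals. -/
noncomputable def nodeCode (x : MorassNode.{u}) : ZFSet.{u} :=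
  ZFSet.pair x.1.toZFSet x.2.toZFSet

/-- The raw data of a morass condition: the set of nodes, the tree order as a set of pairs of
nodes, and the family of maps `π_xy` as a set of pairs `⟨⟨x, y⟩, π_xy⟩`. -/
structure MorassData where
  carrier : ZFSet.{u}
  tree : ZFSet.{u}
  maps : ZFSet.{u}

namespace MorassData

/-- The triple `⟨𝒮, ≺, π⟩` as a single set. -/
def code (p : MorassData.{u}) : ZFSet.{u} :=
  ZFSet.pair p.carrier (ZFSet.pair p.tree p.maps)

variable (κ : Ordinal.{u}) (p q : MorassData.{u})

/-- `x ∈ 𝒮`. -/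
def Mem (x : MorassNode.{u}) : Prop := nodeCode x ∈ p.carrier

/-- `x ≺ y`. -/
def Lt (x y : MorassNode.{u}) : Prop := ZFSet.pair (nodeCode x) (nodeCode y) ∈ p.tree

/-- `y` is an immediate `≺`-successor of `x`. -/
def ImmLt (x y : MorassNode.{u}) : Prop := p.Lt x y ∧ ¬ ∃ z, p.Lt x z ∧ p.Lt z y

/-- The value `π_xy(ν)`; see `WellFormed` for the fact that `π_xy` is a function. -/
noncomputable def π (x y : MorassNode.{u}) (ν : Ordinal.{u}) : Ordinal.{u} :=
  sInf {μ | ∃ f, ZFSet.pair (ZFSet.pair (nodeCode x) (nodeCode y)) f ∈ p.maps ∧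
    ZFSet.pair ν.toZFSet μ.toZFSet ∈ f}

/-- `𝒮` is a set of pairs of ordinals, `≺` is a relation on `𝒮`, and `π` is a family of functions
`π_xy : o(x) + 1 → o(y) + 1` indexed by the pairs `x ≺ y`. -/
structure WellFormed : Prop where
  carrier_nodes : ∀ z ∈ p.carrier, ∃ x, z = nodeCode x
  tree_pairs : ∀ z ∈ p.tree, ∃ x y, p.Mem x ∧ p.Mem y ∧
    z = ZFSet.pair (nodeCode x) (nodeCode y)
  maps_pairs : ∀ z ∈ p.maps, ∃ x y f, p.Lt x y ∧
    ZFSet.IsFunc (x.2 + 1).toZFSet (y.2 + 1).toZFSet f ∧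
    z = ZFSet.pair (ZFSet.pair (nodeCode x) (nodeCode y)) f
  maps_total : ∀ x y, p.Lt x y →
    ∃! f, ZFSet.pair (ZFSet.pair (nodeCode x) (nodeCode y)) f ∈ p.maps

/-- `≺` is a tree order: a strict partial order in which the predecessors of each element are
well ordered. -/
structure IsTreeOrder : Prop where
  irrefl : ∀ x, ¬ p.Lt x x
  trans : ∀ x y z, p.Lt x y → p.Lt y z → p.Lt x z
  wellOrder : ∀ y, IsWellOrder {x // p.Lt x y} (fun a b => p.Lt a.1 b.1)

/-- `λ^p`, the largest level of `p` below `κ`. -/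
noncomputable def lam : Ordinal.{u} := sSup {α | α < κ ∧ ∃ β, p.Mem (α, β)}

/-- `θ_α`: if `{β | ⟨α, β⟩ ∈ 𝒮}` is an ordinal, this is that ordinal. -/
noncomputable def theta (α : Ordinal.{u}) : Ordinal.{u} := sInf {β | ¬ p.Mem (α, β)}

/-- `S^p`, the set of orders of the nodes at level `κ`. -/
def top : Set Ordinal.{u} := {β | p.Mem (κ, β)}

/-- `{l(x) | x ≺ y}` is unbounded in `l(y)`. -/
def UnboundedBelow (y : MorassNode.{u}) : Prop := ∀ δ < y.1, ∃ x, p.Lt x y ∧ δ < x.1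

/-- `g` restricted to `α + 1` is a successor, limit, zero and order preserving function. -/
structure IsSloop (g : Ordinal.{u} → Ordinal.{u}) (α : Ordinal.{u}) : Prop where
  succ : ∀ γ < α, g (γ + 1) = g γ + 1
  limit : ∀ γ ≤ α, Order.IsSuccLimit γ → Order.IsSuccLimit (g γ)
  zero : g 0 = 0
  strictMono : ∀ δ ≤ α, ∀ γ < δ, g γ < g δ

/-- `α` is a mangal of `p`. -/
def IsMangal (α : Ordinal.{u}) : Prop :=
  α ≤ p.lam κ ∧ ∀ x y, p.Lt x y → x.1 < α → α < y.1 →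
    ∃ z : MorassNode.{u}, z.1 = α ∧ p.Lt x z ∧ p.Lt z y

/-- `p` is a `(κ, 1)`-morass condition, where `K` is the set of ordinals below `κ⁺`.
Left-alignment at level `λ` makes that level nonempty, so that the `λ` for which
the requirements hold can only be `p.lam κ`. -/
structure IsCondition (K : Set Ordinal.{u}) : Prop where
  wellFormed : p.WellFormed
  lam_lt : p.lam κ < κ
  nodes : ∀ x, p.Mem x → (x.1 ≤ p.lam κ ∧ x.2 < κ) ∨ (x.1 = κ ∧ x.2 ∈ K)
  treeOrder : p.IsTreeOrder
  leftAligned : ∀ α ≤ p.lam κ, 0 < p.theta α ∧ p.theta α < κ ∧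
    ∀ β, p.Mem (α, β) ↔ β < p.theta α
  top_zero : 0 ∈ p.top κ
  top_succ : ∀ β, β ∈ p.top κ ↔ β + 1 ∈ p.top κ
  -- The strictly increasing `f` below enumerates the top set, so `γ` is its order type.
  top_enum : ∃ γ ≤ p.theta (p.lam κ), ∃ f : Ordinal.{u} → Ordinal.{u},
    StrictMonoOn f (Iio γ) ∧ f '' Iio γ = p.top κ ∧ ∀ ν < γ, p.Lt (p.lam κ, ν) (κ, f ν)
  monotone : ∀ x y, p.Lt x y → x.1 < y.1
  commutative : ∀ x y z, p.Lt x y → p.Lt y z →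
    ∀ ν ≤ x.2, p.π y z (p.π x y ν) = p.π x z ν
  m1 : ∀ x y, p.Lt x y → IsSloop (p.π x y) x.2 ∧ p.π x y x.2 = y.2
  m2 : ∀ x y, p.Lt x y → ∀ ν < x.2, p.Lt (x.1, ν) (y.1, p.π x y ν) ∧
    ∀ ξ ≤ ν, p.π (x.1, ν) (y.1, p.π x y ν) ξ = p.π x y ξ
  m3 : ∀ y, p.Mem y → ∀ γ < y.1, 0 < γ →
    (∀ δ < γ, ∃ x, p.Lt x y ∧ δ < x.1 ∧ x.1 < γ) → ∃ x, p.Lt x y ∧ x.1 = γ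
  m4 : ∀ y, p.Mem y → y.1 ≤ p.lam κ → y.2 + 1 ≠ p.theta y.1 → p.UnboundedBelow y
  m5 : ∀ y, p.Mem y → p.UnboundedBelow y →
    ∀ ξ, ξ < y.2 ↔ ∃ x, p.Lt x y ∧ ∃ ν < x.2, p.π x y ν = ξ
  m6 : ∀ x y, p.ImmLt x y → y.1 ≤ p.lam κ → Order.IsSuccLimit x.2 →
    p.Lt x (y.1, sSup (p.π x y '' Iio x.2)) ∧
      ∀ ξ < x.2, p.π x (y.1, sSup (p.π x y '' Iio x.2)) ξ = p.π x y ξ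
  m7 : ∀ x y, p.ImmLt x y → y.1 ≤ p.lam κ → ∀ α, x.1 < α → α < y.1 →
    Order.IsSuccLimit x.2 → y.2 = sSup (p.π x y '' Iio x.2) →
    (∀ ν < x.2, ∃ γ, p.Lt (α, γ) (y.1, p.π x y ν)) → ∃ γ, p.Lt (α, γ) y

/-- `q ≤ p` in the mangrove forcing, for morass conditions `q` and `p`. -/
structure Extends : Prop where
  subset : ∀ x, p.Mem x → q.Mem x
  nodes_eq : ∀ x : MorassNode.{u}, x.1 ≤ p.lam κ → x.2 < κ → (p.Mem x ↔ q.Mem x)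
  lt_eq : ∀ x y, p.Lt x y ↔ p.Mem x ∧ p.Mem y ∧ q.Lt x y
  maps_eq : ∀ x y, p.Lt x y → ∀ ν ≤ x.2, p.π x y ν = q.π x y ν
  mangal : q.IsMangal κ (p.lam κ)

end MorassData

/-! ### The mangrove forcing of a model, generic filters and generic extensions -/

/-- The underlying class of the mangrove forcing `ℙ_κ` of the model `M`: the morass conditions
lying in `M`, and an extra point, coded by `∅`, which acts as the maximum element. -/
def mangroveForcing (M : Set ZFSet.{u}) (κ : Ordinal.{u}) : Set ZFSet.{u} :=
  {z | z ∈ M ∧ (z = ∅ ∨ ∃ p : MorassData.{u}, p.IsCondition κ (succCardIn M κ) ∧ z = p.code)}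

/-- The order `z ≤ w` of the mangrove forcing: `w` is the maximum element, or both are morass
conditions and `z` extends `w`. -/
def mangroveLE (κ : Ordinal.{u}) (z w : ZFSet.{u}) : Prop :=
  w = ∅ ∨ ∃ q p : MorassData.{u}, z = q.code ∧ w = p.code ∧ MorassData.Extends κ p q

/-- `D` is a dense subclass of the partial order `(P, le)`. -/
def IsDenseIn (P : Set ZFSet.{u}) (le : ZFSet.{u} → ZFSet.{u} → Prop) (D : Set ZFSet.{u}) : Prop :=
  D ⊆ P ∧ ∀ p ∈ P, ∃ d ∈ D, le d p

/-- `G` is a `(P, le)`-generic filter over the model `M`: a filter on `P` that meets every dense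
subclass of `P` which is a class of `M`. (If `P` is a set of `M`, the latter are exactly the
dense subsets of `P` which are elements of `M`, by Separation in `M`.) -/
structure IsGeneric (M P : Set ZFSet.{u}) (le : ZFSet.{u} → ZFSet.{u} → Prop)
    (G : Set ZFSet.{u}) : Prop where
  subset : G ⊆ P
  nonempty : G.Nonempty
  upward : ∀ p ∈ G, ∀ q ∈ P, le p q → q ∈ G
  directed : ∀ p ∈ G, ∀ q ∈ G, ∃ r ∈ G, le r p ∧ le r q
  generic : ∀ D, IsClassOf M D → IsDenseIn P le D → (G ∩ D).Nonempty

theorem rank_lt_of_pair_mem {σ q τ : ZFSet.{u}} (h : ZFSet.pair σ q ∈ τ) :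
    σ.rank < τ.rank := by
  have h1 : σ ∈ ({σ} : ZFSet.{u}) := ZFSet.mem_singleton.2 rfl
  have h2 : ({σ} : ZFSet.{u}) ∈ ZFSet.pair σ q := by simp [ZFSet.pair]
  exact ((ZFSet.rank_lt_of_mem h1).trans (ZFSet.rank_lt_of_mem h2)).trans
    (ZFSet.rank_lt_of_mem h)

/-- The evaluation of the name `τ` by `G`: the set `{val G σ | ∃ q ∈ G, ⟨σ, q⟩ ∈ τ}`. Every set
is regarded as a name, elements of `τ` which are not pairs `⟨σ, q⟩` with `q ∈ G` being
disregarded. -/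
noncomputable def nameVal (G : Set ZFSet.{u}) (τ : ZFSet.{u}) : ZFSet.{u} :=
  ZFSet.range (fun z : {z : τ // ∃ σ, ∃ q ∈ G, ZFSet.pair σ q = z.1} =>
    nameVal G z.2.choose)
termination_by τ.rank
decreasing_by
  obtain ⟨q, -, hq⟩ := z.2.choose_spec
  exact rank_lt_of_pair_mem (q := q) ((congrArg (· ∈ τ) hq).mpr z.1.2)

theorem mem_nameVal {G : Set ZFSet.{u}} {τ y : ZFSet.{u}} :
    y ∈ nameVal G τ ↔ ∃ σ, ∃ q ∈ G, ZFSet.pair σ q ∈ τ ∧ y = nameVal G σ := by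
  rw [nameVal, ZFSet.mem_range]
  constructor
  · rintro ⟨z, rfl⟩
    obtain ⟨q, hG, hq⟩ := z.2.choose_spec
    exact ⟨_, q, hG, (congrArg (· ∈ τ) hq).mpr z.1.2, rfl⟩
  · rintro ⟨σ, q, hG, hq, rfl⟩
    let z : {z : τ // ∃ σ, ∃ q ∈ G, ZFSet.pair σ q = z.1} :=
      ⟨⟨ZFSet.pair σ q, hq⟩, σ, q, hG, rfl⟩
    refine ⟨z, ?_⟩
    obtain ⟨q', -, hq'⟩ := z.2.choose_spec
    have h : z.2.choose = σ := (ZFSet.pair_injective hq').1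
    rw [h]

/-- The generic extension `M[G]`: the class of the evaluations by `G` of the names in `M`. -/
def genericExtension (M G : Set ZFSet.{u}) : Set ZFSet.{u} := nameVal G '' M

/-! Call two conditions twins if they have the same last level λ, the same θ_λ and the same set S of
orders at level κ. For twins a and b the cones below a and below b are isomorphic: in a condition r
≤ a the levels below λ are exchanged for those of b. Since λ is a mangal of r, every relation of r
across λ factors through a node of level λ, and so does its map. Hence the part of r from level λ on
does not depend on what lies below, and it fits onto b as it fitted onto a (`exists_isSwap`); the
exchange preserves the order (`IsSwap.extends`). The morass axioms for the result are a case of a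
general gluing lemma, `IsGlue.isCondition`: a condition, taken up to its last level, may be
continued by any system that satisfies the axioms from that level on.

Any two conditions have twin extensions (`exists_twins`). Both are extended to a common last level Λ
with level κ equal to the union of their tops. A new level α gets the nodes ⟨α, o⟩ with o ≤ `limRank
α`, where `limRank` is the rank of iterated limits, and the nodes of equal o form a branch with
identity maps. M.3 and M.4 hold because o < `limRank γ` means that levels of rank at least o are
unbounded in γ. The nodes of the old last level are attached to the branches by the collapse of the
old top in the new one. A level Λ < κ of sufficient rank exists since κ is regular and uncountable
(`exists_limRank_ge`).

By density some a in G has a twin b ≤ p, and G' is generated by the images of the elements of G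
below a. It contains b, hence p, and it is generic because the exchange is definable over the model
and pulls dense classes back to dense classes. For V[G'] = V[G], names are translated by recursion,
each condition s in a name being replaced by conditions r that the exchange sends below s. If the
forcing is a proper class, all such r need not form a set. It suffices, however, to use those r
whose level κ is bounded by the tops of a and s: any other r in G can be cut down (`IsCut`), which
weakens it and so keeps it in G, and the bounded conditions form a set because the ordinals below κ
have power sets (`exists_bounded_conditions`). The other inclusion follows by exchanging back.

All constructions have to be internal to a model of ZFC⁻. `Dfn M F` says that F preserves M and is
definable there; its closure properties are instances, so that definability of an explicit formula
is found by instance search, and recursion in M is proved once, in `dfn_rec`. The cardinal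
arithmetic at κ, with no Power Set axiom, rests on the notions `SmallIn` and `SizedIn`. -/

set_option linter.unusedSectionVars false
set_option linter.unusedVariables false
set_option synthInstance.maxSize 100000
set_option synthInstance.maxHeartbeats 400000

/-! ### Definability over a transitive class -/

section Base
variable {M : Set ZFSet.{u}} {n : ℕ}

/-- The relation `φ` on tuples is first-order definable over `(M, ∈)` with parameters. -/
def Dn (φ : (Fin n → M) → Prop) : Prop := (univ : Set M).Definable setLang {v | φ v}

theorem Dn.and {φ ψ : (Fin n → M) → Prop} (h : Dn φ) (h' : Dn ψ) : Dn fun v => φ v ∧ ψ v :=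
  Definable.inter h h'
theorem Dn.or {φ ψ : (Fin n → M) → Prop} (h : Dn φ) (h' : Dn ψ) : Dn fun v => φ v ∨ ψ v :=
  Definable.union h h'
theorem Dn.not {φ : (Fin n → M) → Prop} (h : Dn φ) : Dn fun v => ¬ φ v :=
  Definable.compl h
theorem Dn.congr {φ ψ : (Fin n → M) → Prop} (h : Dn φ) (e : ∀ v, ψ v ↔ φ v) : Dn ψ := by
  have : ψ = φ := funext fun v => propext (e v)
  rwa [this]
theorem Dn.imp {φ ψ : (Fin n → M) → Prop} (h : Dn φ) (h' : Dn ψ) : Dn fun v => φ v → ψ v :=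
  (h.not.or h').congr fun _ => imp_iff_not_or
theorem Dn.iff {φ ψ : (Fin n → M) → Prop} (h : Dn φ) (h' : Dn ψ) : Dn fun v => (φ v ↔ ψ v) :=
  ((h.imp h').and (h'.imp h)).congr fun _ => iff_iff_implies_and_implies
theorem Dn.reindex {m : ℕ} {φ : (Fin n → M) → Prop} (h : Dn φ) (f : Fin n → Fin m) :
    Dn fun v => φ (v ∘ f) :=
  Definable.preimage_comp f h
theorem Dn.ex {φ : (Fin (n + 1) → M) → Prop} (h : Dn φ) :
    Dn fun v : Fin n → M => ∃ x, φ (Fin.cons x v) := by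
  have h2 : Dn fun v : Fin n → M => v ∈ (fun w : Fin (n + 1) → M => w ∘ Fin.succ) '' {w | φ w} :=
    Definable.image_comp h Fin.succ
  refine h2.congr fun v => ⟨fun ⟨x, hx⟩ => ⟨_, hx, ?_⟩, ?_⟩
  · funext i; simp
  · rintro ⟨w, hw, rfl⟩
    refine ⟨w 0, ?_⟩
    have : (Fin.cons (w 0) (w ∘ Fin.succ) : Fin (n + 1) → M) = w := Fin.cons_self_tail w
    rw [this]; exact hw
theorem Dn.all {φ : (Fin (n + 1) → M) → Prop} (h : Dn φ) :
    Dn fun v : Fin n → M => ∀ x, φ (Fin.cons x v) :=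
  h.not.ex.not.congr fun v => by simp
theorem Dn.eqc (i : Fin n) (c : M) : Dn fun v : Fin n → M => v i = c := by
  refine ⟨FirstOrder.Language.Term.equal (FirstOrder.Language.Term.var i)
    (FirstOrder.Language.Constants.term
      ((setLang.con (⟨c, mem_univ c⟩ : (univ : Set M))))), ?_⟩
  ext v
  simp [FirstOrder.Language.Formula.realize_equal]
theorem Dn.eq (i j : Fin n) : Dn fun v : Fin n → M => v i = v j := by
  refine ⟨FirstOrder.Language.Term.equal (FirstOrder.Language.Term.var i)
    (FirstOrder.Language.Term.var j), ?_⟩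
  ext v
  simp [FirstOrder.Language.Formula.realize_equal]
theorem Dn.mem (i j : Fin n) : Dn fun v : Fin n → M => (v i : ZFSet.{u}) ∈ (v j : ZFSet.{u}) := by
  refine Definable.mono ((empty_definable_iff).2 ⟨FirstOrder.Language.Relations.formula₂
    (L := setLang) SetRelSymb.mem (FirstOrder.Language.Term.var i)
    (FirstOrder.Language.Term.var j), ?_⟩) (empty_subset _)
  ext v
  rfl

end Base

/-! ### Coding of objects by sets, and definable functions -/

/-- Types whose elements are coded by sets. -/
class Coded.{w} (X : Type w) where
  code : X → ZFSet.{u}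
  code_inj : Function.Injective code

theorem code_injective {X : Type*} [Coded.{u} X] : Function.Injective (Coded.code : X → ZFSet.{u}) :=
  Coded.code_inj

noncomputable instance : Coded.{u} ZFSet.{u} := ⟨fun x => x, fun _ _ h => h⟩
noncomputable instance : Coded.{u} Ordinal.{u} := ⟨Ordinal.toZFSet, Ordinal.toZFSet_injective⟩
-- Truth values are coded by `{∅}` and `∅`, so that predicates are special functions and `Dfn`
-- treats both at once.
open Classical in
noncomputable instance : Coded.{u} Prop := ⟨fun p => if p then {∅} else ∅, fun p q h => by
  have h1 : ({∅} : ZFSet.{u}) ≠ ∅ := fun e => ZFSet.notMem_empty _ (e ▸ ZFSet.mem_singleton.2 rfl)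
  by_cases hp : p <;> by_cases hq : q <;> simp_all [h1.symm]⟩
noncomputable instance {X Y : Type*} [Coded.{u} X] [Coded.{u} Y] : Coded.{u} (X × Y) :=
  ⟨fun z => ZFSet.pair (Coded.code z.1) (Coded.code z.2), fun z w h => by
    obtain ⟨h1, h2⟩ := ZFSet.pair_injective h
    exact Prod.ext (code_injective h1) (code_injective h2)⟩
noncomputable instance : Coded.{u} MorassData.{u} := ⟨MorassData.code, fun p q h => by
  obtain ⟨h1, h2⟩ := ZFSet.pair_injective h
  obtain ⟨h2, h3⟩ := ZFSet.pair_injective h2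
  cases p; cases q; simp_all⟩

/-- The code of `x` lies in `M`. -/
class InM (M : Set ZFSet.{u}) {X : Type*} [Coded.{u} X] (x : X) : Prop where
  mem : Coded.code x ∈ M

/-- `F` maps `M` to `M` and its restriction to `M` is definable over `M`. -/
class Dfn (M : Set ZFSet.{u}) {X Y : Type*} [Coded.{u} X] [Coded.{u} Y] (F : X → Y) : Prop where
  inM : ∀ x, InM M x → InM M (F x)
  graph : Dn fun v : Fin 2 → M => ∃ x, (v 0 : ZFSet.{u}) = Coded.code x ∧
    (v 1 : ZFSet.{u}) = Coded.code (F x)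

/-- The codes of elements of `X` in `M` form a class of `M`. -/
class CodedIn (M : Set ZFSet.{u}) (X : Type*) [Coded.{u} X] : Prop where
  dom : Dn fun v : Fin 1 → M => ∃ x : X, (v 0 : ZFSet.{u}) = Coded.code x

/-! ### Closure of the model under pairing; basic definable functions -/

section Closure
variable {M : Set ZFSet.{u}} [hM : Fact (IsTransitiveModelZFCMinus M)]
variable {X Y Z W : Type*} [Coded.{u} X] [Coded.{u} Y] [Coded.{u} Z] [Coded.{u} W]

theorem mem_trans_M {x y : ZFSet.{u}} (hx : x ∈ M) (hy : y ∈ x) : y ∈ M :=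
  hM.out.transitive x hx y hy

theorem upair_mem_M {x y : ZFSet.{u}} (hx : x ∈ M) (hy : y ∈ M) : ({x, y} : ZFSet.{u}) ∈ M :=
  hM.out.pairing x hx y hy

theorem singleton_mem_M {x : ZFSet.{u}} (hx : x ∈ M) : ({x} : ZFSet.{u}) ∈ M := by
  simpa using upair_mem_M hx hx

theorem pair_mem_M_iff {x y : ZFSet.{u}} : ZFSet.pair x y ∈ M ↔ x ∈ M ∧ y ∈ M := by
  refine ⟨fun h => ?_, fun h => upair_mem_M (singleton_mem_M h.1) (upair_mem_M h.1 h.2)⟩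
  have h1 : ({x, y} : ZFSet.{u}) ∈ M := mem_trans_M h (by simp [ZFSet.pair])
  exact ⟨mem_trans_M h1 (by simp), mem_trans_M h1 (by simp)⟩

theorem empty_mem_M : (∅ : ZFSet.{u}) ∈ M := mem_trans_M hM.out.infinity ZFSet.omega_zero

theorem inM_def {x : X} : InM M x ↔ Coded.code x ∈ M := ⟨fun h => h.1, fun h => ⟨h⟩⟩

theorem inM_prod {x : X × Y} : InM M x ↔ InM M x.1 ∧ InM M x.2 := by
  simp only [inM_def]; exact pair_mem_M_iff

instance inM_prop (p : Prop) : InM M p := ⟨by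
  by_cases hp : p
  · simpa [Coded.code, hp] using singleton_mem_M empty_mem_M
  · simpa [Coded.code, hp] using empty_mem_M⟩

theorem code_true {p : Prop} (hp : p) : (Coded.code p : ZFSet.{u}) = {∅} := by
  simp [Coded.code, hp]
theorem code_false {p : Prop} (hp : ¬ p) : (Coded.code p : ZFSet.{u}) = ∅ := by
  simp [Coded.code, hp]
theorem code_prop_iff {p : Prop} : (Coded.code p : ZFSet.{u}) = {∅} ↔ p := by
  rw [← code_true trivial, code_injective.eq_iff]; simp

theorem dn_upair : Dn fun v : Fin 3 → M => (v 0 : ZFSet.{u}) = {(v 1 : ZFSet.{u}), (v 2 : ZFSet.{u})} := by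
  have h : Dn fun w : Fin 4 → M => ((w 0 : ZFSet.{u}) ∈ (w 1 : ZFSet.{u}) ↔ w 0 = w 2 ∨ w 0 = w 3) :=
    (Dn.mem 0 1).iff ((Dn.eq 0 2).or (Dn.eq 0 3))
  refine h.all.congr fun v => ⟨fun e x => ?_, fun e => ?_⟩
  · change (x : ZFSet.{u}) ∈ (v 0 : ZFSet.{u}) ↔ x = v 1 ∨ x = v 2
    rw [e, ZFSet.mem_pair, Subtype.ext_iff, Subtype.ext_iff]
  · have e' : ∀ x : M, (x : ZFSet.{u}) ∈ (v 0 : ZFSet.{u}) ↔ x = v 1 ∨ x = v 2 := e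
    ext z
    rw [ZFSet.mem_pair]
    constructor
    · intro hz
      have := (e' ⟨z, mem_trans_M (v 0).2 hz⟩).1 hz
      rwa [Subtype.ext_iff, Subtype.ext_iff] at this
    · rintro (rfl | rfl)
      · exact (e' (v 1)).2 (Or.inl rfl)
      · exact (e' (v 2)).2 (Or.inr rfl)

theorem dn_pair : Dn fun v : Fin 3 → M => (v 0 : ZFSet.{u}) = ZFSet.pair (v 1) (v 2) := by
  have h : Dn fun w : Fin 5 → M => (((w 0 : ZFSet.{u}) = {(w 3 : ZFSet.{u}), (w 3 : ZFSet.{u})}) ∧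
      (w 1 : ZFSet.{u}) = {(w 3 : ZFSet.{u}), (w 4 : ZFSet.{u})}) ∧
      (w 2 : ZFSet.{u}) = {(w 0 : ZFSet.{u}), (w 1 : ZFSet.{u})} :=
    ((dn_upair.reindex ![0, 3, 3]).and (dn_upair.reindex ![1, 3, 4])).and
      (dn_upair.reindex ![2, 0, 1])
  refine h.ex.ex.congr fun v => ⟨fun e => ?_, ?_⟩
  · refine ⟨⟨_, upair_mem_M (v 1).2 (v 2).2⟩, ⟨_, singleton_mem_M (v 1).2⟩, ⟨?_, rfl⟩, e⟩
    change ({(v 1 : ZFSet.{u})} : ZFSet.{u}) = {(v 1 : ZFSet.{u}), (v 1 : ZFSet.{u})}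
    simp
  · rintro ⟨t, s, ⟨h1, h2⟩, h3⟩
    change (s : ZFSet.{u}) = {(v 1 : ZFSet.{u}), (v 1 : ZFSet.{u})} at h1
    change (t : ZFSet.{u}) = {(v 1 : ZFSet.{u}), (v 2 : ZFSet.{u})} at h2
    change (v 0 : ZFSet.{u}) = {(s : ZFSet.{u}), (t : ZFSet.{u})} at h3
    rw [h3, h1, h2]; simp [ZFSet.pair]

theorem Dfn.comp {F : Y → Z} {G : X → Y} (hF : Dfn M F) (hG : Dfn M G) :
    Dfn M fun x => F (G x) where
  inM x hx := hF.inM _ (hG.inM _ hx)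
  graph := by
    have h := ((hG.graph.reindex (m := 3) ![1, 0]).and (hF.graph.reindex (m := 3) ![0, 2])).ex
    refine h.congr fun v => ⟨?_, ?_⟩
    · rintro ⟨x, h1, h2⟩
      have hG' : InM M (G x) := hG.inM x ⟨h1 ▸ (v 0).2⟩
      exact ⟨⟨_, hG'.1⟩, ⟨x, h1, rfl⟩, ⟨_, rfl, h2⟩⟩
    · rintro ⟨k, ⟨x, h1, h2⟩, ⟨y, h3, h4⟩⟩
      cases code_injective (h2.symm.trans h3)
      exact ⟨x, h1, h4⟩

/-- The graph of a predicate has value `{∅}` on its extension and `∅` on the rest of the domain. The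
domain itself has to be a class of `M` for the second half, which is the role of `CodedIn`. -/
theorem dfn_prop_iff {R : X → Prop} [hX : CodedIn M X] :
    Dfn M R ↔ Dn fun v : Fin 1 → M => ∃ x, (v 0 : ZFSet.{u}) = Coded.code x ∧ R x := by
  constructor
  · intro h
    have h2 := ((h.graph.reindex (m := 2) ![1, 0]).and
      (Dn.eqc 0 (⟨{∅}, singleton_mem_M empty_mem_M⟩ : M))).ex
    refine h2.congr fun v => ⟨?_, ?_⟩
    · rintro ⟨x, h1, h2⟩
      exact ⟨⟨{∅}, singleton_mem_M empty_mem_M⟩, ⟨x, h1, (code_true h2).symm⟩, rfl⟩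
    · rintro ⟨k, ⟨x, h1, h2⟩, h3⟩
      change (k : ZFSet.{u}) = Coded.code (R x) at h2
      change k = _ at h3
      rw [h3] at h2
      exact ⟨x, h1, code_prop_iff.1 h2.symm⟩
  · intro h
    refine ⟨fun _ _ => inferInstance, ?_⟩
    have h2 := ((h.reindex (m := 2) ![0]).and
      (Dn.eqc 1 (⟨{∅}, singleton_mem_M empty_mem_M⟩ : M))).or
      (((hX.dom.reindex (m := 2) ![0]).and (h.reindex (m := 2) ![0]).not).and
      (Dn.eqc 1 (⟨∅, empty_mem_M⟩ : M)))
    refine h2.congr fun v => ⟨?_, ?_⟩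
    · rintro ⟨x, h1, h2⟩
      by_cases hR : R x
      · exact Or.inl ⟨⟨x, h1, hR⟩, Subtype.ext (h2.trans (code_true hR))⟩
      · refine Or.inr ⟨⟨⟨x, h1⟩, ?_⟩, Subtype.ext (h2.trans (code_false hR))⟩
        rintro ⟨y, h3, h4⟩
        cases code_injective (h1.symm.trans h3)
        exact hR h4
    · rintro (⟨⟨x, h1, h2⟩, h3⟩ | ⟨⟨⟨x, h1⟩, h2⟩, h3⟩)
      · exact ⟨x, h1, by rw [h3, code_true h2]⟩
      · refine ⟨x, h1, ?_⟩
        rw [h3, code_false fun hR => h2 ⟨x, h1, hR⟩]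

theorem Dfn.congr {F G : X → Y} (h : Dfn M F) (e : ∀ x, InM M x → G x = F x) : Dfn M G where
  inM x hx := by rw [e x hx]; exact h.inM x hx
  graph := h.graph.congr fun v => by
    constructor
    · rintro ⟨x, h1, h2⟩
      exact ⟨x, h1, by rw [h2, e x ⟨h1 ▸ (v 0).2⟩]⟩
    · rintro ⟨x, h1, h2⟩
      exact ⟨x, h1, by rw [h2, e x ⟨h1 ▸ (v 0).2⟩]⟩

instance (priority := 90) dfn_const [hX : CodedIn M X] (c : Y) [hc : InM M c] : Dfn M fun _ : X => c where
  inM _ _ := hc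
  graph := ((hX.dom.reindex ![0]).and (Dn.eqc 1 ⟨_, hc.1⟩)).congr fun v => by
    constructor
    · rintro ⟨x, h1, h2⟩
      exact ⟨⟨x, h1⟩, Subtype.ext h2⟩
    · rintro ⟨⟨x, h1⟩, h2⟩
      exact ⟨x, h1, congrArg Subtype.val h2⟩

instance (priority := 100) dfn_pair {F : X → Y} {G : X → Z} [hF : Dfn M F] [hG : Dfn M G] :
    Dfn M fun x => (F x, G x) where
  inM x hx := inM_prod.2 ⟨hF.inM x hx, hG.inM x hx⟩
  graph := by
    have h := (((hF.graph.reindex (m := 4) ![2, 0]).and (hG.graph.reindex (m := 4) ![2, 1])).and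
      (dn_pair.reindex (m := 4) ![3, 0, 1])).ex.ex
    refine h.congr fun v => ⟨?_, ?_⟩
    · rintro ⟨x, h1, h2⟩
      have hx : InM M x := ⟨h1 ▸ (v 0).2⟩
      exact ⟨⟨_, (hG.inM x hx).1⟩, ⟨_, (hF.inM x hx).1⟩, ⟨⟨x, h1, rfl⟩, ⟨x, h1, rfl⟩⟩, h2⟩
    · rintro ⟨k, l, ⟨⟨x, h1, h2⟩, ⟨y, h3, h4⟩⟩, h5⟩
      cases code_injective (h1.symm.trans h3)
      refine ⟨x, h1, h5.trans ?_⟩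
      change ZFSet.pair (l : ZFSet.{u}) (k : ZFSet.{u}) = _
      rw [show (l : ZFSet.{u}) = _ from h2, show (k : ZFSet.{u}) = _ from h4]
      rfl

instance codedIn_prod [hX : CodedIn M X] [hY : CodedIn M Y] : CodedIn M (X × Y) where
  dom := by
    refine (((hX.dom.reindex (m := 3) ![0]).and (hY.dom.reindex (m := 3) ![1])).and
      (dn_pair.reindex (m := 3) ![2, 0, 1])).ex.ex.congr fun v => ⟨?_, ?_⟩
    · rintro ⟨⟨x, y⟩, h⟩
      have h1 : InM M (x, y) := ⟨h ▸ (v 0).2⟩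
      rw [inM_prod] at h1
      exact ⟨⟨_, h1.2.1⟩, ⟨_, h1.1.1⟩, ⟨⟨x, rfl⟩, ⟨y, rfl⟩⟩, h⟩
    · rintro ⟨k, l, ⟨⟨x, h1⟩, ⟨y, h2⟩⟩, h3⟩
      refine ⟨(x, y), h3.trans ?_⟩
      change ZFSet.pair (l : ZFSet.{u}) (k : ZFSet.{u}) = _
      rw [show (l : ZFSet.{u}) = _ from h1, show (k : ZFSet.{u}) = _ from h2]
      rfl

theorem dfn_fst' [hX : CodedIn M X] [hY : CodedIn M Y] : Dfn M fun x : X × Y => x.1 where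
  inM x hx := (inM_prod.1 hx).1
  graph := by
    refine (((hX.dom.reindex (m := 3) ![2]).and (hY.dom.reindex (m := 3) ![0])).and
      (dn_pair.reindex (m := 3) ![1, 2, 0])).ex.congr fun v => ⟨?_, ?_⟩
    · rintro ⟨⟨x, y⟩, h, h'⟩
      have h1 : InM M (x, y) := ⟨h ▸ (v 0).2⟩
      rw [inM_prod] at h1
      refine ⟨⟨_, h1.2.1⟩, ⟨⟨x, h'⟩, ⟨y, rfl⟩⟩, h.trans ?_⟩
      change _ = ZFSet.pair (v 1 : ZFSet.{u}) _
      rw [h']; rfl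
    · rintro ⟨k, ⟨⟨x, h1⟩, ⟨y, h2⟩⟩, h3⟩
      refine ⟨(x, y), h3.trans ?_, h1⟩
      change ZFSet.pair (v 1 : ZFSet.{u}) (k : ZFSet.{u}) = _
      rw [show (k : ZFSet.{u}) = _ from h2, show (v 1 : ZFSet.{u}) = _ from h1]; rfl

theorem dfn_snd' [hX : CodedIn M X] [hY : CodedIn M Y] : Dfn M fun x : X × Y => x.2 where
  inM x hx := (inM_prod.1 hx).2
  graph := by
    refine (((hY.dom.reindex (m := 3) ![2]).and (hX.dom.reindex (m := 3) ![0])).and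
      (dn_pair.reindex (m := 3) ![1, 0, 2])).ex.congr fun v => ⟨?_, ?_⟩
    · rintro ⟨⟨x, y⟩, h, h'⟩
      have h1 : InM M (x, y) := ⟨h ▸ (v 0).2⟩
      rw [inM_prod] at h1
      refine ⟨⟨_, h1.1.1⟩, ⟨⟨y, h'⟩, ⟨x, rfl⟩⟩, h.trans ?_⟩
      change _ = ZFSet.pair _ (v 1 : ZFSet.{u})
      rw [h']; rfl
    · rintro ⟨k, ⟨⟨x, h1⟩, ⟨y, h2⟩⟩, h3⟩
      refine ⟨(y, x), h3.trans ?_, h1⟩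
      change ZFSet.pair (k : ZFSet.{u}) (v 1 : ZFSet.{u}) = _
      rw [show (k : ZFSet.{u}) = _ from h2, show (v 1 : ZFSet.{u}) = _ from h1]; rfl

instance dfn_fst [CodedIn M Y] [CodedIn M Z] {F : X → Y × Z} [hF : Dfn M F] :
    Dfn M fun x => (F x).1 := dfn_fst'.comp hF
instance dfn_snd [CodedIn M Y] [CodedIn M Z] {F : X → Y × Z} [hF : Dfn M F] :
    Dfn M fun x => (F x).2 := dfn_snd'.comp hF

instance dfn_id [hX : CodedIn M X] : Dfn M fun x : X => x where
  inM _ h := h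
  graph := ((hX.dom.reindex ![0]).and (Dn.eq 0 1)).congr fun v => by
    constructor
    · rintro ⟨x, h1, h2⟩
      exact ⟨⟨x, h1⟩, Subtype.ext (h1.trans h2.symm)⟩
    · rintro ⟨⟨x, h1⟩, h2⟩
      exact ⟨x, h1, h2 ▸ h1⟩

instance codedIn_ZFSet : CodedIn M ZFSet.{u} where
  dom := (Dn.eq 0 0).congr fun v => by simp [Coded.code]

/-- Being an ordinal is absolute: it says that the set and all its elements are transitive, and a
transitive `M` contains all sets concerned. -/
instance codedIn_Ordinal : CodedIn M Ordinal.{u} where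
  dom := by
    have h : Dn fun w : Fin 3 → M => (w 1 : ZFSet.{u}) ∈ (w 2 : ZFSet.{u}) →
        (w 0 : ZFSet.{u}) ∈ (w 1 : ZFSet.{u}) → (w 0 : ZFSet.{u}) ∈ (w 2 : ZFSet.{u}) :=
      (Dn.mem 1 2).imp ((Dn.mem 0 1).imp (Dn.mem 0 2))
    have h2 : Dn fun v : Fin 1 → M => (v 0 : ZFSet.{u}).IsTransitive := by
      refine h.all.all.congr fun v => ⟨fun h y x hy hx => h _ hy hx, fun h y hy x hx => ?_⟩
      exact h ⟨y, mem_trans_M (v 0).2 hy⟩ ⟨x, mem_trans_M (mem_trans_M (v 0).2 hy) hx⟩ hy hx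
    refine (h2.and ((Dn.mem 0 1).imp (h2.reindex (m := 2) ![0])).all).congr fun v => ?_
    have : (∃ x : Ordinal.{u}, (v 0 : ZFSet.{u}) = Coded.code x) ↔ (v 0 : ZFSet.{u}).IsOrdinal := by
      rw [ZFSet.isOrdinal_iff_mem_range_toZFSet]
      exact ⟨fun ⟨x, h⟩ => ⟨x, h.symm⟩, fun ⟨x, h⟩ => ⟨x, h.symm⟩⟩
    rw [this, ZFSet.isOrdinal_iff_forall_mem_isTransitive]
    exact and_congr Iff.rfl ⟨fun h y hy => h y hy, fun h y hy => h ⟨y, mem_trans_M (v 0).2 hy⟩ hy⟩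

/-- A definable graph does not by itself give values in `M`, hence the separate first hypothesis.
Functions that are not built by composition enter through this lemma. -/
theorem dfn_of_graph [CodedIn M X] [CodedIn M Y] {F : X → Y} (h1 : ∀ x, InM M x → InM M (F x))
    (h2 : Dfn M fun z : X × Y => z.2 = F z.1) : Dfn M F where
  inM := h1
  graph := by
    refine ((dn_pair.reindex (m := 3) ![0, 1, 2]).and
      ((dfn_prop_iff.1 h2).reindex (m := 3) ![0])).ex.congr fun v => ⟨?_, ?_⟩
    · rintro ⟨x, h3, h4⟩
      refine ⟨⟨ZFSet.pair (v 0) (v 1), pair_mem_M_iff.2 ⟨(v 0).2, (v 1).2⟩⟩, rfl, (x, F x), ?_, rfl⟩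
      change ZFSet.pair (v 0 : ZFSet.{u}) (v 1 : ZFSet.{u}) = _
      rw [h3, h4]; rfl
    · rintro ⟨k, h3, ⟨x, y⟩, h4, h'⟩
      obtain rfl : y = F x := h'
      obtain ⟨h5, h6⟩ := ZFSet.pair_injective (h3.symm.trans h4)
      exact ⟨x, h5, h6⟩

theorem dfn_eq' [CodedIn M X] : Dfn M fun x : X × X => x.1 = x.2 := by
  refine dfn_prop_iff.2 (((codedIn_prod (M := M) (X := X) (Y := X)).dom.reindex (m := 1) ![0]).and
    ((dn_pair.reindex (m := 2) ![1, 0, 0]).ex) |>.congr fun v => ⟨?_, ?_⟩)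
  · rintro ⟨⟨x, y⟩, h1, rfl : x = y⟩
    have h2 : InM M (x, x) := ⟨h1 ▸ (v 0).2⟩
    exact ⟨⟨_, h1⟩, ⟨_, (inM_prod.1 h2).1.1⟩, h1⟩
  · rintro ⟨⟨⟨x, y⟩, h1⟩, k, h2⟩
    obtain ⟨h3, h4⟩ := ZFSet.pair_injective (h1.symm.trans h2)
    exact ⟨_, h1, code_injective (h3.trans h4.symm)⟩

theorem dfn_mem' : Dfn M fun x : ZFSet.{u} × ZFSet.{u} => x.1 ∈ x.2 := by
  refine dfn_prop_iff.2 (((Dn.mem 0 1).and (dn_pair.reindex (m := 3) ![2, 0, 1])).ex.ex.congr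
    fun v => ⟨?_, ?_⟩)
  · rintro ⟨⟨x, y⟩, h1, h2⟩
    have h3 : InM M (x, y) := ⟨h1 ▸ (v 0).2⟩
    rw [inM_prod] at h3
    exact ⟨⟨_, h3.2.1⟩, ⟨_, h3.1.1⟩, h2, h1⟩
  · rintro ⟨k, l, h1, h2⟩
    exact ⟨(l, k), h2, h1⟩

instance dfn_code [hX : CodedIn M X] {Z : Type*} [Coded.{u} Z] {F : Z → X} [hF : Dfn M F] :
    Dfn M fun z => (Coded.code (F z) : ZFSet.{u}) := by
  refine Dfn.comp (F := fun x : X => (Coded.code x : ZFSet.{u})) ⟨fun x hx => ⟨hx.1⟩, ?_⟩ hF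
  refine ((hX.dom.reindex ![0]).and (Dn.eq 0 1)).congr fun v => ⟨?_, ?_⟩
  · rintro ⟨x, h1, h2⟩
    exact ⟨⟨x, h1⟩, Subtype.ext (h1.trans h2.symm)⟩
  · rintro ⟨⟨x, h1⟩, h2⟩
    exact ⟨x, h1, h2 ▸ h1⟩

/-- A function is definable if its composition with the coding is. -/
theorem dfn_of_code [hX : CodedIn M X] [CodedIn M Y] {F : X → Y}
    (h : Dfn M fun x => (Coded.code (F x) : ZFSet.{u})) : Dfn M F :=
  ⟨fun x hx => ⟨(h.inM x hx).1⟩, h.graph⟩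

end Closure

/-! ### Logical operations, quantifiers, Separation and Collection -/

section Logic
variable {M : Set ZFSet.{u}} [hM : Fact (IsTransitiveModelZFCMinus M)]
variable {X Y Z W : Type*} [Coded.{u} X] [Coded.{u} Y] [Coded.{u} Z] [Coded.{u} W]
variable [hX : CodedIn M X] [hY : CodedIn M Y] [hZ : CodedIn M Z]

/-- As local instances, this composition rule and its binary version let instance search reduce a
formula to atoms and to definability hypotheses in the context. -/
theorem dfn_app {F : Y → Z} {G : X → Y} [hF : Dfn M F] [hG : Dfn M G] : Dfn M fun x => F (G x) :=
  hF.comp hG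

theorem dfn_app₂ {F : Y → Z → W} {G : X → Y} {H : X → Z} [hF : Dfn M fun z : Y × Z => F z.1 z.2]
    [hG : Dfn M G] [hH : Dfn M H] : Dfn M fun x => F (G x) (H x) :=
  hF.comp (dfn_pair (F := G) (G := H))

attribute [local instance] dfn_app dfn_app₂

theorem dfn_true : Dfn M fun _ : X => True := dfn_const _

theorem exists_code_iff {R : X → Prop} {v : ZFSet.{u}} {x : X} (h : v = Coded.code x) :
    (∃ y, v = Coded.code y ∧ R y) ↔ R x := by
  constructor
  · rintro ⟨y, h1, h2⟩
    cases code_injective (h.symm.trans h1); exact h2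
  · exact fun h1 => ⟨x, h, h1⟩

instance dfn_not {P : X → Prop} [hP : Dfn M P] : Dfn M fun x => ¬ P x :=
  dfn_prop_iff.2 ((hX.dom.and (dfn_prop_iff.1 hP).not).congr fun v => by
    by_cases h : ∃ x : X, (v 0 : ZFSet.{u}) = Coded.code x
    · obtain ⟨x, h⟩ := h
      rw [exists_code_iff h, exists_code_iff h]
      exact ⟨fun h1 => ⟨⟨x, h⟩, h1⟩, fun h1 => h1.2⟩
    · exact ⟨fun ⟨x, h1, _⟩ => (h ⟨x, h1⟩).elim, fun h1 => (h h1.1).elim⟩)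

instance dfn_and {P Q : X → Prop} [hP : Dfn M P] [hQ : Dfn M Q] : Dfn M fun x => P x ∧ Q x :=
  dfn_prop_iff.2 (((dfn_prop_iff.1 hP).and (dfn_prop_iff.1 hQ)).congr fun v => by
    by_cases h : ∃ x : X, (v 0 : ZFSet.{u}) = Coded.code x
    · obtain ⟨x, h⟩ := h
      rw [exists_code_iff h, exists_code_iff h, exists_code_iff h]
    · exact ⟨fun ⟨x, h1, _⟩ => (h ⟨x, h1⟩).elim, fun ⟨⟨x, h1, _⟩, _⟩ => (h ⟨x, h1⟩).elim⟩)

instance dfn_or {P Q : X → Prop} [hP : Dfn M P] [hQ : Dfn M Q] : Dfn M fun x => P x ∨ Q x :=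
  (inferInstance : Dfn M fun x => ¬ (¬ P x ∧ ¬ Q x)).congr fun x _ => by
    rw [not_and_or, not_not, not_not]

instance dfn_imp {P Q : X → Prop} [hP : Dfn M P] [hQ : Dfn M Q] : Dfn M fun x => P x → Q x :=
  (inferInstance : Dfn M fun x => ¬ P x ∨ Q x).congr fun x _ => by rw [imp_iff_not_or]

instance dfn_iff {P Q : X → Prop} [hP : Dfn M P] [hQ : Dfn M Q] : Dfn M fun x => P x ↔ Q x :=
  (inferInstance : Dfn M fun x => (P x → Q x) ∧ (Q x → P x)).congr fun x _ => by
    rw [iff_iff_implies_and_implies]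

/-- Definability over `(M, ∈)` only knows quantifiers ranging over `M`. Unrestricted quantifiers are
reduced to this case in `dfn_ex` and `dfn_all`, by checking that all relevant witnesses or
counterexamples lie in `M`. -/
instance dfn_exM {R : X → Y → Prop} [hR : Dfn M fun z : X × Y => R z.1 z.2] :
    Dfn M fun x => ∃ y, InM M y ∧ R x y := by
  refine dfn_prop_iff.2 (((dn_pair.reindex (m := 3) ![1, 2, 0]).and
    ((dfn_prop_iff.1 hR).reindex (m := 3) ![1])).ex.ex.congr fun v => ⟨?_, ?_⟩)
  · rintro ⟨x, h1, y, h2, h3⟩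
    have h4 : InM M (x, y) := inM_prod.2 ⟨⟨h1 ▸ (v 0).2⟩, h2⟩
    refine ⟨⟨_, h4.1⟩, ⟨_, h2.1⟩, ?_, ⟨(x, y), rfl, h3⟩⟩
    change (Coded.code (x, y) : ZFSet.{u}) = ZFSet.pair (v 0 : ZFSet.{u}) (Coded.code y)
    rw [h1]; rfl
  · rintro ⟨k, l, h1, ⟨x, y⟩, h2, h3⟩
    obtain ⟨h4, h5⟩ := ZFSet.pair_injective (h1.symm.trans h2)
    exact ⟨x, h4, y, ⟨by rw [← show _ = Coded.code y from h5]; exact l.2⟩, h3⟩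

instance dfn_allM {R : X → Y → Prop} [hR : Dfn M fun z : X × Y => R z.1 z.2] :
    Dfn M fun x => ∀ y, InM M y → R x y :=
  (inferInstance : Dfn M fun x => ¬ ∃ y, InM M y ∧ ¬ R x y).congr fun x _ => by simp

theorem dfn_ex {R : X → Y → Prop} (hR : Dfn M fun z : X × Y => R z.1 z.2)
    (h : ∀ x y, InM M x → R x y → InM M y) : Dfn M fun x => ∃ y, R x y :=
  (inferInstance : Dfn M fun x => ∃ y, InM M y ∧ R x y).congr fun x hx =>
    propext ⟨fun ⟨y, h1⟩ => ⟨y, h x y hx h1, h1⟩, fun ⟨y, _, h1⟩ => ⟨y, h1⟩⟩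

theorem dfn_all {R : X → Y → Prop} (hR : Dfn M fun z : X × Y => R z.1 z.2)
    (h : ∀ x y, InM M x → ¬ InM M y → R x y) : Dfn M fun x => ∀ y, R x y :=
  (inferInstance : Dfn M fun x => ∀ y, InM M y → R x y).congr fun x hx =>
    propext ⟨fun h1 y _ => h1 y, fun h1 y => by
      by_cases hy : InM M y
      exacts [h1 y hy, h x y hx hy]⟩

instance dfn_eq {F G : X → Y} [hF : Dfn M F] [hG : Dfn M G] : Dfn M fun x => F x = G x :=
  Dfn.comp dfn_eq' (dfn_pair (F := F) (G := G))

instance dfn_mem {F G : X → ZFSet.{u}} [hF : Dfn M F] [hG : Dfn M G] : Dfn M fun x => F x ∈ G x :=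
  Dfn.comp dfn_mem' (dfn_pair (F := F) (G := G))

instance dfn_toZFSet {F : X → Ordinal.{u}} [hF : Dfn M F] : Dfn M fun x => (F x).toZFSet :=
  dfn_code (F := F)

instance dfn_nodeCode {F : X → MorassNode.{u}} [hF : Dfn M F] : Dfn M fun x => nodeCode (F x) :=
  dfn_code (F := F)

instance dfn_mkpair {F G : X → ZFSet.{u}} [hF : Dfn M F] [hG : Dfn M G] :
    Dfn M fun x => ZFSet.pair (F x) (G x) :=
  dfn_code (F := fun x => (F x, G x))

instance dfn_lt {F G : X → Ordinal.{u}} [hF : Dfn M F] [hG : Dfn M G] : Dfn M fun x => F x < G x :=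
  (inferInstance : Dfn M fun x => (F x).toZFSet ∈ (G x).toZFSet).congr fun x _ => by
    rw [Ordinal.toZFSet_mem_toZFSet_iff]

instance dfn_le {F G : X → Ordinal.{u}} [hF : Dfn M F] [hG : Dfn M G] : Dfn M fun x => F x ≤ G x :=
  (inferInstance : Dfn M fun x => ¬ G x < F x).congr fun x _ => by rw [not_lt]

theorem inM_of_lt {α β : Ordinal.{u}} (h : α < β) (hβ : InM M β) : InM M α :=
  ⟨mem_trans_M hβ.1 (Ordinal.toZFSet_mem_toZFSet_iff.2 h)⟩

theorem inM_of_le {α β : Ordinal.{u}} (h : α ≤ β) (hβ : InM M β) : InM M α := by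
  rcases h.lt_or_eq with h | rfl
  exacts [inM_of_lt h hβ, hβ]

theorem inM_of_mem {x y : ZFSet.{u}} (h : x ∈ y) (hy : InM M y) : InM M x :=
  ⟨mem_trans_M hy.1 h⟩

theorem inM_of_code_mem {x : X} {y : ZFSet.{u}} (h : Coded.code x ∈ y) (hy : InM M y) : InM M x :=
  ⟨mem_trans_M hy.1 h⟩

instance dfn_ex_lt {F : X → Ordinal.{u}} {R : X → Ordinal.{u} → Prop} [hF : Dfn M F]
    [hR : Dfn M fun z : X × Ordinal.{u} => R z.1 z.2] : Dfn M fun x => ∃ y, y < F x ∧ R x y :=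
  dfn_ex inferInstance fun x y hx h => inM_of_lt h.1 (hF.inM x hx)

instance dfn_ex_le {F : X → Ordinal.{u}} {R : X → Ordinal.{u} → Prop} [hF : Dfn M F]
    [hR : Dfn M fun z : X × Ordinal.{u} => R z.1 z.2] : Dfn M fun x => ∃ y, y ≤ F x ∧ R x y :=
  dfn_ex inferInstance fun x y hx h => inM_of_le h.1 (hF.inM x hx)

instance dfn_all_lt {F : X → Ordinal.{u}} {R : X → Ordinal.{u} → Prop} [hF : Dfn M F]
    [hR : Dfn M fun z : X × Ordinal.{u} => R z.1 z.2] : Dfn M fun x => ∀ y, y < F x → R x y :=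
  dfn_all inferInstance fun x y hx h h' => (h (inM_of_lt h' (hF.inM x hx))).elim

instance dfn_all_le {F : X → Ordinal.{u}} {R : X → Ordinal.{u} → Prop} [hF : Dfn M F]
    [hR : Dfn M fun z : X × Ordinal.{u} => R z.1 z.2] : Dfn M fun x => ∀ y, y ≤ F x → R x y :=
  dfn_all inferInstance fun x y hx h h' => (h (inM_of_le h' (hF.inM x hx))).elim

instance dfn_ex_mem {F : X → ZFSet.{u}} {R : X → ZFSet.{u} → Prop} [hF : Dfn M F]
    [hR : Dfn M fun z : X × ZFSet.{u} => R z.1 z.2] : Dfn M fun x => ∃ y, y ∈ F x ∧ R x y :=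
  dfn_ex inferInstance fun x y hx h => inM_of_mem h.1 (hF.inM x hx)

instance dfn_all_mem {F : X → ZFSet.{u}} {R : X → ZFSet.{u} → Prop} [hF : Dfn M F]
    [hR : Dfn M fun z : X × ZFSet.{u} => R z.1 z.2] : Dfn M fun x => ∀ y, y ∈ F x → R x y :=
  dfn_all inferInstance fun x y hx h h' => (h (inM_of_mem h' (hF.inM x hx))).elim

/-! ### Sets in the model -/

theorem isClassOf_of_dfn {R : ZFSet.{u} → Prop} (h : Dfn M R) : IsClassOf M {z | z ∈ M ∧ R z} := by
  refine ⟨fun z hz => hz.1, ?_⟩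
  refine (dfn_prop_iff.1 h).congr (n := 1) (ψ := fun v => v 0 ∈ {x : M | (x : ZFSet.{u}) ∈ {z | z ∈ M ∧ R z}})
    fun v => ?_
  exact ⟨fun h => ⟨_, rfl, h.2⟩, fun ⟨x, h1, h2⟩ => ⟨(v 0).2, by rw [h1]; exact h2⟩⟩

theorem dfn_of_isClassOf {D : Set ZFSet.{u}} (h : IsClassOf M D) : Dfn M fun z => z ∈ D := by
  refine dfn_prop_iff.2 (Dn.congr (φ := fun v : Fin 1 → M => v 0 ∈ {x : M | (x : ZFSet.{u}) ∈ D}) h.2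
    fun v => ?_)
  exact ⟨fun ⟨x, h1, h2⟩ => by rw [show x = _ from h1.symm] at h2; exact h2, fun h => ⟨_, rfl, h⟩⟩

theorem exists_sep {R : X → ZFSet.{u} → Prop} (hR : Dfn M fun z : X × ZFSet.{u} => R z.1 z.2)
    {x : X} (hx : InM M x) {a : ZFSet.{u}} (ha : a ∈ M) : ZFSet.sep (R x) a ∈ M := by
  have h : Dfn M (R x) := hR.comp (dfn_pair (F := fun _ => x) (G := fun z => z))
  have := hM.out.separation _ (isClassOf_of_dfn h) a ha
  convert this using 1
  ext z
  simp only [ZFSet.mem_sep]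
  exact ⟨fun h => ⟨h.1, mem_trans_M ha h.1, h.2⟩, fun h => ⟨h.1, h.2.2⟩⟩

theorem exists_collection {R : X → ZFSet.{u} → Y → Prop}
    (hR : Dfn M fun z : (X × ZFSet.{u}) × Y => R z.1.1 z.1.2 z.2)
    {x : X} (hx : InM M x) {a : ZFSet.{u}} (ha : a ∈ M)
    (h : ∀ z ∈ a, ∃ y, InM M y ∧ R x z y) :
    ∃ b ∈ M, ∀ z ∈ a, ∃ y, InM M y ∧ R x z y ∧ Coded.code y ∈ b := by
  have h1 : Dfn M fun z : ZFSet.{u} × Y => R x z.1 z.2 :=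
    hR.comp (dfn_pair (F := fun z : ZFSet.{u} × Y => (x, z.1)) (G := fun z => z.2))
  have h2 : Dfn M fun z : ZFSet.{u} × ZFSet.{u} => ∃ y, InM M y ∧ z.2 = Coded.code y ∧ R x z.1 y := by
    have : Dfn M fun z : (ZFSet.{u} × ZFSet.{u}) × Y => R x z.1.1 z.2 :=
      h1.comp (dfn_pair (F := fun z : (ZFSet.{u} × ZFSet.{u}) × Y => z.1.1) (G := fun z => z.2))
    infer_instance
  have h3 := ((dfn_prop_iff.1 h2).reindex (m := 3) ![0]).and (dn_pair.reindex (m := 3) ![0, 1, 2])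
  have h4 : (Set.univ : Set M).Definable₂ setLang
      {w : M × M | ∃ y, InM M y ∧ (w.2 : ZFSet.{u}) = Coded.code y ∧ R x w.1 y} := by
    refine h3.ex.congr (n := 2) fun v => ⟨?_, ?_⟩
    · rintro ⟨y, h5, h6, h7⟩
      exact ⟨⟨_, pair_mem_M_iff.2 ⟨(v 0).2, (v 1).2⟩⟩, ⟨(v 0, v 1), rfl, y, h5, h6, h7⟩, rfl⟩
    · rintro ⟨k, ⟨⟨z, w⟩, h5, y, h6, h7, h8⟩, h9⟩
      obtain ⟨h10, h11⟩ := ZFSet.pair_injective (h5.symm.trans h9)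
      obtain rfl : z = _ := h10
      obtain rfl : w = _ := h11
      exact ⟨y, h6, h7, h8⟩
  obtain ⟨b, hb, h5⟩ := hM.out.collection _ h4 a ha fun z hz => by
    obtain ⟨y, h5, h6⟩ := h z hz
    exact ⟨⟨_, h5.1⟩, y, h5, rfl, h6⟩
  refine ⟨b, hb, fun z hz => ?_⟩
  obtain ⟨w, h5, y, h6, h7, h8⟩ := h5 ⟨z, mem_trans_M ha hz⟩ hz
  exact ⟨y, h6, h8, h7 ▸ h5⟩

/-- By Extensionality a set-valued function is determined by its membership relation, and by
transitivity only elements in `M` have to be tested. -/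
theorem dfn_set_of_ext {A : X → ZFSet.{u}} {R : X → ZFSet.{u} → Prop}
    (hR : Dfn M fun z : X × ZFSet.{u} => R z.1 z.2)
    (h : ∀ x, InM M x → A x ∈ M) (h' : ∀ x z, InM M x → InM M z → (z ∈ A x ↔ R x z)) : Dfn M A := by
  refine dfn_of_graph (fun x hx => ⟨h x hx⟩) ?_
  have h1 : Dfn M fun w : (X × ZFSet.{u}) × ZFSet.{u} => R w.1.1 w.2 :=
    hR.comp (dfn_pair (F := fun w : (X × ZFSet.{u}) × ZFSet.{u} => w.1.1) (G := fun w => w.2))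
  refine (inferInstance : Dfn M fun w : X × ZFSet.{u} => ∀ z, InM M z → (z ∈ w.2 ↔ R w.1 z)).congr
    fun w hw => propext ⟨fun e z hz => ?_, fun e => ?_⟩
  · rw [show w.2 = A w.1 from e, h' _ _ (inM_prod.1 hw).1 hz]
  · ext z
    constructor
    · intro hz
      have hz' := inM_of_mem hz (inM_prod.1 hw).2
      rw [h' _ _ (inM_prod.1 hw).1 hz', ← e z hz']; exact hz
    · intro hz
      have hz' : InM M z := inM_of_mem hz ⟨h _ (inM_prod.1 hw).1⟩
      rw [e z hz', ← h' _ _ (inM_prod.1 hw).1 hz']; exact hz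

instance dfn_sep {A : X → ZFSet.{u}} {R : X → ZFSet.{u} → Prop} [hA : Dfn M A]
    [hR : Dfn M fun z : X × ZFSet.{u} => R z.1 z.2] : Dfn M fun x => ZFSet.sep (R x) (A x) :=
  dfn_set_of_ext (R := fun x z => z ∈ A x ∧ R x z) inferInstance
    (fun x hx => exists_sep hR hx (hA.inM x hx).1) fun x z _ _ => ZFSet.mem_sep

instance dfn_sUnion {A : X → ZFSet.{u}} [hA : Dfn M A] : Dfn M fun x => ZFSet.sUnion (A x) :=
  dfn_set_of_ext (R := fun x z => ∃ w, w ∈ A x ∧ z ∈ w) inferInstance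
    (fun x hx => hM.out.union _ (hA.inM x hx).1) fun x z _ _ => ZFSet.mem_sUnion

instance dfn_upair {A B : X → ZFSet.{u}} [hA : Dfn M A] [hB : Dfn M B] :
    Dfn M fun x => ({A x, B x} : ZFSet.{u}) :=
  dfn_set_of_ext (R := fun x z => z = A x ∨ z = B x) inferInstance
    (fun x hx => upair_mem_M (hA.inM x hx).1 (hB.inM x hx).1) fun x z _ _ => ZFSet.mem_pair

instance dfn_singleton {A : X → ZFSet.{u}} [hA : Dfn M A] :
    Dfn M fun x => ({A x} : ZFSet.{u}) :=
  (dfn_upair (A := A) (B := A)).congr fun x _ => by simp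

instance dfn_union {A B : X → ZFSet.{u}} [hA : Dfn M A] [hB : Dfn M B] :
    Dfn M fun x => A x ∪ B x :=
  (dfn_sUnion (A := fun x => {A x, B x})).congr fun x _ => by simp

instance dfn_insert {A B : X → ZFSet.{u}} [hA : Dfn M A] [hB : Dfn M B] :
    Dfn M fun x => insert (A x) (B x) :=
  (inferInstance : Dfn M fun x => {A x} ∪ B x).congr fun x _ => by
    rw [ZFSet.insert_eq]

instance inM_empty : InM M (∅ : ZFSet.{u}) := ⟨empty_mem_M⟩
instance inM_zero : InM M (0 : Ordinal.{u}) := ⟨by simpa [Coded.code] using empty_mem_M⟩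

instance dfn_succ {F : X → Ordinal.{u}} [hF : Dfn M F] : Dfn M fun x => F x + 1 :=
  dfn_of_code <| (inferInstance : Dfn M fun x => insert (F x).toZFSet (F x).toZFSet).congr
    fun x _ => by simp [Coded.code]

/-- The set of all `f x` for `x` with code in `a`. -/
noncomputable def img (f : X → ZFSet.{u}) (a : ZFSet.{u}) : ZFSet.{u} :=
  ZFSet.range fun z : {z : a // ∃ x : X, Coded.code x = (z : ZFSet.{u})} => f z.2.choose

theorem mem_img {f : X → ZFSet.{u}} {a y : ZFSet.{u}} :
    y ∈ img f a ↔ ∃ x, Coded.code x ∈ a ∧ y = f x := by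
  rw [img, ZFSet.mem_range]
  constructor
  · rintro ⟨z, rfl⟩
    refine ⟨_, ?_, rfl⟩
    rw [z.2.choose_spec]; exact z.1.2
  · rintro ⟨x, hx, rfl⟩
    let z : {z : a // ∃ x : X, Coded.code x = (z : ZFSet.{u})} := ⟨⟨_, hx⟩, x, rfl⟩
    exact ⟨z, congrArg f (code_injective z.2.choose_spec)⟩

/-- This is Replacement: Collection bounds the image and Separation cuts it out. -/
instance dfn_img {A : X → ZFSet.{u}} {F : X → Y → ZFSet.{u}} [hA : Dfn M A]
    [hF : Dfn M fun z : X × Y => F z.1 z.2] : Dfn M fun x => img (F x) (A x) := by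
  refine dfn_set_of_ext (R := fun x z => ∃ y, InM M y ∧ (Coded.code y ∈ A x ∧ z = F x y)) ?_ ?_ ?_
  · have h1 : Dfn M fun w : (X × ZFSet.{u}) × Y => F w.1.1 w.2 :=
      hF.comp (dfn_pair (F := fun w : (X × ZFSet.{u}) × Y => w.1.1) (G := fun w => w.2))
    infer_instance
  · intro x hx
    have h1 : Dfn M fun w : (X × ZFSet.{u}) × ZFSet.{u} =>
        ∀ y, InM M y → w.1.2 = Coded.code y → w.2 = F w.1.1 y := by
      have h1 : Dfn M fun w : ((X × ZFSet.{u}) × ZFSet.{u}) × Y => F w.1.1.1 w.2 :=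
        hF.comp (dfn_pair (F := fun w : ((X × ZFSet.{u}) × ZFSet.{u}) × Y => w.1.1.1) (G := fun w => w.2))
      infer_instance
    obtain ⟨b, hb, h2⟩ := exists_collection (R := fun x z w => ∀ y, InM M y → z = Coded.code y → w = F x y) h1 hx (hA.inM x hx).1 (fun z hz => by
      by_cases h3 : ∃ y : Y, z = Coded.code y
      · obtain ⟨y, rfl⟩ := h3
        have : InM M (x, y) := inM_prod.2 ⟨hx, inM_of_code_mem hz (hA.inM x hx)⟩
        refine ⟨F x y, hF.inM _ this, fun y' _ e => ?_⟩
        rw [code_injective e]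
      -- Collection needs a value for every element of `A x`, so those that are not codes receive a
      -- dummy value.
      · exact ⟨∅, ⟨empty_mem_M⟩, fun y _ e => (h3 ⟨y, e⟩).elim⟩)
    have h3 : Dfn M fun z : X × ZFSet.{u} => ∃ y, InM M y ∧ (Coded.code y ∈ A z.1 ∧ z.2 = F z.1 y) := by
      have h1 : Dfn M fun w : (X × ZFSet.{u}) × Y => F w.1.1 w.2 :=
        hF.comp (dfn_pair (F := fun w : (X × ZFSet.{u}) × Y => w.1.1) (G := fun w => w.2))
      have h2 : Dfn M fun w : (X × ZFSet.{u}) × Y => A w.1.1 :=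
        hA.comp inferInstance
      infer_instance
    have h4 := exists_sep (R := fun x z => ∃ y, InM M y ∧ (Coded.code y ∈ A x ∧ z = F x y)) h3 hx hb
    convert h4 using 1
    ext z
    rw [mem_img, ZFSet.mem_sep]
    constructor
    · rintro ⟨y, hy, rfl⟩
      obtain ⟨w, h5, h6, h7⟩ := h2 _ hy
      have hy' := inM_of_code_mem hy (hA.inM x hx)
      obtain rfl := h6 y hy' rfl
      exact ⟨h7, y, hy', hy, rfl⟩
    · rintro ⟨_, y, _, hy, e⟩
      exact ⟨y, hy, e⟩
  · intro x z hx hz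
    rw [mem_img]
    exact ⟨fun ⟨y, h1, h2⟩ => ⟨y, inM_of_code_mem h1 (hA.inM x hx), h1, h2⟩,
      fun ⟨y, _, h1, h2⟩ => ⟨y, h1, h2⟩⟩

end Logic

/-! ### Infima and suprema of ordinals; morass data as coded objects -/

section Infimum
variable {M : Set ZFSet.{u}} [hM : Fact (IsTransitiveModelZFCMinus M)]
variable {X Y : Type*} [Coded.{u} X] [hX : CodedIn M X] [Coded.{u} Y] [hY : CodedIn M Y]
attribute [local instance] dfn_app dfn_app₂

theorem dfn_sInf {R : X → Ordinal.{u} → Prop} [hR : Dfn M fun z : X × Ordinal.{u} => R z.1 z.2]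
    (h : ∀ x μ, InM M x → R x μ → InM M μ) : Dfn M fun x => sInf {μ | R x μ} := by
  refine dfn_of_graph (fun x hx => ?_) ?_
  · by_cases hne : {μ | R x μ}.Nonempty
    · exact h x _ hx (csInf_mem hne)
    · rw [not_nonempty_iff_eq_empty] at hne
      rw [hne, Ordinal.sInf_empty]; infer_instance
  -- The second disjunct covers the empty set, whose infimum is `0`.
  · refine (inferInstance : Dfn M fun z : X × Ordinal.{u} =>
      (R z.1 z.2 ∧ ∀ μ, μ < z.2 → ¬ R z.1 μ) ∨ (z.2 = 0 ∧ ∀ μ, InM M μ → ¬ R z.1 μ)).congr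
      fun z hz => propext ⟨fun e => ?_, ?_⟩
    · by_cases hne : {μ | R z.1 μ}.Nonempty
      · left
        rw [e]
        exact ⟨csInf_mem hne, fun μ hμ hR => (notMem_of_lt_csInf hμ (OrderBot.bddBelow _)) hR⟩
      · right
        refine ⟨?_, fun μ _ hμ => hne ⟨μ, hμ⟩⟩
        rw [not_nonempty_iff_eq_empty] at hne
        rw [e, hne, Ordinal.sInf_empty]
    · rintro (⟨h1, h2⟩ | ⟨h1, h2⟩)
      · refine le_antisymm (le_csInf ⟨_, h1⟩ fun μ hμ => ?_) (csInf_le (OrderBot.bddBelow _) h1)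
        by_contra hlt
        exact h2 μ (not_le.1 hlt) hμ
      · have : {μ | R z.1 μ} = ∅ := by
          ext μ
          exact ⟨fun hμ => (h2 μ (h _ _ (inM_prod.1 hz).1 hμ) hμ).elim, fun h => h.elim⟩
        rw [this, Ordinal.sInf_empty, h1]

theorem sSup_empty_ordinal : sSup (∅ : Set Ordinal.{u}) = 0 := by
  rw [csSup_empty]; rfl

theorem dfn_sSup {R : X → Ordinal.{u} → Prop} [hR : Dfn M fun z : X × Ordinal.{u} => R z.1 z.2]
    (h : ∀ x, InM M x → ∃ b, InM M b ∧ ∀ μ, R x μ → μ ≤ b) : Dfn M fun x => sSup {μ | R x μ} := by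
  have key : ∀ x, InM M x → InM M (sSup {μ | R x μ}) := by
    intro x hx
    obtain ⟨b, hb, h1⟩ := h x hx
    refine inM_of_le ?_ hb
    by_cases hne : {μ | R x μ}.Nonempty
    · exact csSup_le hne h1
    · rw [not_nonempty_iff_eq_empty] at hne
      rw [hne, sSup_empty_ordinal]; exact zero_le
  have bdd : ∀ x, InM M x → BddAbove {μ | R x μ} := fun x hx => by
    obtain ⟨b, hb, h1⟩ := h x hx
    exact ⟨b, h1⟩
  refine dfn_of_graph key ?_
  refine (inferInstance : Dfn M fun z : X × Ordinal.{u} =>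
      (∀ μ, InM M μ → (R z.1 μ → μ ≤ z.2)) ∧
      ∀ y, y < z.2 → ∃ μ, InM M μ ∧ (R z.1 μ ∧ y < μ)).congr
      fun z hz => propext ⟨fun e => ?_, ?_⟩
  · have hx := (inM_prod.1 hz).1
    refine ⟨fun μ _ hμ => e ▸ le_csSup (bdd _ hx) hμ, fun y hy => ?_⟩
    rw [e] at hy
    have hne : {μ | R z.1 μ}.Nonempty := by
      by_contra hne
      rw [not_nonempty_iff_eq_empty] at hne
      rw [hne, sSup_empty_ordinal] at hy
      exact not_lt_zero hy
    obtain ⟨μ, hμ, h1⟩ := exists_lt_of_lt_csSup hne hy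
    obtain ⟨b, hb, h2⟩ := h _ hx
    exact ⟨μ, inM_of_le (h2 μ hμ) hb, hμ, h1⟩
  · rintro ⟨h1, h2⟩
    have hx := (inM_prod.1 hz).1
    obtain ⟨b, hb, h3⟩ := h _ hx
    refine le_antisymm ?_ ?_
    · by_contra hlt
      obtain ⟨μ, _, h4, h5⟩ := h2 _ (not_le.1 hlt)
      exact absurd (le_csSup (bdd _ hx) h4) (not_le.2 h5)
    · by_cases hne : {μ | R z.1 μ}.Nonempty
      · exact csSup_le hne fun μ hμ => h1 μ (inM_of_le (h3 μ hμ) hb) hμ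
      · rw [not_nonempty_iff_eq_empty] at hne
        rw [hne, sSup_empty_ordinal]; exact zero_le

theorem dfn_recode (e : X → Y) (h : ∀ x, (Coded.code (e x) : ZFSet.{u}) = Coded.code x) : Dfn M e :=
  dfn_of_code <| (dfn_code (F := fun x : X => x)).congr fun x _ => h x

instance codedIn_MorassData : CodedIn M MorassData.{u} where
  dom := (codedIn_prod (M := M) (X := ZFSet.{u}) (Y := ZFSet.{u} × ZFSet.{u})).dom.congr fun v =>
    ⟨fun ⟨p, hp⟩ => ⟨(p.carrier, p.tree, p.maps), hp⟩, fun ⟨p, hp⟩ => ⟨⟨p.1, p.2.1, p.2.2⟩, hp⟩⟩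

theorem dfn_toTriple : Dfn M fun p : MorassData.{u} => (p.carrier, p.tree, p.maps) :=
  dfn_recode _ fun _ => rfl

instance dfn_carrier {P : X → MorassData.{u}} [hP : Dfn M P] : Dfn M fun x => (P x).carrier :=
  (dfn_fst'.comp dfn_toTriple).comp hP
instance dfn_tree {P : X → MorassData.{u}} [hP : Dfn M P] : Dfn M fun x => (P x).tree :=
  (Dfn.comp (F := fun p : ZFSet.{u} × ZFSet.{u} × ZFSet.{u} => p.2.1) inferInstance dfn_toTriple).comp hP
instance dfn_maps {P : X → MorassData.{u}} [hP : Dfn M P] : Dfn M fun x => (P x).maps :=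
  (Dfn.comp (F := fun p : ZFSet.{u} × ZFSet.{u} × ZFSet.{u} => p.2.2) inferInstance dfn_toTriple).comp hP
instance dfn_morassCode {P : X → MorassData.{u}} [hP : Dfn M P] : Dfn M fun x => (P x).code :=
  dfn_code (F := P)

instance dfn_isFunc {A B F : X → ZFSet.{u}} [hA : Dfn M A] [hB : Dfn M B] [hF : Dfn M F] :
    Dfn M fun x => ZFSet.IsFunc (A x) (B x) (F x) := by
  have h1 : Dfn M fun z : X × ZFSet.{u} => ∃ w, ZFSet.pair z.2 w ∈ F z.1 ∧
      ∀ w', ZFSet.pair z.2 w' ∈ F z.1 → w' = w := by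
    refine dfn_ex (dfn_and (hP := inferInstance) (hQ := dfn_all inferInstance ?_)) ?_
    · intro x y hx hy h
      exact absurd (inM_def.2 (pair_mem_M_iff.1 (mem_trans_M (hF.inM _ (inM_prod.1 (inM_prod.1 hx).1).1).1 h)).2) hy
    · rintro x y hx ⟨h, _⟩
      exact inM_def.2 (pair_mem_M_iff.1 (mem_trans_M (hF.inM _ (inM_prod.1 hx).1).1 h)).2
  refine (inferInstance : Dfn M fun x => (∀ w, w ∈ F x → ∃ a, a ∈ A x ∧ ∃ b, b ∈ B x ∧ w = ZFSet.pair a b) ∧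
    ∀ z, z ∈ A x → ∃ w, ZFSet.pair z w ∈ F x ∧ ∀ w', ZFSet.pair z w' ∈ F x → w' = w).congr fun x _ => ?_
  simp only [ZFSet.IsFunc, ExistsUnique, ZFSet.subset_def, ZFSet.mem_prod]

end Infimum

/-! ### Definability of the notions attached to morass data -/

section Terms
variable {M : Set ZFSet.{u}} [hM : Fact (IsTransitiveModelZFCMinus M)]
variable {X Y : Type*} [Coded.{u} X] [hX : CodedIn M X] [Coded.{u} Y] [hY : CodedIn M Y]
variable {P : X → MorassData.{u}} [hP : Dfn M P]
attribute [local instance] dfn_app dfn_app₂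

theorem inM_morass {p : MorassData.{u}} : InM M p ↔ p.carrier ∈ M ∧ p.tree ∈ M ∧ p.maps ∈ M := by
  rw [inM_def, ← pair_mem_M_iff, ← pair_mem_M_iff]; rfl

theorem MorassData.Mem.inM {p : MorassData.{u}} {x : MorassNode.{u}} (h : p.Mem x) (hp : InM M p) :
    InM M x := ⟨mem_trans_M (inM_morass.1 hp).1 h⟩

theorem MorassData.Lt.inM {p : MorassData.{u}} {x y : MorassNode.{u}} (h : p.Lt x y) (hp : InM M p) :
    InM M x ∧ InM M y := by
  have := pair_mem_M_iff.1 (mem_trans_M (inM_morass.1 hp).2.1 h)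
  exact ⟨⟨this.1⟩, ⟨this.2⟩⟩

instance dfn_Mem {N : X → MorassNode.{u}} [hN : Dfn M N] : Dfn M fun x => (P x).Mem (N x) :=
  (inferInstance : Dfn M fun x => nodeCode (N x) ∈ (P x).carrier)

instance dfn_Lt {N N' : X → MorassNode.{u}} [hN : Dfn M N] [hN' : Dfn M N'] :
    Dfn M fun x => (P x).Lt (N x) (N' x) :=
  (inferInstance : Dfn M fun x => ZFSet.pair (nodeCode (N x)) (nodeCode (N' x)) ∈ (P x).tree)

instance dfn_allMem {R : X → MorassNode.{u} → Prop}
    [hR : Dfn M fun z : X × MorassNode.{u} => R z.1 z.2] :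
    Dfn M fun x => ∀ y, (P x).Mem y → R x y :=
  dfn_all inferInstance fun x y hx h h' => (h (h'.inM (hP.inM x hx))).elim

instance dfn_exMem {R : X → MorassNode.{u} → Prop}
    [hR : Dfn M fun z : X × MorassNode.{u} => R z.1 z.2] :
    Dfn M fun x => ∃ y, (P x).Mem y ∧ R x y :=
  dfn_ex inferInstance fun x y hx h => (h.1.inM (hP.inM x hx))

instance dfn_exPred {R : X → MorassNode.{u} → Prop} {N : X → MorassNode.{u}} [hN : Dfn M N]
    [hR : Dfn M fun z : X × MorassNode.{u} => R z.1 z.2] :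
    Dfn M fun x => ∃ y, (P x).Lt y (N x) ∧ R x y :=
  dfn_ex inferInstance fun x y hx h => (h.1.inM (hP.inM x hx)).1

instance dfn_exSucc {R : X → MorassNode.{u} → Prop} {N : X → MorassNode.{u}} [hN : Dfn M N]
    [hR : Dfn M fun z : X × MorassNode.{u} => R z.1 z.2] :
    Dfn M fun x => ∃ y, (P x).Lt (N x) y ∧ R x y :=
  dfn_ex inferInstance fun x y hx h => (h.1.inM (hP.inM x hx)).2

instance dfn_exPredLevel {A : X → Ordinal.{u}} {N : X → MorassNode.{u}} [hN : Dfn M N]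
    [hA : Dfn M A] : Dfn M fun x => ∃ γ, (P x).Lt (A x, γ) (N x) :=
  dfn_ex inferInstance fun x y hx h => (inM_prod.1 (h.inM (hP.inM x hx)).1).2

instance dfn_exSuccLevel {A : X → Ordinal.{u}} {N : X → MorassNode.{u}} [hN : Dfn M N]
    [hA : Dfn M A] : Dfn M fun x => ∃ γ, (P x).Lt (N x) (A x, γ) :=
  dfn_ex inferInstance fun x y hx h => (inM_prod.1 (h.inM (hP.inM x hx)).2).2

instance dfn_allLt {R : X → MorassNode.{u} → MorassNode.{u} → Prop}
    [hR : Dfn M fun z : (X × MorassNode.{u}) × MorassNode.{u} => R z.1.1 z.1.2 z.2] :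
    Dfn M fun x => ∀ y z, (P x).Lt y z → R x y z :=
  (inferInstance : Dfn M fun x => ∀ y, InM M y → ∀ z, InM M z → ((P x).Lt y z → R x y z)).congr
    fun x hx => propext ⟨fun h y _ z _ => h y z, fun h y z hyz =>
      have := hyz.inM (hP.inM x hx); h y this.1 z this.2 hyz⟩

instance dfn_ImmLt {N N' : X → MorassNode.{u}} [hN : Dfn M N] [hN' : Dfn M N'] :
    Dfn M fun x => (P x).ImmLt (N x) (N' x) :=
  (inferInstance : Dfn M fun x => (P x).Lt (N x) (N' x) ∧ ¬ ∃ z, (P x).Lt (N x) z ∧ (P x).Lt z (N' x))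

theorem map_inM {p : MorassData.{u}} (hp : InM M p) {z f : ZFSet.{u}} (h : ZFSet.pair z f ∈ p.maps) :
    InM M f := ⟨(pair_mem_M_iff.1 (mem_trans_M (inM_morass.1 hp).2.2 h)).2⟩

instance dfn_pi {N N' : X → MorassNode.{u}} {F : X → Ordinal.{u}} [hN : Dfn M N] [hN' : Dfn M N']
    [hF : Dfn M F] : Dfn M fun x => (P x).π (N x) (N' x) (F x) := by
  refine dfn_sInf (R := fun x μ => ∃ f, ZFSet.pair (ZFSet.pair (nodeCode (N x)) (nodeCode (N' x))) f ∈ (P x).maps ∧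
    ZFSet.pair (F x).toZFSet μ.toZFSet ∈ f) (hR := ?_) ?_
  · refine dfn_ex inferInstance ?_
    rintro x f hx ⟨h, _⟩
    exact map_inM (hP.inM _ (inM_prod.1 hx).1) h
  · rintro x μ hx ⟨f, h, h'⟩
    exact ⟨(pair_mem_M_iff.1 (mem_trans_M (map_inM (hP.inM _ hx) h).1 h')).2⟩

instance dfn_lam {K : X → Ordinal.{u}} [hK : Dfn M K] : Dfn M fun x => (P x).lam (K x) := by
  refine dfn_sSup (R := fun x α => α < K x ∧ ∃ β, (P x).Mem (α, β)) (hR := ?_) ?_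
  · refine dfn_and (hP := inferInstance) (hQ := dfn_ex inferInstance ?_)
    intro x y hx h
    exact (inM_prod.1 (h.inM (hP.inM _ (inM_prod.1 hx).1))).2
  · exact fun x hx => ⟨K x, hK.inM x hx, fun μ h => h.1.le⟩

instance dfn_lam_const {κ : Ordinal.{u}} [hκ : InM M κ] : Dfn M (MorassData.lam κ) :=
  dfn_lam (P := fun p => p) (K := fun _ => κ)

/-- The set whose infimum is `theta` also contains ordinals outside `M`, so `dfn_sInf` is not
applicable. Instead `theta` is obtained by Separation, as the set of those `β` up to which all nodes
of the level are present. -/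
instance dfn_theta {A : X → Ordinal.{u}} [hA : Dfn M A] : Dfn M fun x => (P x).theta (A x) := by
  refine dfn_of_code ((inferInstance : Dfn M fun x => ZFSet.sep
    (fun z => ∃ β : Ordinal.{u}, InM M β ∧ (z = β.toZFSet ∧ ∀ γ, γ ≤ β → (P x).Mem (A x, γ)))
      (ZFSet.sUnion (ZFSet.sUnion (P x).carrier))).congr fun x hx => ?_)
  have h0 : ∀ β, (P x).Mem (A x, β) → InM M β := fun β h => (inM_prod.1 (h.inM (hP.inM x hx))).2
  have hth : ∀ β, β < (P x).theta (A x) ↔ ∀ γ ≤ β, (P x).Mem (A x, γ) := by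
    intro β
    have hne : {β | ¬ (P x).Mem (A x, β)}.Nonempty := by
      by_contra hne
      rw [not_nonempty_iff_eq_empty] at hne
      have hall : ∀ β, (P x).Mem (A x, β) := fun β => by
        by_contra h
        exact (hne ▸ h : β ∈ (∅ : Set Ordinal.{u}))
      -- A level containing all ordinals would put every ordinal below the rank of the carrier.
      have h1 : ∀ β : Ordinal.{u}, β < (P x).carrier.rank := by
        intro β
        have h2 := ZFSet.rank_lt_of_mem (hall β)
        refine lt_of_le_of_lt ?_ h2
        have h3 : β.toZFSet ∈ ({(A x).toZFSet, β.toZFSet} : ZFSet.{u}) := by simp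
        have h4 : ({(A x).toZFSet, β.toZFSet} : ZFSet.{u}) ∈ nodeCode (A x, β) := by
          simp [nodeCode, ZFSet.pair]
        have := (ZFSet.rank_lt_of_mem h3).trans (ZFSet.rank_lt_of_mem h4)
        rw [Ordinal.rank_toZFSet] at this
        exact this.le
      exact lt_irrefl _ (h1 _)
    constructor
    · intro h γ hγ
      by_contra h2
      exact notMem_of_lt_csInf (hγ.trans_lt h) (OrderBot.bddBelow _) h2
    · intro h
      by_contra h2
      exact csInf_mem hne (h _ (not_lt.1 h2))
  ext z
  simp only [Coded.code, ZFSet.mem_sep, Ordinal.mem_toZFSet_iff]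
  constructor
  · rintro ⟨β, hβ, rfl⟩
    have hm := (hth β).1 hβ
    refine ⟨?_, β, h0 _ (hm β le_rfl), rfl, hm⟩
    refine ZFSet.mem_sUnion.2 ⟨{(A x).toZFSet, β.toZFSet}, ZFSet.mem_sUnion.2 ⟨_, hm β le_rfl, ?_⟩, ZFSet.mem_pair.2 (Or.inr rfl)⟩
    simp [nodeCode, ZFSet.pair]
  · rintro ⟨_, β, _, rfl, hm⟩
    exact ⟨β, (hth β).2 hm, rfl⟩

instance dfn_UnboundedBelow {N : X → MorassNode.{u}} [hN : Dfn M N] :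
    Dfn M fun x => (P x).UnboundedBelow (N x) :=
  (inferInstance : Dfn M fun x => ∀ δ, δ < (N x).1 → ∃ z, (P x).Lt z (N x) ∧ δ < z.1)

end Terms

/-! ### Reformulation of the axioms with bounded quantifiers -/

namespace MorassData
variable (κ : Ordinal.{u}) (K : Set Ordinal.{u}) (p q : MorassData.{u})

/-- Any two predecessors of a node are comparable. -/
def LinearPreds : Prop :=
  ∀ x y, p.Lt x y → ∀ z, p.Lt z y → x = z ∨ p.Lt x z ∨ p.Lt z x

/-- The nodes of level `κ` are enumerated increasingly by the nodes of level `λ` below them. -/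
def TopEnum : Prop :=
  ∃ γ, γ ≤ p.theta (p.lam κ) ∧
    (∀ x, p.Mem x → x.1 = κ → ∃ ν, ν < γ ∧ p.Lt (p.lam κ, ν) x) ∧
    (∀ ν, ν < γ → ∃ β, p.Lt (p.lam κ, ν) (κ, β)) ∧
    (∀ x y, p.Lt x y → x.1 = p.lam κ → y.1 = κ → ∀ x' y', p.Lt x' y' → x'.1 = p.lam κ → y'.1 = κ →
      (x.2 < x'.2 → y.2 < y'.2) ∧ (x.2 = x'.2 → y.2 = y'.2))

variable {κ K p q}

theorem WellFormed.mem_of_lt (h : p.WellFormed) {x y : MorassNode.{u}} (hxy : p.Lt x y) :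
    p.Mem x ∧ p.Mem y := by
  obtain ⟨x', y', h1, h2, h3⟩ := h.tree_pairs _ hxy
  obtain ⟨h4, h5⟩ := ZFSet.pair_injective h3
  obtain rfl : x = x' := code_injective h4
  obtain rfl : y = y' := code_injective h5
  exact ⟨h1, h2⟩

/-- Levels are ordinals and increase along `≺`, so well-foundedness is automatic. What remains,
transitivity and comparability of predecessors, is first-order. -/
theorem treeOrder_iff (hm : ∀ x y, p.Lt x y → x.1 < y.1) :
    p.IsTreeOrder ↔ (∀ x y, p.Lt x y → ∀ z, p.Lt y z → p.Lt x z) ∧ p.LinearPreds := by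
  constructor
  · intro h
    refine ⟨fun x y hxy z hyz => h.trans x y z hxy hyz, fun x y hxy z hzy => ?_⟩
    have := h.wellOrder y
    rcases trichotomous_of (fun a b : {x // p.Lt x y} => p.Lt a.1 b.1) ⟨x, hxy⟩ ⟨z, hzy⟩ with h | h | h
    · exact Or.inr (Or.inl h)
    · exact Or.inl (congrArg Subtype.val h)
    · exact Or.inr (Or.inr h)
  · rintro ⟨h1, h2⟩
    refine ⟨fun x hx => lt_irrefl _ (hm x x hx), fun x y z hxy hyz => h1 x y hxy z hyz, fun y => ?_⟩
    have wf : WellFounded (fun a b : {x // p.Lt x y} => p.Lt a.1 b.1) :=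
      Subrelation.wf (r := InvImage (· < ·) fun a : {x // p.Lt x y} => a.1.1) (fun h => hm _ _ h)
        (InvImage.wf _ Ordinal.lt_wf)
    exact
      { wf := wf
        trichotomous := fun a b hab hba => by
          rcases h2 a.1 y a.2 b.1 b.2 with h | h | h
          · exact Subtype.ext h
          · exact (hab h).elim
          · exact (hba h).elim }

theorem pred_unique (hm : ∀ x y, p.Lt x y → x.1 < y.1) (hl : p.LinearPreds) {α ν ν' : Ordinal.{u}}
    {y : MorassNode.{u}} (h : p.Lt (α, ν) y) (h' : p.Lt (α, ν') y) : ν = ν' := by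
  rcases hl _ _ h _ h' with h1 | h1 | h1
  · exact congrArg Prod.snd h1
  · exact (lt_irrefl α (hm _ _ h1)).elim
  · exact (lt_irrefl α (hm _ _ h1)).elim

/-- The enumeration `f` is an external function over which `M` cannot quantify. It is recovered from
the tree order, since `f ν` is the order of the node of level `κ` above `⟨λ, ν⟩`. -/
theorem topEnum_iff (hw : p.WellFormed) (hm : ∀ x y, p.Lt x y → x.1 < y.1) (hl : p.LinearPreds) :
    (∃ γ ≤ p.theta (p.lam κ), ∃ f : Ordinal.{u} → Ordinal.{u},
      StrictMonoOn f (Iio γ) ∧ f '' Iio γ = p.top κ ∧ ∀ ν < γ, p.Lt (p.lam κ, ν) (κ, f ν)) ↔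
    p.TopEnum κ := by
  constructor
  · rintro ⟨γ, hγ, f, hf, him, hlt⟩
    have key : ∀ x y, p.Lt x y → x.1 = p.lam κ → y.1 = κ → x.2 < γ ∧ y.2 = f x.2 := by
      rintro ⟨α, ν⟩ ⟨κ', β⟩ h rfl rfl
      have : β ∈ f '' Iio γ := him ▸ (hw.mem_of_lt h).2
      obtain ⟨ν', hν', rfl⟩ := this
      obtain rfl := pred_unique hm hl h (hlt ν' hν')
      exact ⟨hν', rfl⟩
    refine ⟨γ, hγ, ?_, fun ν hν => ⟨_, hlt ν hν⟩, ?_⟩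
    · rintro ⟨κ', β⟩ hx rfl
      have : β ∈ f '' Iio γ := him ▸ hx
      obtain ⟨ν', hν', rfl⟩ := this
      exact ⟨ν', hν', hlt _ hν'⟩
    · intro x y h h1 h2 x' y' h' h1' h2'
      obtain ⟨h3, h4⟩ := key x y h h1 h2
      obtain ⟨h3', h4'⟩ := key x' y' h' h1' h2'
      rw [h4, h4']
      exact ⟨fun h => hf h3 h3' h, fun h => by rw [h]⟩
  · rintro ⟨γ, hγ, h1, h2, h3⟩
    choose! f hf using h2
    refine ⟨γ, hγ, f, fun a ha b hb hab => (h3 _ _ (hf a ha) rfl rfl _ _ (hf b hb) rfl rfl).1 hab, ?_, hf⟩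
    ext β
    constructor
    · rintro ⟨ν, hν, rfl⟩
      exact (hw.mem_of_lt (hf ν hν)).2
    · intro hβ
      obtain ⟨ν, hν, h⟩ := h1 (κ, β) hβ rfl
      exact ⟨ν, hν, (h3 _ _ (hf ν hν) rfl rfl _ _ h rfl rfl).2 rfl⟩

end MorassData

/-! ### Being a morass condition is definable -/

section Fields
variable {M : Set ZFSet.{u}} [hM : Fact (IsTransitiveModelZFCMinus M)]
variable {κ : Ordinal.{u}} [hκ : InM M κ]

instance dfn_wellFormed : Dfn M fun p : MorassData.{u} => p.WellFormed := by
  have h1 : Dfn M fun p : MorassData.{u} => ∀ z, z ∈ p.carrier → ∃ x, z = nodeCode x := by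
    have : Dfn M fun g : MorassData.{u} × ZFSet.{u} => ∃ x, g.2 = nodeCode x :=
      dfn_ex inferInstance fun g x hg h => by
        have h5 := (inM_prod.1 hg).2.1
        rw [h] at h5; exact ⟨h5⟩
    infer_instance
  have h2 : Dfn M fun p : MorassData.{u} => ∀ z, z ∈ p.tree → ∃ x, p.Mem x ∧ ∃ y, p.Mem y ∧
    z = ZFSet.pair (nodeCode x) (nodeCode y) := inferInstance
  have h3 : Dfn M fun p : MorassData.{u} => ∀ z, z ∈ p.maps → ∃ y, p.Mem y ∧ ∃ x, p.Lt x y ∧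
      ∃ f, ZFSet.IsFunc (x.2 + 1).toZFSet (y.2 + 1).toZFSet f ∧
      z = ZFSet.pair (ZFSet.pair (nodeCode x) (nodeCode y)) f := by
    have : Dfn M fun g : ((MorassData.{u} × ZFSet.{u}) × MorassNode.{u}) × MorassNode.{u} =>
        ∃ f, ZFSet.IsFunc (g.2.2 + 1).toZFSet (g.1.2.2 + 1).toZFSet f ∧
      g.1.1.2 = ZFSet.pair (ZFSet.pair (nodeCode g.2) (nodeCode g.1.2)) f := by
      refine dfn_ex inferInstance ?_
      rintro g f hg ⟨_, h⟩
      have h5 : g.1.1.2 ∈ M := (inM_prod.1 (inM_prod.1 (inM_prod.1 hg).1).1).2.1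
      rw [h, pair_mem_M_iff] at h5
      exact ⟨h5.2⟩
    infer_instance
  have h4 : Dfn M fun p : MorassData.{u} => ∀ x y, p.Lt x y →
      ∃ f, ZFSet.pair (ZFSet.pair (nodeCode x) (nodeCode y)) f ∈ p.maps ∧
      ∀ f', ZFSet.pair (ZFSet.pair (nodeCode x) (nodeCode y)) f' ∈ p.maps → f' = f := by
    have : Dfn M fun g : (MorassData.{u} × MorassNode.{u}) × MorassNode.{u} =>
      ∃ f, ZFSet.pair (ZFSet.pair (nodeCode g.1.2) (nodeCode g.2)) f ∈ g.1.1.maps ∧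
      ∀ f', ZFSet.pair (ZFSet.pair (nodeCode g.1.2) (nodeCode g.2)) f' ∈ g.1.1.maps → f' = f := by
      refine dfn_ex (dfn_and (hP := inferInstance) (hQ := dfn_all inferInstance ?_)) ?_
      · intro g f hg hf h
        exact (hf (map_inM (inM_prod.1 (inM_prod.1 (inM_prod.1 hg).1).1).1 h)).elim
      · rintro g f hg ⟨h, _⟩
        exact map_inM (inM_prod.1 (inM_prod.1 hg).1).1 h
    infer_instance
  have h5 : Dfn M fun p : MorassData.{u} => _ ∧ _ ∧ _ ∧ _ :=
    dfn_and (hP := h1) (hQ := dfn_and (hP := h2) (hQ := dfn_and (hP := h3) (hQ := h4)))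
  refine h5.congr fun p _ => propext ⟨fun h => ⟨h.carrier_nodes, ?_, ?_, h.maps_total⟩, ?_⟩
  · intro z hz
    obtain ⟨x, y, h6, h7, h8⟩ := h.tree_pairs z hz
    exact ⟨x, h6, y, h7, h8⟩
  · intro z hz
    obtain ⟨x, y, f, h6, h7, h8⟩ := h.maps_pairs z hz
    exact ⟨y, (h.mem_of_lt h6).2, x, h6, f, h7, h8⟩
  · rintro ⟨h6, h7, h8, h9⟩
    refine ⟨h6, ?_, ?_, h9⟩
    · intro z hz
      obtain ⟨x, h10, y, h11, h12⟩ := h7 z hz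
      exact ⟨x, y, h10, h11, h12⟩
    · intro z hz
      obtain ⟨y, h10, x, h11, f, h12⟩ := h8 z hz
      exact ⟨x, y, f, h11, h12⟩

instance dfn_linearPreds : Dfn M fun p : MorassData.{u} => p.LinearPreds := by
  have h : Dfn M fun p : MorassData.{u} => ∀ x y, p.Lt x y → ∀ z y', p.Lt z y' → y' = y →
    x = z ∨ p.Lt x z ∨ p.Lt z x := inferInstance
  refine h.congr fun p _ => propext ⟨fun h x y hxy z y' hzy e => h x y hxy z (e ▸ hzy), fun h x y hxy z hzy => ?_⟩
  exact h x y hxy z y hzy rfl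

set_option maxHeartbeats 1000000 in
instance dfn_topEnum : Dfn M fun p : MorassData.{u} => p.TopEnum κ := inferInstanceAs (Dfn M fun p : MorassData.{u} =>
  ∃ γ, γ ≤ p.theta (p.lam κ) ∧
    (∀ x, p.Mem x → x.1 = κ → ∃ ν, ν < γ ∧ p.Lt (p.lam κ, ν) x) ∧
    (∀ ν, ν < γ → ∃ β, p.Lt (p.lam κ, ν) (κ, β)) ∧
    (∀ x y, p.Lt x y → x.1 = p.lam κ → y.1 = κ → ∀ x' y', p.Lt x' y' → x'.1 = p.lam κ → y'.1 = κ →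
      (x.2 < x'.2 → y.2 < y'.2) ∧ (x.2 = x'.2 → y.2 = y'.2)))

/-- The first-order content of being a condition; see `isCondition_iff`. -/
def MorassData.Conds (κ : Ordinal.{u}) (K : Set Ordinal.{u}) (p : MorassData.{u}) : Fin 17 → Prop :=
  ![p.WellFormed, p.lam κ < κ,
    ∀ x, p.Mem x → (x.1 ≤ p.lam κ ∧ x.2 < κ) ∨ (x.1 = κ ∧ x.2 ∈ K),
    (∀ x y, p.Lt x y → x.1 < y.1),
    (∀ x y, p.Lt x y → ∀ x' z, p.Lt x' z → x' = y → p.Lt x z) ∧ p.LinearPreds,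
    ∀ α, α ≤ p.lam κ → 0 < p.theta α ∧ p.theta α < κ ∧ (∀ β, β < p.theta α → p.Mem (α, β)) ∧
      ∀ x, p.Mem x → x.1 = α → x.2 < p.theta α,
    p.Mem (κ, 0),
    ∀ x, p.Mem x → x.1 = κ → p.Mem (κ, x.2 + 1) ∧ ∀ β, β < x.2 → x.2 = β + 1 → p.Mem (κ, β),
    p.TopEnum κ,
    ∀ x y, p.Lt x y → ∀ x' z, p.Lt x' z → x' = y →
      ∀ ν, ν ≤ x.2 → p.π y z (p.π x y ν) = p.π x z ν,
    ∀ x y, p.Lt x y → (∀ γ, γ < x.2 → p.π x y (γ + 1) = p.π x y γ + 1) ∧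
      (∀ γ, γ ≤ x.2 → Order.IsSuccLimit γ → Order.IsSuccLimit (p.π x y γ)) ∧
      p.π x y 0 = 0 ∧ (∀ δ, δ ≤ x.2 → ∀ γ, γ < δ → p.π x y γ < p.π x y δ) ∧ p.π x y x.2 = y.2,
    ∀ x y, p.Lt x y → ∀ ν, ν < x.2 → p.Lt (x.1, ν) (y.1, p.π x y ν) ∧
      ∀ ξ, ξ ≤ ν → p.π (x.1, ν) (y.1, p.π x y ν) ξ = p.π x y ξ,
    ∀ y, p.Mem y → ∀ γ, γ < y.1 → 0 < γ →
      (∀ δ, δ < γ → ∃ x, p.Lt x y ∧ δ < x.1 ∧ x.1 < γ) → ∃ x, p.Lt x y ∧ x.1 = γ,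
    ∀ y, p.Mem y → y.1 ≤ p.lam κ → y.2 + 1 ≠ p.theta y.1 → p.UnboundedBelow y,
    ∀ y, p.Mem y → p.UnboundedBelow y → (∀ ξ, ξ < y.2 → ∃ x, p.Lt x y ∧ ∃ ν, ν < x.2 ∧ p.π x y ν = ξ) ∧
      ∀ x y', p.Lt x y' → y' = y → ∀ ν, ν < x.2 → p.π x y ν < y.2,
    ∀ x y, p.Lt x y → p.ImmLt x y → y.1 ≤ p.lam κ → Order.IsSuccLimit x.2 →
      p.Lt x (y.1, sSup {μ | ∃ ν, ν < x.2 ∧ p.π x y ν = μ}) ∧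
      ∀ ξ, ξ < x.2 → p.π x (y.1, sSup {μ | ∃ ν, ν < x.2 ∧ p.π x y ν = μ}) ξ = p.π x y ξ,
    ∀ x y, p.Lt x y → p.ImmLt x y → y.1 ≤ p.lam κ → ∀ α, α < y.1 → x.1 < α →
      Order.IsSuccLimit x.2 → y.2 = sSup {μ | ∃ ν, ν < x.2 ∧ p.π x y ν = μ} →
      (∀ ν, ν < x.2 → ∃ γ, p.Lt (α, γ) (y.1, p.π x y ν)) → ∃ γ, p.Lt (α, γ) y]

/-- In `Conds` every quantifier is bounded by `p` or by an ordinal, so that it may be relativised to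
`M`. Equivalences over all ordinals are split into two bounded halves, and a chain `x ≺ y ≺ z` is
written as two related pairs with an equation, to fit the quantifier over `≺`. -/
theorem MorassData.isCondition_iff {κ : Ordinal.{u}} {K : Set Ordinal.{u}} {p : MorassData.{u}} :
    p.IsCondition κ K ↔ ∀ i, p.Conds κ K i := by
  have himg : ∀ (f : Ordinal.{u} → Ordinal.{u}) (a : Ordinal.{u}),
      f '' Iio a = {μ | ∃ ν, ν < a ∧ f ν = μ} := fun f a => rfl
  have htop : (∀ β, p.Mem (κ, β) ↔ p.Mem (κ, β + 1)) ↔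
      ∀ x, p.Mem x → x.1 = κ → p.Mem (κ, x.2 + 1) ∧ ∀ β, β < x.2 → x.2 = β + 1 → p.Mem (κ, β) := by
    constructor
    · rintro h ⟨κ', β⟩ hx rfl
      refine ⟨(h β).1 hx, fun β' _ e => (h β').2 ?_⟩
      rw [← show β = _ from e]; exact hx
    · intro h β
      exact ⟨fun h1 => (h _ h1 rfl).1, fun h1 => (h _ h1 rfl).2 β (Order.lt_add_one_iff.2 le_rfl) rfl⟩
  have hleft : ∀ α, (∀ β, p.Mem (α, β) ↔ β < p.theta α) ↔ ((∀ β, β < p.theta α → p.Mem (α, β)) ∧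
      ∀ x, p.Mem x → x.1 = α → x.2 < p.theta α) := by
    intro α
    constructor
    · intro h
      refine ⟨fun β hβ => (h β).2 hβ, ?_⟩
      rintro ⟨α', β⟩ hx rfl
      exact (h β).1 hx
    · rintro ⟨h1, h2⟩ β
      exact ⟨fun h => h2 _ h rfl, h1 β⟩
  have htrans : (∀ x y, p.Lt x y → ∀ z, p.Lt y z → p.Lt x z) ↔
      ∀ x y, p.Lt x y → ∀ x' z, p.Lt x' z → x' = y → p.Lt x z :=
    ⟨fun h x y hxy x' z hz e => h x y hxy z (e ▸ hz), fun h x y hxy z hz => h x y hxy y z hz rfl⟩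
  have hcomm : (∀ x y z, p.Lt x y → p.Lt y z → ∀ ν ≤ x.2, p.π y z (p.π x y ν) = p.π x z ν) ↔
      ∀ x y, p.Lt x y → ∀ x' z, p.Lt x' z → x' = y →
      ∀ ν, ν ≤ x.2 → p.π y z (p.π x y ν) = p.π x z ν :=
    ⟨fun h x y hxy x' z hz e => h x y z hxy (e ▸ hz), fun h x y z hxy hz => h x y hxy y z hz rfl⟩
  have h5 : (∀ y, p.Mem y → p.UnboundedBelow y →
        ∀ ξ, ξ < y.2 ↔ ∃ x, p.Lt x y ∧ ∃ ν < x.2, p.π x y ν = ξ) ↔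
      ∀ y, p.Mem y → p.UnboundedBelow y →
      (∀ ξ, ξ < y.2 → ∃ x, p.Lt x y ∧ ∃ ν, ν < x.2 ∧ p.π x y ν = ξ) ∧
      ∀ x y', p.Lt x y' → y' = y → ∀ ν, ν < x.2 → p.π x y ν < y.2 := by
    refine forall_congr' fun y => imp_congr_right fun _ => imp_congr_right fun _ => ?_
    constructor
    · intro h
      refine ⟨fun ξ hξ => (h ξ).1 hξ, ?_⟩
      rintro x y' hx rfl ν hν
      exact (h _).2 ⟨x, hx, ν, hν, rfl⟩
    · rintro ⟨h1, h2⟩ ξ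
      refine ⟨h1 ξ, ?_⟩
      rintro ⟨x, hx, ν, hν, rfl⟩
      exact h2 x y hx rfl ν hν
  simp only [Conds, Fin.forall_fin_succ, Matrix.cons_val_zero, Matrix.cons_val_succ,
    IsEmpty.forall_iff, and_true, ← htop, ← htrans, ← hcomm, ← h5, ← hleft]
  constructor
  · intro h
    refine ⟨h.wellFormed, h.lam_lt, h.nodes, h.monotone, (treeOrder_iff h.monotone).1 h.treeOrder,
      h.leftAligned, h.top_zero, h.top_succ, ?_, h.commutative, ?_, h.m2, h.m3, h.m4, h.m5, ?_, ?_⟩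
    · exact (topEnum_iff h.wellFormed h.monotone ((treeOrder_iff h.monotone).1 h.treeOrder).2).1 h.top_enum
    · intro x y hxy
      obtain ⟨h1, h2⟩ := h.m1 x y hxy
      exact ⟨h1.succ, h1.limit, h1.zero, h1.strictMono, h2⟩
    · intro x y _; exact h.m6 x y
    · intro x y _ hi hy α h1 h2; exact h.m7 x y hi hy α h2 h1
  · rintro ⟨h1, h2, h3, h4, h5, h6, h7, h8, h9, h10, h11, h12, h13, h14, h15, h16, h17⟩
    exact ⟨h1, h2, h3, (treeOrder_iff h4).2 h5, h6, h7, h8, (topEnum_iff h1 h4 h5.2).2 h9, h4, h10,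
      fun x y hxy => ⟨⟨(h11 x y hxy).1, (h11 x y hxy).2.1, (h11 x y hxy).2.2.1, (h11 x y hxy).2.2.2.1⟩,
        (h11 x y hxy).2.2.2.2⟩, h12, h13, h14, h15, fun x y hi => h16 x y hi.1 hi,
      fun x y hi hy α h1 h2 => h17 x y hi.1 hi hy α h2 h1⟩

variable {X : Type*} [Coded.{u} X] [hX : CodedIn M X]

theorem dfn_memK {K : Set Ordinal.{u}} (hK : Dfn M fun β => β ∈ K) {F : X → Ordinal.{u}} [hF : Dfn M F] :
    Dfn M fun x => F x ∈ K := hK.comp hF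

instance dfn_ne {Y : Type*} [Coded.{u} Y] [CodedIn M Y] {F G : X → Y} [hF : Dfn M F] [hG : Dfn M G] :
    Dfn M fun x => F x ≠ G x := dfn_not

attribute [local instance] dfn_app dfn_app₂

instance dfn_isSuccLimit {F : X → Ordinal.{u}} [hF : Dfn M F] :
    Dfn M fun x => Order.IsSuccLimit (F x) :=
  (inferInstance : Dfn M fun x => ¬ F x = 0 ∧ ∀ ν, ν < F x → ν + 1 < F x).congr fun x _ => by
    rw [Ordinal.isSuccLimit_iff, Order.isSuccPrelimit_iff_succ_lt]
    simp only [Order.succ_eq_add_one, ne_eq]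

theorem bddAbove_image_lt (F : Ordinal.{u} → Ordinal.{u}) (a : Ordinal.{u}) :
    BddAbove {μ | ∃ ν, ν < a ∧ F ν = μ} := by
  have : {μ | ∃ ν, ν < a ∧ F ν = μ} = F '' Iio a := rfl
  rw [this]
  exact Ordinal.bddAbove_of_small

theorem lt_sSup_image {F : Ordinal.{u} → Ordinal.{u}} {a β : Ordinal.{u}} :
    β < sSup {μ | ∃ ν, ν < a ∧ F ν = μ} ↔ ∃ ν, ν < a ∧ β < F ν := by
  constructor
  · intro h
    have hne : {μ | ∃ ν, ν < a ∧ F ν = μ}.Nonempty := by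
      by_contra hne
      rw [not_nonempty_iff_eq_empty] at hne
      rw [hne, sSup_empty_ordinal] at h
      exact not_lt_zero h
    obtain ⟨_, ⟨ν, hν, rfl⟩, h1⟩ := exists_lt_of_lt_csSup hne h
    exact ⟨ν, hν, h1⟩
  · rintro ⟨ν, hν, h⟩
    exact h.trans_le (le_csSup (bddAbove_image_lt F a) ⟨ν, hν, rfl⟩)

/-- No bound for the values need be known in advance: Replacement gives the set of values, and its
union is the supremum. -/
instance dfn_sSupImage {A : X → Ordinal.{u}} {F : X → Ordinal.{u} → Ordinal.{u}} [hA : Dfn M A]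
    [hF : Dfn M fun z : X × Ordinal.{u} => F z.1 z.2] :
    Dfn M fun x => sSup {μ | ∃ ν, ν < A x ∧ F x ν = μ} := by
  refine dfn_of_code ((inferInstance : Dfn M fun x =>
    ZFSet.sUnion (img (fun ν => (F x ν).toZFSet) (A x).toZFSet)).congr fun x hx => ?_)
  ext z
  simp only [Coded.code, Ordinal.mem_toZFSet_iff, ZFSet.mem_sUnion, mem_img, lt_sSup_image]
  constructor
  · rintro ⟨β, ⟨ν, h1, h2⟩, rfl⟩
    exact ⟨_, ⟨ν, ⟨ν, h1, rfl⟩, rfl⟩, Ordinal.toZFSet_mem_toZFSet_iff.2 h2⟩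
  · rintro ⟨_, ⟨ν, ⟨ν', h1, h2⟩, rfl⟩, h3⟩
    obtain rfl := Ordinal.toZFSet_injective h2
    obtain ⟨β, h4, rfl⟩ := Ordinal.mem_toZFSet_iff.1 h3
    exact ⟨β, ⟨_, h1, h4⟩, rfl⟩

theorem dfn_forall_fin {n : ℕ} {R : X → Fin n → Prop} (h : ∀ i, Dfn M fun x => R x i) :
    Dfn M fun x => ∀ i, R x i := by
  induction n with
  | zero => exact dfn_true.congr fun x _ => by simp
  | succ n ih =>
    have h1 := h 0
    have h2 := ih (R := fun x i => R x i.succ) fun i => h i.succ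
    exact (dfn_and (hP := h1) (hQ := h2)).congr fun x _ => propext Fin.forall_fin_succ

set_option maxHeartbeats 2000000 in
theorem dfn_isCondition {K : Set Ordinal.{u}} (hK : Dfn M fun β => β ∈ K) :
    Dfn M fun p : MorassData.{u} => p.IsCondition κ K := by
  refine Dfn.congr (F := fun p : MorassData.{u} => ∀ i, p.Conds κ K i)
    (dfn_forall_fin fun i => ?_) fun p _ => propext MorassData.isCondition_iff
  have hK' : Dfn M fun z : MorassData.{u} × MorassNode.{u} => z.2.2 ∈ K := dfn_memK hK
  fin_cases i <;> simp only [MorassData.Conds, Fin.reduceFinMk, Matrix.cons_val, Fin.zero_eta, Fin.mk_one,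
    Fin.isValue]
  all_goals infer_instance

end Fields

/-! ### The order of the forcing is definable -/

section Extends
variable {M : Set ZFSet.{u}} [hM : Fact (IsTransitiveModelZFCMinus M)]
variable {κ : Ordinal.{u}} [hκ : InM M κ]
variable {X : Type*} [Coded.{u} X] [hX : CodedIn M X]

theorem dfn_extends : Dfn M fun z : MorassData.{u} × MorassData.{u} => z.1.Extends κ z.2 := by
  refine (inferInstance : Dfn M fun z : MorassData.{u} × MorassData.{u} =>
    (∀ x, z.1.Mem x → z.2.Mem x) ∧
    ((∀ x, z.1.Mem x → x.1 ≤ z.1.lam κ → x.2 < κ → z.2.Mem x) ∧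
      ∀ x, z.2.Mem x → x.1 ≤ z.1.lam κ → x.2 < κ → z.1.Mem x) ∧
    ((∀ x y, z.1.Lt x y → z.1.Mem x ∧ z.1.Mem y ∧ z.2.Lt x y) ∧
      ∀ x y, z.2.Lt x y → z.1.Mem x → z.1.Mem y → z.1.Lt x y) ∧
    (∀ x y, z.1.Lt x y → ∀ ν, ν ≤ x.2 → z.1.π x y ν = z.2.π x y ν) ∧
    z.1.lam κ ≤ z.2.lam κ ∧
    ∀ x y, z.2.Lt x y → x.1 < z.1.lam κ → z.1.lam κ < y.1 →
      ∃ w, z.2.Lt x w ∧ w.1 = z.1.lam κ ∧ z.2.Lt w y).congr fun z _ => propext ⟨fun h => ?_, ?_⟩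
  · refine ⟨h.subset, ⟨fun x hx h1 h2 => (h.nodes_eq x h1 h2).1 hx, fun x hx h1 h2 => (h.nodes_eq x h1 h2).2 hx⟩,
      ⟨fun x y hxy => (h.lt_eq x y).1 hxy, fun x y h1 h2 h3 => (h.lt_eq x y).2 ⟨h2, h3, h1⟩⟩, h.maps_eq,
      h.mangal.1, fun x y h1 h2 h3 => ?_⟩
    obtain ⟨w, h4, h5, h6⟩ := h.mangal.2 x y h1 h2 h3
    exact ⟨w, h5, h4, h6⟩
  · rintro ⟨h1, ⟨h2, h3⟩, ⟨h4, h5⟩, h6, h7, h8⟩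
    refine ⟨h1, fun x h9 h10 => ⟨fun h => h2 x h h9 h10, fun h => h3 x h h9 h10⟩,
      fun x y => ⟨fun h => h4 x y h, fun h => h5 x y h.2.2 h.1 h.2.1⟩, h6, h7, fun x y h9 h10 h11 => ?_⟩
    obtain ⟨w, h4, h5, h6⟩ := h8 x y h9 h10 h11
    exact ⟨w, h5, h4, h6⟩

instance dfn_extends' {P Q : X → MorassData.{u}} [hP : Dfn M P] [hQ : Dfn M Q] :
    Dfn M fun x => (P x).Extends κ (Q x) :=
  dfn_extends.comp (dfn_pair (F := P) (G := Q))

end Extends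

/-! ### Recursion inside the model -/

section Recursion
variable {M : Set ZFSet.{u}} [hM : Fact (IsTransitiveModelZFCMinus M)]
variable {X Y : Type*} [Coded.{u} X] [hX : CodedIn M X] [Coded.{u} Y] [hY : CodedIn M Y]
attribute [local instance] dfn_app dfn_app₂

/-- Recursion along a definable set-like relation `code y ∈ P x` that decreases the rank `ρ`. -/
theorem dfn_rec (P : X → ZFSet.{u}) [hP : Dfn M P] (ρ : X → Ordinal.{u})
    (hρ : ∀ x y, Coded.code y ∈ P x → ρ y < ρ x) (F : X → ZFSet.{u} → Y)
    [hF : Dfn M fun z : X × ZFSet.{u} => F z.1 z.2] (G : X → Y)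
    (hG : ∀ x, G x = F x (img (fun y : X => Coded.code (y, G y)) (P x))) : Dfn M G := by
  let restr : X → ZFSet.{u} → ZFSet.{u} := fun x h =>
    ZFSet.sep (fun w => ∃ y : X, InM M y ∧ (∃ v : Y, InM M v ∧ (Coded.code y ∈ P x ∧ w = Coded.code (y, v)))) h
  -- An approximation is a set of pairs whose arguments are closed under predecessors and whose
  -- values obey the recursion, evaluated on `restr y h`, the part of `h` over the predecessors of
  -- `y`.
  let Att : ZFSet.{u} → Prop := fun h => ∀ w, w ∈ h → ∃ y : X, InM M y ∧ ∃ v : Y, InM M v ∧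
    (w = Coded.code (y, v) ∧ (∀ y' : X, InM M y' → (Coded.code y' ∈ P y →
      ∃ v' : Y, InM M v' ∧ Coded.code (y', v') ∈ h)) ∧ v = F y (restr y h))
  have hrestr : Dfn M fun z : X × ZFSet.{u} => restr z.1 z.2 := inferInstanceAs (Dfn M fun z : X × ZFSet.{u} =>
    ZFSet.sep (fun w => ∃ y : X, InM M y ∧ (∃ v : Y, InM M v ∧ (Coded.code y ∈ P z.1 ∧ w = Coded.code (y, v)))) z.2)
  have hAtt : Dfn M Att := inferInstanceAs (Dfn M fun h : ZFSet.{u} => ∀ w, w ∈ h → ∃ y : X, InM M y ∧ ∃ v : Y, InM M v ∧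
    (w = Coded.code (y, v) ∧ (∀ y' : X, InM M y' → (Coded.code y' ∈ P y →
      ∃ v' : Y, InM M v' ∧ Coded.code (y', v') ∈ h)) ∧ v = F y (restr y h)))
  have codeM : ∀ {y : X} {v : Y} {h : ZFSet.{u}}, h ∈ M → Coded.code (y, v) ∈ h → InM M y ∧ InM M v := by
    intro y v h hh hyv
    exact (inM_prod (x := (y, v))).1 ⟨mem_trans_M hh hyv⟩
  have codeI : ∀ {y y' : X} {v v' : Y}, (Coded.code (y, v) : ZFSet.{u}) = Coded.code (y', v') → y = y' ∧ v = v' := by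
    intro y y' v v' e
    exact Prod.mk.inj (code_injective e)
  -- approximations to the recursion take the values of `G`
  have hval : ∀ h ∈ M, (∀ (y : X) v, Coded.code (y, v) ∈ h → v = G y) → ∀ y, InM M y →
      (∀ y' : X, InM M y' → Coded.code y' ∈ P y → ∃ v' : Y, InM M v' ∧ Coded.code (y', v') ∈ h) →
      restr y h = img (fun y : X => Coded.code (y, G y)) (P y) := by
    intro h hh hv y hy hc
    ext w
    rw [ZFSet.mem_sep, mem_img]
    constructor
    · rintro ⟨hw, y', hy', v, hv', h1, rfl⟩
      exact ⟨y', h1, by rw [← hv _ _ hw]⟩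
    · rintro ⟨y', h1, rfl⟩
      have hy' : InM M y' := inM_of_code_mem h1 (hP.inM _ hy)
      obtain ⟨v', h2, h3⟩ := hc y' hy' h1
      obtain rfl := hv _ _ h3
      exact ⟨h3, y', hy', _, h2, h1, rfl⟩
  have hattG : ∀ h ∈ M, Att h → ∀ o, ∀ y : X, ρ y = o → ∀ v, Coded.code (y, v) ∈ h → v = G y := by
    intro h hh ha o
    induction o using WellFoundedLT.induction with
    | ind o ih =>
      rintro y rfl v hyv
      obtain ⟨y1, hy1, v1, hv1, h1, h2, h3⟩ := ha _ hyv
      obtain ⟨rfl, rfl⟩ := codeI h1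
      rw [h3, hG]
      congr 1
      ext w
      rw [ZFSet.mem_sep, mem_img]
      constructor
      · rintro ⟨hw, y', hy', v', hv', h4, rfl⟩
        exact ⟨y', h4, by rw [← ih _ (hρ _ _ h4) y' rfl _ hw]⟩
      · rintro ⟨y', h4, rfl⟩
        have hy' : InM M y' := inM_of_code_mem h4 (hP.inM _ hy1)
        obtain ⟨v', h5, h6⟩ := h2 y' hy' h4
        obtain rfl := ih _ (hρ _ _ h4) y' rfl _ h6
        exact ⟨h6, y', hy', _, h5, h4, rfl⟩
  have hex : ∀ o, ∀ x, ρ x = o → InM M x → ∃ h ∈ M, Att h ∧ Coded.code (x, G x) ∈ h := by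
    intro o
    induction o using WellFoundedLT.induction with
    | ind o ih =>
      rintro x rfl hx
      have hR : Dfn M fun z : (X × ZFSet.{u}) × ZFSet.{u} => (Att z.2 ∧ ∀ y : X, InM M y → (z.1.2 = Coded.code y →
          ∃ v : Y, InM M v ∧ Coded.code (y, v) ∈ z.2)) := inferInstance
      obtain ⟨b, hb, h1⟩ := exists_collection (R := fun _ c h => Att h ∧ ∀ y : X, InM M y → (c = Coded.code y →
          ∃ v : Y, InM M v ∧ Coded.code (y, v) ∈ h)) hR hx (hP.inM x hx).1 (by
        intro c hc
        by_cases h2 : ∃ y : X, c = Coded.code y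
        · obtain ⟨y, rfl⟩ := h2
          obtain ⟨h, hh, h3, h4⟩ := ih _ (hρ _ _ hc) y rfl (inM_of_code_mem hc (hP.inM x hx))
          refine ⟨h, ⟨hh⟩, h3, fun y' hy' e => ?_⟩
          cases code_injective e
          exact ⟨_, (codeM hh h4).2, h4⟩
        · exact ⟨∅, inferInstance, fun w hw => (ZFSet.notMem_empty _ hw).elim, fun y _ e => (h2 ⟨y, e⟩).elim⟩)
      -- Collection may also deliver sets that are not approximations; they are removed before the
      -- union is taken.
      have hS : InM M (ZFSet.sUnion (ZFSet.sep Att b)) :=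
        (dfn_sUnion (A := fun b => ZFSet.sep Att b)
          (hA := dfn_sep (A := fun b => b) (R := fun _ => Att))).inM b ⟨hb⟩
      set S := ZFSet.sUnion (ZFSet.sep Att b) with hSdef
      have hSm : ∀ w, w ∈ S ↔ ∃ h ∈ M, Att h ∧ h ∈ b ∧ w ∈ h := by
        intro w
        rw [hSdef, ZFSet.mem_sUnion]
        constructor
        · rintro ⟨h, h2, h3⟩
          rw [ZFSet.mem_sep] at h2
          exact ⟨h, mem_trans_M hb h2.1, h2.2, h2.1, h3⟩
        · rintro ⟨h, _, h2, h3, h4⟩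
          exact ⟨h, ZFSet.mem_sep.2 ⟨h3, h2⟩, h4⟩
      have hSv : ∀ (y : X) v, Coded.code (y, v) ∈ S → v = G y := by
        intro y v h
        obtain ⟨h', h2, h3, _, h4⟩ := (hSm _).1 h
        exact hattG h' h2 h3 _ y rfl v h4
      have hxc : ∀ y' : X, InM M y' → Coded.code y' ∈ P x → ∃ v' : Y, InM M v' ∧ Coded.code (y', v') ∈ S := by
        intro y' hy' h2
        obtain ⟨h, hh, ⟨h3, h4⟩, h5⟩ := h1 _ h2
        obtain ⟨v, hv, h6⟩ := h4 y' hy' rfl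
        exact ⟨v, hv, (hSm _).2 ⟨h, hh.1, h3, h5, h6⟩⟩
      have hGx : InM M (G x) := by
        rw [hG, ← hval S hS.1 hSv x hx hxc]
        exact hF.inM (x, restr x S) (inM_prod.2 ⟨hx, hrestr.inM (x, S) (inM_prod.2 ⟨hx, hS⟩)⟩)
      -- The approximations at the predecessors of `x` agree with `G`, so their union with the one
      -- new pair is an approximation at `x`.
      have hT : InM M (insert (Coded.code (x, G x)) S) :=
        (inferInstance : Dfn M fun z : ZFSet.{u} × ZFSet.{u} => insert z.1 z.2).inM
          (Coded.code (x, G x), S) (inM_prod.2 ⟨⟨(inM_prod.2 ⟨hx, hGx⟩ : InM M (x, G x)).1⟩, hS⟩)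
      have hTv : ∀ (y : X) v, Coded.code (y, v) ∈ insert (Coded.code (x, G x)) S → v = G y := by
        intro y v h
        rcases ZFSet.mem_insert_iff.1 h with h | h
        · obtain ⟨rfl, rfl⟩ := codeI h; rfl
        · exact hSv y v h
      refine ⟨_, hT.1, ?_, ZFSet.mem_insert _ _⟩
      intro w hw
      rcases ZFSet.mem_insert_iff.1 hw with rfl | hw
      · have hc : ∀ y' : X, InM M y' → Coded.code y' ∈ P x → ∃ v' : Y, InM M v' ∧
            Coded.code (y', v') ∈ insert (Coded.code (x, G x)) S := fun y' hy' h2 => by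
          obtain ⟨v', hv', h3⟩ := hxc y' hy' h2
          exact ⟨v', hv', ZFSet.mem_insert_of_mem _ h3⟩
        exact ⟨x, hx, G x, hGx, rfl, hc, by rw [hval _ hT.1 hTv x hx hc, ← hG]⟩
      · obtain ⟨h, hh, ha, hb', hw'⟩ := (hSm w).1 hw
        obtain ⟨y, hy, v, hv, rfl, h3, h4⟩ := ha w hw'
        have hc : ∀ y' : X, InM M y' → Coded.code y' ∈ P y → ∃ v' : Y, InM M v' ∧
            Coded.code (y', v') ∈ insert (Coded.code (x, G x)) S := fun y' hy' h2 => by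
          obtain ⟨v', hv', h5⟩ := h3 y' hy' h2
          exact ⟨v', hv', ZFSet.mem_insert_of_mem _ ((hSm _).2 ⟨h, hh, ha, hb', h5⟩)⟩
        exact ⟨y, hy, v, hv, rfl, hc, by rw [hval _ hT.1 hTv y hy hc, ← hG]; exact hSv _ _ hw⟩
  have hGM : ∀ x, InM M x → InM M (G x) := fun x hx => by
    obtain ⟨h, hh, _, h2⟩ := hex _ x rfl hx
    exact (codeM hh h2).2
  refine dfn_of_graph hGM ?_
  refine (inferInstance : Dfn M fun z : X × Y => ∃ h, InM M h ∧ (Att h ∧ Coded.code z ∈ h)).congr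
    fun z hz => propext ⟨fun e => ?_, ?_⟩
  · obtain ⟨h, hh, h1, h2⟩ := hex _ z.1 rfl (inM_prod.1 hz).1
    refine ⟨h, ⟨hh⟩, h1, ?_⟩
    rw [show z = (z.1, G z.1) from Prod.ext rfl e]; exact h2
  · rintro ⟨h, hh, h1, h2⟩
    exact hattG h hh.1 h1 _ z.1 rfl z.2 h2

/-- Recursion on ordinals. -/
theorem dfn_rec_ord (F : Ordinal.{u} → ZFSet.{u} → Y)
    [hF : Dfn M fun z : Ordinal.{u} × ZFSet.{u} => F z.1 z.2] (G : Ordinal.{u} → Y)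
    (hG : ∀ x, G x = F x (img (fun y : Ordinal.{u} => Coded.code (y, G y)) x.toZFSet)) : Dfn M G :=
  dfn_rec (hP := dfn_toZFSet (F := fun α => α)) (fun α : Ordinal.{u} => α.toZFSet) (fun α => α)
    (fun x y h => Ordinal.toZFSet_mem_toZFSet_iff.1 h) F G hG

end Recursion

/-! ### Gluing an upper part onto a condition -/

/-- Nodes, tree order and maps, without a code. -/
structure PreMorass where
  Mem : MorassNode.{u} → Prop
  Lt : MorassNode.{u} → MorassNode.{u} → Prop
  π : MorassNode.{u} → MorassNode.{u} → Ordinal.{u} → Ordinal.{u}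

namespace PreMorass

/-- `y` is an immediate successor of `x`. -/
def ImmLt (U : PreMorass.{u}) (x y : MorassNode.{u}) : Prop := U.Lt x y ∧ ¬ ∃ z, U.Lt x z ∧ U.Lt z y

/-- `U` satisfies the requirements on morass conditions on the levels in `[l, L] ∪ {κ}`. -/
structure IsUpper (κ : Ordinal.{u}) (K : Set Ordinal.{u}) (l L : Ordinal.{u}) (U : PreMorass.{u}) : Prop where
  lt_mem : ∀ x y, U.Lt x y → U.Mem x ∧ U.Mem y
  le_level : ∀ x, U.Mem x → l ≤ x.1
  le : l ≤ L
  lt_card : L < κ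
  nodes : ∀ x, U.Mem x → (x.1 ≤ L ∧ x.2 < κ) ∨ (x.1 = κ ∧ x.2 ∈ K)
  trans : ∀ x y z, U.Lt x y → U.Lt y z → U.Lt x z
  linear : ∀ x y z, U.Lt x y → U.Lt z y → x = z ∨ U.Lt x z ∨ U.Lt z x
  leftAligned : ∀ α, l ≤ α → α ≤ L → ∃ θ, 0 < θ ∧ θ < κ ∧ ∀ β, U.Mem (α, β) ↔ β < θ
  top_zero : U.Mem (κ, 0)
  top_succ : ∀ β, U.Mem (κ, β) ↔ U.Mem (κ, β + 1)
  top_enum : ∃ γ, ∃ f : Ordinal.{u} → Ordinal.{u},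
    StrictMonoOn f (Iio γ) ∧ f '' Iio γ = {β | U.Mem (κ, β)} ∧ ∀ ν < γ, U.Lt (L, ν) (κ, f ν)
  monotone : ∀ x y, U.Lt x y → x.1 < y.1
  commutative : ∀ x y z, U.Lt x y → U.Lt y z → ∀ ν ≤ x.2, U.π y z (U.π x y ν) = U.π x z ν
  m1 : ∀ x y, U.Lt x y → MorassData.IsSloop (U.π x y) x.2 ∧ U.π x y x.2 = y.2
  m2 : ∀ x y, U.Lt x y → ∀ ν < x.2, U.Lt (x.1, ν) (y.1, U.π x y ν) ∧
    ∀ ξ ≤ ν, U.π (x.1, ν) (y.1, U.π x y ν) ξ = U.π x y ξ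
  m3 : ∀ y, U.Mem y → ∀ γ < y.1, l < γ →
    (∀ δ < γ, ∃ x, U.Lt x y ∧ δ < x.1 ∧ x.1 < γ) → ∃ x, U.Lt x y ∧ x.1 = γ
  m4 : ∀ y, U.Mem y → l < y.1 → y.1 ≤ L → U.Mem (y.1, y.2 + 1) → ∀ δ < y.1, ∃ x, U.Lt x y ∧ δ < x.1
  m5 : ∀ y, U.Mem y → l < y.1 → (∀ δ < y.1, ∃ x, U.Lt x y ∧ δ < x.1) →
    ∀ ξ < y.2, ∃ x, U.Lt x y ∧ ∃ ν < x.2, U.π x y ν = ξ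
  m6 : ∀ x y, U.ImmLt x y → y.1 ≤ L → Order.IsSuccLimit x.2 →
    U.Lt x (y.1, sSup (U.π x y '' Iio x.2)) ∧
      ∀ ξ < x.2, U.π x (y.1, sSup (U.π x y '' Iio x.2)) ξ = U.π x y ξ
  m7 : ∀ x y, U.ImmLt x y → y.1 ≤ L → ∀ α, x.1 < α → α < y.1 →
    Order.IsSuccLimit x.2 → y.2 = sSup (U.π x y '' Iio x.2) →
    (∀ ν < x.2, ∃ γ, U.Lt (α, γ) (y.1, U.π x y ν)) → ∃ γ, U.Lt (α, γ) y

theorem IsUpper.pred_unique {κ : Ordinal.{u}} {K : Set Ordinal.{u}} {l L : Ordinal.{u}} {U : PreMorass.{u}}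
    (h : U.IsUpper κ K l L) {α ν ν' : Ordinal.{u}} {y : MorassNode.{u}} (h1 : U.Lt (α, ν) y)
    (h2 : U.Lt (α, ν') y) : ν = ν' := by
  rcases h.linear _ _ _ h1 h2 with h3 | h3 | h3
  · exact congrArg Prod.snd h3
  · exact absurd (h.monotone _ _ h3) (lt_irrefl _)
  · exact absurd (h.monotone _ _ h3) (lt_irrefl _)

end PreMorass

namespace MorassData

theorem IsSloop.le {g : Ordinal.{u} → Ordinal.{u}} {α : Ordinal.{u}} (h : IsSloop g α) {γ : Ordinal.{u}}
    (hγ : γ ≤ α) : g γ ≤ g α := by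
  rcases hγ.lt_or_eq with h1 | rfl
  exacts [(h.strictMono _ le_rfl _ h1).le, le_rfl]

theorem IsSloop.congr {g h : Ordinal.{u} → Ordinal.{u}} {α : Ordinal.{u}} (H : IsSloop g α)
    (e : ∀ ξ ≤ α, h ξ = g ξ) : IsSloop h α where
  succ γ hγ := by rw [e _ (Order.add_one_le_iff.2 hγ), e _ hγ.le, H.succ γ hγ]
  limit γ hγ hl := by rw [e _ hγ]; exact H.limit γ hγ hl
  zero := by rw [e _ zero_le, H.zero]
  strictMono δ hδ γ hγ := by rw [e _ hδ, e _ (hγ.le.trans hδ)]; exact H.strictMono δ hδ γ hγ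

theorem IsSloop.comp {g h : Ordinal.{u} → Ordinal.{u}} {α β : Ordinal.{u}} (H : IsSloop g α)
    (e : g α = β) (H' : IsSloop h β) : IsSloop (fun ξ => h (g ξ)) α where
  succ γ hγ := by
    have h1 : g γ < β := e ▸ H.strictMono _ le_rfl _ hγ
    rw [H.succ γ hγ, H'.succ _ h1]
  limit γ hγ hl := H'.limit _ (e ▸ H.le hγ) (H.limit γ hγ hl)
  zero := by rw [H.zero, H'.zero]
  strictMono δ hδ γ hγ := H'.strictMono _ (e ▸ H.le hδ) _ (H.strictMono δ hδ γ hγ)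

variable {κ : Ordinal.{u}} {K : Set Ordinal.{u}} {p q b r : MorassData.{u}}

theorem lam_eq {L : Ordinal.{u}} (h1 : L < κ) (h2 : ∃ β, p.Mem (L, β)) (h3 : ∀ x, p.Mem x → x.1 < κ → x.1 ≤ L) :
    p.lam κ = L := by
  refine le_antisymm (csSup_le ⟨L, h1, h2⟩ fun α h => ?_) (le_csSup ⟨κ, fun α h => h.1.le⟩ ⟨h1, h2⟩)
  obtain ⟨β, hβ⟩ := h.2
  exact h3 _ hβ h.1

theorem theta_eq {α θ : Ordinal.{u}} (h : ∀ β, p.Mem (α, β) ↔ β < θ) : p.theta α = θ := by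
  have : {β | ¬ p.Mem (α, β)} = Ici θ := by
    ext β; simp [h]
  rw [theta, this, csInf_Ici]

theorem theta_congr {α : Ordinal.{u}} (h : ∀ β, p.Mem (α, β) ↔ q.Mem (α, β)) : p.theta α = q.theta α := by
  simp only [theta, h]

namespace IsCondition

theorem lt_mem (h : p.IsCondition κ K) {x y : MorassNode.{u}} (hxy : p.Lt x y) : p.Mem x ∧ p.Mem y :=
  h.wellFormed.mem_of_lt hxy

theorem linearPreds (h : p.IsCondition κ K) : p.LinearPreds := ((treeOrder_iff h.monotone).1 h.treeOrder).2

theorem linear (h : p.IsCondition κ K) {x y z : MorassNode.{u}} (h1 : p.Lt x y) (h2 : p.Lt z y) :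
    x = z ∨ p.Lt x z ∨ p.Lt z x := h.linearPreds x y h1 z h2

theorem trans (h : p.IsCondition κ K) {x y z : MorassNode.{u}} (h1 : p.Lt x y) (h2 : p.Lt y z) : p.Lt x z :=
  h.treeOrder.trans _ _ _ h1 h2

theorem pred_unique (h : p.IsCondition κ K) {α ν ν' : Ordinal.{u}} {y : MorassNode.{u}} (h1 : p.Lt (α, ν) y)
    (h2 : p.Lt (α, ν') y) : ν = ν' := MorassData.pred_unique h.monotone h.linearPreds h1 h2

theorem map_le (h : p.IsCondition κ K) {x y : MorassNode.{u}} (hxy : p.Lt x y) {ν : Ordinal.{u}} (hν : ν ≤ x.2) :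
    p.π x y ν ≤ y.2 := by
  have h1 := h.m1 x y hxy
  exact h1.2 ▸ h1.1.le hν

theorem map_lt (h : p.IsCondition κ K) {x y : MorassNode.{u}} (hxy : p.Lt x y) {ν : Ordinal.{u}} (hν : ν < x.2) :
    p.π x y ν < y.2 := by
  have h1 := h.m1 x y hxy
  exact h1.2 ▸ h1.1.strictMono _ le_rfl _ hν

theorem mem_lam (h : p.IsCondition κ K) {β : Ordinal.{u}} : p.Mem (p.lam κ, β) ↔ β < p.theta (p.lam κ) :=
  (h.leftAligned _ le_rfl).2.2 β

theorem level_le (h : p.IsCondition κ K) {x : MorassNode.{u}} (hx : p.Mem x) (hκ : x.1 ≠ κ) : x.1 ≤ p.lam κ := by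
  rcases h.nodes x hx with h1 | h1
  exacts [h1.1, absurd h1.1 hκ]

theorem snd_lt (h : p.IsCondition κ K) {x : MorassNode.{u}} (hx : p.Mem x) (hκ : x.1 ≤ p.lam κ) : x.2 < κ := by
  rcases h.nodes x hx with h1 | h1
  exacts [h1.2, absurd h.lam_lt (not_lt.2 (h1.1 ▸ hκ))]

theorem level_le_of_lt (h : p.IsCondition κ K) {x y : MorassNode.{u}} (hxy : p.Lt x y) : x.1 ≤ p.lam κ := by
  refine h.level_le (h.lt_mem hxy).1 fun e => ?_
  have h1 := h.monotone _ _ hxy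
  rcases h.nodes y (h.lt_mem hxy).2 with h2 | h2
  · exact absurd (h1.trans_le h2.1) (not_lt.2 (e ▸ h.lam_lt.le))
  · rw [h2.1, e] at h1; exact lt_irrefl _ h1

/-- Below `κ` there is no level after `λ`, so a node of level `κ` has no predecessors other than the
one on level `λ` and those below it. -/
theorem lt_top_iff (h : p.IsCondition κ K) {ν β : Ordinal.{u}} (h1 : p.Lt (p.lam κ, ν) (κ, β)) {x : MorassNode.{u}} :
    p.Lt x (κ, β) ↔ x = (p.lam κ, ν) ∨ p.Lt x (p.lam κ, ν) := by
  refine ⟨fun h2 => ?_, ?_⟩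
  · rcases h.linear h2 h1 with h3 | h3 | h3
    · exact .inl h3
    · exact .inr h3
    · exact absurd (h.level_le_of_lt h2) (not_le.2 (h.monotone _ _ h3))
  · rintro (rfl | h2)
    exacts [h1, h.trans h2 h1]

/-- By M.2 the node of level `κ` with order the value at `ξ` lies above `⟨λ, ξ⟩`, and a node has
only one predecessor on a level. So all maps into level `κ` from level `λ` are restrictions of the
one enumeration `f`. -/
theorem map_top (h : p.IsCondition κ K) {γ : Ordinal.{u}} {f : Ordinal.{u} → Ordinal.{u}}
    (hf : f '' Iio γ = p.top κ) (hf' : ∀ ν < γ, p.Lt (p.lam κ, ν) (κ, f ν)) {ν ξ : Ordinal.{u}} (hν : ν < γ)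
    (hξ : ξ ≤ ν) : p.π (p.lam κ, ν) (κ, f ν) ξ = f ξ := by
  rcases hξ.lt_or_eq with h1 | rfl
  · have h2 := (h.m2 _ _ (hf' ν hν) ξ h1).1
    have h3 : p.π (p.lam κ, ν) (κ, f ν) ξ ∈ p.top κ := (h.lt_mem h2).2
    rw [← hf] at h3
    obtain ⟨ξ', h4, h5⟩ := h3
    have h6 := hf' ξ' h4
    rw [h5] at h6
    rw [← h5, h.pred_unique h2 h6]
  · exact (h.m1 _ _ (hf' ξ hν)).2

/-- The nodes of level at least `l`. -/
theorem isUpper (h : p.IsCondition κ K) {l : Ordinal.{u}} (hl : l ≤ p.lam κ) :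
    (PreMorass.mk (fun x => l ≤ x.1 ∧ p.Mem x) (fun x y => l ≤ x.1 ∧ p.Lt x y) p.π).IsUpper κ K l (p.lam κ) where
  lt_mem x y hxy := ⟨⟨hxy.1, (h.lt_mem hxy.2).1⟩, hxy.1.trans (h.monotone _ _ hxy.2).le, (h.lt_mem hxy.2).2⟩
  le_level x hx := hx.1
  le := hl
  lt_card := h.lam_lt
  nodes x hx := h.nodes x hx.2
  trans x y z h1 h2 := ⟨h1.1, h.trans h1.2 h2.2⟩
  linear x y z h1 h2 := by
    rcases h.linear h1.2 h2.2 with h3 | h3 | h3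
    exacts [.inl h3, .inr (.inl ⟨h1.1, h3⟩), .inr (.inr ⟨h2.1, h3⟩)]
  leftAligned α h1 h2 := by
    obtain ⟨h3, h4, h5⟩ := h.leftAligned α h2
    exact ⟨_, h3, h4, fun β => by simp [h1, h5]⟩
  top_zero := ⟨hl.trans h.lam_lt.le, h.top_zero⟩
  top_succ β := and_congr_right fun _ => h.top_succ β
  top_enum := by
    obtain ⟨γ, h1, f, h2, h3, h4⟩ := h.top_enum
    refine ⟨γ, f, h2, h3.trans ?_, fun ν hν => ⟨hl, h4 ν hν⟩⟩
    ext β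
    exact ⟨fun h5 => ⟨hl.trans h.lam_lt.le, h5⟩, fun h5 => h5.2⟩
  monotone x y hxy := h.monotone x y hxy.2
  commutative x y z h1 h2 := h.commutative x y z h1.2 h2.2
  m1 x y hxy := h.m1 x y hxy.2
  m2 x y hxy ν hν := ⟨⟨hxy.1, (h.m2 x y hxy.2 ν hν).1⟩, (h.m2 x y hxy.2 ν hν).2⟩
  m3 y hy γ hγ hlγ H := by
    obtain ⟨x, h1, h2⟩ := h.m3 y hy.2 γ hγ (bot_lt_of_lt hlγ) fun δ hδ => by
      obtain ⟨x, h1, h2⟩ := H δ hδ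
      exact ⟨x, h1.2, h2⟩
    exact ⟨x, ⟨h2 ▸ hlγ.le, h1⟩, h2⟩
  m4 y hy hly hyL hy' δ hδ := by
    -- A node with a right neighbour is not the last of its level. The bound `max δ l` keeps the
    -- predecessor inside the part from level `l` on.
    have h1 := h.m4 y hy.2 hyL (((h.leftAligned _ hyL).2.2 _).1 hy'.2).ne (max δ l) (max_lt hδ hly)
    obtain ⟨x, h2, h3⟩ := h1
    exact ⟨x, ⟨(le_max_right _ _).trans h3.le, h2⟩, (le_max_left _ _).trans_lt h3⟩
  m5 y hy hly H ξ hξ := by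
    have h1 : p.UnboundedBelow y := fun δ hδ => by
      obtain ⟨x, h1, h2⟩ := H δ hδ
      exact ⟨x, h1.2, h2⟩
    obtain ⟨x, h2, ν, h3, h4⟩ := (h.m5 y hy.2 h1 ξ).1 hξ
    by_cases hx : l ≤ x.1
    · exact ⟨x, ⟨hx, h2⟩, ν, h3, h4⟩
    -- A value attained from below level `l` is also attained from a predecessor `z` of `y` above
    -- level `l`, through which the map factors.
    · obtain ⟨z, h5, h6⟩ := H l hly
      rcases h.linear h2 h5.2 with rfl | h7 | h7
      · exact absurd h6.le hx
      · exact ⟨z, h5, p.π x z ν, h.map_lt h7 h3, (h.commutative x z y h7 h5.2 ν h3.le).trans h4⟩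
      · exact absurd (h6.le.trans (h.monotone _ _ h7).le) hx
  m6 x y hxy hyL hx := by
    have h1 : p.ImmLt x y := ⟨hxy.1.2, fun ⟨z, h1, h2⟩ => hxy.2 ⟨z, ⟨hxy.1.1, h1⟩,
      hxy.1.1.trans (h.monotone _ _ h1).le, h2⟩⟩
    obtain ⟨h2, h3⟩ := h.m6 x y h1 hyL hx
    exact ⟨⟨hxy.1.1, h2⟩, h3⟩
  m7 x y hxy hyL α h1 h2 h3 h4 h5 := by
    have h6 : p.ImmLt x y := ⟨hxy.1.2, fun ⟨z, h1, h2⟩ => hxy.2 ⟨z, ⟨hxy.1.1, h1⟩,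
      hxy.1.1.trans (h.monotone _ _ h1).le, h2⟩⟩
    obtain ⟨γ, h7⟩ := h.m7 x y h6 hyL α h1 h2 h3 h4 fun ν hν => by
      obtain ⟨γ, h7⟩ := h5 ν hν
      exact ⟨γ, h7.2⟩
    exact ⟨γ, hxy.1.1.trans h1.le, h7⟩

end IsCondition

/-- `p` consists of the levels of `b` up to `l` and of `U` on the levels from `l` on. -/
structure IsGlue (p b : MorassData.{u}) (l : Ordinal.{u}) (U : PreMorass.{u}) : Prop where
  wf : p.WellFormed
  mem : ∀ x, p.Mem x ↔ (x.1 ≤ l ∧ b.Mem x) ∨ U.Mem x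
  lt : ∀ x y, p.Lt x y ↔ (y.1 ≤ l ∧ b.Lt x y) ∨ U.Lt x y ∨ ∃ n, b.Lt x (l, n) ∧ U.Lt (l, n) y
  π_low : ∀ x y, y.1 ≤ l → b.Lt x y → ∀ ν ≤ x.2, p.π x y ν = b.π x y ν
  π_high : ∀ x y, U.Lt x y → ∀ ν ≤ x.2, p.π x y ν = U.π x y ν
  π_mix : ∀ x y n, b.Lt x (l, n) → U.Lt (l, n) y → ∀ ν ≤ x.2, p.π x y ν = U.π (l, n) y (b.π x (l, n) ν)

theorem image_congr_Iio {f g : Ordinal.{u} → Ordinal.{u}} {a : Ordinal.{u}} (h : ∀ ν ≤ a, f ν = g ν) :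
    f '' Iio a = g '' Iio a := image_congr fun ν hν => h ν (le_of_lt hν)

section Glue

variable {U : PreMorass.{u}} {L : Ordinal.{u}}
variable (hb : b.IsCondition κ K) (hU : U.IsUpper κ K (b.lam κ) L)
  (hbU : ∀ β, b.Mem (b.lam κ, β) ↔ U.Mem (b.lam κ, β)) (hp : p.IsGlue b (b.lam κ) U)

theorem IsGlue.lt_cases (hb : b.IsCondition κ K) (hU : U.IsUpper κ K (b.lam κ) L) (hp : p.IsGlue b (b.lam κ) U)
    {x y : MorassNode.{u}} (hxy : p.Lt x y) :
    (y.1 ≤ b.lam κ ∧ b.Lt x y) ∨ (b.lam κ < y.1 ∧ b.lam κ ≤ x.1 ∧ U.Lt x y) ∨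
      (b.lam κ < y.1 ∧ x.1 < b.lam κ ∧ ∃ n, b.Lt x (b.lam κ, n) ∧ U.Lt (b.lam κ, n) y) := by
  rcases (hp.lt x y).1 hxy with h | h | ⟨n, h1, h2⟩
  · exact .inl h
  · have h1 := hU.le_level _ (hU.lt_mem _ _ h).1
    exact .inr (.inl ⟨h1.trans_lt (hU.monotone _ _ h), h1, h⟩)
  · exact .inr (.inr ⟨hU.monotone _ _ h2, hb.monotone _ _ h1, n, h1, h2⟩)

theorem IsGlue.mem_low (hU : U.IsUpper κ K (b.lam κ) L)
    (hbU : ∀ β, b.Mem (b.lam κ, β) ↔ U.Mem (b.lam κ, β)) (hp : p.IsGlue b (b.lam κ) U)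
    {x : MorassNode.{u}} (hx : x.1 ≤ b.lam κ) : p.Mem x ↔ b.Mem x := by
  rw [hp.mem]
  refine ⟨?_, fun h => .inl ⟨hx, h⟩⟩
  rintro (h | h)
  · exact h.2
  · have h1 := hU.le_level _ h
    obtain ⟨x1, x2⟩ := x
    obtain rfl : x1 = b.lam κ := le_antisymm hx h1
    exact (hbU x2).2 h

theorem IsGlue.mem_high (hbU : ∀ β, b.Mem (b.lam κ, β) ↔ U.Mem (b.lam κ, β)) (hp : p.IsGlue b (b.lam κ) U)
    {x : MorassNode.{u}} (hx : b.lam κ ≤ x.1) : p.Mem x ↔ U.Mem x := by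
  rw [hp.mem]
  refine ⟨?_, .inr⟩
  rintro (⟨h1, h2⟩ | h)
  · obtain ⟨x1, x2⟩ := x
    obtain rfl : x1 = b.lam κ := le_antisymm h1 hx
    exact (hbU x2).1 h2
  · exact h

theorem IsGlue.lt_low (hU : U.IsUpper κ K (b.lam κ) L) (hb : b.IsCondition κ K) (hp : p.IsGlue b (b.lam κ) U)
    {x y : MorassNode.{u}} (hy : y.1 ≤ b.lam κ) : p.Lt x y ↔ b.Lt x y := by
  refine ⟨fun h => ?_, fun h => (hp.lt _ _).2 (.inl ⟨hy, h⟩)⟩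
  rcases hp.lt_cases hb hU h with h | h | h
  exacts [h.2, absurd hy (not_le.2 h.1), absurd hy (not_le.2 h.1)]

theorem IsGlue.lt_high (hU : U.IsUpper κ K (b.lam κ) L) (hb : b.IsCondition κ K) (hp : p.IsGlue b (b.lam κ) U)
    {x y : MorassNode.{u}} (hx : b.lam κ ≤ x.1) : p.Lt x y ↔ U.Lt x y := by
  refine ⟨fun h => ?_, fun h => (hp.lt _ _).2 (.inr (.inl h))⟩
  rcases hp.lt_cases hb hU h with h | h | h
  exacts [absurd (hb.monotone _ _ h.2) (not_lt.2 (h.1.trans hx)), h.2.2, absurd h.2.1 (not_lt.2 hx)]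

theorem IsGlue.lam (hU : U.IsUpper κ K (b.lam κ) L) (hp : p.IsGlue b (b.lam κ) U) :
    p.lam κ = L := by
  obtain ⟨θ, h1, h2, h3⟩ := hU.leftAligned L hU.le le_rfl
  refine lam_eq hU.lt_card ⟨0, (hp.mem _).2 (.inr ((h3 0).2 h1))⟩ fun x hx hxκ => ?_
  rcases (hp.mem _).1 hx with h | h
  · exact h.1.trans hU.le
  · rcases hU.nodes x h with h | h
    exacts [h.1, absurd h.1 hxκ.ne]

/-- Relations from below level `λ` to above it factor through a unique node of level `λ`, and their
maps are the compositions. Hence the axioms for pairs pass from the two parts to mixed pairs. M.6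
and M.7 say nothing about mixed pairs, as these are never immediate successors. For a node above
`λ`, M.4 and M.5 only need predecessors from level `λ` on; so does M.3 at closure points above `λ`,
which is why `IsUpper` requires these three only above `l`. -/
theorem IsGlue.isCondition (hb : b.IsCondition κ K) (hU : U.IsUpper κ K (b.lam κ) L)
    (hbU : ∀ β, b.Mem (b.lam κ, β) ↔ U.Mem (b.lam κ, β)) (hp : p.IsGlue b (b.lam κ) U) :
    p.IsCondition κ K := by
  have hlam := hp.lam hU
  have hlκ := hb.lam_lt
  have hmono : ∀ x y, p.Lt x y → x.1 < y.1 := by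
    intro x y hxy
    rcases hp.lt_cases hb hU hxy with h | h | h
    exacts [hb.monotone _ _ h.2, hU.monotone _ _ h.2.2, h.2.1.trans h.1]
  have hm1 : ∀ x y, p.Lt x y → IsSloop (p.π x y) x.2 ∧ p.π x y x.2 = y.2 := by
    intro x y hxy
    rcases hp.lt_cases hb hU hxy with h | h | ⟨h1, h2, n, h3, h4⟩
    · obtain ⟨h1, h2⟩ := hb.m1 x y h.2
      exact ⟨h1.congr (hp.π_low x y h.1 h.2), by rw [hp.π_low x y h.1 h.2 _ le_rfl, h2]⟩
    · obtain ⟨h1, h2⟩ := hU.m1 x y h.2.2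
      exact ⟨h1.congr (hp.π_high x y h.2.2), by rw [hp.π_high x y h.2.2 _ le_rfl, h2]⟩
    · obtain ⟨h5, h6⟩ := hb.m1 _ _ h3
      obtain ⟨h7, h8⟩ := hU.m1 _ _ h4
      refine ⟨(h5.comp h6 h7).congr (hp.π_mix x y n h3 h4), ?_⟩
      rw [hp.π_mix x y n h3 h4 _ le_rfl, h6, h8]
  have htop : ∀ β, β ∈ p.top κ ↔ U.Mem (κ, β) := fun β => hp.mem_high hbU hlκ.le
  refine
    { wellFormed := hp.wf
      lam_lt := hlam ▸ hU.lt_card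
      nodes := ?_
      treeOrder := (treeOrder_iff hmono).2 ⟨?_, ?_⟩
      leftAligned := ?_
      top_zero := (htop _).2 hU.top_zero
      top_succ := fun β => by rw [htop, htop]; exact hU.top_succ β
      top_enum := ?_
      monotone := hmono
      commutative := ?_
      m1 := hm1
      m2 := ?_
      m3 := ?_
      m4 := ?_
      m5 := ?_
      m6 := ?_
      m7 := ?_ }
  · intro x hx
    rw [hlam]
    rcases (hp.mem x).1 hx with h | h
    · exact .inl ⟨h.1.trans hU.le, hb.snd_lt h.2 h.1⟩
    · exact hU.nodes x h
  · intro x y hxy z hyz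
    refine (hp.lt x z).2 ?_
    rcases hp.lt_cases hb hU hyz with h | h | ⟨h1, h2, n, h3, h4⟩
    · exact .inl ⟨h.1, hb.trans ((hp.lt_low hU hb ((hb.monotone _ _ h.2).le.trans h.1)).1 hxy) h.2⟩
    · rcases hp.lt_cases hb hU hxy with h' | h' | ⟨h1, h2, n, h3, h4⟩
      · obtain ⟨y1, y2⟩ := y
        obtain rfl : y1 = b.lam κ := le_antisymm h'.1 h.2.1
        exact .inr (.inr ⟨y2, h'.2, h.2.2⟩)
      · exact .inr (.inl (hU.trans _ _ _ h'.2.2 h.2.2))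
      · exact .inr (.inr ⟨n, h3, hU.trans _ _ _ h4 h.2.2⟩)
    · exact .inr (.inr ⟨n, hb.trans ((hp.lt_low hU hb h2.le).1 hxy) h3, h4⟩)
  · intro x y hxy z hzy
    rcases hp.lt_cases hb hU hxy with h | h | ⟨h1, h2, n, h3, h4⟩
    · have h1 := (hp.lt_low hU hb h.1).1 hzy
      rcases hb.linear h.2 h1 with h2 | h2 | h2
      · exact .inl h2
      · exact .inr (.inl ((hp.lt _ _).2 (.inl ⟨(hb.monotone _ _ h1).le.trans h.1, h2⟩)))
      · exact .inr (.inr ((hp.lt _ _).2 (.inl ⟨(hb.monotone _ _ h.2).le.trans h.1, h2⟩)))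
    · rcases hp.lt_cases hb hU hzy with h' | h' | ⟨h1, h2, n, h3, h4⟩
      · exact absurd h.1 (not_lt.2 h'.1)
      · rcases hU.linear _ _ _ h.2.2 h'.2.2 with h2 | h2 | h2
        · exact .inl h2
        · exact .inr (.inl ((hp.lt _ _).2 (.inr (.inl h2))))
        · exact .inr (.inr ((hp.lt _ _).2 (.inr (.inl h2))))
      · rcases hU.linear _ _ _ h.2.2 h4 with rfl | h5 | h5
        · exact .inr (.inr ((hp.lt _ _).2 (.inl ⟨le_rfl, h3⟩)))
        · exact absurd (hU.monotone _ _ h5) (not_lt.2 h.2.1)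
        · exact .inr (.inr ((hp.lt _ _).2 (.inr (.inr ⟨n, h3, h5⟩))))
    · rcases hp.lt_cases hb hU hzy with h' | h' | ⟨h1', h2', n', h3', h4'⟩
      · exact absurd h1 (not_lt.2 h'.1)
      · rcases hU.linear _ _ _ h'.2.2 h4 with rfl | h5 | h5
        · exact .inr (.inl ((hp.lt _ _).2 (.inl ⟨le_rfl, h3⟩)))
        · exact absurd (hU.monotone _ _ h5) (not_lt.2 h'.2.1)
        · exact .inr (.inl ((hp.lt _ _).2 (.inr (.inr ⟨n, h3, h5⟩))))
      · obtain rfl := hU.pred_unique h4 h4'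
        rcases hb.linear h3 h3' with h5 | h5 | h5
        · exact .inl h5
        · exact .inr (.inl ((hp.lt _ _).2 (.inl ⟨h2'.le, h5⟩)))
        · exact .inr (.inr ((hp.lt _ _).2 (.inl ⟨h2.le, h5⟩)))
  · intro α hα
    rw [hlam] at hα
    rcases le_or_gt α (b.lam κ) with h | h
    · have h1 : ∀ β, p.Mem (α, β) ↔ b.Mem (α, β) := fun β => hp.mem_low hU hbU h
      rw [theta_congr h1]
      simpa only [h1] using hb.leftAligned α h
    · obtain ⟨θ, h1, h2, h3⟩ := hU.leftAligned α h.le hα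
      have h4 : ∀ β, p.Mem (α, β) ↔ β < θ := fun β => (hp.mem_high hbU h.le).trans (h3 β)
      rw [theta_eq h4]
      exact ⟨h1, h2, h4⟩
  · obtain ⟨γ, f, h1, h2, h3⟩ := hU.top_enum
    rw [hlam]
    refine ⟨γ, ?_, f, h1, h2.trans (Set.ext fun β => (htop β).symm), fun ν hν => (hp.lt _ _).2 (.inr (.inl (h3 ν hν)))⟩
    obtain ⟨θ, h4, h5, h6⟩ := hU.leftAligned L hU.le le_rfl
    rw [theta_eq fun β => (hp.mem_high hbU (x := (L, β)) hU.le).trans (h6 β)]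
    -- If `γ` exceeded the length `θ` of level `L`, then `⟨L, θ⟩` would be a node.
    by_contra h7
    exact lt_irrefl θ ((h6 θ).1 (hU.lt_mem _ _ (h3 θ (not_le.1 h7))).1)
  · intro x y z hxy hyz ν hν
    rcases hp.lt_cases hb hU hyz with h | h | ⟨h1, h2, n, h3, h4⟩
    · have hy := (hb.monotone _ _ h.2).le.trans h.1
      have h1 := (hp.lt_low hU hb hy).1 hxy
      rw [hp.π_low _ _ hy h1 _ hν, hp.π_low _ _ h.1 h.2 _ (hb.map_le h1 hν),
        hp.π_low _ _ h.1 (hb.trans h1 h.2) _ hν, hb.commutative _ _ _ h1 h.2 _ hν]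
    · rcases hp.lt_cases hb hU hxy with h' | h' | ⟨h1, h2, n, h3, h4⟩
      · obtain ⟨y1, y2⟩ := y
        obtain rfl : y1 = b.lam κ := le_antisymm h'.1 h.2.1
        rw [hp.π_low _ _ h'.1 h'.2 _ hν, hp.π_high _ _ h.2.2 _ (hb.map_le h'.2 hν),
          hp.π_mix _ _ y2 h'.2 h.2.2 _ hν]
      · have h1 := hU.m1 _ _ h'.2.2
        rw [hp.π_high _ _ h'.2.2 _ hν, hp.π_high _ _ h.2.2 _ (h1.2 ▸ h1.1.le hν),
          hp.π_high _ _ (hU.trans _ _ _ h'.2.2 h.2.2) _ hν, hU.commutative _ _ _ h'.2.2 h.2.2 _ hν]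
      · have h5 := hU.m1 _ _ h4
        have h6 := hb.map_le h3 hν
        rw [hp.π_mix _ _ n h3 h4 _ hν, hp.π_high _ _ h.2.2 _ (h5.2 ▸ h5.1.le h6),
          hp.π_mix _ _ n h3 (hU.trans _ _ _ h4 h.2.2) _ hν, hU.commutative _ _ _ h4 h.2.2 _ h6]
    · have h5 := (hp.lt_low hU hb h2.le).1 hxy
      rw [hp.π_low _ _ h2.le h5 _ hν, hp.π_mix _ _ n h3 h4 _ (hb.map_le h5 hν),
        hp.π_mix _ _ n (hb.trans h5 h3) h4 _ hν, hb.commutative _ _ _ h5 h3 _ hν]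
  · intro x y hxy ν hν
    rcases hp.lt_cases hb hU hxy with h | h | ⟨h1, h2, n, h3, h4⟩
    · rw [hp.π_low _ _ h.1 h.2 _ hν.le]
      obtain ⟨h1, h2⟩ := hb.m2 x y h.2 ν hν
      refine ⟨(hp.lt _ _).2 (.inl ⟨h.1, h1⟩), fun ξ hξ => ?_⟩
      rw [hp.π_low (x.1, ν) (y.1, b.π x y ν) h.1 h1 _ hξ, hp.π_low _ _ h.1 h.2 _ (hξ.trans hν.le), h2 _ hξ]
    · rw [hp.π_high _ _ h.2.2 _ hν.le]
      obtain ⟨h1, h2⟩ := hU.m2 x y h.2.2 ν hν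
      refine ⟨(hp.lt _ _).2 (.inr (.inl h1)), fun ξ hξ => ?_⟩
      rw [hp.π_high _ _ h1 _ hξ, hp.π_high _ _ h.2.2 _ (hξ.trans hν.le), h2 _ hξ]
    · rw [hp.π_mix _ _ n h3 h4 _ hν.le]
      obtain ⟨h5, h6⟩ := hb.m2 _ _ h3 ν hν
      have h7 := hb.map_lt h3 hν
      obtain ⟨h8, h9⟩ := hU.m2 _ _ h4 _ h7
      refine ⟨(hp.lt _ _).2 (.inr (.inr ⟨_, h5, h8⟩)), fun ξ hξ => ?_⟩
      rw [hp.π_mix _ _ _ h5 h8 _ hξ, hp.π_mix _ _ n h3 h4 _ (hξ.trans hν.le), h6 _ hξ, h9]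
      rcases hξ.lt_or_eq with h | rfl
      · exact ((hb.m1 _ _ h3).1.strictMono _ hν.le _ h).le
      · exact le_rfl
  · intro y hy γ hγ hγ0 H
    rcases le_or_gt y.1 (b.lam κ) with h | h
    · obtain ⟨x, h1, h2⟩ := hb.m3 y ((hp.mem_low hU hbU h).1 hy) γ hγ hγ0 fun δ hδ => by
        obtain ⟨x, h1, h2⟩ := H δ hδ
        exact ⟨x, (hp.lt_low hU hb h).1 h1, h2⟩
      exact ⟨x, (hp.lt_low hU hb h).2 h1, h2⟩
    -- The predecessors of `y` below level `λ` all lie below the same node of that level. For `γ <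
    -- λ`, M.3 of `b` applies to this node; for `γ = λ`, the node itself is the required
    -- predecessor.
    · rcases lt_trichotomy γ (b.lam κ) with h1 | rfl | h1
      · obtain ⟨x0, h2, _, h3⟩ := H 0 hγ0
        rcases hp.lt_cases hb hU h2 with h4 | h4 | ⟨_, _, n, h5, h6⟩
        · exact absurd h (not_lt.2 h4.1)
        · exact absurd (h3.trans h1) (not_lt.2 h4.2.1)
        obtain ⟨x, h7, h8⟩ := hb.m3 (b.lam κ, n) (hb.lt_mem h5).2 γ h1 hγ0 fun δ hδ => by
          obtain ⟨x, h7, h8, h9⟩ := H δ hδ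
          rcases hp.lt_cases hb hU h7 with h4 | h4 | ⟨_, _, n', h5', h6'⟩
          · exact absurd h (not_lt.2 h4.1)
          · exact absurd (h9.trans h1) (not_lt.2 h4.2.1)
          obtain rfl := hU.pred_unique h6 h6'
          exact ⟨x, h5', h8, h9⟩
        exact ⟨x, (hp.lt _ _).2 (.inr (.inr ⟨n, h7, h6⟩)), h8⟩
      · obtain ⟨x0, h2, _, h3⟩ := H 0 hγ0
        rcases hp.lt_cases hb hU h2 with h4 | h4 | ⟨_, _, n, h5, h6⟩
        · exact absurd h (not_lt.2 h4.1)
        · exact absurd h3 (not_lt.2 h4.2.1)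
        exact ⟨_, (hp.lt _ _).2 (.inr (.inl h6)), rfl⟩
      · obtain ⟨x, h2, h3⟩ := hU.m3 y ((hp.mem_high hbU h.le).1 hy) γ hγ h1 fun δ hδ => by
          obtain ⟨x, h2, h3, h4⟩ := H (max δ (b.lam κ)) (max_lt hδ h1)
          exact ⟨x, (hp.lt_high hU hb ((le_max_right _ _).trans h3.le)).1 h2, (le_max_left _ _).trans_lt h3, h4⟩
        exact ⟨x, (hp.lt _ _).2 (.inr (.inl h2)), h3⟩
  · intro y hy hyL hθ δ hδ
    rw [hlam] at hyL
    rcases le_or_gt y.1 (b.lam κ) with h | h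
    · rw [theta_congr fun β => hp.mem_low hU hbU (x := (y.1, β)) h] at hθ
      obtain ⟨x, h1, h2⟩ := hb.m4 y ((hp.mem_low hU hbU h).1 hy) h hθ δ hδ
      exact ⟨x, (hp.lt_low hU hb h).2 h1, h2⟩
    · obtain ⟨θ, h1, h2, h3⟩ := hU.leftAligned y.1 h.le hyL
      have hy' := (hp.mem_high hbU h.le).1 hy
      rw [theta_eq fun β => (hp.mem_high hbU (x := (y.1, β)) h.le).trans (h3 β)] at hθ
      obtain ⟨x, h4, h5⟩ := hU.m4 y hy' h hyL ((h3 _).2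
        (lt_of_le_of_ne (Order.add_one_le_iff.2 ((h3 _).1 hy')) hθ)) δ hδ
      exact ⟨x, (hp.lt _ _).2 (.inr (.inl h4)), h5⟩
  · intro y hy H ξ
    refine ⟨fun hξ => ?_, ?_⟩
    · rcases le_or_gt y.1 (b.lam κ) with h | h
      · obtain ⟨x, h1, ν, h2, h3⟩ := (hb.m5 y ((hp.mem_low hU hbU h).1 hy) (fun δ hδ => by
          obtain ⟨x, h1, h2⟩ := H δ hδ
          exact ⟨x, (hp.lt_low hU hb h).1 h1, h2⟩) ξ).1 hξ
        exact ⟨x, (hp.lt_low hU hb h).2 h1, ν, h2, by rw [hp.π_low _ _ h h1 _ h2.le, h3]⟩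
      · obtain ⟨x, h1, ν, h2, h3⟩ := hU.m5 y ((hp.mem_high hbU h.le).1 hy) h (fun δ hδ => by
          obtain ⟨x, h1, h2⟩ := H (max δ (b.lam κ)) (max_lt hδ h)
          exact ⟨x, (hp.lt_high hU hb ((le_max_right _ _).trans h2.le)).1 h1, (le_max_left _ _).trans_lt h2⟩) ξ hξ
        exact ⟨x, (hp.lt _ _).2 (.inr (.inl h1)), ν, h2, by rw [hp.π_high _ _ h1 _ h2.le, h3]⟩
    · rintro ⟨x, h1, ν, h2, rfl⟩
      obtain ⟨h3, h4⟩ := hm1 x y h1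
      exact h4 ▸ h3.strictMono _ le_rfl _ h2
  · intro x y hxy hyL hx
    rw [hlam] at hyL
    rcases hp.lt_cases hb hU hxy.1 with h | h | ⟨h1, h2, n, h3, h4⟩
    · have h1 : b.ImmLt x y := ⟨h.2, fun ⟨z, h1, h2⟩ => hxy.2 ⟨z,
        (hp.lt_low hU hb ((hb.monotone _ _ h2).le.trans h.1)).2 h1, (hp.lt_low hU hb h.1).2 h2⟩⟩
      rw [image_congr_Iio (hp.π_low _ _ h.1 h.2)]
      obtain ⟨h2, h3⟩ := hb.m6 x y h1 h.1 hx
      refine ⟨(hp.lt_low hU hb (y := (y.1, sSup (b.π x y '' Iio x.2))) h.1).2 h2, fun ξ hξ => ?_⟩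
      rw [hp.π_low x (y.1, sSup (b.π x y '' Iio x.2)) h.1 h2 _ hξ.le, hp.π_low _ _ h.1 h.2 _ hξ.le, h3 _ hξ]
    · have h1 : U.ImmLt x y := ⟨h.2.2, fun ⟨z, h1, h2⟩ => hxy.2 ⟨z,
        (hp.lt _ _).2 (.inr (.inl h1)), (hp.lt _ _).2 (.inr (.inl h2))⟩⟩
      rw [image_congr_Iio (hp.π_high _ _ h.2.2)]
      obtain ⟨h2, h3⟩ := hU.m6 x y h1 hyL hx
      refine ⟨(hp.lt _ _).2 (.inr (.inl h2)), fun ξ hξ => ?_⟩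
      rw [hp.π_high _ _ h2 _ hξ.le, hp.π_high _ _ h.2.2 _ hξ.le, h3 _ hξ]
    · exact absurd ⟨_, (hp.lt _ _).2 (.inl ⟨le_rfl, h3⟩), (hp.lt _ _).2 (.inr (.inl h4))⟩ hxy.2
  · intro x y hxy hyL α h1 h2 h3 h4 h5
    rw [hlam] at hyL
    rcases hp.lt_cases hb hU hxy.1 with h | h | ⟨_, _, n, h6, h7⟩
    · have h6 : b.ImmLt x y := ⟨h.2, fun ⟨z, h1, h2⟩ => hxy.2 ⟨z,
        (hp.lt_low hU hb ((hb.monotone _ _ h2).le.trans h.1)).2 h1, (hp.lt_low hU hb h.1).2 h2⟩⟩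
      rw [image_congr_Iio (hp.π_low _ _ h.1 h.2)] at h4
      obtain ⟨γ, h7⟩ := hb.m7 x y h6 h.1 α h1 h2 h3 h4 fun ν hν => by
        obtain ⟨γ, h7⟩ := h5 ν hν
        rw [hp.π_low _ _ h.1 h.2 _ hν.le, hp.lt_low hU hb (y := (y.1, b.π x y ν)) h.1] at h7
        exact ⟨γ, h7⟩
      exact ⟨γ, (hp.lt_low hU hb h.1).2 h7⟩
    · have h6 : U.ImmLt x y := ⟨h.2.2, fun ⟨z, h1, h2⟩ => hxy.2 ⟨z,
        (hp.lt _ _).2 (.inr (.inl h1)), (hp.lt _ _).2 (.inr (.inl h2))⟩⟩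
      rw [image_congr_Iio (hp.π_high _ _ h.2.2)] at h4
      obtain ⟨γ, h7⟩ := hU.m7 x y h6 hyL α h1 h2 h3 h4 fun ν hν => by
        obtain ⟨γ, h7⟩ := h5 ν hν
        rw [hp.π_high _ _ h.2.2 _ hν.le, hp.lt_high hU hb (h.2.1.trans h1.le)] at h7
        exact ⟨γ, h7⟩
      exact ⟨γ, (hp.lt _ _).2 (.inr (.inl h7))⟩
    · exact absurd ⟨_, (hp.lt _ _).2 (.inl ⟨le_rfl, h6⟩), (hp.lt _ _).2 (.inr (.inl h7))⟩ hxy.2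

/-- Up to level `λ` nothing changes. What `b` says about a node `⟨κ, f ν⟩` is determined by its
predecessor `⟨λ, ν⟩` and by `f`, so it is enough that the upper part keeps these relations with the
maps given by `f`. The level `λ` is a mangal because mixed relations pass through it by
construction. -/
theorem IsGlue.extends (hb : b.IsCondition κ K) (hU : U.IsUpper κ K (b.lam κ) L)
    (hbU : ∀ β, b.Mem (b.lam κ, β) ↔ U.Mem (b.lam κ, β)) (hp : p.IsGlue b (b.lam κ) U)
    {γ : Ordinal.{u}} {f : Ordinal.{u} → Ordinal.{u}} (hf : f '' Iio γ = b.top κ)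
    (hf' : ∀ ν < γ, b.Lt (b.lam κ, ν) (κ, f ν))
    (hUf : ∀ ν < γ, U.Lt (b.lam κ, ν) (κ, f ν) ∧ ∀ ξ ≤ ν, U.π (b.lam κ, ν) (κ, f ν) ξ = f ξ) :
    b.Extends κ p := by
  have hlκ := hb.lam_lt
  have htop : ∀ {x : MorassNode.{u}}, b.Mem x → ¬ x.1 ≤ b.lam κ → ∃ ν < γ, x = (κ, f ν) := by
    rintro ⟨x1, x2⟩ hx h
    obtain rfl : x1 = κ := by
      by_contra h1
      exact h (hb.level_le hx h1)
    have h1 : x2 ∈ b.top x1 := hx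
    rw [← hf] at h1
    obtain ⟨ν, h2, rfl⟩ := h1
    exact ⟨ν, h2, rfl⟩
  have hsub : ∀ x, b.Mem x → p.Mem x := by
    intro x hx
    by_cases h : x.1 ≤ b.lam κ
    · exact (hp.mem_low hU hbU h).2 hx
    · obtain ⟨ν, hν, rfl⟩ := htop hx h
      exact (hp.mem _).2 (.inr (hU.lt_mem _ _ (hUf ν hν).1).2)
  have hlt : ∀ x y, b.Lt x y → p.Lt x y ∧ ∀ ν ≤ x.2, b.π x y ν = p.π x y ν := by
    intro x y hxy
    by_cases h : y.1 ≤ b.lam κ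
    · exact ⟨(hp.lt_low hU hb h).2 hxy, fun ν hν => (hp.π_low _ _ h hxy _ hν).symm⟩
    · obtain ⟨ν, hν, rfl⟩ := htop (hb.lt_mem hxy).2 h
      obtain ⟨h1, h2⟩ := hUf ν hν
      rcases (hb.lt_top_iff (hf' ν hν)).1 hxy with rfl | h3
      · refine ⟨(hp.lt _ _).2 (.inr (.inl h1)), fun ξ hξ => ?_⟩
        rw [hp.π_high _ _ h1 _ hξ, h2 _ hξ, hb.map_top hf hf' hν hξ]
      · refine ⟨(hp.lt _ _).2 (.inr (.inr ⟨ν, h3, h1⟩)), fun ξ hξ => ?_⟩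
        rw [hp.π_mix _ _ ν h3 h1 _ hξ, h2 _ (hb.map_le h3 hξ), ← hb.commutative _ _ _ h3 (hf' ν hν) _ hξ,
          hb.map_top hf hf' hν (hb.map_le h3 hξ)]
  refine ⟨hsub, fun x hx hx' => (hp.mem_low hU hbU hx).symm, fun x y => ⟨fun hxy => ⟨(hb.lt_mem hxy).1,
    (hb.lt_mem hxy).2, (hlt x y hxy).1⟩, ?_⟩, fun x y hxy => (hlt x y hxy).2, (hp.lam hU).symm ▸ hU.le, ?_⟩
  · rintro ⟨hx, hy, hxy⟩
    by_cases h : y.1 ≤ b.lam κ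
    · exact (hp.lt_low hU hb h).1 hxy
    · obtain ⟨ν, hν, rfl⟩ := htop hy h
      refine (hb.lt_top_iff (hf' ν hν)).2 ?_
      rcases hp.lt_cases hb hU hxy with h1 | h1 | ⟨h1, h2, n, h3, h4⟩
      · exact absurd h1.1 h
      · have h2 : x.1 ≤ b.lam κ := by
          by_contra h2
          obtain ⟨ν', _, rfl⟩ := htop hx h2
          exact lt_irrefl κ (hU.monotone _ _ h1.2.2)
        obtain ⟨x1, x2⟩ := x
        obtain rfl : x1 = b.lam κ := le_antisymm h2 h1.2.1
        rw [hU.pred_unique h1.2.2 (hUf ν hν).1]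
        exact .inl rfl
      · rw [hU.pred_unique h4 (hUf ν hν).1] at h3
        exact .inr h3
  · intro x y hxy h1 h2
    rcases hp.lt_cases hb hU hxy with h | h | ⟨_, _, n, h3, h4⟩
    · exact absurd h2 (not_lt.2 h.1)
    · exact absurd h1 (not_lt.2 h.2.1)
    · exact ⟨_, rfl, (hp.lt _ _).2 (.inl ⟨le_rfl, h3⟩), (hp.lt _ _).2 (.inr (.inl h4))⟩

end Glue

end MorassData

/-! ### Constructing morass data in the model -/

section Build
variable {M : Set ZFSet.{u}} [hM : Fact (IsTransitiveModelZFCMinus M)]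
variable {X Y : Type*} [Coded.{u} X] [hX : CodedIn M X] [Coded.{u} Y] [hY : CodedIn M Y]

theorem sep_mem_M {R : ZFSet.{u} → Prop} (hR : Dfn M R) {a : ZFSet.{u}} (ha : a ∈ M) : ZFSet.sep R a ∈ M :=
  exists_sep (X := Ordinal.{u}) (R := fun _ => R) (x := 0) (hR.comp dfn_snd') inferInstance ha

theorem img_mem_M {f : X → ZFSet.{u}} (hf : Dfn M f) {a : ZFSet.{u}} (ha : a ∈ M) : img f a ∈ M := by
  have : Dfn M fun z : ZFSet.{u} × X => f z.2 := hf.comp dfn_snd'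
  exact ((dfn_img (X := ZFSet.{u}) (A := fun z => z) (F := fun _ => f)).inM a ⟨ha⟩).1

section
attribute [local instance] dfn_app dfn_app₂

instance dfn_prod {A B : X → ZFSet.{u}} [hA : Dfn M A] [hB : Dfn M B] :
    Dfn M fun x => ZFSet.prod (A x) (B x) := by
  refine (inferInstance : Dfn M fun x => ZFSet.sUnion
    (img (fun a : ZFSet.{u} => img (fun b : ZFSet.{u} => ZFSet.pair a b) (B x)) (A x))).congr fun x _ => ?_
  ext z
  rw [ZFSet.mem_prod, ZFSet.mem_sUnion]
  constructor
  · rintro ⟨a, ha, b, hb, rfl⟩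
    exact ⟨_, mem_img.2 ⟨a, ha, rfl⟩, mem_img.2 ⟨b, hb, rfl⟩⟩
  · rintro ⟨w, hw, hz⟩
    obtain ⟨a, ha, rfl⟩ := mem_img.1 hw
    obtain ⟨b, hb, rfl⟩ := mem_img.1 hz
    exact ⟨a, ha, b, hb, rfl⟩

instance dfn_ite {c : X → Prop} [∀ x, Decidable (c x)] {F G : X → Y} [hc : Dfn M c] [hF : Dfn M F] [hG : Dfn M G] :
    Dfn M fun x => if c x then F x else G x := by
  have hc' : Dfn M fun z : X × Y => c z.1 := hc.comp dfn_fst'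
  have hF' : Dfn M fun z : X × Y => F z.1 := hF.comp dfn_fst'
  have hG' : Dfn M fun z : X × Y => G z.1 := hG.comp dfn_fst'
  refine dfn_of_graph (fun x hx => ?_) ((inferInstance : Dfn M fun z : X × Y =>
    (c z.1 → z.2 = F z.1) ∧ (¬ c z.1 → z.2 = G z.1)).congr fun z _ => ?_)
  · split_ifs
    exacts [hF.inM x hx, hG.inM x hx]
  · by_cases h : c z.1 <;> simp [h]

end

/-- Turns a definable description into an element of `M`: the tree order is separated from `A × A`
and the family of maps is an image of it. -/
theorem exists_data {A : ZFSet.{u}} (hA : A ∈ M) (hA' : ∀ z ∈ A, ∃ x, z = nodeCode x)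
    {L : MorassNode.{u} → MorassNode.{u} → Prop} (hL : Dfn M fun z : MorassNode.{u} × MorassNode.{u} => L z.1 z.2)
    (hLA : ∀ x y, L x y → nodeCode x ∈ A ∧ nodeCode y ∈ A)
    {F : MorassNode.{u} → MorassNode.{u} → Ordinal.{u} → Ordinal.{u}}
    (hF : Dfn M fun z : (MorassNode.{u} × MorassNode.{u}) × Ordinal.{u} => F z.1.1 z.1.2 z.2)
    (hFL : ∀ x y, L x y → ∀ ν ≤ x.2, F x y ν ≤ y.2) :
    ∃ p : MorassData.{u}, InM M p ∧ p.WellFormed ∧ (∀ x, p.Mem x ↔ nodeCode x ∈ A) ∧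
      (∀ x y, p.Lt x y ↔ L x y) ∧ ∀ x y, L x y → ∀ ν ≤ x.2, p.π x y ν = F x y ν := by
  have hA1 : InM M A := ⟨hA⟩
  let gr : MorassNode.{u} × MorassNode.{u} → ZFSet.{u} := fun z =>
    img (fun ν : Ordinal.{u} => ZFSet.pair ν.toZFSet (F z.1 z.2 ν).toZFSet) (z.1.2 + 1).toZFSet
  have hgr : Dfn M gr := by
    have : Dfn M fun w : (MorassNode.{u} × MorassNode.{u}) × Ordinal.{u} =>
      ZFSet.pair w.2.toZFSet (F w.1.1 w.1.2 w.2).toZFSet := inferInstance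
    exact dfn_img (A := fun z : MorassNode.{u} × MorassNode.{u} => (z.1.2 + 1).toZFSet) (F := fun (z : MorassNode.{u} × MorassNode.{u}) (ν : Ordinal.{u}) => ZFSet.pair ν.toZFSet (F z.1 z.2 ν).toZFSet)
  let T : ZFSet.{u} := ZFSet.sep (fun w : ZFSet.{u} => ∃ z : MorassNode.{u} × MorassNode.{u}, InM M z ∧
    (w = Coded.code z ∧ L z.1 z.2)) (ZFSet.prod A A)
  have hT : InM M T := by
    have hR : Dfn M fun w : ZFSet.{u} => ∃ z : MorassNode.{u} × MorassNode.{u}, InM M z ∧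
      (w = Coded.code z ∧ L z.1 z.2) := by
      have : Dfn M fun w : ZFSet.{u} × (MorassNode.{u} × MorassNode.{u}) => L w.2.1 w.2.2 := hL.comp dfn_snd'
      infer_instance
    exact ⟨sep_mem_M hR ((dfn_prod (A := fun z : ZFSet.{u} => z) (B := fun z => z)).inM A hA1).1⟩
  let P : ZFSet.{u} := img (fun z : MorassNode.{u} × MorassNode.{u} => ZFSet.pair (Coded.code z) (gr z)) T
  have hP : InM M P := by
    have : Dfn M fun z : MorassNode.{u} × MorassNode.{u} => ZFSet.pair (Coded.code z) (gr z) :=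
      dfn_mkpair (hF := dfn_code (F := fun z => z)) (hG := hgr)
    exact ⟨img_mem_M this hT.1⟩
  have hmem : ∀ x, (MorassData.mk A T P).Mem x ↔ nodeCode x ∈ A := fun x => Iff.rfl
  have hlt : ∀ x y, (MorassData.mk A T P).Lt x y ↔ L x y := by
    intro x y
    change ZFSet.pair (nodeCode x) (nodeCode y) ∈ T ↔ L x y
    rw [ZFSet.mem_sep, ZFSet.pair_mem_prod]
    constructor
    · rintro ⟨-, z, -, h1, h2⟩
      have h3 : (x, y) = z := code_injective h1
      subst h3; exact h2
    · intro h
      obtain ⟨h1, h2⟩ := hLA x y h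
      exact ⟨⟨h1, h2⟩, (x, y), inM_prod.2 ⟨⟨mem_trans_M hA h1⟩, ⟨mem_trans_M hA h2⟩⟩, rfl, h⟩
  have hmap : ∀ x y f, ZFSet.pair (ZFSet.pair (nodeCode x) (nodeCode y)) f ∈ P ↔ L x y ∧ f = gr (x, y) := by
    intro x y f
    rw [mem_img]
    constructor
    · rintro ⟨z, h1, h2⟩
      obtain ⟨h3, h4⟩ := ZFSet.pair_injective h2
      have h5 : (x, y) = z := code_injective h3
      subst h5
      exact ⟨(hlt x y).1 h1, h4⟩
    · rintro ⟨h, rfl⟩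
      exact ⟨(x, y), (hlt x y).2 h, rfl⟩
  have hgrm : ∀ x y ν w, ZFSet.pair (Ordinal.toZFSet ν) w ∈ gr (x, y) ↔ ν ≤ x.2 ∧ w = (F x y ν).toZFSet := by
    intro x y ν w
    rw [mem_img]
    constructor
    · rintro ⟨ν', h1, h2⟩
      obtain ⟨h3, h4⟩ := ZFSet.pair_injective h2
      obtain rfl := Ordinal.toZFSet_injective h3
      exact ⟨Order.lt_add_one_iff.1 (Ordinal.toZFSet_mem_toZFSet_iff.1 h1), h4⟩
    · rintro ⟨h, rfl⟩
      exact ⟨ν, Ordinal.toZFSet_mem_toZFSet_iff.2 (Order.lt_add_one_iff.2 h), rfl⟩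
  refine ⟨⟨A, T, P⟩, inM_morass.2 ⟨hA, hT.1, hP.1⟩, ⟨hA', ?_, ?_, ?_⟩, hmem, hlt, ?_⟩
  · intro w hw
    obtain ⟨-, z, -, rfl, h2⟩ := ZFSet.mem_sep.1 (show w ∈ T from hw)
    exact ⟨z.1, z.2, (hLA _ _ h2).1, (hLA _ _ h2).2, rfl⟩
  · intro w hw
    obtain ⟨⟨x, y⟩, h1, hw'⟩ := (mem_img (f := fun z : MorassNode.{u} × MorassNode.{u} =>
      ZFSet.pair (Coded.code z) (gr z)) (a := T)).1 hw
    have h2 := (hlt x y).1 h1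
    refine ⟨x, y, gr (x, y), h1, ⟨fun w hw => ?_, fun w hw => ?_⟩, hw'⟩
    · obtain ⟨ν, h3, rfl⟩ := (mem_img (f := fun ν : Ordinal.{u} => ZFSet.pair ν.toZFSet (F x y ν).toZFSet)
        (a := (x.2 + 1).toZFSet)).1 hw
      rw [ZFSet.pair_mem_prod]
      refine ⟨h3, Ordinal.toZFSet_mem_toZFSet_iff.2 (Order.lt_add_one_iff.2 (hFL x y h2 ν ?_))⟩
      exact Order.lt_add_one_iff.1 (Ordinal.toZFSet_mem_toZFSet_iff.1 h3)
    · obtain ⟨ν, h3, rfl⟩ := Ordinal.mem_toZFSet_iff.1 hw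
      exact ⟨_, (hgrm x y ν _).2 ⟨Order.lt_add_one_iff.1 h3, rfl⟩, fun w' hw' => ((hgrm x y ν _).1 hw').2⟩
  · intro x y h
    exact ⟨gr (x, y), (hmap x y _).2 ⟨(hlt x y).1 h, rfl⟩, fun f hf => ((hmap x y f).1 hf).2⟩
  · intro x y h ν hν
    have : {μ : Ordinal.{u} | ∃ f, ZFSet.pair (ZFSet.pair (nodeCode x) (nodeCode y)) f ∈ P ∧
        ZFSet.pair ν.toZFSet μ.toZFSet ∈ f} = {F x y ν} := by
      ext μ
      constructor
      · rintro ⟨f, h1, h2⟩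
        obtain ⟨-, rfl⟩ := (hmap x y f).1 h1
        exact Ordinal.toZFSet_injective ((hgrm x y ν _).1 h2).2
      · rintro rfl
        exact ⟨_, (hmap x y _).2 ⟨h, rfl⟩, (hgrm x y ν _).2 ⟨hν, rfl⟩⟩
    exact (congrArg sInf this).trans (csInf_singleton _)

variable {κ : Ordinal.{u}} {K : Set Ordinal.{u}} {b : MorassData.{u}} {U : PreMorass.{u}} {L : Ordinal.{u}}

/-- The upper part is only given as definable classes; `hset` bounds its nodes by a set of `M`,
without which the result need not be a set. -/
theorem exists_glue [hκ : InM M κ] (hbM : InM M b) (hb : b.IsCondition κ K) (hU : U.IsUpper κ K (b.lam κ) L)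
    (hUM : Dfn M U.Mem) (hUL : Dfn M fun z : MorassNode.{u} × MorassNode.{u} => U.Lt z.1 z.2)
    (hUπ : Dfn M fun z : (MorassNode.{u} × MorassNode.{u}) × Ordinal.{u} => U.π z.1.1 z.1.2 z.2)
    (hset : ∃ B ∈ M, ∀ x, U.Mem x → nodeCode x ∈ B) : ∃ p : MorassData.{u}, InM M p ∧ p.IsGlue b (b.lam κ) U := by
  classical
  obtain ⟨B, hB, hUB⟩ := hset
  have hl : InM M (b.lam κ) := dfn_lam_const.inM b hbM
  set l := b.lam κ with hldef
  have d1 : Dfn M fun w : ZFSet.{u} × MorassNode.{u} => U.Mem w.2 := hUM.comp dfn_snd'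
  have dA : Dfn M fun w : ZFSet.{u} => ∃ x : MorassNode.{u}, InM M x ∧
    (w = nodeCode x ∧ ((x.1 ≤ l ∧ b.Mem x) ∨ U.Mem x)) := inferInstance
  have hBM : InM M B := ⟨hB⟩
  have hAM : ZFSet.sep (fun w : ZFSet.{u} => ∃ x : MorassNode.{u}, InM M x ∧
    (w = nodeCode x ∧ ((x.1 ≤ l ∧ b.Mem x) ∨ U.Mem x))) (b.carrier ∪ B) ∈ M :=
    sep_mem_M dA
      ((dfn_union (A := fun p : MorassData.{u} => p.carrier) (B := fun _ => B)).inM b hbM).1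
  have hAmem : ∀ x, nodeCode x ∈ ZFSet.sep (fun w : ZFSet.{u} => ∃ x : MorassNode.{u}, InM M x ∧
    (w = nodeCode x ∧ ((x.1 ≤ l ∧ b.Mem x) ∨ U.Mem x))) (b.carrier ∪ B) ↔ (x.1 ≤ l ∧ b.Mem x) ∨ U.Mem x := by
    intro x
    rw [ZFSet.mem_sep]
    constructor
    · rintro ⟨-, y, -, h1, h2⟩
      have : x = y := code_injective h1
      subst this; exact h2
    · intro h
      have h1 : nodeCode x ∈ b.carrier ∪ B := by
        rw [ZFSet.mem_union]
        exact h.imp (fun h => h.2) (hUB x)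
      exact ⟨h1, x, ⟨mem_trans_M ((dfn_union (A := fun p : MorassData.{u} => p.carrier) (B := fun _ => B)).inM
        b hbM).1 h1⟩, rfl, h⟩
  have d2 : Dfn M fun w : (MorassNode.{u} × MorassNode.{u}) × Ordinal.{u} => U.Lt (l, w.2) w.1.2 :=
    hUL.comp (dfn_pair (F := fun w : (MorassNode.{u} × MorassNode.{u}) × Ordinal.{u} => (l, w.2))
      (G := fun w => w.1.2))
  have d3 : Dfn M fun z : MorassNode.{u} × MorassNode.{u} => ∃ n, b.Lt z.1 (l, n) ∧ U.Lt (l, n) z.2 :=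
    dfn_ex inferInstance fun z n _ h => (inM_prod.1 (h.1.inM hbM).2).2
  have hL : Dfn M fun z : MorassNode.{u} × MorassNode.{u} => (z.2.1 ≤ l ∧ b.Lt z.1 z.2) ∨ U.Lt z.1 z.2 ∨
    ∃ n, b.Lt z.1 (l, n) ∧ U.Lt (l, n) z.2 := inferInstance
  -- The node of level `l` through which a mixed pair factors is unique; the infimum merely selects
  -- it definably.
  let N : MorassNode.{u} → MorassNode.{u} → Ordinal.{u} := fun x y => sInf {n | b.Lt x (l, n) ∧ U.Lt (l, n) y}
  have hN : Dfn M fun z : MorassNode.{u} × MorassNode.{u} => N z.1 z.2 :=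
    dfn_sInf (R := fun (z : MorassNode.{u} × MorassNode.{u}) n => b.Lt z.1 (l, n) ∧ U.Lt (l, n) z.2)
      fun z n _ h => (inM_prod.1 (h.1.inM hbM).2).2
  have hNeq : ∀ x y n, b.Lt x (l, n) → U.Lt (l, n) y → N x y = n := by
    intro x y n h1 h2
    have : {n | b.Lt x (l, n) ∧ U.Lt (l, n) y} = {n} := by
      ext m
      exact ⟨fun h => hU.pred_unique h.2 h2, by rintro rfl; exact ⟨h1, h2⟩⟩
    exact (congrArg sInf this).trans (csInf_singleton _)
  let F : MorassNode.{u} → MorassNode.{u} → Ordinal.{u} → Ordinal.{u} := fun x y ν =>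
    if y.1 ≤ l then b.π x y ν else if l ≤ x.1 then U.π x y ν else U.π (l, N x y) y (b.π x (l, N x y) ν)
  have hF : Dfn M fun z : (MorassNode.{u} × MorassNode.{u}) × Ordinal.{u} => F z.1.1 z.1.2 z.2 := by
    have d4 : Dfn M fun z : (MorassNode.{u} × MorassNode.{u}) × Ordinal.{u} => N z.1.1 z.1.2 := hN.comp dfn_fst'
    have d5 : Dfn M fun z : (MorassNode.{u} × MorassNode.{u}) × Ordinal.{u} =>
        U.π (l, N z.1.1 z.1.2) z.1.2 (b.π z.1.1 (l, N z.1.1 z.1.2) z.2) :=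
      hUπ.comp (dfn_pair (F := fun z : (MorassNode.{u} × MorassNode.{u}) × Ordinal.{u} =>
        ((l, N z.1.1 z.1.2), z.1.2)) (G := fun z => b.π z.1.1 (l, N z.1.1 z.1.2) z.2))
    infer_instance
  have hlow : ∀ x y ν, y.1 ≤ l → F x y ν = b.π x y ν := fun x y ν h => if_pos h
  have hhigh : ∀ x y ν, U.Lt x y → F x y ν = U.π x y ν := fun x y ν h => by
    have h1 := hU.le_level _ (hU.lt_mem _ _ h).1
    have h2 := hU.monotone _ _ h
    exact (if_neg (not_le.2 (h1.trans_lt h2))).trans (if_pos h1)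
  have hmix : ∀ x y n ν, b.Lt x (l, n) → U.Lt (l, n) y → F x y ν = U.π (l, n) y (b.π x (l, n) ν) := by
    intro x y n ν h1 h2
    rw [← hNeq x y n h1 h2]
    exact (if_neg (not_le.2 (hU.monotone _ _ h2))).trans (if_neg (not_le.2 (hb.monotone _ _ h1)))
  obtain ⟨p, hp1, hp2, hp3, hp4, hp5⟩ := exists_data (L := fun x y => (y.1 ≤ l ∧ b.Lt x y) ∨ U.Lt x y ∨
    ∃ n, b.Lt x (l, n) ∧ U.Lt (l, n) y) (F := F) hAM (fun z hz => by
    obtain ⟨-, x, -, h, -⟩ := ZFSet.mem_sep.1 hz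
    exact ⟨x, h⟩) hL (fun x y h => by
      rw [hAmem, hAmem]
      rcases h with h | h | ⟨n, h1, h2⟩
      · exact ⟨.inl ⟨(hb.monotone _ _ h.2).le.trans h.1, (hb.lt_mem h.2).1⟩, .inl ⟨h.1, (hb.lt_mem h.2).2⟩⟩
      · exact ⟨.inr (hU.lt_mem _ _ h).1, .inr (hU.lt_mem _ _ h).2⟩
      · exact ⟨.inl ⟨(hb.monotone _ _ h1).le, (hb.lt_mem h1).1⟩, .inr (hU.lt_mem _ _ h2).2⟩) hF (by
      rintro x y (h | h | ⟨n, h1, h2⟩) ν hν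
      · rw [hlow _ _ _ h.1]; exact hb.map_le h.2 hν
      · rw [hhigh _ _ _ h]
        exact (hU.m1 _ _ h).2 ▸ (hU.m1 _ _ h).1.le hν
      · rw [hmix _ _ n _ h1 h2]
        exact (hU.m1 _ _ h2).2 ▸ (hU.m1 _ _ h2).1.le (hb.map_le h1 hν))
  refine ⟨p, hp1, hp2, fun x => (hp3 x).trans (hAmem x), hp4, fun x y h1 h2 ν hν => ?_, fun x y h ν hν => ?_,
    fun x y n h1 h2 ν hν => ?_⟩
  · rw [hp5 x y (.inl ⟨h1, h2⟩) ν hν, hlow _ _ _ h1]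
  · rw [hp5 x y (.inr (.inl h)) ν hν, hhigh _ _ _ h]
  · rw [hp5 x y (.inr (.inr ⟨n, h1, h2⟩)) ν hν, hmix _ _ n _ h1 h2]

end Build

/-! ### Twin conditions and the exchange of their lower parts -/

/-- Increasing enumerations by ordinals are unique. -/
theorem enum_unique {f g : Ordinal.{u} → Ordinal.{u}} {γ γ' : Ordinal.{u}} (hf : StrictMonoOn f (Iio γ))
    (hg : StrictMonoOn g (Iio γ')) (h : f '' Iio γ = g '' Iio γ') : γ = γ' ∧ ∀ ν < γ, f ν = g ν := by
  have key : ∀ ν, ν < γ → ν < γ' → (∀ μ < ν, f μ = g μ) → f ν = g ν := by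
    intro ν h1 h2 ih
    obtain ⟨a, ha, ha'⟩ : f ν ∈ g '' Iio γ' := h ▸ mem_image_of_mem f h1
    obtain ⟨c, hc, hc'⟩ : g ν ∈ f '' Iio γ := h.symm ▸ mem_image_of_mem g h2
    have h3 : ν ≤ a := by
      by_contra h3
      rw [not_le] at h3
      rw [← ih a h3] at ha'
      exact (hf (h3.trans h1) h1 h3).ne ha'
    have h4 : ν ≤ c := by
      by_contra h3
      rw [not_le] at h3
      rw [ih c h3] at hc'
      exact (hg (h3.trans h2) h2 h3).ne hc'
    exact le_antisymm (hc' ▸ hf.monotoneOn h1 hc h4) (ha' ▸ hg.monotoneOn h2 ha h3)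
  have key2 : ∀ ν, ν < γ → ν < γ' → f ν = g ν := by
    intro ν
    induction ν using WellFoundedLT.induction with
    | ind ν ih => exact fun h1 h2 => key ν h1 h2 fun μ hμ => ih μ hμ (hμ.trans h1) (hμ.trans h2)
  have h1 : γ = γ' := by
    rcases lt_trichotomy γ γ' with h1 | h1 | h1
    · obtain ⟨a, ha, ha'⟩ : g γ ∈ f '' Iio γ := h.symm ▸ mem_image_of_mem g h1
      rw [key2 a ha (lt_trans (show a < γ from ha) h1)] at ha'
      exact absurd ha' (hg (lt_trans (show a < γ from ha) h1) h1 ha).ne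
    · exact h1
    · obtain ⟨a, ha, ha'⟩ : f γ' ∈ g '' Iio γ' := h ▸ mem_image_of_mem f h1
      rw [← key2 a (lt_trans (show a < γ' from ha) h1) ha] at ha'
      exact absurd ha' (hf (lt_trans (show a < γ' from ha) h1) h1 ha).ne
  exact ⟨h1, fun ν hν => key2 ν hν (h1 ▸ hν)⟩

namespace MorassData

variable {κ : Ordinal.{u}} {K : Set Ordinal.{u}} {p q a b r s r₁ s₁ : MorassData.{u}}

theorem IsCondition.exists_top (h : p.IsCondition κ K) {x : MorassNode.{u}} (hx : p.Mem x)
    (h' : p.lam κ < x.1) : ∃ ν β, x = (κ, β) ∧ p.Lt (p.lam κ, ν) (κ, β) := by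
  obtain ⟨γ, -, f, -, h2, h3⟩ := h.top_enum
  rcases h.nodes x hx with h1 | h1
  · exact absurd h' (not_lt.2 h1.1)
  · have h4 : x.2 ∈ p.top κ := by rw [← h1.1]; exact hx
    rw [← h2] at h4
    obtain ⟨ν, hν, h4⟩ := h4
    exact ⟨ν, f ν, Prod.ext h1.1 h4.symm, h3 ν hν⟩

/-- The only clause with content is that `λ` is a mangal of its own condition. It holds because the
only level above `λ` is `κ`, and everything below a node of level `κ` passes through level `λ`. -/
theorem Extends.refl (h : p.IsCondition κ K) : p.Extends κ p := by
  refine ⟨fun x hx => hx, fun x _ _ => Iff.rfl, fun x y => ⟨fun hxy => ⟨(h.lt_mem hxy).1, (h.lt_mem hxy).2, hxy⟩,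
    fun h => h.2.2⟩, fun x y _ ν _ => rfl, le_rfl, fun x y hxy h1 h2 => ?_⟩
  obtain ⟨ν, β, rfl, h3⟩ := h.exists_top (h.lt_mem hxy).2 h2
  rcases (h.lt_top_iff h3).1 hxy with rfl | h4
  · exact absurd h1 (lt_irrefl _)
  · exact ⟨_, rfl, h4, h3⟩

theorem Extends.lt (h : p.Extends κ q) {x y : MorassNode.{u}} (hxy : p.Lt x y) : q.Lt x y :=
  ((h.lt_eq x y).1 hxy).2.2

theorem Extends.mem_low (h : p.Extends κ q) (hp : p.IsCondition κ K) (hq : q.IsCondition κ K)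
    {x : MorassNode.{u}} (hx : x.1 ≤ p.lam κ) : p.Mem x ↔ q.Mem x :=
  ⟨fun h1 => h.subset _ h1, fun h1 => (h.nodes_eq x hx (hq.snd_lt h1 (hx.trans h.mangal.1))).2 h1⟩

theorem Extends.lt_low (h : p.Extends κ q) (hp : p.IsCondition κ K) (hq : q.IsCondition κ K)
    {x y : MorassNode.{u}} (hy : y.1 ≤ p.lam κ) : p.Lt x y ↔ q.Lt x y := by
  refine ⟨h.lt, fun h1 => (h.lt_eq x y).2 ⟨?_, ?_, h1⟩⟩
  · exact (h.mem_low hp hq ((hq.monotone _ _ h1).le.trans hy)).2 (hq.lt_mem h1).1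
  · exact (h.mem_low hp hq hy).2 (hq.lt_mem h1).2

theorem Extends.trans (h : p.Extends κ q) (h' : q.Extends κ r) (hp : p.IsCondition κ K) (hq : q.IsCondition κ K)
    (hr : r.IsCondition κ K) : p.Extends κ r := by
  have hle := h.mangal.1
  refine ⟨fun x hx => h'.subset _ (h.subset _ hx), fun x hx hx' => (h.nodes_eq x hx hx').trans
    (h'.nodes_eq x (hx.trans hle) hx'), fun x y => ⟨fun hxy => ⟨(hp.lt_mem hxy).1, (hp.lt_mem hxy).2, h'.lt (h.lt hxy)⟩,
    fun h1 => (h.lt_eq x y).2 ⟨h1.1, h1.2.1, (h'.lt_eq x y).2 ⟨h.subset _ h1.1, h.subset _ h1.2.1, h1.2.2⟩⟩⟩,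
    fun x y hxy ν hν => (h.maps_eq x y hxy ν hν).trans (h'.maps_eq x y (h.lt hxy) ν hν), hle.trans h'.mangal.1, ?_⟩
  -- For pairs up to level `λ^q` the mangal property of `λ^p` is inherited from `q`. A pair reaching
  -- beyond `λ^q` is first factored through that level.
  have key : ∀ x y, r.Lt x y → x.1 < p.lam κ → p.lam κ < y.1 → y.1 ≤ q.lam κ →
      ∃ z : MorassNode.{u}, z.1 = p.lam κ ∧ r.Lt x z ∧ r.Lt z y := fun x y hxy h1 h2 h3 => by
    obtain ⟨z, h4, h5, h6⟩ := h.mangal.2 x y ((h'.lt_low hq hr h3).2 hxy) h1 h2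
    exact ⟨z, h4, h'.lt h5, h'.lt h6⟩
  intro x y hxy h1 h2
  rcases le_or_gt y.1 (q.lam κ) with h3 | h3
  · exact key x y hxy h1 h2 h3
  · obtain ⟨z, h4, h5, h6⟩ := h'.mangal.2 x y hxy (h1.trans_le hle) h3
    rcases hle.lt_or_eq with h7 | h7
    · obtain ⟨w, h8, h9, h10⟩ := key x z h5 h1 (h4 ▸ h7) h4.le
      exact ⟨w, h8, h9, hr.trans h10 h6⟩
    · exact ⟨z, h4.trans h7.symm, h5, h6⟩

/-- `a` and `b` have the same top level below `κ`, of the same length, and the same level `κ`. -/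
structure Twins (κ : Ordinal.{u}) (a b : MorassData.{u}) : Prop where
  lam_eq : a.lam κ = b.lam κ
  theta_eq : a.theta (a.lam κ) = b.theta (a.lam κ)
  top_eq : a.top κ = b.top κ

theorem Twins.symm (h : Twins κ a b) : Twins κ b a := ⟨h.lam_eq.symm, h.lam_eq ▸ h.theta_eq.symm, h.top_eq.symm⟩

/-- `r ≤ a` and `s ≤ b` agree on the levels from `λ` on, where `λ` is the last level of `a` and `b`. -/
structure IsSwap (κ : Ordinal.{u}) (a b r s : MorassData.{u}) : Prop where
  left : a.Extends κ r
  right : b.Extends κ s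
  mem : ∀ x, a.lam κ ≤ x.1 → (r.Mem x ↔ s.Mem x)
  lt : ∀ x y, a.lam κ ≤ x.1 → (r.Lt x y ↔ s.Lt x y)
  maps : ∀ x y, r.Lt x y → a.lam κ ≤ x.1 → ∀ ν ≤ x.2, r.π x y ν = s.π x y ν

theorem IsSwap.symm (hab : Twins κ a b) (h : IsSwap κ a b r s) : IsSwap κ b a s r where
  left := h.right
  right := h.left
  mem x hx := (h.mem x (hab.lam_eq ▸ hx)).symm
  lt x y hx := (h.lt x y (hab.lam_eq ▸ hx)).symm
  maps x y hxy hx ν hν := (h.maps x y ((h.lt x y (hab.lam_eq ▸ hx)).2 hxy) (hab.lam_eq ▸ hx) ν hν).symm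

/-- The node `⟨λ^r, 0⟩` belongs to the common upper part, hence to `s`, and it is not on level `κ`.
-/
theorem IsSwap.lam_le (hr : r.IsCondition κ K) (hs : s.IsCondition κ K)
    (h : IsSwap κ a b r s) : r.lam κ ≤ s.lam κ := by
  have h1 := (h.mem (r.lam κ, 0) h.left.mangal.1).1 (hr.mem_lam.2 (hr.leftAligned _ le_rfl).1)
  rcases hs.nodes _ h1 with h2 | h2
  exacts [h2.1, absurd h2.1 hr.lam_lt.ne]

theorem IsSwap.lam_eq (hab : Twins κ a b) (hr : r.IsCondition κ K) (hs : s.IsCondition κ K)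
    (h : IsSwap κ a b r s) : r.lam κ = s.lam κ :=
  le_antisymm (h.lam_le hr hs) ((h.symm hab).lam_le hs hr)

/-- Here the mangal clause of the order is used: relations across `λ^b` are determined by `b` and by
the levels from `λ^b` on, which is what makes lower parts exchangeable. -/
theorem Extends.lt_iff_of_mangal (h : b.Extends κ s) (hb : b.IsCondition κ K) (hs : s.IsCondition κ K)
    {x y : MorassNode.{u}} (hx : x.1 < b.lam κ) (hy : b.lam κ < y.1) :
    s.Lt x y ↔ ∃ n, b.Lt x (b.lam κ, n) ∧ s.Lt (b.lam κ, n) y := by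
  constructor
  · intro hxy
    obtain ⟨⟨z1, z2⟩, rfl, h1, h2⟩ := h.mangal.2 x y hxy hx hy
    exact ⟨z2, (h.lt_low hb hs le_rfl).2 h1, h2⟩
  · rintro ⟨n, h1, h2⟩
    exact hs.trans (h.lt h1) h2

/-- The exchange preserves the order. Below `λ` both `s` and `s₁` coincide with `b`; from `λ` on
they copy `r` and `r₁`; pairs across `λ`, and their maps, decompose through that level. -/
theorem IsSwap.extends (hab : Twins κ a b) (hb : b.IsCondition κ K)
    (hr : r.IsCondition κ K) (hs : s.IsCondition κ K) (hr₁ : r₁.IsCondition κ K) (hs₁ : s₁.IsCondition κ K)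
    (h : IsSwap κ a b r s) (h₁ : IsSwap κ a b r₁ s₁) (H : r.Extends κ r₁) : s.Extends κ s₁ := by
  have hl := hab.lam_eq
  have hlam := h.lam_eq hab hr hs
  have hlam₁ := h₁.lam_eq hab hr₁ hs₁
  have hlow : ∀ x : MorassNode.{u}, x.1 ≤ b.lam κ → (s.Mem x ↔ s₁.Mem x) := fun x hx =>
    (h.right.mem_low hb hs hx).symm.trans (h₁.right.mem_low hb hs₁ hx)
  have hhigh : ∀ x y, a.lam κ ≤ x.1 → (s.Lt x y ↔ s.Mem x ∧ s.Mem y ∧ s₁.Lt x y) := by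
    intro x y hx
    rw [← h.lt x y hx, H.lt_eq, ← h.mem x hx, ← h₁.lt x y hx]
    refine and_congr_right fun h1 => and_congr_left fun h2 => h.mem y (hx.trans (hr₁.monotone _ _ h2).le)
  have hsub : ∀ x, s.Mem x → s₁.Mem x := fun x hx => by
    rcases le_total (a.lam κ) x.1 with h1 | h1
    · exact (h₁.mem x h1).1 (H.subset _ ((h.mem x h1).2 hx))
    · exact (hlow x (hl ▸ h1)).1 hx
  have hπ : ∀ x y, s.Lt x y → a.lam κ ≤ x.1 → ∀ ν ≤ x.2, s.π x y ν = s₁.π x y ν := fun x y hxy hx ν hν => by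
    have h1 := (h.lt x y hx).2 hxy
    rw [← h.maps x y h1 hx ν hν, H.maps_eq x y h1 ν hν, h₁.maps x y (H.lt h1) hx ν hν]
  refine ⟨hsub, fun x hx hx' => ?_, fun x y => ?_, fun x y hxy ν hν => ?_, ?_, ?_⟩
  · rcases le_total (a.lam κ) x.1 with h1 | h1
    · rw [← h.mem x h1, ← h₁.mem x h1]
      exact H.nodes_eq x (hlam ▸ hx) hx'
    · exact hlow x (hl ▸ h1)
  · rcases le_or_gt (a.lam κ) x.1 with h1 | h1
    · exact hhigh x y h1
    rcases le_or_gt y.1 (a.lam κ) with h2 | h2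
    · have h3 := (h.right.lt_low hb hs (hl ▸ h2) (x := x)).symm.trans (h₁.right.lt_low hb hs₁ (hl ▸ h2))
      rw [← h3]
      exact ⟨fun h4 => ⟨(hs.lt_mem h4).1, (hs.lt_mem h4).2, h4⟩, fun h4 => h4.2.2⟩
    · rw [h.right.lt_iff_of_mangal hb hs (hl ▸ h1) (hl ▸ h2), h₁.right.lt_iff_of_mangal hb hs₁ (hl ▸ h1) (hl ▸ h2)]
      constructor
      · rintro ⟨n, h3, h4⟩
        exact ⟨h.right.subset _ (hb.lt_mem h3).1, (hs.lt_mem h4).2, n, h3, ((hhigh (b.lam κ, n) y hl.le).1 h4).2.2⟩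
      · rintro ⟨h5, h6, n, h3, h4⟩
        exact ⟨n, h3, (hhigh (b.lam κ, n) y hl.le).2 ⟨h.right.subset _ (hb.lt_mem h3).2, h6, h4⟩⟩
  · rcases le_or_gt (a.lam κ) x.1 with h1 | h1
    · exact hπ x y hxy h1 ν hν
    rcases le_or_gt y.1 (a.lam κ) with h2 | h2
    · have h3 := (h.right.lt_low hb hs (hl ▸ h2)).2 hxy
      rw [← h.right.maps_eq x y h3 ν hν, ← h₁.right.maps_eq x y h3 ν hν]
    · obtain ⟨n, h3, h4⟩ := (h.right.lt_iff_of_mangal hb hs (hl ▸ h1) (hl ▸ h2)).1 hxy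
      have h5 := ((hhigh (b.lam κ, n) y hl.le).1 h4).2.2
      rw [← hs.commutative _ _ _ (h.right.lt h3) h4 ν hν, ← hs₁.commutative _ _ _ (h₁.right.lt h3) h5 ν hν,
        ← h.right.maps_eq _ _ h3 ν hν, ← h₁.right.maps_eq _ _ h3 ν hν]
      exact hπ _ _ h4 hl.le _ (hb.map_le h3 hν)
  · rw [← hlam, ← hlam₁]; exact H.mangal.1
  · have key : ∀ x y, s₁.Lt x y → a.lam κ ≤ x.1 → x.1 < s.lam κ → s.lam κ < y.1 →
        ∃ z : MorassNode.{u}, z.1 = s.lam κ ∧ s₁.Lt x z ∧ s₁.Lt z y := fun x y hxy h1 h2 h3 => by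
      rw [← hlam] at h2 h3 ⊢
      obtain ⟨z, h4, h5, h6⟩ := H.mangal.2 x y ((h₁.lt x y h1).2 hxy) h2 h3
      exact ⟨z, h4, (h₁.lt _ _ h1).1 h5, (h₁.lt _ _ (by rw [h4]; exact h.left.mangal.1)).1 h6⟩
    intro x y hxy h2 h3
    rcases le_or_gt (a.lam κ) x.1 with h1 | h1
    · exact key x y hxy h1 h2 h3
    · have h4 : b.lam κ ≤ s.lam κ := h.right.mangal.1
      obtain ⟨n, h5, h6⟩ := (h₁.right.lt_iff_of_mangal hb hs₁ (hl ▸ h1) (h4.trans_lt h3)).1 hxy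
      rcases h4.lt_or_eq with h7 | h7
      · obtain ⟨z, h8, h9, h10⟩ := key _ _ h6 hl.le h7 h3
        exact ⟨z, h8, hs₁.trans (h₁.right.lt h5) h9, h10⟩
      · exact ⟨_, h7, h₁.right.lt h5, h6⟩

end MorassData

section
variable {M : Set ZFSet.{u}} [hM : Fact (IsTransitiveModelZFCMinus M)]
variable {κ : Ordinal.{u}} [hκ : InM M κ] {K : Set Ordinal.{u}} {a b r : MorassData.{u}}

instance dfn_Mem_const {p : MorassData.{u}} [hp : InM M p] : Dfn M p.Mem :=
  dfn_Mem (P := fun _ => p) (N := fun x => x)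

-- The levels of `r` from `λ` on are glued to `b`. The parts fit because level `λ` has the same
-- length in `a` and `b`. The result extends `b` because the tops agree: increasing enumerations
-- being unique, `⟨λ, ν⟩` lies below the same node of level `κ` in `a` and in `b`.
open MorassData in
theorem exists_isSwap (haM : InM M a) (hbM : InM M b) (hrM : InM M r) (ha : a.IsCondition κ K)
    (hb : b.IsCondition κ K) (hr : r.IsCondition κ K)
    (hab : Twins κ a b) (har : a.Extends κ r) :
    ∃ s, InM M s ∧ s.IsCondition κ K ∧ IsSwap κ a b r s := by
  have hl : b.lam κ ≤ r.lam κ := hab.lam_eq ▸ har.mangal.1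
  have hlM : InM M (b.lam κ) := dfn_lam_const.inM b hbM
  have hU := hr.isUpper hl
  have hbU : ∀ β, b.Mem (b.lam κ, β) ↔ b.lam κ ≤ b.lam κ ∧ r.Mem (b.lam κ, β) := fun β => by
    rw [← hab.lam_eq, ← har.mem_low ha hr (x := (a.lam κ, β)) le_rfl, ha.mem_lam, hab.theta_eq, hab.lam_eq, hb.mem_lam]
    simp
  obtain ⟨s, hsM, hs⟩ := exists_glue hbM hb hU
    (inferInstanceAs (Dfn M fun x : MorassNode.{u} => b.lam κ ≤ x.1 ∧ r.Mem x)) (by exact inferInstance) (by exact inferInstance)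
    ⟨r.carrier, (inM_morass.1 hrM).1, fun x hx => hx.2⟩
  obtain ⟨γ, h1, f, h2, h3, h4⟩ := ha.top_enum
  obtain ⟨γ', h1', f', h2', h3', h4'⟩ := hb.top_enum
  obtain ⟨rfl, h5⟩ := enum_unique h2 h2' (by rw [h3, h3', hab.top_eq])
  refine ⟨s, hsM, hs.isCondition hb hU hbU, har, hs.extends hb hU hbU h3' h4' fun ν hν => ?_, fun x hx => ?_,
    fun x y hx => ?_, fun x y hxy hx ν hν => ?_⟩
  · rw [← h5 ν hν, ← hab.lam_eq]
    refine ⟨⟨le_rfl, har.lt (h4 ν hν)⟩, fun ξ hξ => ?_⟩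
    exact (har.maps_eq _ _ (h4 ν hν) ξ hξ).symm.trans ((ha.map_top h3 h4 hν hξ).trans rfl) |>.trans
      (h5 ξ (hξ.trans_lt hν))
  · rw [hs.mem_high hbU (hab.lam_eq ▸ hx)]
    simp [← hab.lam_eq, hx]
  · rw [hs.lt_high hU hb (hab.lam_eq ▸ hx)]
    simp [← hab.lam_eq, hx]
  · exact (hs.π_high x y ⟨hab.lam_eq ▸ hx, hxy⟩ ν hν).symm

end

/-! ### Collapse of a class of ordinals and the rank of iterated limits -/

section OrdinalRecursion
variable {M : Set ZFSet.{u}} [hM : Fact (IsTransitiveModelZFCMinus M)]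
variable {X : Type*} [Coded.{u} X] [hX : CodedIn M X]

/-- The value at `ν` of a function on ordinals, given by its graph `h`. -/
noncomputable def lookup (h : ZFSet.{u}) (ν : Ordinal.{u}) : Ordinal.{u} :=
  sInf {v | Coded.code (ν, v) ∈ h}

attribute [local instance] dfn_app dfn_app₂

instance dfn_lookup {H : X → ZFSet.{u}} {N : X → Ordinal.{u}} [hH : Dfn M H] [hN : Dfn M N] :
    Dfn M fun x => lookup (H x) (N x) :=
  dfn_sInf (R := fun x v => Coded.code (N x, v) ∈ H x)
    fun x v hx h => (inM_prod.1 (inM_of_code_mem h (hH.inM x hx))).2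

theorem lookup_img (G : Ordinal.{u} → Ordinal.{u}) {ν ξ : Ordinal.{u}} (h : ν < ξ) :
    lookup (img (fun y : Ordinal.{u} => Coded.code (y, G y)) ξ.toZFSet) ν = G ν := by
  have : {v | Coded.code (ν, v) ∈ img (fun y : Ordinal.{u} => Coded.code (y, G y)) ξ.toZFSet} = {G ν} := by
    ext v
    simp only [mem_ofPred_eq, mem_img, mem_singleton_iff]
    constructor
    · rintro ⟨y, -, h2⟩
      obtain ⟨rfl, rfl⟩ := Prod.mk.inj (code_injective h2)
      rfl
    · rintro rfl
      exact ⟨ν, Ordinal.toZFSet_mem_toZFSet_iff.2 h, rfl⟩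
  exact (congrArg sInf this).trans (csInf_singleton _)

theorem sSupImage_congr {F G : Ordinal.{u} → Ordinal.{u}} {a : Ordinal.{u}} (h : ∀ ν < a, F ν = G ν) :
    sSup {μ | ∃ ν, ν < a ∧ F ν = μ} = sSup {μ | ∃ ν, ν < a ∧ G ν = μ} := by
  congr 1
  ext μ
  exact exists_congr fun ν => and_congr_right fun hν => by rw [h ν hν]

open Classical in
/-- The Mostowski collapse of a class of ordinals. -/
noncomputable def ordCollapse (S : Set Ordinal.{u}) (ξ : Ordinal.{u}) : Ordinal.{u} :=
  sSup (range fun ν : Iio ξ => if ν.1 ∈ S then ordCollapse S ν.1 + 1 else 0)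
termination_by ξ
decreasing_by exact ν.2

open Classical in
theorem ordCollapse_eq (S : Set Ordinal.{u}) (ξ : Ordinal.{u}) :
    ordCollapse S ξ = sSup {μ | ∃ ν, ν < ξ ∧ (if ν ∈ S then ordCollapse S ν + 1 else 0) = μ} := by
  rw [ordCollapse]
  congr 1
  ext μ
  simp

theorem lt_ordCollapse {S : Set Ordinal.{u}} {ξ β : Ordinal.{u}} :
    β < ordCollapse S ξ ↔ ∃ ν < ξ, ν ∈ S ∧ β ≤ ordCollapse S ν := by
  rw [ordCollapse_eq, lt_sSup_image]
  refine exists_congr fun ν => and_congr_right fun _ => ?_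
  split_ifs with h <;> simp [h]

theorem ordCollapse_lt {S : Set Ordinal.{u}} {ν ξ : Ordinal.{u}} (h : ν < ξ) (hν : ν ∈ S) :
    ordCollapse S ν < ordCollapse S ξ := lt_ordCollapse.2 ⟨ν, h, hν, le_rfl⟩

theorem ordCollapse_strictMonoOn (S : Set Ordinal.{u}) : StrictMonoOn (ordCollapse S) S :=
  fun _ h _ _ h2 => ordCollapse_lt h2 h

theorem exists_ordCollapse_eq {S : Set Ordinal.{u}} {ξ β : Ordinal.{u}} (h : β < ordCollapse S ξ) :
    ∃ ν < ξ, ν ∈ S ∧ ordCollapse S ν = β := by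
  induction ξ using WellFoundedLT.induction with
  | ind ξ ih =>
    obtain ⟨ν, h1, h2, h3⟩ := lt_ordCollapse.1 h
    rcases h3.lt_or_eq with h3 | rfl
    · obtain ⟨ν', h4, h5⟩ := ih ν h1 h3
      exact ⟨ν', h4.trans h1, h5⟩
    · exact ⟨ν, h1, h2, rfl⟩

theorem dfn_ordCollapse {S : Set Ordinal.{u}} (hS : Dfn M fun ξ => ξ ∈ S) : Dfn M (ordCollapse S) := by
  classical
  have h1 : Dfn M fun z : (Ordinal.{u} × ZFSet.{u}) × Ordinal.{u} => z.2 ∈ S := hS.comp dfn_snd'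
  have h2 : Dfn M fun z : Ordinal.{u} × ZFSet.{u} =>
      sSup {μ | ∃ ν, ν < z.1 ∧ (if ν ∈ S then lookup z.2 ν + 1 else 0) = μ} := inferInstance
  refine dfn_rec_ord (hF := h2) (fun ξ h => sSup {μ | ∃ ν, ν < ξ ∧ (if ν ∈ S then lookup h ν + 1 else 0) = μ})
    _ fun ξ => ?_
  rw [ordCollapse_eq]
  exact sSupImage_congr fun ν hν => by rw [lookup_img _ hν]

/-- The rank of iterated limits: `β < limRank γ` if and only if the ordinals of rank at least `β` are
unbounded in `γ`. -/
noncomputable def limRank (γ : Ordinal.{u}) : Ordinal.{u} :=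
  sInf {β | β ≤ γ ∧ (0 < γ → ∃ δ, δ < γ ∧ ∀ ν : Iio γ, δ < ν.1 → limRank ν.1 < β)}
termination_by γ
decreasing_by exact ν.2

theorem limRank_eq (γ : Ordinal.{u}) : limRank γ =
    sInf {β | β ≤ γ ∧ (0 < γ → ∃ δ, δ < γ ∧ ∀ ν, ν < γ → (δ < ν → limRank ν < β))} := by
  rw [limRank]
  simp

theorem limRank_le (γ : Ordinal.{u}) : limRank γ ≤ γ := by
  induction γ using WellFoundedLT.induction with
  | ind γ ih =>
    rw [limRank_eq]
    exact csInf_le (OrderBot.bddBelow _) ⟨le_rfl, fun h => ⟨0, h, fun ν hν _ => (ih ν hν).trans_lt hν⟩⟩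

theorem lt_limRank {β γ : Ordinal.{u}} :
    β < limRank γ ↔ 0 < γ ∧ ∀ δ < γ, ∃ ν < γ, δ < ν ∧ β ≤ limRank ν := by
  constructor
  · intro h
    have h1 : β ≤ γ := h.le.trans (limRank_le γ)
    rw [limRank_eq] at h
    by_contra h2
    refine notMem_of_lt_csInf h (OrderBot.bddBelow _) ⟨h1, fun h3 => ?_⟩
    by_contra h4
    refine h2 ⟨h3, fun δ hδ => ?_⟩
    by_contra h5
    exact h4 ⟨δ, hδ, fun ν hν h6 => by
      by_contra h7
      exact h5 ⟨ν, hν, h6, not_lt.1 h7⟩⟩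
  · rintro ⟨h1, h2⟩
    by_contra h3
    rw [not_lt] at h3
    have h4 : limRank γ ∈ {β | β ≤ γ ∧ (0 < γ → ∃ δ, δ < γ ∧ ∀ ν, ν < γ → (δ < ν → limRank ν < β))} := by
      rw [limRank_eq γ]
      exact csInf_mem ⟨γ, le_rfl, fun h => ⟨0, h, fun ν hν _ => (limRank_le ν).trans_lt hν⟩⟩
    obtain ⟨δ, hδ, h5⟩ := h4.2 h1
    obtain ⟨ν, hν, h6, h7⟩ := h2 δ hδ
    exact absurd (h5 ν hν h6) (not_lt.2 (h3.trans h7))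

/-- The clause `β ≤ γ` in the definition does no harm, as the rank never exceeds `γ`; it keeps all
candidates for the infimum inside `M`. -/
theorem dfn_limRank : Dfn M limRank.{u} := by
  have h1 : Dfn M fun z : (Ordinal.{u} × ZFSet.{u}) × Ordinal.{u} =>
      z.2 ≤ z.1.1 ∧ (0 < z.1.1 → ∃ δ, δ < z.1.1 ∧ ∀ ν, ν < z.1.1 → (δ < ν → lookup z.1.2 ν < z.2)) := inferInstance
  have h2 : Dfn M fun z : Ordinal.{u} × ZFSet.{u} =>
      sInf {β | β ≤ z.1 ∧ (0 < z.1 → ∃ δ, δ < z.1 ∧ ∀ ν, ν < z.1 → (δ < ν → lookup z.2 ν < β))} :=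
    dfn_sInf (R := fun (z : Ordinal.{u} × ZFSet.{u}) β => β ≤ z.1 ∧ (0 < z.1 → ∃ δ, δ < z.1 ∧
      ∀ ν, ν < z.1 → (δ < ν → lookup z.2 ν < β))) fun z β hz h => inM_of_le h.1 (inM_prod.1 hz).1
  refine dfn_rec_ord (hF := h2) (fun γ h => sInf {β | β ≤ γ ∧ (0 < γ → ∃ δ, δ < γ ∧
    ∀ ν, ν < γ → (δ < ν → lookup h ν < β))}) _ fun γ => ?_
  rw [limRank_eq]
  congr 1
  ext β
  refine and_congr_right fun _ => imp_congr_right fun _ => exists_congr fun δ => and_congr_right fun _ =>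
    forall_congr' fun ν => imp_congr_right fun hν => ?_
  rw [lookup_img _ hν]

end OrdinalRecursion

/-! ### Sets of size less than `κ`, and subsets of sets of size `κ` -/

section Small
variable {M : Set ZFSet.{u}} [hM : Fact (IsTransitiveModelZFCMinus M)]
variable {X : Type*} [Coded.{u} X] [hX : CodedIn M X]
attribute [local instance] dfn_app dfn_app₂

theorem dfn_of_const_left {Y Z W : Type*} [Coded.{u} Y] [Coded.{u} Z] [Coded.{u} W] [CodedIn M Y] [CodedIn M Z]
    {F : Y → Z → W} (hF : Dfn M fun z : Y × Z => F z.1 z.2) (y : Y) [hy : InM M y] : Dfn M (F y) :=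
  hF.comp (dfn_pair (F := fun _ : Z => y) (G := fun z => z))

/-- The ordinal coded by a set. -/
noncomputable def ordOf (z : ZFSet.{u}) : Ordinal.{u} := sInf {μ | z = μ.toZFSet}

theorem ordOf_toZFSet (α : Ordinal.{u}) : ordOf α.toZFSet = α := by
  have : {μ : Ordinal.{u} | α.toZFSet = μ.toZFSet} = {α} := by
    ext μ
    exact ⟨fun h => (Ordinal.toZFSet_injective h).symm, by rintro rfl; rfl⟩
  exact (congrArg sInf this).trans (csInf_singleton _)

theorem dfn_ordOf : Dfn M ordOf.{u} :=
  dfn_sInf (R := fun z μ => z = μ.toZFSet) fun z μ hz h => by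
    subst h; exact ⟨hz.1⟩

/-- In `M`, the set `a` has fewer than `κ` elements. -/
def SmallIn (M : Set ZFSet.{u}) (κ : Ordinal.{u}) (a : ZFSet.{u}) : Prop :=
  a ∈ M ∧ ∃ ε < κ, ∃ f : ZFSet.{u} → Ordinal.{u}, Dfn M f ∧ (∀ x ∈ a, ∀ y ∈ a, f x = f y → x = y) ∧ ∀ x ∈ a, f x < ε

variable {κ : Ordinal.{u}} {a b : ZFSet.{u}}

theorem SmallIn.exists_bound (hκ : IsRegularUncountableIn M κ) (ha : SmallIn M κ a) {F : ZFSet.{u} → Ordinal.{u}}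
    (hF : Dfn M F) (hFκ : ∀ x ∈ a, F x < κ) : ∃ γ < κ, ∀ x ∈ a, F x < γ := by
  obtain ⟨haM, ε, hε, f, hf, hfi, hfε⟩ := ha
  have hκM : InM M κ := ⟨hκ.1⟩
  have haM' : InM M a := ⟨haM⟩
  have hεM : InM M ε := inM_of_lt hε hκM
  -- The value of `F` at the element with index `ξ`; at unused indices it is `0`. Regularity of `κ`
  -- then applies to a function on all of `ε`.
  let I : Ordinal.{u} → Ordinal.{u} := fun ξ => sInf {μ | ∃ x, x ∈ a ∧ (f x = ξ ∧ μ = F x)}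
  have hI : Dfn M I := dfn_sInf (R := fun ξ μ => ∃ x, x ∈ a ∧ (f x = ξ ∧ μ = F x)) (by
    rintro ξ μ hξ ⟨x, hx, -, rfl⟩
    exact hF.inM x ⟨mem_trans_M haM hx⟩)
  have hIf : ∀ x ∈ a, I (f x) = F x := fun x hx => by
    have : {μ | ∃ y, y ∈ a ∧ (f y = f x ∧ μ = F y)} = {F x} := by
      ext μ
      constructor
      · rintro ⟨y, hy, h1, rfl⟩
        rw [hfi y hy x hx h1]; rfl
      · rintro rfl
        exact ⟨x, hx, rfl, rfl⟩
    exact (congrArg sInf this).trans (csInf_singleton _)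
  have hIκ : ∀ ξ, I ξ < κ := fun ξ => by
    by_cases hne : {μ | ∃ x, x ∈ a ∧ (f x = ξ ∧ μ = F x)}.Nonempty
    · obtain ⟨x, hx, -, h1⟩ := csInf_mem hne
      exact (show I ξ = F x from h1) ▸ hFκ x hx
    · rw [not_nonempty_iff_eq_empty] at hne
      have : I ξ = 0 := (congrArg sInf hne).trans Ordinal.sInf_empty
      rw [this]; exact Ordinal.omega0_pos.trans hκ.2.1
  have hg : Dfn M fun ξ : Ordinal.{u} => ZFSet.pair ξ.toZFSet (I ξ).toZFSet :=
    dfn_mkpair (hF := dfn_toZFSet (F := fun ξ => ξ)) (hG := dfn_toZFSet (hF := hI))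
  obtain ⟨γ, hγ, h1⟩ := hκ.2.2 ε hε (img (fun ξ : Ordinal.{u} => ZFSet.pair ξ.toZFSet (I ξ).toZFSet) ε.toZFSet)
    (img_mem_M hg hεM.1) ⟨fun w hw => by
      obtain ⟨ξ, h1, rfl⟩ := mem_img.1 hw
      exact ZFSet.pair_mem_prod.2 ⟨h1, Ordinal.toZFSet_mem_toZFSet_iff.2 (hIκ ξ)⟩, fun z hz => by
      obtain ⟨ξ, h1, rfl⟩ := Ordinal.mem_toZFSet_iff.1 hz
      refine ⟨(I ξ).toZFSet, mem_img.2 ⟨ξ, hz, rfl⟩, fun w hw => ?_⟩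
      obtain ⟨ξ', h2, h3⟩ := mem_img.1 hw
      obtain ⟨h4, h5⟩ := ZFSet.pair_injective h3
      obtain rfl := Ordinal.toZFSet_injective h4
      exact h5⟩
  refine ⟨γ, hγ, fun x hx => h1 (f x) (F x) (mem_img.2 ⟨f x, Ordinal.toZFSet_mem_toZFSet_iff.2 (hfε x hx), ?_⟩)⟩
  rw [hIf x hx]

theorem SmallIn.subset (ha : SmallIn M κ a) (hb : b ∈ M) (h : b ⊆ a) : SmallIn M κ b := by
  obtain ⟨haM, ε, hε, f, hf, hfi, hfε⟩ := ha
  exact ⟨hb, ε, hε, f, hf, fun x hx y hy => hfi x (h hx) y (h hy), fun x hx => hfε x (h hx)⟩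

theorem SmallIn.pullback (ha : SmallIn M κ a) (hb : b ∈ M) {g : ZFSet.{u} → ZFSet.{u}} (hg : Dfn M g)
    (hgi : ∀ x ∈ b, ∀ y ∈ b, g x = g y → x = y) (hga : ∀ x ∈ b, g x ∈ a) : SmallIn M κ b := by
  obtain ⟨haM, ε, hε, f, hf, hfi, hfε⟩ := ha
  exact ⟨hb, ε, hε, fun x => f (g x), inferInstance, fun x hx y hy h =>
    hgi x hx y hy (hfi _ (hga x hx) _ (hga y hy) h), fun x hx => hfε _ (hga x hx)⟩

theorem smallIn_toZFSet (hκ : IsRegularUncountableIn M κ) {ε : Ordinal.{u}} (hε : ε < κ) : SmallIn M κ ε.toZFSet := by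
  have hκM : InM M κ := ⟨hκ.1⟩
  refine ⟨(inM_of_lt hε hκM).1, ε, hε, ordOf, dfn_ordOf, fun x hx y hy h => ?_, fun x hx => ?_⟩
  · obtain ⟨α, h1, rfl⟩ := Ordinal.mem_toZFSet_iff.1 hx
    obtain ⟨β, h2, rfl⟩ := Ordinal.mem_toZFSet_iff.1 hy
    rw [ordOf_toZFSet, ordOf_toZFSet] at h
    rw [h]
  · obtain ⟨α, h1, rfl⟩ := Ordinal.mem_toZFSet_iff.1 hx
    rwa [ordOf_toZFSet]

/-- A set is small if all functions from it to `κ` are bounded. -/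
theorem smallIn_of_bound (hκ : IsRegularUncountableIn M κ) (ha : a ∈ M)
    (h : ∀ F : ZFSet.{u} → Ordinal.{u}, Dfn M F → (∀ x ∈ a, F x < κ) → ∃ γ < κ, ∀ x ∈ a, F x < γ) :
    SmallIn M κ a := by
  classical
  have hκM : InM M κ := ⟨hκ.1⟩
  obtain ⟨α, hα, e, he, hef, hei⟩ := hM.out.choice a ha
  have heM : InM M e := ⟨he⟩
  have haM : InM M a := ⟨ha⟩
  let E : ZFSet.{u} → Ordinal.{u} := fun x => sInf {μ | ZFSet.pair x μ.toZFSet ∈ e}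
  have hE : Dfn M E := dfn_sInf (R := fun x μ => ZFSet.pair x μ.toZFSet ∈ e) fun x μ hx h =>
    ⟨(pair_mem_M_iff.1 (mem_trans_M he h)).2⟩
  have hEe : ∀ x ∈ a, ZFSet.pair x (E x).toZFSet ∈ e := fun x hx => by
    obtain ⟨w, hw, -⟩ := hef.2 x hx
    obtain ⟨μ, -, rfl⟩ := Ordinal.mem_toZFSet_iff.1 (ZFSet.pair_mem_prod.1 (hef.1 hw)).2
    exact csInf_mem (⟨μ, hw⟩ : {μ : Ordinal.{u} | ZFSet.pair x μ.toZFSet ∈ e}.Nonempty)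
  have hEi : ∀ x ∈ a, ∀ y ∈ a, E x = E y → x = y := fun x hx y hy h =>
    hei x y _ (hEe x hx) (h ▸ hEe y hy)
  let S : Set Ordinal.{u} := {ξ | ∃ x, x ∈ a ∧ E x = ξ}
  have hS : Dfn M fun ξ => ξ ∈ S := (inferInstance : Dfn M fun ξ => ∃ x, x ∈ a ∧ E x = ξ)
  have hc : Dfn M (ordCollapse S) := dfn_ordCollapse hS
  have hci : ∀ x ∈ a, ∀ y ∈ a, ordCollapse S (E x) = ordCollapse S (E y) → x = y := fun x hx y hy h =>
    hEi x hx y hy ((ordCollapse_strictMonoOn S).injOn ⟨x, hx, rfl⟩ ⟨y, hy, rfl⟩ h)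
  by_cases hτ : ∃ ε < κ, ∀ x ∈ a, ordCollapse S (E x) < ε
  · obtain ⟨ε, hε, h1⟩ := hτ
    exact ⟨ha, ε, hε, fun x => ordCollapse S (E x), inferInstance, hci, h1⟩
  · exfalso
    have hκ0 : 0 < κ := Ordinal.omega0_pos.trans hκ.2.1
    -- The values of the collapse form an initial segment. If they are not bounded below `κ`, every
    -- `γ < κ` is one of them, and the collapse truncated to values below `κ` is an unbounded
    -- function into `κ`.
    let F : ZFSet.{u} → Ordinal.{u} := fun x => if ordCollapse S (E x) < κ then ordCollapse S (E x) else 0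
    have hF : Dfn M F := dfn_ite (c := fun x => ordCollapse S (E x) < κ)
    obtain ⟨γ, hγ, h1⟩ := h F hF fun x _ => by
      change (if _ then _ else _) < κ
      split_ifs with h2
      exacts [h2, hκ0]
    refine hτ ⟨γ, hγ, fun x hx => ?_⟩
    by_contra h2
    rw [not_lt] at h2
    have h3 : ∃ y ∈ a, ordCollapse S (E y) = γ := by
      rcases h2.lt_or_eq with h2 | h2
      · obtain ⟨ν, -, ⟨y, hy, rfl⟩, h4⟩ := exists_ordCollapse_eq h2
        exact ⟨y, hy, h4⟩
      · exact ⟨x, hx, h2.symm⟩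
    obtain ⟨y, hy, h4⟩ := h3
    have h5 := h1 y hy
    change (if _ then _ else _) < γ at h5
    rw [h4, if_pos hγ] at h5
    exact lt_irrefl _ h5

/-- Smallness is tested by boundedness of functions into `κ`: a function on the union is bounded on
each piece, and the least bounds again form a function on the small index set. No choice of
injections for the pieces is needed. -/
theorem SmallIn.sUnion_img (hκ : IsRegularUncountableIn M κ) (ha : SmallIn M κ a) {G : ZFSet.{u} → ZFSet.{u}}
    (hG : Dfn M G) (hGs : ∀ x ∈ a, SmallIn M κ (G x)) : SmallIn M κ (ZFSet.sUnion (img G a)) := by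
  have hκM : InM M κ := ⟨hκ.1⟩
  refine smallIn_of_bound hκ ((dfn_sUnion (A := fun z : ZFSet.{u} => z)).inM _
    ⟨img_mem_M hG ha.1⟩).1 fun F hF hFκ => ?_
  have hmem : ∀ x ∈ a, ∀ y ∈ G x, y ∈ ZFSet.sUnion (img G a) := fun x hx y hy =>
    ZFSet.mem_sUnion.2 ⟨_, mem_img.2 ⟨x, hx, rfl⟩, hy⟩
  let B : ZFSet.{u} → Ordinal.{u} := fun x => sInf {γ | γ < κ ∧ ∀ y, y ∈ G x → F y < γ}
  have hB : Dfn M B := dfn_sInf (R := fun x γ => γ < κ ∧ ∀ y, y ∈ G x → F y < γ) fun x γ _ h => inM_of_lt h.1 hκM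
  have hBm : ∀ x ∈ a, B x < κ ∧ ∀ y, y ∈ G x → F y < B x := fun x hx => by
    obtain ⟨γ, h1, h2⟩ := (hGs x hx).exists_bound hκ hF fun y hy => hFκ y (hmem x hx y hy)
    exact csInf_mem (s := {γ | γ < κ ∧ ∀ y, y ∈ G x → F y < γ}) ⟨γ, h1, h2⟩
  obtain ⟨γ, hγ, h1⟩ := ha.exists_bound hκ hB fun x hx => (hBm x hx).1
  refine ⟨γ, hγ, fun y hy => ?_⟩
  obtain ⟨w, hw, hy⟩ := ZFSet.mem_sUnion.1 hy
  obtain ⟨x, hx, rfl⟩ := mem_img.1 hw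
  exact ((hBm x hx).2 y hy).trans (h1 x hx)

theorem SmallIn.union (hκ : IsRegularUncountableIn M κ) (ha : SmallIn M κ a) (hb : SmallIn M κ b) :
    SmallIn M κ (a ∪ b) := by
  have haM : InM M a := ⟨ha.1⟩
  have hbM : InM M b := ⟨hb.1⟩
  refine smallIn_of_bound hκ ((inferInstance : Dfn M fun z : ZFSet.{u} => z ∪ b).inM a haM).1 fun F hF hFκ => ?_
  obtain ⟨γ, h1, h2⟩ := ha.exists_bound hκ hF fun x hx => hFκ x (ZFSet.mem_union.2 (.inl hx))
  obtain ⟨γ', h1', h2'⟩ := hb.exists_bound hκ hF fun x hx => hFκ x (ZFSet.mem_union.2 (.inr hx))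
  refine ⟨max γ γ', max_lt h1 h1', fun x hx => ?_⟩
  rcases ZFSet.mem_union.1 hx with hx | hx
  exacts [lt_max_of_lt_left (h2 x hx), lt_max_of_lt_right (h2' x hx)]

theorem SmallIn.prod (hκ : IsRegularUncountableIn M κ) (ha : SmallIn M κ a) (hb : SmallIn M κ b) :
    SmallIn M κ (ZFSet.prod a b) := by
  have haM : InM M a := ⟨ha.1⟩
  have hbM : InM M b := ⟨hb.1⟩
  have h1 : Dfn M fun x : ZFSet.{u} => img (fun y : ZFSet.{u} => ZFSet.pair x y) b := inferInstance
  refine (ha.sUnion_img hκ h1 fun x hx => ?_).subset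
    ((inferInstance : Dfn M fun z : ZFSet.{u} => ZFSet.prod z b).inM a haM).1 fun z hz => ?_
  · have hxM : InM M x := ⟨mem_trans_M ha.1 hx⟩
    refine hb.pullback (h1.inM x hxM).1 (g := fun w => ZFSet.sUnion (ZFSet.sep (fun y => w = ZFSet.pair x y) b))
      inferInstance ?_ ?_
    all_goals
      have h2 : ∀ y ∈ b, ZFSet.sUnion (ZFSet.sep (fun y' => ZFSet.pair x y = ZFSet.pair x y') b) = y := fun y hy => by
        have : ZFSet.sep (fun y' => ZFSet.pair x y = ZFSet.pair x y') b = {y} := by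
          ext w
          rw [ZFSet.mem_sep, ZFSet.mem_singleton]
          exact ⟨fun h => (ZFSet.pair_injective h.2).2.symm, by rintro rfl; exact ⟨hy, rfl⟩⟩
        rw [this, ZFSet.sUnion_singleton]
    · intro w hw w' hw' h
      obtain ⟨y, hy, rfl⟩ := mem_img.1 hw
      obtain ⟨y', hy', rfl⟩ := mem_img.1 hw'
      rw [h2 y hy, h2 y' hy'] at h
      rw [h]
    · intro w hw
      obtain ⟨y, hy, rfl⟩ := mem_img.1 hw
      rw [h2 y hy]; exact hy
  · obtain ⟨x, hx, y, hy, rfl⟩ := ZFSet.mem_prod.1 hz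
    exact ZFSet.mem_sUnion.2 ⟨_, mem_img.2 ⟨x, hx, rfl⟩, mem_img.2 ⟨y, hy, rfl⟩⟩

/-- In `M`, there is a set that has all subsets of `a` as elements. -/
theorem SmallIn.exists_powerset (hpow : ∀ α < κ, HasPowersetIn M α.toZFSet) (ha : SmallIn M κ a) :
    ∃ B ∈ M, ∀ x ∈ M, x ⊆ a → x ∈ B := by
  obtain ⟨haM, ε, hε, f, hf, hfi, hfε⟩ := ha
  have haM' : InM M a := ⟨haM⟩
  -- The injection `f` identifies subsets of `a` with certain subsets of `ε`, and `ε` has a power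
  -- set in `M`.
  obtain ⟨Q, hQ, hQ'⟩ := hpow ε hε
  have h1 : Dfn M fun w : ZFSet.{u} => ZFSet.sep (fun y => (f y).toZFSet ∈ w) a := inferInstance
  have h2 : Dfn M fun y : ZFSet.{u} => (f y).toZFSet := inferInstance
  refine ⟨_, img_mem_M h1 hQ, fun x hx hxa => mem_img.2 ⟨img (fun y : ZFSet.{u} => (f y).toZFSet) x, ?_, ?_⟩⟩
  · refine (hQ' _).2 ⟨img_mem_M h2 hx, fun z hz => ?_⟩
    obtain ⟨y, hy, rfl⟩ := mem_img.1 hz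
    exact Ordinal.toZFSet_mem_toZFSet_iff.2 (hfε y (hxa hy))
  · ext y
    rw [ZFSet.mem_sep]
    refine ⟨fun hy => ⟨hxa hy, mem_img.2 ⟨y, hy, rfl⟩⟩, ?_⟩
    rintro ⟨hy, h⟩
    obtain ⟨y', hy', h3⟩ := mem_img.1 h
    rw [hfi y hy y' (hxa hy') (Ordinal.toZFSet_injective h3)]
    exact hy'

/-- In `M`, the set `B` is the union of an increasing sequence of length `κ` of small sets. -/
def SizedIn (M : Set ZFSet.{u}) (κ : Ordinal.{u}) (B : ZFSet.{u}) : Prop :=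
  B ∈ M ∧ ∃ h : ZFSet.{u} → Ordinal.{u}, Dfn M h ∧ (∀ x ∈ B, h x < κ) ∧
    ∀ δ < κ, SmallIn M κ (ZFSet.sep (fun x => h x < δ) B)

/-- By regularity a small subset lies within one stage of the sequence. Each stage is small and has
all its subsets inside a set of `M`; Collection over the `κ` stages gathers these sets. A power set
of `κ` itself is not needed. -/
theorem SizedIn.exists_small_subsets (hκ : IsRegularUncountableIn M κ)
    (hpow : ∀ α < κ, HasPowersetIn M α.toZFSet) {B : ZFSet.{u}} (hB : SizedIn M κ B) :
    ∃ C ∈ M, ∀ x ∈ M, SmallIn M κ x → x ⊆ B → x ∈ C := by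
  obtain ⟨hBM, h, hh, hhκ, hs⟩ := hB
  have hκM : InM M κ := ⟨hκ.1⟩
  have hBM' : InM M B := ⟨hBM⟩
  have hR : Dfn M fun z : (ZFSet.{u} × ZFSet.{u}) × ZFSet.{u} => ∀ x, InM M x →
      ((∀ y, y ∈ x → y ∈ B ∧ (h y).toZFSet ∈ z.1.2) → x ∈ z.2) := inferInstance
  obtain ⟨C, hC, h1⟩ := exists_collection (x := B) (R := fun (_ : ZFSet.{u}) (d C : ZFSet.{u}) => ∀ x, InM M x →
      ((∀ y, y ∈ x → y ∈ B ∧ (h y).toZFSet ∈ d) → x ∈ C)) hR hBM' hκ.1 (by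
    intro d hd
    obtain ⟨δ, hδ, rfl⟩ := Ordinal.mem_toZFSet_iff.1 hd
    obtain ⟨C, hC, h2⟩ := (hs δ hδ).exists_powerset hpow
    refine ⟨C, ⟨hC⟩, fun x hx h3 => h2 x hx.1 fun y hy => ?_⟩
    exact ZFSet.mem_sep.2 ⟨(h3 y hy).1, Ordinal.toZFSet_mem_toZFSet_iff.1 (h3 y hy).2⟩)
  refine ⟨ZFSet.sUnion C, hM.out.union _ hC, fun x hx hxs hxB => ?_⟩
  obtain ⟨δ, hδ, h2⟩ := hxs.exists_bound hκ hh fun y hy => hhκ y (hxB hy)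
  obtain ⟨D, hD, h3, h4⟩ := h1 _ (Ordinal.toZFSet_mem_toZFSet_iff.2 hδ)
  exact ZFSet.mem_sUnion.2 ⟨D, h4, h3 x ⟨hx⟩ fun y hy => ⟨hxB hy, Ordinal.toZFSet_mem_toZFSet_iff.2 (h2 y hy)⟩⟩

end Small

/-! ### Closure properties of sets of size at most `κ` -/

section Sized
variable {M : Set ZFSet.{u}} [hM : Fact (IsTransitiveModelZFCMinus M)]
variable {X : Type*} [Coded.{u} X] [hX : CodedIn M X]
attribute [local instance] dfn_app dfn_app₂
variable {κ : Ordinal.{u}} {a b : ZFSet.{u}}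

instance dfn_isInjFunc {A B F : X → ZFSet.{u}} [hA : Dfn M A] [hB : Dfn M B] [hF : Dfn M F] :
    Dfn M fun x => IsInjFunc (A x) (B x) (F x) := by
  refine (inferInstance : Dfn M fun x => ZFSet.IsFunc (A x) (B x) (F x) ∧ ∀ u, InM M u → ∀ v, InM M v →
    ∀ w, InM M w → (ZFSet.pair u w ∈ F x → ZFSet.pair v w ∈ F x → u = v)).congr fun x hx => propext ⟨fun h =>
      ⟨h.1, fun u _ v _ w _ => h.2 u v w⟩, fun h => ⟨h.1, fun u v w h1 h2 => ?_⟩⟩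
  have h3 := pair_mem_M_iff.1 (mem_trans_M (hF.inM x hx).1 h1)
  have h4 := pair_mem_M_iff.1 (mem_trans_M (hF.inM x hx).1 h2)
  exact h.2 u ⟨h3.1⟩ v ⟨h4.1⟩ w ⟨h3.2⟩ h1 h2

theorem dfn_succCardIn [hκM : InM M κ] : Dfn M fun β => β ∈ succCardIn M κ :=
  (inferInstance : Dfn M fun β : Ordinal.{u} => ∃ f, InM M f ∧ IsInjFunc β.toZFSet κ.toZFSet f).congr
    fun β hβ => propext ⟨fun ⟨h1, f, h2, h3⟩ => ⟨f, ⟨h2⟩, h3⟩, fun ⟨f, h2, h3⟩ => ⟨hβ.1, f, h2.1, h3⟩⟩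

theorem IsInjFunc.exists_value {x f : ZFSet.{u}} {α : Ordinal.{u}} (h : IsInjFunc x α.toZFSet f) {y : ZFSet.{u}}
    (hy : y ∈ x) : ∃ μ < α, ZFSet.pair y μ.toZFSet ∈ f ∧ ∀ ν : Ordinal.{u}, ZFSet.pair y ν.toZFSet ∈ f → ν = μ := by
  obtain ⟨w, hw, hw'⟩ := h.1.2 y hy
  obtain ⟨μ, hμ, rfl⟩ := Ordinal.mem_toZFSet_iff.1 (ZFSet.pair_mem_prod.1 (h.1.1 hw)).2
  exact ⟨μ, hμ, hw, fun ν hν => Ordinal.toZFSet_injective (hw' _ hν)⟩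

theorem exists_dfn_injOn (ha : a ∈ M) : ∃ E : ZFSet.{u} → Ordinal.{u}, Dfn M E ∧
    ∀ x ∈ a, ∀ y ∈ a, E x = E y → x = y := by
  obtain ⟨α, hα, e, he, hei⟩ := hM.out.choice a ha
  have heM : InM M e := ⟨he⟩
  refine ⟨fun x => sInf {μ | ZFSet.pair x μ.toZFSet ∈ e}, dfn_sInf (R := fun x μ => ZFSet.pair x μ.toZFSet ∈ e)
    fun x μ hx h => ⟨(pair_mem_M_iff.1 (mem_trans_M he h)).2⟩, ?_⟩
  have hEe : ∀ x ∈ a, ZFSet.pair x (sInf {μ : Ordinal.{u} | ZFSet.pair x μ.toZFSet ∈ e}).toZFSet ∈ e := fun x hx => by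
    obtain ⟨μ, -, hμ, -⟩ := hei.exists_value hx
    exact csInf_mem (⟨μ, hμ⟩ : {μ : Ordinal.{u} | ZFSet.pair x μ.toZFSet ∈ e}.Nonempty)
  intro x hx y hy h
  have h1 := hEe y hy
  beta_reduce at h
  rw [← h] at h1
  exact hei.2 x y _ (hEe x hx) h1

theorem SmallIn.sized (hκ : IsRegularUncountableIn M κ) (ha : SmallIn M κ a) : SizedIn M κ a := by
  have haM : InM M a := ⟨ha.1⟩
  refine ⟨ha.1, fun _ => 0, inferInstance, fun _ _ => Ordinal.omega0_pos.trans hκ.2.1, fun δ hδ => ?_⟩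
  have hδM : InM M δ := inM_of_lt hδ ⟨hκ.1⟩
  exact ha.subset (sep_mem_M (by infer_instance) ha.1) fun x hx => (ZFSet.mem_sep.1 hx).1

theorem sized_toZFSet (hκ : IsRegularUncountableIn M κ) : SizedIn M κ κ.toZFSet := by
  refine ⟨hκ.1, ordOf, dfn_ordOf, fun x hx => ?_, fun δ hδ => ?_⟩
  · obtain ⟨α, h1, rfl⟩ := Ordinal.mem_toZFSet_iff.1 hx
    rwa [ordOf_toZFSet]
  · have hδM : InM M δ := inM_of_lt hδ ⟨hκ.1⟩
    have := dfn_ordOf (M := M)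
    refine (smallIn_toZFSet hκ hδ).subset (sep_mem_M (by infer_instance) hκ.1) fun x hx => ?_
    obtain ⟨h1, h2⟩ := ZFSet.mem_sep.1 hx
    obtain ⟨α, -, rfl⟩ := Ordinal.mem_toZFSet_iff.1 h1
    rw [ordOf_toZFSet] at h2
    exact Ordinal.toZFSet_mem_toZFSet_iff.2 h2

theorem SizedIn.union (hκ : IsRegularUncountableIn M κ) (ha : SizedIn M κ a) (hb : SizedIn M κ b) :
    SizedIn M κ (a ∪ b) := by
  classical
  obtain ⟨haM, h, hh, hhκ, hs⟩ := ha
  obtain ⟨hbM, h', hh', hhκ', hs'⟩ := hb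
  have haM' : InM M a := ⟨haM⟩
  have hbM' : InM M b := ⟨hbM⟩
  have hu : a ∪ b ∈ M := ((inferInstance : Dfn M fun z : ZFSet.{u} => z ∪ b).inM a haM').1
  have hd : Dfn M fun x => if x ∈ a then h x else h' x :=
    dfn_ite (hc := dfn_mem (F := fun x => x) (G := fun _ => a)) (hF := hh) (hG := hh')
  refine ⟨hu, fun x => if x ∈ a then h x else h' x, hd, fun x hx => ?_, fun δ hδ => ?_⟩
  · beta_reduce
    split_ifs with h1
    exacts [hhκ x h1, hhκ' x ((ZFSet.mem_union.1 hx).resolve_left h1)]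
  · have hδM : InM M δ := inM_of_lt hδ ⟨hκ.1⟩
    refine ((hs δ hδ).union hκ (hs' δ hδ)).subset (sep_mem_M (by infer_instance) hu) fun x hx => ?_
    obtain ⟨h1, h2⟩ := ZFSet.mem_sep.1 hx
    rw [ZFSet.mem_union, ZFSet.mem_sep, ZFSet.mem_sep]
    beta_reduce at h2
    split_ifs at h2 with h3
    exacts [.inl ⟨h3, h2⟩, .inr ⟨(ZFSet.mem_union.1 h1).resolve_left h3, h2⟩]

theorem SizedIn.prod (hκ : IsRegularUncountableIn M κ) (ha : SizedIn M κ a) (hb : SizedIn M κ b) :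
    SizedIn M κ (ZFSet.prod a b) := by
  obtain ⟨haM, h, hh, hhκ, hs⟩ := ha
  obtain ⟨hbM, h', hh', hhκ', hs'⟩ := hb
  have haM' : InM M a := ⟨haM⟩
  have hbM' : InM M b := ⟨hbM⟩
  have hκM : InM M κ := ⟨hκ.1⟩
  have hu : ZFSet.prod a b ∈ M := ((inferInstance : Dfn M fun z : ZFSet.{u} => ZFSet.prod z b).inM a haM').1
  have hR : Dfn M fun z : ZFSet.{u} × Ordinal.{u} => z.2 < κ ∧ ∃ x, x ∈ a ∧ ∃ y, y ∈ b ∧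
    (z.1 = ZFSet.pair x y ∧ h x ≤ z.2 ∧ h' y ≤ z.2) := inferInstance
  -- A pair gets the larger of the two indices, so that stage `δ` of the product is contained in the
  -- product of the stages `δ`.
  have hd : Dfn M fun z : ZFSet.{u} => sInf {μ | μ < κ ∧ ∃ x, x ∈ a ∧ ∃ y, y ∈ b ∧
      (z = ZFSet.pair x y ∧ h x ≤ μ ∧ h' y ≤ μ)} :=
    dfn_sInf (R := fun z μ => μ < κ ∧ ∃ x, x ∈ a ∧ ∃ y, y ∈ b ∧ (z = ZFSet.pair x y ∧ h x ≤ μ ∧ h' y ≤ μ))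
      fun z μ _ hz => inM_of_lt hz.1 hκM
  have key : ∀ x ∈ a, ∀ y ∈ b, sInf {μ | μ < κ ∧ ∃ x', x' ∈ a ∧ ∃ y', y' ∈ b ∧
      (ZFSet.pair x y = ZFSet.pair x' y' ∧ h x' ≤ μ ∧ h' y' ≤ μ)} ∈ {μ | μ < κ ∧ ∃ x', x' ∈ a ∧ ∃ y', y' ∈ b ∧
      (ZFSet.pair x y = ZFSet.pair x' y' ∧ h x' ≤ μ ∧ h' y' ≤ μ)} := fun x hx y hy =>
    csInf_mem ⟨max (h x) (h' y), max_lt (hhκ x hx) (hhκ' y hy), x, hx, y, hy, rfl, le_max_left _ _, le_max_right _ _⟩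
  refine ⟨hu, _, hd, fun z hz => ?_, fun δ hδ => ?_⟩
  · obtain ⟨x, hx, y, hy, rfl⟩ := ZFSet.mem_prod.1 hz
    exact (key x hx y hy).1
  · have hδM : InM M δ := inM_of_lt hδ ⟨hκ.1⟩
    refine ((hs δ hδ).prod hκ (hs' δ hδ)).subset (sep_mem_M (dfn_lt (hF := hd)) hu) fun z hz => ?_
    obtain ⟨h1, h2⟩ := ZFSet.mem_sep.1 hz
    obtain ⟨x, hx, y, hy, rfl⟩ := ZFSet.mem_prod.1 h1
    obtain ⟨-, x', hx', y', hy', h3, h4, h5⟩ := key x hx y hy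
    obtain ⟨rfl, rfl⟩ := ZFSet.pair_injective h3
    exact ZFSet.pair_mem_prod.2 ⟨ZFSet.mem_sep.2 ⟨hx, h4.trans_lt h2⟩, ZFSet.mem_sep.2 ⟨hy, h5.trans_lt h2⟩⟩

/-- The union of a small set of ordinals below `κ⁺` has size at most `κ`. -/
theorem SmallIn.sUnion_sized (hκ : IsRegularUncountableIn M κ) (ha : SmallIn M κ a)
    (haK : ∀ z ∈ a, ∃ β ∈ succCardIn M κ, z = β.toZFSet) : SizedIn M κ (ZFSet.sUnion a) := by
  have haM : InM M a := ⟨ha.1⟩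
  have hκM : InM M κ := ⟨hκ.1⟩
  have hκ0 : 0 < κ := Ordinal.omega0_pos.trans hκ.2.1
  have hR : Dfn M fun z : (ZFSet.{u} × ZFSet.{u}) × ZFSet.{u} => IsInjFunc z.1.2 κ.toZFSet z.2 := inferInstance
  obtain ⟨b, hb, h1⟩ := exists_collection (x := a) (R := fun (_ : ZFSet.{u}) x f => IsInjFunc x κ.toZFSet f) hR
    haM ha.1 (by
      intro z hz
      obtain ⟨β, ⟨h1, f, h2, h3⟩, rfl⟩ := haK z hz
      exact ⟨f, ⟨h2⟩, h3⟩)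
  have hbM : InM M b := ⟨hb⟩
  obtain ⟨E, hE, hEi⟩ := exists_dfn_injOn hb
  -- Collection gives a set `b` with an injection into `κ` for each `x`, but perhaps several. As `E`
  -- indexes `b` injectively by ordinals, the least index `c x` chooses one of them.
  obtain ⟨c, hc, hcf⟩ : ∃ c : ZFSet.{u} → Ordinal.{u}, Dfn M c ∧ ∀ x ∈ a, ∃ f ∈ b, IsInjFunc x κ.toZFSet f ∧ E f = c x := by
    refine ⟨fun x => sInf {μ | ∃ f, f ∈ b ∧ (IsInjFunc x κ.toZFSet f ∧ E f = μ)}, dfn_sInf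
      (R := fun x μ => ∃ f, f ∈ b ∧ (IsInjFunc x κ.toZFSet f ∧ E f = μ)) ?_, fun x hx => ?_⟩
    · rintro x μ hx ⟨f, hf, -, rfl⟩
      exact hE.inM f ⟨mem_trans_M hb hf⟩
    · obtain ⟨f, _, h2, h3⟩ := h1 x hx
      exact csInf_mem (s := {μ | ∃ f, f ∈ b ∧ (IsInjFunc x κ.toZFSet f ∧ E f = μ)}) ⟨_, f, h3, h2, rfl⟩
  obtain ⟨v, hv, hvf⟩ : ∃ v : ZFSet.{u} → ZFSet.{u} → Ordinal.{u}, Dfn M (fun z : ZFSet.{u} × ZFSet.{u} => v z.1 z.2) ∧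
      ∀ x ∈ a, ∃ f, IsInjFunc x κ.toZFSet f ∧ ∀ y ∈ x, v x y < κ ∧ ZFSet.pair y (v x y).toZFSet ∈ f := by
    refine ⟨fun x y => sInf {μ | μ < κ ∧ ∃ f, f ∈ b ∧ (IsInjFunc x κ.toZFSet f ∧ E f = c x ∧
      ZFSet.pair y μ.toZFSet ∈ f)}, dfn_sInf (R := fun (z : ZFSet.{u} × ZFSet.{u}) μ => μ < κ ∧ ∃ f, f ∈ b ∧
      (IsInjFunc z.1 κ.toZFSet f ∧ E f = c z.1 ∧ ZFSet.pair z.2 μ.toZFSet ∈ f)) ?_, fun x hx => ?_⟩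
    · exact fun x μ _ h => inM_of_lt h.1 hκM
    · obtain ⟨f, hf, hf1, hf2⟩ := hcf x hx
      refine ⟨f, hf1, fun y hy => ?_⟩
      obtain ⟨μ, h2, h3, -⟩ := hf1.exists_value hy
      have := csInf_mem (s := {μ | μ < κ ∧ ∃ f, f ∈ b ∧ (IsInjFunc x κ.toZFSet f ∧ E f = c x ∧
        ZFSet.pair y μ.toZFSet ∈ f)}) ⟨μ, h2, f, hf, hf1, hf2, h3⟩
      obtain ⟨h4, f', hf', h5, h6, h7⟩ := this
      obtain rfl := hEi f' hf' f hf (h6.trans hf2.symm)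
      exact ⟨h4, h7⟩
  have hU : ZFSet.sUnion a ∈ M := hM.out.union _ ha.1
  -- An element lying in several members of `a` gets its least value. Stage `δ` is then covered by
  -- the sets of `y ∈ x` with value below `δ`, each of which the chosen injection maps into `δ`.
  have hd : Dfn M fun y : ZFSet.{u} => sInf {μ | μ < κ ∧ ∃ x, x ∈ a ∧ (y ∈ x ∧ μ = v x y)} :=
    dfn_sInf (R := fun y μ => μ < κ ∧ ∃ x, x ∈ a ∧ (y ∈ x ∧ μ = v x y)) fun y μ _ h => inM_of_lt h.1 hκM
  have key : ∀ y ∈ ZFSet.sUnion a, sInf {μ | μ < κ ∧ ∃ x, x ∈ a ∧ (y ∈ x ∧ μ = v x y)} < κ ∧ ∃ x, x ∈ a ∧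
      (y ∈ x ∧ sInf {μ | μ < κ ∧ ∃ x, x ∈ a ∧ (y ∈ x ∧ μ = v x y)} = v x y) := fun y hy => by
    obtain ⟨x, hx, hy⟩ := ZFSet.mem_sUnion.1 hy
    obtain ⟨f, -, h2⟩ := hvf x hx
    exact csInf_mem (s := {μ | μ < κ ∧ ∃ x, x ∈ a ∧ (y ∈ x ∧ μ = v x y)}) ⟨_, (h2 y hy).1, x, hx, hy, rfl⟩
  refine ⟨hU, _, hd, fun y hy => (key y hy).1, fun δ hδ => ?_⟩
  have hδM : InM M δ := inM_of_lt hδ hκM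
  have hS : Dfn M fun x : ZFSet.{u} => ZFSet.sep (fun y => v x y < δ) x := inferInstance
  refine (ha.sUnion_img hκ hS fun x hx => ?_).subset (sep_mem_M (dfn_lt (hF := hd)) hU) fun y hy => ?_
  · have hxM : InM M x := ⟨mem_trans_M ha.1 hx⟩
    obtain ⟨f, hf, h2⟩ := hvf x hx
    refine ⟨(hS.inM x hxM).1, δ, hδ, v x, dfn_of_const_left hv x, fun y hy y' hy' h3 => ?_, fun y hy =>
      (ZFSet.mem_sep.1 hy).2⟩
    have h4 := (h2 y' (ZFSet.mem_sep.1 hy').1).2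
    rw [← h3] at h4
    exact hf.2 y y' _ (h2 y (ZFSet.mem_sep.1 hy).1).2 h4
  · obtain ⟨h2, h3⟩ := ZFSet.mem_sep.1 hy
    obtain ⟨-, x, hx, h4, h5⟩ := key y h2
    exact ZFSet.mem_sUnion.2 ⟨_, mem_img.2 ⟨x, hx, rfl⟩, ZFSet.mem_sep.2 ⟨h4, h5 ▸ h3⟩⟩

end Sized

/-! ### Conditions with bounded level `κ` form a set -/

section Bounded
variable {M : Set ZFSet.{u}} [hM : Fact (IsTransitiveModelZFCMinus M)]
variable {κ : Ordinal.{u}} {K : Set Ordinal.{u}} {p r : MorassData.{u}}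

namespace MorassData

theorem WellFormed.π_eq (h : r.WellFormed) {x y : MorassNode.{u}} {f : ZFSet.{u}}
    (hf : ZFSet.pair (ZFSet.pair (nodeCode x) (nodeCode y)) f ∈ r.maps) {ν μ : Ordinal.{u}}
    (hν : ZFSet.pair ν.toZFSet μ.toZFSet ∈ f) : r.π x y ν = μ := by
  have h0 : ∀ f', ZFSet.pair (ZFSet.pair (nodeCode x) (nodeCode y)) f' ∈ r.maps →
      r.Lt x y ∧ ZFSet.IsFunc (x.2 + 1).toZFSet (y.2 + 1).toZFSet f' := by
    intro f' hf'
    obtain ⟨x', y', f'', h1, h2, h3⟩ := h.maps_pairs _ hf'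
    obtain ⟨h4, rfl⟩ := ZFSet.pair_injective h3
    obtain ⟨h5, h6⟩ := ZFSet.pair_injective h4
    obtain rfl : x = x' := code_injective h5
    obtain rfl : y = y' := code_injective h6
    exact ⟨h1, h2⟩
  have hu : ∀ {f'}, ZFSet.pair (ZFSet.pair (nodeCode x) (nodeCode y)) f' ∈ r.maps → f = f' := fun h1 =>
    (h.maps_total x y (h0 f hf).1).unique hf h1
  have : {μ : Ordinal.{u} | ∃ f, ZFSet.pair (ZFSet.pair (nodeCode x) (nodeCode y)) f ∈ r.maps ∧
    ZFSet.pair ν.toZFSet μ.toZFSet ∈ f} = {μ} := by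
    ext μ'
    constructor
    · rintro ⟨f', h1, h2⟩
      obtain rfl := hu h1
      obtain ⟨w, -, h3⟩ := (h0 f hf).2.2 _ (ZFSet.pair_mem_prod.1 ((h0 f hf).2.1 hν)).1
      exact Ordinal.toZFSet_injective ((h3 _ h2).trans (h3 _ hν).symm)
    · rintro rfl
      exact ⟨f, hf, hν⟩
  exact (congrArg sInf this).trans (csInf_singleton _)

/-- The lengths of the levels below `λ` have a common bound below `κ` by regularity. Level `λ` has
length less than `κ`, and level `κ` injects into it by sending a node to its predecessor there. -/
theorem IsCondition.smallIn_carrier (hκ : IsRegularUncountableIn M κ) (hrM : InM M r) (hr : r.IsCondition κ K) :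
    SmallIn M κ r.carrier := by
  have hκM : InM M κ := ⟨hκ.1⟩
  have hcM : r.carrier ∈ M := (inM_morass.1 hrM).1
  have hcM' : InM M r.carrier := ⟨hcM⟩
  have hlM : InM M (r.lam κ) := dfn_lam_const.inM r hrM
  have hθ : Dfn M fun z : ZFSet.{u} => r.theta (ordOf z) := by
    have := dfn_ordOf (M := M)
    exact dfn_theta (P := fun _ => r) (A := ordOf)
  have hθM : InM M (r.theta (r.lam κ)) := inM_of_lt (hr.leftAligned _ le_rfl).2.1 hκM
  obtain ⟨δ, hδ, h1⟩ := (smallIn_toZFSet hκ hr.lam_lt).exists_bound hκ hθ (by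
    intro x hx
    obtain ⟨α, hα, rfl⟩ := Ordinal.mem_toZFSet_iff.1 hx
    rw [ordOf_toZFSet]
    exact (hr.leftAligned α (le_of_lt hα)).2.1)
  have hone : SmallIn M κ {(r.lam κ).toZFSet} := by
    refine ⟨singleton_mem_M hlM.1, 1, ?_, fun _ => 0, inferInstance, fun x hx y hy _ => ?_, fun x hx => zero_lt_one⟩
    · exact Ordinal.one_lt_omega0.trans hκ.2.1
    · rw [ZFSet.mem_singleton.1 hx, ZFSet.mem_singleton.1 hy]
  have hlow := (((smallIn_toZFSet hκ hr.lam_lt).prod hκ (smallIn_toZFSet hκ hδ)).union hκ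
    (hone.prod hκ (smallIn_toZFSet hκ (hr.leftAligned _ le_rfl).2.1)))
  have hRd : Dfn M fun z : ZFSet.{u} => ∃ x : MorassNode.{u}, InM M x ∧ (z = nodeCode x ∧ x.1 = κ) := inferInstance
  have hhigh : SmallIn M κ (ZFSet.sep (fun z => ∃ x : MorassNode.{u}, InM M x ∧ (z = nodeCode x ∧ x.1 = κ)) r.carrier) := by
    have key : ∀ x, r.Mem x → x.1 = κ → r.Lt (r.lam κ, sInf {ν | ∃ y, InM M y ∧ (nodeCode x = nodeCode y ∧
        r.Lt (r.lam κ, ν) y)}) x := by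
      intro x hx hxκ
      obtain ⟨ν, β, rfl, h2⟩ := hr.exists_top hx (hxκ ▸ hr.lam_lt)
      have := csInf_mem (s := {ν | ∃ y, InM M y ∧ (nodeCode (κ, β) = nodeCode y ∧ r.Lt (r.lam κ, ν) y)})
        ⟨ν, (κ, β), hx.inM hrM, rfl, h2⟩
      obtain ⟨y, hy, h3, h4⟩ := this
      have h5 : (κ, β) = y := code_injective h3
      rw [← h5] at h4
      exact h4
    refine ⟨sep_mem_M hRd hcM, r.theta (r.lam κ), (hr.leftAligned _ le_rfl).2.1,
      fun z => sInf {ν | ∃ y, InM M y ∧ (z = nodeCode y ∧ r.Lt (r.lam κ, ν) y)}, ?_, ?_, ?_⟩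
    · exact dfn_sInf (R := fun z ν => ∃ y, InM M y ∧ (z = nodeCode y ∧ r.Lt (r.lam κ, ν) y))
        fun z ν _ h => by
          obtain ⟨y, _, _, h2⟩ := h
          exact (inM_prod.1 (h2.inM hrM).1).2
    · intro z hz w hw h
      obtain ⟨h1, x, hx, rfl, hxκ⟩ := ZFSet.mem_sep.1 hz
      obtain ⟨h1', x', hx', rfl, hxκ'⟩ := ZFSet.mem_sep.1 hw
      have h2 := key x h1 hxκ
      have h3 := key x' h1' hxκ'
      beta_reduce at h
      rw [h] at h2
      obtain ⟨γ, -, f, hf1, hf2, hf3⟩ := hr.top_enum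
      have h4 : ∀ y : MorassNode.{u}, r.Mem y → y.1 = κ → ∃ ν < γ, y = (κ, f ν) := fun y hy hyκ => by
        have h5 : y.2 ∈ r.top κ := by rw [← hyκ]; exact hy
        rw [← hf2] at h5
        obtain ⟨ν, hν, h5⟩ := h5
        exact ⟨ν, hν, Prod.ext hyκ h5.symm⟩
      obtain ⟨ν, hν, rfl⟩ := h4 x h1 hxκ
      obtain ⟨ν', hν', rfl⟩ := h4 x' h1' hxκ'
      have h5 : ν = ν' := (hr.pred_unique (hf3 ν hν) h2).trans (hr.pred_unique (hf3 ν' hν') h3).symm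
      rw [h5]
    · intro z hz
      obtain ⟨h1, x, hx, rfl, hxκ⟩ := ZFSet.mem_sep.1 hz
      exact hr.mem_lam.1 (hr.lt_mem (key x h1 hxκ)).1
  refine (hlow.union hκ hhigh).subset hcM fun z hz => ?_
  obtain ⟨x, rfl⟩ := hr.wellFormed.carrier_nodes z hz
  rw [ZFSet.mem_union, ZFSet.mem_union]
  rcases hr.nodes x hz with ⟨h2, -⟩ | h2
  · left
    rcases h2.lt_or_eq with h3 | h3
    · left
      refine ZFSet.pair_mem_prod.2 ⟨Ordinal.toZFSet_mem_toZFSet_iff.2 h3, Ordinal.toZFSet_mem_toZFSet_iff.2 ?_⟩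
      have h4 := h1 _ (Ordinal.toZFSet_mem_toZFSet_iff.2 h3)
      rw [ordOf_toZFSet] at h4
      exact (((hr.leftAligned _ h2).2.2 x.2).1 hz).trans h4
    · right
      refine ZFSet.pair_mem_prod.2 ⟨ZFSet.mem_singleton.2 (by rw [h3]), Ordinal.toZFSet_mem_toZFSet_iff.2 ?_⟩
      rw [← h3]
      exact ((hr.leftAligned _ h2).2.2 x.2).1 hz
  · right
    exact ZFSet.mem_sep.2 ⟨hz, x, MorassData.Mem.inM hz hrM, rfl, h2.1⟩

/-- The values of all the maps of `r`, as pairs of nodes. -/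
noncomputable def values (M : Set ZFSet.{u}) (r : MorassData.{u}) : ZFSet.{u} :=
  ZFSet.sep (fun w => ∃ z : (MorassNode.{u} × MorassNode.{u}) × (MorassNode.{u} × MorassNode.{u}), InM M z ∧
    (w = Coded.code z ∧ r.Lt z.1.1 z.1.2 ∧ z.2.1.1 = z.1.1.1 ∧ z.2.1.2 ≤ z.1.1.2 ∧
      z.2.2 = (z.1.2.1, r.π z.1.1 z.1.2 z.2.1.2)))
    (ZFSet.prod (ZFSet.prod r.carrier r.carrier) (ZFSet.prod r.carrier r.carrier))

theorem values_mem_M (hrM : InM M r) : r.values M ∈ M := by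
  have hcM' : InM M r.carrier := ⟨(inM_morass.1 hrM).1⟩
  have hR : Dfn M fun w : ZFSet.{u} => ∃ z : (MorassNode.{u} × MorassNode.{u}) × (MorassNode.{u} × MorassNode.{u}),
    InM M z ∧ (w = Coded.code z ∧ r.Lt z.1.1 z.1.2 ∧ z.2.1.1 = z.1.1.1 ∧ z.2.1.2 ≤ z.1.1.2 ∧
      z.2.2 = (z.1.2.1, r.π z.1.1 z.1.2 z.2.1.2)) := inferInstance
  exact sep_mem_M hR ((inferInstance : Dfn M fun z : ZFSet.{u} =>
    ZFSet.prod (ZFSet.prod z z) (ZFSet.prod z z)).inM r.carrier hcM').1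

theorem IsCondition.mem_values (hrM : InM M r) (hr : r.IsCondition κ K) {x y w z : MorassNode.{u}} :
    Coded.code ((x, y), (w, z)) ∈ r.values M ↔ r.Lt x y ∧ w.1 = x.1 ∧ w.2 ≤ x.2 ∧ z = (y.1, r.π x y w.2) := by
  rw [values, ZFSet.mem_sep]
  constructor
  · rintro ⟨-, v, -, h1, h2⟩
    have h3 := code_injective h1
    subst h3
    exact h2
  · rintro ⟨h1, h2, h3, h4⟩
    have hx := (hr.lt_mem h1).1
    have hy := (hr.lt_mem h1).2
    -- By M.2 arguments and values of the maps are orders of nodes of `r`, so the coded values lie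
    -- in a product of copies of the carrier.
    have h5 : r.Mem w ∧ r.Mem z := by
      obtain ⟨w1, w2⟩ := w
      obtain rfl : w1 = x.1 := h2
      subst h4
      rcases (show w2 ≤ x.2 from h3).lt_or_eq with h6 | rfl
      · exact hr.lt_mem (hr.m2 x y h1 w2 h6).1
      · refine ⟨hx, ?_⟩
        change r.Mem (y.1, r.π x y x.2)
        rw [(hr.m1 x y h1).2]
        exact hy
    refine ⟨ZFSet.pair_mem_prod.2 ⟨ZFSet.pair_mem_prod.2 ⟨hx, hy⟩, ZFSet.pair_mem_prod.2 ⟨h5.1, h5.2⟩⟩,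
      ((x, y), (w, z)), ?_, rfl, h1, h2, h3, h4⟩
    exact inM_prod.2 ⟨inM_prod.2 ⟨hx.inM hrM, hy.inM hrM⟩, inM_prod.2 ⟨h5.1.inM hrM, h5.2.inM hrM⟩⟩

/-- The family of maps with the values `v`. -/
noncomputable def ofValues (t v : ZFSet.{u}) : ZFSet.{u} :=
  img (fun z : MorassNode.{u} × MorassNode.{u} => ZFSet.pair (Coded.code z)
    (img (fun w : MorassNode.{u} × MorassNode.{u} => ZFSet.pair w.1.2.toZFSet w.2.2.toZFSet)
      (ZFSet.sep (fun w => ZFSet.pair (Coded.code z) w ∈ v) (ZFSet.sUnion (ZFSet.sUnion v))))) t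

/-- The family of maps consists of sets of pairs, so it is not directly a subset of a set of size
`κ`. Its flat coding by quadruples of nodes is a small subset of such a set, and this lemma says
that nothing is lost. -/
theorem IsCondition.ofValues_values (hrM : InM M r) (hr : r.IsCondition κ K) :
    ofValues r.tree (r.values M) = r.maps := by
  have hwf := hr.wellFormed
  have hgr : ∀ x y f, ZFSet.pair (ZFSet.pair (nodeCode x) (nodeCode y)) f ∈ r.maps → r.Lt x y →
      ZFSet.IsFunc (x.2 + 1).toZFSet (y.2 + 1).toZFSet f →
      f = img (fun w : MorassNode.{u} × MorassNode.{u} => ZFSet.pair w.1.2.toZFSet w.2.2.toZFSet)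
      (ZFSet.sep (fun w => ZFSet.pair (Coded.code (x, y)) w ∈ r.values M)
        (ZFSet.sUnion (ZFSet.sUnion (r.values M)))) := by
    intro x y f hf hxy hfun
    ext v
    rw [mem_img]
    constructor
    · intro hv
      obtain ⟨a, ha, b, hb, rfl⟩ := ZFSet.mem_prod.1 (hfun.1 hv)
      obtain ⟨ν, hν, rfl⟩ := Ordinal.mem_toZFSet_iff.1 ha
      obtain ⟨μ, hμ, rfl⟩ := Ordinal.mem_toZFSet_iff.1 hb
      have h1 := hwf.π_eq hf hv
      have h2 : ZFSet.pair (Coded.code (x, y)) (Coded.code ((x.1, ν), (y.1, μ))) ∈ r.values M :=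
        (hr.mem_values hrM (x := x) (y := y) (w := (x.1, ν)) (z := (y.1, μ))).2
          ⟨hxy, rfl, Order.lt_add_one_iff.1 hν, by rw [h1]⟩
      refine ⟨((x.1, ν), (y.1, μ)), ZFSet.mem_sep.2 ⟨?_, h2⟩, rfl⟩
      refine ZFSet.mem_sUnion.2 ⟨{Coded.code (x, y), Coded.code ((x.1, ν), (y.1, μ))}, ZFSet.mem_sUnion.2 ⟨_, h2, ?_⟩, ?_⟩
      · simp [ZFSet.pair]
      · simp
    · rintro ⟨⟨w, z⟩, h1, rfl⟩
      obtain ⟨h2, h3, h4, h5⟩ := (hr.mem_values hrM).1 (ZFSet.mem_sep.1 h1).2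
      obtain ⟨b, hb, -⟩ := hfun.2 w.2.toZFSet (Ordinal.toZFSet_mem_toZFSet_iff.2 (Order.lt_add_one_iff.2 h4))
      obtain ⟨μ, hμ, rfl⟩ := Ordinal.mem_toZFSet_iff.1 (ZFSet.pair_mem_prod.1 (hfun.1 hb)).2
      have h6 := hwf.π_eq hf hb
      rw [h5]
      change ZFSet.pair w.2.toZFSet (r.π x y w.2).toZFSet ∈ f
      rw [h6]
      exact hb
  ext v
  rw [ofValues, mem_img]
  constructor
  · rintro ⟨⟨x, y⟩, h1, rfl⟩
    obtain ⟨f, hf, -⟩ := hwf.maps_total x y h1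
    obtain ⟨x', y', f', h2, h3, h4⟩ := hwf.maps_pairs _ hf
    obtain ⟨h5, rfl⟩ := ZFSet.pair_injective h4
    obtain ⟨h6, h7⟩ := ZFSet.pair_injective h5
    obtain rfl : x = x' := code_injective h6
    obtain rfl : y = y' := code_injective h7
    rw [← hgr x y f hf h1 h3]
    exact hf
  · intro hv
    obtain ⟨x, y, f, h1, h2, rfl⟩ := hwf.maps_pairs _ hv
    refine ⟨(x, y), h1, ?_⟩
    rw [← hgr x y f hv h1 h2]
    rfl

end MorassData

open MorassData in
/-- In `M`, the conditions whose level `κ` is bounded by a given small set of ordinals form a set. -/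
theorem exists_bounded_conditions (hκ : IsRegularUncountableIn M κ) (hpow : ∀ α < κ, HasPowersetIn M α.toZFSet)
    {A : ZFSet.{u}} (hA : SmallIn M κ A) (hAK : ∀ z ∈ A, ∃ β ∈ succCardIn M κ, z = β.toZFSet) :
    ∃ W ∈ M, ∀ r : MorassData.{u}, InM M r → r.IsCondition κ K →
      (∀ β ∈ r.top κ, ∃ γ : Ordinal.{u}, γ.toZFSet ∈ A ∧ β < γ) → r.code ∈ W := by
  have hκM : InM M κ := ⟨hκ.1⟩
  have hone : SmallIn M κ {κ.toZFSet} := by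
    refine ⟨singleton_mem_M hκ.1, 1, ?_, fun _ => 0, inferInstance, fun x hx y hy _ => ?_, fun x hx => zero_lt_one⟩
    · exact Ordinal.one_lt_omega0.trans hκ.2.1
    · rw [ZFSet.mem_singleton.1 hx, ZFSet.mem_singleton.1 hy]
  -- All nodes of the conditions in question lie in this product: levels are at most `κ`, and orders
  -- are below `κ` or below an element of `A`. Carriers, tree orders and coded maps are then small
  -- subsets of sets of size `κ`.
  have hB := ((sized_toZFSet hκ).union hκ (hone.sized hκ)).prod hκ ((sized_toZFSet hκ).union hκ (hA.sUnion_sized hκ hAK))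
  set B := ZFSet.prod (κ.toZFSet ∪ {κ.toZFSet}) (κ.toZFSet ∪ ZFSet.sUnion A) with hBdef
  have hBB := hB.prod hκ hB
  obtain ⟨C₁, hC₁, h1⟩ := hB.exists_small_subsets hκ hpow
  obtain ⟨C₂, hC₂, h2⟩ := hBB.exists_small_subsets hκ hpow
  obtain ⟨C₃, hC₃, h3⟩ := (hBB.prod hκ hBB).exists_small_subsets hκ hpow
  have hC₁M : InM M C₁ := ⟨hC₁⟩
  have hC₂M : InM M C₂ := ⟨hC₂⟩
  have hC₃M : InM M C₃ := ⟨hC₃⟩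
  have hR : Dfn M fun z : ZFSet.{u} × ZFSet.{u} × ZFSet.{u} => ZFSet.pair z.1 (ZFSet.pair z.2.1 (ofValues z.2.1 z.2.2)) :=
    (inferInstance : Dfn M fun z : ZFSet.{u} × ZFSet.{u} × ZFSet.{u} => ZFSet.pair z.1 (ZFSet.pair z.2.1
      (img (fun x : MorassNode.{u} × MorassNode.{u} => ZFSet.pair (Coded.code x)
    (img (fun w : MorassNode.{u} × MorassNode.{u} => ZFSet.pair w.1.2.toZFSet w.2.2.toZFSet)
      (ZFSet.sep (fun w => ZFSet.pair (Coded.code x) w ∈ z.2.2) (ZFSet.sUnion (ZFSet.sUnion z.2.2))))) z.2.1)))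
  refine ⟨_, img_mem_M hR ((inferInstance : Dfn M fun z : ZFSet.{u} => ZFSet.prod z (ZFSet.prod C₂ C₃)).inM C₁
    hC₁M).1, fun r hrM hr hrA => mem_img.2 ⟨(r.carrier, r.tree, r.values M), ?_, ?_⟩⟩
  · have hsm := hr.smallIn_carrier hκ hrM
    have hcB : r.carrier ⊆ B := fun z hz => by
      obtain ⟨x, rfl⟩ := hr.wellFormed.carrier_nodes z hz
      refine ZFSet.pair_mem_prod.2 ⟨ZFSet.mem_union.2 ?_, ZFSet.mem_union.2 ?_⟩
      · rcases hr.nodes x hz with h4 | h4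
        · exact .inl (Ordinal.toZFSet_mem_toZFSet_iff.2 (h4.1.trans_lt hr.lam_lt))
        · exact .inr (ZFSet.mem_singleton.2 (by rw [h4.1]))
      · rcases hr.nodes x hz with h4 | h4
        · exact .inl (Ordinal.toZFSet_mem_toZFSet_iff.2 h4.2)
        · obtain ⟨γ, h5, h6⟩ := hrA x.2 (by rw [← h4.1]; exact hz)
          exact .inr (ZFSet.mem_sUnion.2 ⟨_, h5, Ordinal.toZFSet_mem_toZFSet_iff.2 h6⟩)
    have hpm : ∀ {a b c d : ZFSet.{u}}, a ⊆ c → b ⊆ d → ZFSet.prod a b ⊆ ZFSet.prod c d := fun h4 h5 z hz => by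
      obtain ⟨x, hx, y, hy, rfl⟩ := ZFSet.mem_prod.1 hz
      exact ZFSet.pair_mem_prod.2 ⟨h4 hx, h5 hy⟩
    have htc : r.tree ⊆ ZFSet.prod r.carrier r.carrier := fun z hz => by
      obtain ⟨x, y, h4, h5, rfl⟩ := hr.wellFormed.tree_pairs z hz
      exact ZFSet.pair_mem_prod.2 ⟨h4, h5⟩
    have hvc : r.values M ⊆ ZFSet.prod (ZFSet.prod r.carrier r.carrier) (ZFSet.prod r.carrier r.carrier) :=
      fun z hz => (ZFSet.mem_sep.1 hz).1
    refine ZFSet.pair_mem_prod.2 ⟨h1 _ hsm.1 hsm hcB, ZFSet.pair_mem_prod.2 ⟨h2 _ (inM_morass.1 hrM).2.1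
      ((hsm.prod hκ hsm).subset (inM_morass.1 hrM).2.1 htc) fun z hz => hpm hcB hcB (htc hz), h3 _ (values_mem_M hrM)
      (((hsm.prod hκ hsm).prod hκ (hsm.prod hκ hsm)).subset (values_mem_M hrM) hvc) fun z hz =>
        hpm (hpm hcB hcB) (hpm hcB hcB) (hvc hz)⟩⟩
  · rw [hr.ofValues_values hrM]
    rfl

end Bounded

/-! ### Ordinals below `κ` of large limit rank -/

section Rank
variable {M : Set ZFSet.{u}} [hM : Fact (IsTransitiveModelZFCMinus M)]
variable {κ : Ordinal.{u}}
attribute [local instance] dfn_app dfn_app₂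

theorem IsRegularUncountableIn.pos (hκ : IsRegularUncountableIn M κ) : 0 < κ := Ordinal.omega0_pos.trans hκ.2.1

theorem IsRegularUncountableIn.sSup_lt (hκ : IsRegularUncountableIn M κ) {α : Ordinal.{u}} (hα : α < κ)
    {F : Ordinal.{u} → Ordinal.{u}} (hF : Dfn M F) (h : ∀ ν < α, F ν < κ) : sSup {μ | ∃ ν, ν < α ∧ F ν = μ} < κ := by
  have := dfn_ordOf (M := M)
  obtain ⟨γ, hγ, h1⟩ := (smallIn_toZFSet hκ hα).exists_bound hκ (F := fun z => F (ordOf z)) inferInstance (by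
    intro x hx
    obtain ⟨ν, hν, rfl⟩ := Ordinal.mem_toZFSet_iff.1 hx
    rw [ordOf_toZFSet]
    exact h ν hν)
  refine lt_of_le_of_lt (not_lt.1 fun h2 => ?_) hγ
  obtain ⟨ν, hν, h3⟩ := lt_sSup_image.1 h2
  have h4 := h1 _ (Ordinal.toZFSet_mem_toZFSet_iff.2 hν)
  rw [ordOf_toZFSet] at h4
  exact lt_asymm h3 h4

/-- Regularity applied to the constant function `α` on `1`: its strict bound is at least the
successor of `α`. -/
theorem IsRegularUncountableIn.succ_lt (hκ : IsRegularUncountableIn M κ) {α : Ordinal.{u}} (hα : α < κ) : α + 1 < κ := by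
  have hαM : InM M α := inM_of_lt hα ⟨hκ.1⟩
  obtain ⟨γ, hγ, h⟩ := (smallIn_toZFSet hκ (Ordinal.one_lt_omega0.trans hκ.2.1)).exists_bound hκ (F := fun _ => α)
    inferInstance fun _ _ => hα
  have h1 : (0 : Ordinal.{u}).toZFSet ∈ (1 : Ordinal.{u}).toZFSet := Ordinal.toZFSet_mem_toZFSet_iff.2 zero_lt_one
  exact (Order.add_one_le_iff.2 (h _ h1)).trans_lt hγ

instance dfn_max {X : Type*} [Coded.{u} X] [CodedIn M X] {F G : X → Ordinal.{u}} [hF : Dfn M F] [hG : Dfn M G] :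
    Dfn M fun x => max (F x) (G x) :=
  (dfn_ite (c := fun x => F x ≤ G x) (hc := dfn_le (F := F) (G := G)) (hF := hG) (hG := hF)).congr fun x _ => by
    split_ifs with h
    exacts [max_eq_right h, max_eq_left (le_of_not_ge h)]

theorem exists_recursion (M : Set ZFSet.{u}) [hM : Fact (IsTransitiveModelZFCMinus M)] (D : Ordinal.{u} → Ordinal.{u}) [hD : Dfn M D] (c : Ordinal.{u}) [hc : InM M c] :
    ∃ d : Ordinal.{u} → Ordinal.{u}, Dfn M d ∧ ∀ ξ, d ξ = sSup {μ | ∃ ν, ν < ξ ∧ D (max c (d ν)) = μ} := by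
  let F : (ξ : Ordinal.{u}) → ((ν : Ordinal.{u}) → ν < ξ → Ordinal.{u}) → Ordinal.{u} :=
    fun ξ ih => sSup (range fun ν : Iio ξ => D (max c (ih ν.1 ν.2)))
  let d : Ordinal.{u} → Ordinal.{u} := WellFoundedLT.fix F
  have hd : ∀ ξ, d ξ = sSup {μ | ∃ ν, ν < ξ ∧ D (max c (d ν)) = μ} := fun ξ => by
    refine (WellFoundedLT.fix_eq F ξ).trans (congrArg sSup ?_)
    ext μ
    constructor
    · rintro ⟨ν, rfl⟩
      exact ⟨ν.1, ν.2, rfl⟩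
    · rintro ⟨ν, hν, rfl⟩
      exact ⟨⟨ν, hν⟩, rfl⟩
  have h1 : Dfn M fun z : (Ordinal.{u} × ZFSet.{u}) × Ordinal.{u} => D (max c (lookup z.1.2 z.2)) :=
    hD.comp (dfn_max (F := fun _ => c) (G := fun z : (Ordinal.{u} × ZFSet.{u}) × Ordinal.{u} => lookup z.1.2 z.2))
  have h2 : Dfn M fun z : Ordinal.{u} × ZFSet.{u} => sSup {μ | ∃ ν, ν < z.1 ∧ D (max c (lookup z.2 ν)) = μ} :=
    dfn_sSupImage (A := fun z => z.1) (F := fun (z : Ordinal.{u} × ZFSet.{u}) ν => D (max c (lookup z.2 ν)))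
  refine ⟨d, dfn_rec_ord (hF := h2) (fun ξ h => sSup {μ | ∃ ν, ν < ξ ∧ D (max c (lookup h ν)) = μ}) _ fun ξ => ?_, hd⟩
  exact (hd ξ).trans (sSupImage_congr fun ν hν => by rw [lookup_img d hν])

/-- There are arbitrarily large ordinals below `κ` of any rank below `κ`. -/
theorem exists_limRank_ge (hκ : IsRegularUncountableIn M κ) (e : Ordinal.{u}) (he : e < κ) :
    ∀ c < κ, ∃ Λ < κ, c < Λ ∧ e ≤ limRank Λ := by
  have hκM : InM M κ := ⟨hκ.1⟩
  have hr := dfn_limRank (M := M)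
  induction e using WellFoundedLT.induction with
  | ind e ih =>
    intro c hc
    have heM : InM M e := inM_of_lt he hκM
    have hcM : InM M c := inM_of_lt hc hκM
    let Γ : Ordinal.{u} → Ordinal.{u} → Ordinal.{u} := fun α ε => sInf {γ | γ < κ ∧ α < γ ∧ ε ≤ limRank γ}
    have hΓ : Dfn M fun z : Ordinal.{u} × Ordinal.{u} => Γ z.1 z.2 :=
      dfn_sInf (R := fun (z : Ordinal.{u} × Ordinal.{u}) γ => γ < κ ∧ z.1 < γ ∧ z.2 ≤ limRank γ)
        fun z γ _ h => inM_of_lt h.1 hκM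
    have hΓm : ∀ α < κ, ∀ ε < e, Γ α ε < κ ∧ α < Γ α ε ∧ ε ≤ limRank (Γ α ε) := fun α hα ε hε => by
      obtain ⟨Λ, h1, h2, h3⟩ := ih ε hε (hε.trans he) α hα
      exact csInf_mem (s := {γ | γ < κ ∧ α < γ ∧ ε ≤ limRank γ}) ⟨Λ, h1, h2, h3⟩
    let D : Ordinal.{u} → Ordinal.{u} := fun α => sSup {μ | ∃ ε, ε < e ∧ Γ α ε = μ}
    have hD : Dfn M D := dfn_sSupImage (A := fun _ => e) (F := Γ)
    have hDκ : ∀ α < κ, D α < κ := fun α hα => by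
      have hαM : InM M α := inM_of_lt hα hκM
      exact hκ.sSup_lt he (dfn_of_const_left hΓ α) fun ε hε => (hΓm α hα ε hε).1
    have hΓD : ∀ α, ∀ ε < e, Γ α ε ≤ D α := fun α ε hε => le_csSup (bddAbove_image_lt _ _) ⟨ε, hε, rfl⟩
    -- The function `D` jumps past ordinals of all ranks below `e`. Iterating it `ω` times from `c`
    -- on, such ordinals occur cofinally below `d ω`, and `d ω < κ` as `κ` is regular and
    -- uncountable.
    obtain ⟨d, hdM, hd⟩ := exists_recursion M D c (hD := hD)
    have hdκ : ∀ ξ < κ, d ξ < κ := fun ξ => by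
      induction ξ using WellFoundedLT.induction with
      | ind ξ ih' =>
        intro hξ
        rw [hd]
        exact hκ.sSup_lt hξ (hD.comp (dfn_max (F := fun _ => c) (G := d))) fun ν hν => hDκ _ (max_lt hc (ih' ν hν (hν.trans hξ)))
    have hdD : ∀ ν ξ, ν < ξ → D (max c (d ν)) ≤ d ξ := fun ν ξ h => by
      rw [hd ξ]
      exact le_csSup (bddAbove_image_lt (fun ν => D (max c (d ν))) _) ⟨ν, h, rfl⟩
    rcases (zero_le (a := e)).eq_or_lt with rfl | he0
    · exact ⟨c + 1, hκ.succ_lt hc, lt_add_one c, zero_le⟩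
    have hmaxκ : ∀ n < Ordinal.omega0, max c (d n) < κ := fun n hn => max_lt hc (hdκ n (hn.trans hκ.2.1))
    have hs : ∀ n < Ordinal.omega0, n + 1 < Ordinal.omega0 := fun n hn =>
      Ordinal.isSuccLimit_omega0.add_one_lt hn
    have hcω : ∀ n < Ordinal.omega0, max c (d n) < d Ordinal.omega0 := fun n hn => by
      have h1 := hΓm _ (hmaxκ n hn) 0 he0
      exact h1.2.1.trans_le ((hΓD _ _ he0).trans (hdD n _ hn))
    refine ⟨d Ordinal.omega0, hdκ _ hκ.2.1, (le_max_left _ _).trans_lt (hcω 0 Ordinal.omega0_pos), ?_⟩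
    -- If the rank of `d ω` were below `e`, ordinals of at least this rank would be unbounded in `d
    -- ω`, and the rank would exceed itself.
    by_contra hlt
    rw [not_le] at hlt
    refine lt_irrefl _ (lt_limRank.2 ⟨(zero_le).trans_lt (hcω 0 Ordinal.omega0_pos), fun δ hδ => ?_⟩)
    rw [hd] at hδ
    obtain ⟨n, hn, h1⟩ := lt_sSup_image.1 hδ
    have h2 := hs n hn
    obtain ⟨h3, h4, h5⟩ := hΓm _ (hmaxκ _ h2) _ hlt
    refine ⟨_, ?_, ?_, h5⟩
    · calc _ ≤ D (max c (d (n + 1))) := hΓD _ _ hlt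
        _ ≤ d (n + 1 + 1) := hdD _ _ (lt_add_one _)
        _ ≤ max c (d (n + 1 + 1)) := le_max_right _ _
        _ < d Ordinal.omega0 := hcω _ (hs _ h2)
    · calc δ < D (max c (d n)) := h1
        _ ≤ d (n + 1) := hdD _ _ (lt_add_one _)
        _ ≤ max c (d (n + 1)) := le_max_right _ _
        _ < _ := h4

end Rank

section
variable {S : Set Ordinal.{u}}

theorem ordCollapse_zero : ordCollapse S 0 = 0 := by
  by_contra h
  obtain ⟨ν, h1, -⟩ := lt_ordCollapse.1 (bot_lt_iff_ne_bot.2 h)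
  exact not_lt_bot h1

theorem ordCollapse_mono {ν ξ : Ordinal.{u}} (h : ν ≤ ξ) : ordCollapse S ν ≤ ordCollapse S ξ := by
  by_contra h1
  obtain ⟨η, h2, h3, h4⟩ := lt_ordCollapse.1 (not_le.1 h1)
  exact lt_irrefl _ (h4.trans_lt (lt_ordCollapse.2 ⟨η, h2.trans_le h, h3, le_rfl⟩))

theorem ordCollapse_succ {β : Ordinal.{u}} (h : β ∈ S) : ordCollapse S (β + 1) = ordCollapse S β + 1 := by
  refine le_antisymm (not_lt.1 fun h1 => ?_) (Order.add_one_le_iff.2 (lt_ordCollapse.2 ⟨β, lt_add_one β, h, le_rfl⟩))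
  obtain ⟨ν, h2, h3, h4⟩ := lt_ordCollapse.1 h1
  exact not_lt.2 (h4.trans (ordCollapse_mono (Order.lt_add_one_iff.1 h2))) (lt_add_one _)

theorem isSuccLimit_iff' {α : Ordinal.{u}} : Order.IsSuccLimit α ↔ α ≠ 0 ∧ ∀ ν, ν < α → ν + 1 < α := by
  rw [Ordinal.isSuccLimit_iff, Order.isSuccPrelimit_iff_succ_lt]
  rfl

theorem lt_sSup_image_Iio {F : Ordinal.{u} → Ordinal.{u}} {a β : Ordinal.{u}} :
    β < sSup (F '' Iio a) ↔ ∃ ν, ν < a ∧ β < F ν := lt_sSup_image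

end

/-! ### The upper part used to lengthen a condition -/

/-- The data for extending a condition with last level `l` to a condition with last level `L` and level `κ` equal
to `S`, where `g` is the collapse of the level `κ` of the former, indexed by the `ν` with `N ν`. -/
structure ExtensionData (κ : Ordinal.{u}) (K : Set Ordinal.{u}) where
  (l L θ : Ordinal.{u})
  S : Set Ordinal.{u}
  N : Ordinal.{u} → Prop
  (u g : Ordinal.{u} → Ordinal.{u})
  l_lt : l < L
  L_lt : L < κ
  θ_pos : 0 < θ
  θ_lt : θ < κ
  succ_lt : ∀ α < κ, α + 1 < κ
  S_sub : ∀ β ∈ S, β ∈ K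
  zero_mem : 0 ∈ S
  succ_mem : ∀ β, β ∈ S ↔ β + 1 ∈ S
  u_collapse : ∀ ξ ∈ S, u (ordCollapse S ξ) = ξ
  collapse_le : ∀ ξ ∈ S, ordCollapse S ξ ≤ limRank L
  N_down : ∀ ν, N ν → ∀ μ < ν, N μ
  g_zero : g 0 = 0
  g_succ : ∀ ν, N (ν + 1) → g (ν + 1) = g ν + 1
  g_limit : ∀ ν, N ν → Order.IsSuccLimit ν → Order.IsSuccLimit (g ν)
  g_mono : ∀ ν, N ν → ∀ μ < ν, g μ < g ν

namespace ExtensionData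
variable {κ : Ordinal.{u}} {K : Set Ordinal.{u}} (d : ExtensionData κ K)

/-- The node `⟨l, ν⟩` is attached to the branch of position `o`. -/
def Att (ν o : Ordinal.{u}) : Prop :=
  d.N ν ∧ (o = d.g ν ∨ (Order.IsSuccLimit ν ∧ o = sSup {μ | ∃ ξ, ξ < ν ∧ d.g ξ = μ}))

open Classical in
/-- The position of a node among the nodes of its level. -/
noncomputable def pos (y : MorassNode.{u}) : Ordinal.{u} := if y.1 = κ then ordCollapse d.S y.2 else y.2

open Classical in
/-- The enumeration of the nodes of level `α`. -/
noncomputable def emb (α ξ : Ordinal.{u}) : Ordinal.{u} := if α = κ then d.u ξ else ξ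

open Classical in
/-- The position of the value at `ξ` of the map from `x` to a node of position `o`. -/
noncomputable def base (x : MorassNode.{u}) (o ξ : Ordinal.{u}) : Ordinal.{u} :=
  if d.l < x.1 then ξ else if ξ = x.2 then o else d.g ξ

/-- Membership in the upper part of the extension. -/
def UMem (x : MorassNode.{u}) : Prop :=
  (x.1 = d.l ∧ x.2 < d.θ) ∨ (d.l < x.1 ∧ x.1 ≤ d.L ∧ x.2 ≤ limRank x.1) ∨ (x.1 = κ ∧ x.2 ∈ d.S)

/-- The upper part of the extension. -/
noncomputable def upper : PreMorass.{u} where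
  Mem := d.UMem
  Lt x y := d.UMem x ∧ d.UMem y ∧ x.1 < y.1 ∧ ((d.l < x.1 ∧ x.2 = d.pos y) ∨ (x.1 = d.l ∧ d.Att x.2 (d.pos y)))
  π x y ξ := d.emb y.1 (d.base x (d.pos y) ξ)

variable {d} {x y : MorassNode.{u}} {ν ν' o ξ η : Ordinal.{u}}

theorem l_lt_card : d.l < κ := d.l_lt.trans d.L_lt

theorem Att.lt (h : d.Att ν o) (hξ : ξ < ν) : d.g ξ < o := by
  rcases h.2 with rfl | ⟨h1, rfl⟩
  · exact d.g_mono ν h.1 ξ hξ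
  · have h2 := (isSuccLimit_iff'.1 h1).2 ξ hξ
    exact lt_sSup_image.2 ⟨ξ + 1, h2, d.g_mono _ (d.N_down ν h.1 _ h2) _ (lt_add_one ξ)⟩

theorem Att.le (h : d.Att ν o) : o ≤ d.g ν := by
  rcases h.2 with rfl | ⟨h1, rfl⟩
  · exact le_rfl
  · refine not_lt.1 fun h2 => ?_
    obtain ⟨ξ, h3, h4⟩ := lt_sSup_image.1 h2
    exact lt_asymm h4 (d.g_mono ν h.1 ξ h3)

/-- A position attached to `ν` is at most `g ν` and exceeds `g ξ` for all `ξ < ν`, so `ν` is the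
least index whose `g`-value reaches it. -/
theorem Att.unique (h : d.Att ν o) (h' : d.Att ν' o) : ν = ν' := by
  rcases lt_trichotomy ν ν' with h1 | h1 | h1
  · exact absurd (h'.lt h1) (not_lt.2 h.le)
  · exact h1
  · exact absurd (h.lt h1) (not_lt.2 h'.le)

theorem isSloop_base (h : (d.l < x.1 ∧ x.2 = o) ∨ (x.1 = d.l ∧ d.Att x.2 o)) :
    MorassData.IsSloop (d.base x o) x.2 ∧ d.base x o x.2 = o := by
  rcases h with ⟨h1, h2⟩ | ⟨h1, h2⟩
  · have h3 : ∀ ξ, d.base x o ξ = ξ := fun ξ => if_pos h1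
    refine ⟨⟨fun γ _ => by rw [h3, h3], fun γ _ h => by rwa [h3], h3 0, fun δ _ γ h => by rwa [h3, h3]⟩, ?_⟩
    rw [h3, h2]
  · have h3 : d.base x o x.2 = o := (if_neg (by rw [h1]; exact lt_irrefl _)).trans (if_pos rfl)
    have h4 : ∀ ξ < x.2, d.base x o ξ = d.g ξ := fun ξ hξ =>
      (if_neg (by rw [h1]; exact lt_irrefl _)).trans (if_neg hξ.ne)
    refine ⟨⟨fun γ hγ => ?_, fun γ hγ hl => ?_, ?_, fun δ hδ γ hγ => ?_⟩, h3⟩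
    · rw [h4 γ hγ]
      rcases (Order.add_one_le_iff.2 hγ).lt_or_eq with h5 | h5
      · rw [h4 _ h5, d.g_succ _ (d.N_down _ h2.1 _ h5)]
      · rw [h5, h3]
        rcases h2.2 with h6 | ⟨h6, -⟩
        · rw [h6, ← h5]
          exact d.g_succ _ (h5 ▸ h2.1)
        · exact absurd ((isSuccLimit_iff'.1 h6).2 γ hγ) (by rw [h5]; exact lt_irrefl _)
    · rcases hγ.lt_or_eq with h5 | rfl
      · rw [h4 _ h5]
        exact d.g_limit _ (d.N_down _ h2.1 _ h5) hl
      · rw [h3]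
        have h5 := h2
        rcases h2.2 with h6 | ⟨h6, h7⟩
        · rw [h6]; exact d.g_limit _ h2.1 hl
        · refine isSuccLimit_iff'.2 ⟨?_, fun β hβ => ?_⟩
          · exact (bot_lt_of_lt (h5.lt (bot_lt_iff_ne_bot.2 (isSuccLimit_iff'.1 h6).1))).ne'
          · rw [h7] at hβ
            obtain ⟨ξ, h8, h9⟩ := lt_sSup_image.1 hβ
            exact (Order.add_one_le_iff.2 h9).trans_lt (h5.lt h8)
    · rcases (zero_le (a := x.2)).lt_or_eq with h5 | h5
      · rw [h4 _ h5, d.g_zero]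
      · rw [h5, h3]
        rcases h2.2 with h6 | ⟨h6, -⟩
        · rw [h6, ← h5, d.g_zero]
        · exact absurd h5.symm (isSuccLimit_iff'.1 h6).1
    · rw [h4 γ (hγ.trans_le hδ)]
      rcases hδ.lt_or_eq with h5 | rfl
      · rw [h4 δ h5]
        exact d.g_mono _ (d.N_down _ h2.1 _ h5) _ hγ
      · rw [h3]; exact h2.lt hγ

theorem collapse_mem_of_le (hξ : ξ ∈ d.S) (h : η ≤ ordCollapse d.S ξ) : ∃ ζ ∈ d.S, ordCollapse d.S ζ = η := by
  rcases h.lt_or_eq with h | rfl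
  · obtain ⟨ζ, -, h1, h2⟩ := exists_ordCollapse_eq h
    exact ⟨ζ, h1, h2⟩
  · exact ⟨ξ, hξ, rfl⟩

/-- Limits go to limits because `S` is closed under predecessors: a successor in `S` collapses to a
successor. -/
theorem isSloop_u (hξ : ξ ∈ d.S) : MorassData.IsSloop d.u (ordCollapse d.S ξ) where
  succ γ hγ := by
    obtain ⟨ζ, h1, rfl⟩ := collapse_mem_of_le hξ hγ.le
    rw [← ordCollapse_succ h1, d.u_collapse _ h1, d.u_collapse _ ((d.succ_mem ζ).1 h1)]
  limit γ hγ hl := by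
    obtain ⟨ζ, h1, rfl⟩ := collapse_mem_of_le hξ hγ
    rw [d.u_collapse _ h1]
    obtain ⟨h2, h3⟩ := isSuccLimit_iff'.1 hl
    refine isSuccLimit_iff'.2 ⟨?_, fun ν hν => ?_⟩
    · rintro rfl
      exact h2 ordCollapse_zero
    · refine lt_of_le_of_ne (Order.add_one_le_iff.2 hν) ?_
      rintro rfl
      have h4 := (d.succ_mem ν).2 h1
      rw [ordCollapse_succ h4] at h3
      exact lt_irrefl _ (h3 _ (lt_add_one _))
  zero := by
    have := d.u_collapse 0 d.zero_mem
    rwa [ordCollapse_zero] at this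
  strictMono δ hδ γ hγ := by
    obtain ⟨ζ, h1, rfl⟩ := collapse_mem_of_le hξ hδ
    obtain ⟨ζ', h1', rfl⟩ := collapse_mem_of_le hξ (hγ.le.trans hδ)
    rw [d.u_collapse _ h1, d.u_collapse _ h1']
    exact not_le.1 fun h => not_lt.2 (ordCollapse_mono h) hγ

theorem pos_top (β : Ordinal.{u}) : d.pos (κ, β) = ordCollapse d.S β := if_pos rfl

theorem pos_of_lt (hy : y.1 < κ) : d.pos y = y.2 := if_neg hy.ne

theorem emb_top (ξ : Ordinal.{u}) : d.emb κ ξ = d.u ξ := if_pos rfl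

theorem emb_of_lt {α : Ordinal.{u}} (h : α < κ) : d.emb α ξ = ξ := if_neg h.ne

theorem UMem.cases (hy : d.UMem y) (hl : d.l < y.1) :
    (y.1 < κ ∧ y.1 ≤ d.L ∧ y.2 ≤ limRank y.1) ∨ (y.1 = κ ∧ y.2 ∈ d.S) := by
  rcases hy with h | h | h
  · exact absurd hl (by rw [h.1]; exact lt_irrefl _)
  · exact .inl ⟨h.2.1.trans_lt d.L_lt, h.2⟩
  · exact .inr h

theorem UMem.le_card (hy : d.UMem y) : y.1 ≤ κ := by
  rcases hy with h | h | h
  exacts [h.1 ▸ l_lt_card.le, h.2.1.trans d.L_lt.le, h.1.le]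

theorem UMem.le_level (hy : d.UMem y) : d.l ≤ y.1 := by
  rcases hy with h | h | h
  exacts [h.1.ge, h.1.le, (l_lt_card (d := d)).le.trans h.1.ge]

theorem emb_pos (hy : d.UMem y) (hl : d.l < y.1) : d.emb y.1 (d.pos y) = y.2 := by
  rcases hy.cases hl with h | ⟨h1, h2⟩
  · rw [emb_of_lt h.1, pos_of_lt h.1]
  · obtain ⟨y1, y2⟩ := y
    obtain rfl : y1 = κ := h1
    rw [pos_top, emb_top, d.u_collapse _ h2]

theorem node_emb (hy : d.UMem y) (hl : d.l < y.1) (hη : η ≤ d.pos y) :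
    d.UMem (y.1, d.emb y.1 η) ∧ d.pos (y.1, d.emb y.1 η) = η := by
  rcases hy.cases hl with h | ⟨h1, h2⟩
  · rw [pos_of_lt h.1] at hη
    rw [emb_of_lt h.1]
    exact ⟨.inr (.inl ⟨hl, h.2.1, hη.trans h.2.2⟩), pos_of_lt (y := (y.1, η)) h.1⟩
  · obtain ⟨y1, y2⟩ := y
    obtain rfl : y1 = κ := h1
    rw [pos_top] at hη
    obtain ⟨ζ, h3, rfl⟩ := collapse_mem_of_le h2 hη
    rw [emb_top, d.u_collapse _ h3, pos_top]
    exact ⟨.inr (.inr ⟨rfl, h3⟩), rfl⟩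

theorem isSloop_emb (hy : d.UMem y) (hl : d.l < y.1) : MorassData.IsSloop (d.emb y.1) (d.pos y) := by
  rcases hy.cases hl with h | ⟨h1, h2⟩
  · have h3 : ∀ ξ, d.emb y.1 ξ = ξ := fun ξ => emb_of_lt h.1
    exact ⟨fun γ _ => by rw [h3, h3], fun γ _ h => by rwa [h3], h3 0, fun δ _ γ h => by rwa [h3, h3]⟩
  · obtain ⟨y1, y2⟩ := y
    obtain rfl : y1 = κ := h1
    rw [pos_top]
    exact (isSloop_u h2).congr fun ξ _ => emb_top ξ

theorem lt_of_upper (h : d.upper.Lt x y) : d.l < y.1 ∧ x.1 < κ :=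
  ⟨(UMem.le_level h.1).trans_lt h.2.2.1, h.2.2.1.trans_le (UMem.le_card h.2.1)⟩

theorem att_g (h : d.N ν) : d.Att ν (d.g ν) := ⟨h, .inl rfl⟩

theorem base_high (h : d.l < x.1) : d.base x o ξ = ξ := if_pos h

theorem base_low (h : x.1 = d.l) (hξ : ξ < x.2) : d.base x o ξ = d.g ξ :=
  (if_neg (by rw [h]; exact lt_irrefl _)).trans (if_neg hξ.ne)

theorem sSup_Iio_limit (h : Order.IsSuccLimit ν) {F : Ordinal.{u} → Ordinal.{u}} (hF : ∀ ξ, F ξ = ξ) :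
    sSup (F '' Iio ν) = ν := by
  refine le_antisymm (not_lt.1 fun h1 => ?_) (not_lt.1 fun h1 => ?_)
  · obtain ⟨ξ, h2, h3⟩ := lt_sSup_image_Iio.1 h1
    rw [hF] at h3
    exact lt_asymm h2 h3
  · have h2 := (isSuccLimit_iff'.1 h).2 _ h1
    have h3 : sSup (F '' Iio ν) < sSup (F '' Iio ν) := lt_sSup_image_Iio.2 ⟨_, h2, by rw [hF]; exact lt_add_one _⟩
    exact lt_irrefl _ h3

/-- Above level `l` the nodes of one position `o` form a branch with identity maps, present exactly
at the levels of rank at least `o`. A limit of such levels has rank greater than `o`, whence M.3; a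
node of level `α` with a right neighbour has position below `limRank α`, whence M.4. Nodes of level
`l` are attached to branches by `g`, and for a limit `ν` also to the supremum of `g` below `ν`: this
is the node that M.6 asks for. In M.7 the positions used on level `α` are at most `limRank α`, and
so is their supremum. -/
theorem isUpper : d.upper.IsUpper κ K d.l d.L := by
  have hm1 : ∀ x y, d.upper.Lt x y → MorassData.IsSloop (d.upper.π x y) x.2 ∧ d.upper.π x y x.2 = y.2 := by
    intro x y hxy
    obtain ⟨h1, h2⟩ := isSloop_base hxy.2.2.2
    have h3 := isSloop_emb hxy.2.1 (lt_of_upper hxy).1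
    refine ⟨h1.comp h2 h3, ?_⟩
    change d.emb y.1 (d.base x (d.pos y) x.2) = y.2
    rw [h2, emb_pos hxy.2.1 (lt_of_upper hxy).1]
  refine
    { lt_mem := fun x y h => ⟨h.1, h.2.1⟩
      le_level := fun x h => UMem.le_level h
      le := d.l_lt.le
      lt_card := d.L_lt
      nodes := ?_
      trans := ?_
      linear := ?_
      leftAligned := ?_
      top_zero := .inr (.inr ⟨rfl, d.zero_mem⟩)
      top_succ := ?_
      top_enum := ?_
      monotone := fun x y h => h.2.2.1
      commutative := ?_
      m1 := hm1
      m2 := ?_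
      m3 := ?_
      m4 := ?_
      m5 := ?_
      m6 := ?_
      m7 := ?_ }
  · rintro x (h | h | h)
    · exact .inl ⟨h.1 ▸ d.l_lt.le, h.2.trans d.θ_lt⟩
    · exact .inl ⟨h.2.1, (h.2.2.trans (limRank_le _)).trans_lt (h.2.1.trans_lt d.L_lt)⟩
    · exact .inr ⟨h.1, d.S_sub _ h.2⟩
  · intro x y z hxy hyz
    refine ⟨hxy.1, hyz.2.1, hxy.2.2.1.trans hyz.2.2.1, ?_⟩
    have h1 : y.2 = d.pos z := by
      rcases hyz.2.2.2 with h | h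
      · exact h.2
      · exact absurd (lt_of_upper hxy).1 (by rw [h.1]; exact lt_irrefl _)
    rw [← h1, ← pos_of_lt (d := d) (lt_of_upper hyz).2]
    exact hxy.2.2.2
  · intro x y z hxy hzy
    rcases hxy.2.2.2 with h1 | h1 <;> rcases hzy.2.2.2 with h2 | h2
    · rcases lt_trichotomy x.1 z.1 with h3 | h3 | h3
      · refine .inr (.inl ⟨hxy.1, hzy.1, h3, .inl ⟨h1.1, ?_⟩⟩)
        rw [pos_of_lt (lt_of_upper hzy).2, h1.2, h2.2]
      · exact .inl (Prod.ext h3 (h1.2.trans h2.2.symm))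
      · refine .inr (.inr ⟨hzy.1, hxy.1, h3, .inl ⟨h2.1, ?_⟩⟩)
        rw [pos_of_lt (lt_of_upper hxy).2, h1.2, h2.2]
    · refine .inr (.inr ⟨hzy.1, hxy.1, h2.1 ▸ h1.1, .inr ⟨h2.1, ?_⟩⟩)
      rw [pos_of_lt (lt_of_upper hxy).2, h1.2]
      exact h2.2
    · refine .inr (.inl ⟨hxy.1, hzy.1, h1.1 ▸ h2.1, .inr ⟨h1.1, ?_⟩⟩)
      rw [pos_of_lt (lt_of_upper hzy).2, h2.2]
      exact h1.2
    · exact .inl (Prod.ext (h1.1.trans h2.1.symm) (h1.2.unique h2.2))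
  · intro α h1 h2
    rcases h1.eq_or_lt with rfl | h1
    · refine ⟨d.θ, d.θ_pos, d.θ_lt, fun β => ⟨?_, fun h => .inl ⟨rfl, h⟩⟩⟩
      rintro (h | h | h)
      · exact h.2
      · exact absurd h.1 (lt_irrefl _)
      · exact absurd (l_lt_card (d := d)) (by rw [show d.l = κ from h.1]; exact lt_irrefl _)
    · refine ⟨limRank α + 1, bot_lt_of_lt (lt_add_one _), d.succ_lt _ ((limRank_le α).trans_lt (h2.trans_lt d.L_lt)),
        fun β => ⟨fun h => ?_, fun h => .inr (.inl ⟨h1, h2, Order.lt_add_one_iff.1 h⟩)⟩⟩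
      rcases UMem.cases h h1 with h3 | h3
      · exact Order.lt_add_one_iff.2 h3.2.2
      · exact absurd h3.1 (h2.trans_lt d.L_lt).ne
  · intro β
    have h : ∀ β, d.upper.Mem (κ, β) ↔ β ∈ d.S := fun β => by
      refine ⟨fun h => ?_, fun h => .inr (.inr ⟨rfl, h⟩)⟩
      rcases UMem.cases h l_lt_card with h1 | h1
      · exact absurd h1.1 (lt_irrefl _)
      · exact h1.2
    rw [h, h]
    exact d.succ_mem β
  · have h : ∀ β, d.upper.Mem (κ, β) ↔ β ∈ d.S := fun β => by
      refine ⟨fun h => ?_, fun h => .inr (.inr ⟨rfl, h⟩)⟩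
      rcases UMem.cases h l_lt_card with h1 | h1
      · exact absurd h1.1 (lt_irrefl _)
      · exact h1.2
    -- `τ` is the order type of `S`. The values of the collapse are an initial segment, and `limRank
    -- L + 1` is not among them.
    obtain ⟨τ, hτ⟩ : ∃ τ, ∀ ν, ν < τ ↔ ∃ ξ ∈ d.S, ordCollapse d.S ξ = ν := by
      refine ⟨sInf {ν | ¬ ∃ ξ ∈ d.S, ordCollapse d.S ξ = ν}, fun ν => ⟨fun h1 => ?_, fun h1 => ?_⟩⟩
      · by_contra h2
        exact notMem_of_lt_csInf h1 (OrderBot.bddBelow _) h2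
      · obtain ⟨ξ, hξ, rfl⟩ := h1
        refine not_le.1 fun h2 => ?_
        have h3 := csInf_mem (s := {ν | ¬ ∃ ξ ∈ d.S, ordCollapse d.S ξ = ν}) ⟨limRank d.L + 1, by
          rintro ⟨ζ, h4, h5⟩
          have h6 := d.collapse_le ζ h4
          rw [h5] at h6
          exact absurd h6 (not_le.2 (lt_add_one _))⟩
        exact h3 (collapse_mem_of_le hξ h2)
    refine ⟨τ, d.u, ?_, ?_, ?_⟩
    · intro ν hν ν' hν' hlt
      obtain ⟨ξ, hξ, rfl⟩ := (hτ ν').1 hν'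
      exact (isSloop_u hξ).strictMono _ le_rfl _ hlt
    · ext β
      refine Iff.trans ⟨?_, fun hβ => ⟨ordCollapse d.S β, (hτ _).2 ⟨β, hβ, rfl⟩, d.u_collapse β hβ⟩⟩ (h β).symm
      rintro ⟨ν, hν, rfl⟩
      obtain ⟨ξ, hξ, rfl⟩ := (hτ ν).1 hν
      rw [d.u_collapse ξ hξ]
      exact hξ
    · intro ν hν
      obtain ⟨ξ, hξ, rfl⟩ := (hτ ν).1 hν
      rw [d.u_collapse ξ hξ]
      exact ⟨.inr (.inl ⟨d.l_lt, le_rfl, d.collapse_le ξ hξ⟩), .inr (.inr ⟨rfl, hξ⟩), d.L_lt,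
        .inl ⟨d.l_lt, (pos_top ξ).symm⟩⟩
  · intro x y z hxy hyz ν hν
    have h1 : y.2 = d.pos z := by
      rcases hyz.2.2.2 with h | h
      · exact h.2
      · exact absurd (lt_of_upper hxy).1 (by rw [h.1]; exact lt_irrefl _)
    change d.emb z.1 (d.base y (d.pos z) (d.emb y.1 (d.base x (d.pos y) ν))) = d.emb z.1 (d.base x (d.pos z) ν)
    rw [emb_of_lt (lt_of_upper hyz).2, pos_of_lt (lt_of_upper hyz).2, base_high (lt_of_upper hxy).1, h1]
  · intro x y hxy ν hν
    have hy := (lt_of_upper hxy).1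
    obtain ⟨h1, h2⟩ := isSloop_base hxy.2.2.2
    have h3 : d.base x (d.pos y) ν < d.pos y := by
      have := h1.strictMono _ le_rfl _ hν
      rwa [h2] at this
    obtain ⟨h4, h5⟩ := node_emb hxy.2.1 hy h3.le
    have h6 : d.UMem (x.1, ν) := by
      rcases hxy.1 with h | h | h
      · exact .inl ⟨h.1, hν.trans h.2⟩
      · exact .inr (.inl ⟨h.1, h.2.1, hν.le.trans h.2.2⟩)
      · exact absurd h.1 (lt_of_upper hxy).2.ne
    refine ⟨⟨h6, h4, hxy.2.2.1, ?_⟩, fun ξ hξ => ?_⟩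
    · change (d.l < x.1 ∧ ν = d.pos (y.1, d.emb y.1 (d.base x (d.pos y) ν))) ∨ (x.1 = d.l ∧
        d.Att ν (d.pos (y.1, d.emb y.1 (d.base x (d.pos y) ν))))
      rw [h5]
      rcases hxy.2.2.2 with h | h
      · exact .inl ⟨h.1, (base_high h.1).symm⟩
      · rw [base_low h.1 hν]
        exact .inr ⟨h.1, att_g (d.N_down _ h.2.1 _ hν)⟩
    · change d.emb y.1 (d.base (x.1, ν) (d.pos (y.1, d.emb y.1 (d.base x (d.pos y) ν))) ξ) =
        d.emb y.1 (d.base x (d.pos y) ξ)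
      rw [h5]
      rcases hxy.2.2.2 with h | h
      · rw [base_high (x := (x.1, ν)) h.1, base_high h.1]
      · rw [base_low h.1 (hξ.trans_lt hν), base_low h.1 hν]
        rcases hξ.lt_or_eq with h7 | rfl
        · rw [base_low (x := (x.1, ν)) h.1 h7]
        · rw [show d.base (x.1, ξ) (d.g ξ) ξ = d.g ξ from
            (isSloop_base (x := (x.1, ξ)) (.inr ⟨h.1, att_g (d.N_down _ h.2.1 _ hν)⟩)).2]
  · intro y hy γ hγ hlγ H
    have hyl := hlγ.trans hγ
    have h1 : ∀ δ < γ, ∃ ν < γ, δ < ν ∧ d.pos y ≤ limRank ν ∧ ν ≤ d.L := fun δ hδ => by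
      obtain ⟨x, h1, h2, h3⟩ := H (max δ d.l) (max_lt hδ hlγ)
      have h4 := (le_max_right _ _).trans_lt h2
      rcases UMem.cases h1.1 h4 with h5 | h5
      · rcases h1.2.2.2 with h6 | h6
        · exact ⟨x.1, h3, (le_max_left _ _).trans_lt h2, h6.2 ▸ h5.2.2, h5.2.1⟩
        · exact absurd h4 (by rw [h6.1]; exact lt_irrefl _)
      · exact absurd h5.1 (lt_of_upper h1).2.ne
    have hγL : γ ≤ d.L := by
      refine not_lt.1 fun h2 => ?_
      obtain ⟨ν, _, h3, _, h4⟩ := h1 _ h2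
      exact not_lt.2 h4 h3
    have h2 : d.pos y < limRank γ := lt_limRank.2 ⟨bot_lt_of_lt hlγ, fun δ hδ => by
      obtain ⟨ν, h2, h3, h4, -⟩ := h1 δ hδ
      exact ⟨ν, h2, h3, h4⟩⟩
    exact ⟨(γ, d.pos y), ⟨.inr (.inl ⟨hlγ, hγL, h2.le⟩), hy, hγ, .inl ⟨hlγ, rfl⟩⟩, rfl⟩
  · intro y hy hl hyL hy' δ hδ
    have hyκ := hyL.trans_lt d.L_lt
    have h1 : y.2 + 1 ≤ limRank y.1 := by
      rcases UMem.cases hy' hl with h | h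
      · exact h.2.2
      · exact absurd h.1 hyκ.ne
    obtain ⟨ν, h2, h3, h4⟩ := (lt_limRank.1 (Order.add_one_le_iff.1 h1)).2 (max δ d.l) (max_lt hδ hl)
    have h5 := (le_max_right _ _).trans_lt h3
    exact ⟨(ν, y.2), ⟨.inr (.inl ⟨h5, h2.le.trans hyL, h4⟩), hy, h2, .inl ⟨h5, (pos_of_lt hyκ).symm⟩⟩,
      (le_max_left _ _).trans_lt h3⟩
  · intro y hy hl H ξ hξ
    rcases UMem.cases hy hl with h | h
    -- The maps between new levels are identities, so a single predecessor above level `l` attains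
    -- every value.
    · obtain ⟨x, h1, h2⟩ := H d.l hl
      have h3 : x.2 = y.2 := by
        rcases h1.2.2.2 with h4 | h4
        · rw [h4.2, pos_of_lt h.1]
        · exact absurd h2 (by rw [h4.1]; exact lt_irrefl _)
      refine ⟨x, h1, ξ, h3 ▸ hξ, ?_⟩
      change d.emb y.1 (d.base x (d.pos y) ξ) = ξ
      rw [emb_of_lt h.1, base_high h2]
    -- Predecessors of a node of level `κ` have level at most `L`, so the premise of M.5 fails
    -- there.
    · obtain ⟨x, h1, h2⟩ := H d.L (h.1 ▸ d.L_lt)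
      rcases UMem.cases h1.1 (d.l_lt.trans h2) with h3 | h3
      · exact absurd h2 (not_lt.2 h3.2.1)
      · exact absurd h3.1 (lt_of_upper h1).2.ne
  · intro x y hxy hyL hx
    have hyκ := hyL.trans_lt d.L_lt
    have hπ : ∀ ξ, d.upper.π x y ξ = d.base x (d.pos y) ξ := fun ξ => emb_of_lt hyκ
    rcases hxy.1.2.2.2 with h | h
    · have h1 : sSup (d.upper.π x y '' Iio x.2) = y.2 := by
        rw [sSup_Iio_limit hx fun ξ => (hπ ξ).trans (base_high h.1), h.2, pos_of_lt hyκ]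
      rw [h1]
      exact ⟨hxy.1, fun ξ _ => rfl⟩
    · have h1 : sSup (d.upper.π x y '' Iio x.2) = sSup {μ | ∃ ξ, ξ < x.2 ∧ d.g ξ = μ} :=
        sSupImage_congr fun ξ hξ => (hπ ξ).trans (base_low h.1 hξ)
      rw [h1]
      set o := sSup {μ | ∃ ξ, ξ < x.2 ∧ d.g ξ = μ} with ho
      have h2 : d.Att x.2 o := ⟨h.2.1, .inr ⟨hx, rfl⟩⟩
      have h3 : o ≤ y.2 := by
        refine not_lt.1 fun h3 => ?_
        obtain ⟨ξ, h4, h5⟩ := lt_sSup_image.1 h3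
        have h6 := h.2.lt h4
        rw [pos_of_lt hyκ] at h6
        exact lt_asymm h5 h6
      have hl := (lt_of_upper hxy.1).1
      have h4 : d.UMem (y.1, o) := by
        rcases UMem.cases hxy.1.2.1 hl with h5 | h5
        · exact .inr (.inl ⟨hl, hyL, h3.trans h5.2.2⟩)
        · exact absurd h5.1 hyκ.ne
      refine ⟨⟨hxy.1.1, h4, hxy.1.2.2.1, .inr ⟨h.1, ?_⟩⟩, fun ξ hξ => ?_⟩
      · rw [pos_of_lt (y := (y.1, o)) hyκ]; exact h2
      · rw [hπ, base_low h.1 hξ]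
        exact (emb_of_lt hyκ).trans (base_low h.1 hξ)
  · intro x y hxy hyL α hα hα' hx hy H
    have hyκ := hyL.trans_lt d.L_lt
    have hlα : d.l < α := (UMem.le_level hxy.1.1).trans_lt hα
    have h1 : y.2 ≤ limRank α := by
      rw [hy]
      refine not_lt.1 fun h1 => ?_
      obtain ⟨ν, h2, h3⟩ := lt_sSup_image_Iio.1 h1
      obtain ⟨γ, h4⟩ := H ν h2
      rcases h4.2.2.2 with h5 | h5
      · have h6 : γ = d.upper.π x y ν := h5.2.trans (pos_of_lt (y := (y.1, _)) hyκ)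
        rcases UMem.cases h4.1 hlα with h7 | h7
        · exact not_lt.2 h7.2.2 (by rw [h6]; exact h3)
        · exact absurd h7.1 (hα'.trans hyκ).ne
      · exact absurd h5.1 hlα.ne'
    exact ⟨y.2, .inr (.inl ⟨hlα, hα'.le.trans hyL, h1⟩), hxy.1.2.1, hα', .inl ⟨hlα, (pos_of_lt hyκ).symm⟩⟩

end ExtensionData

/-! ### Definability of this upper part -/

namespace ExtensionData
variable {M : Set ZFSet.{u}} [hM : Fact (IsTransitiveModelZFCMinus M)]
variable {κ : Ordinal.{u}} [hκ : InM M κ] {K : Set Ordinal.{u}} {d : ExtensionData κ K}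
attribute [local instance] dfn_app dfn_app₂

theorem dfn_UMem [hl : InM M d.l] [hL : InM M d.L] [hθ : InM M d.θ] (hS : Dfn M fun ξ => ξ ∈ d.S) :
    Dfn M d.upper.Mem := by
  have h1 : Dfn M limRank.{u} := dfn_limRank
  have h2 : Dfn M fun x : MorassNode.{u} => x.2 ∈ d.S := hS.comp dfn_snd'
  exact (inferInstance : Dfn M fun x : MorassNode.{u} => (x.1 = d.l ∧ x.2 < d.θ) ∨
    (d.l < x.1 ∧ x.1 ≤ d.L ∧ x.2 ≤ limRank x.1) ∨ (x.1 = κ ∧ x.2 ∈ d.S))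

theorem dfn_pos (hS : Dfn M fun ξ => ξ ∈ d.S) : Dfn M d.pos := by
  classical
  have h1 : Dfn M (ordCollapse d.S) := dfn_ordCollapse hS
  exact (inferInstance : Dfn M fun y : MorassNode.{u} => if y.1 = κ then ordCollapse d.S y.2 else y.2)

theorem dfn_upperLt [hl : InM M d.l] [hL : InM M d.L] [hθ : InM M d.θ] (hS : Dfn M fun ξ => ξ ∈ d.S)
    (hN : Dfn M d.N) (hg : Dfn M d.g) : Dfn M fun z : MorassNode.{u} × MorassNode.{u} => d.upper.Lt z.1 z.2 := by
  have h1 : Dfn M d.UMem := dfn_UMem hS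
  have h2 : Dfn M d.pos := dfn_pos hS
  have h3 : Dfn M fun ν : Ordinal.{u} => sSup {μ | ∃ ξ, ξ < ν ∧ d.g ξ = μ} :=
    dfn_sSupImage (A := fun ν => ν) (F := fun _ ξ => d.g ξ)
  have h4 : Dfn M fun z : Ordinal.{u} × Ordinal.{u} => d.Att z.1 z.2 := by
    have h5 : Dfn M fun z : Ordinal.{u} × Ordinal.{u} => z.2 = sSup {μ | ∃ ξ, ξ < z.1 ∧ d.g ξ = μ} :=
      dfn_eq (F := fun z : Ordinal.{u} × Ordinal.{u} => z.2) (hG := h3.comp dfn_fst')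
    have h6 : Dfn M fun z : Ordinal.{u} × Ordinal.{u} => z.2 = d.g z.1 := inferInstance
    have h7 : Dfn M fun z : Ordinal.{u} × Ordinal.{u} => d.N z.1 := hN.comp dfn_fst'
    have h8 : Dfn M fun z : Ordinal.{u} × Ordinal.{u} => Order.IsSuccLimit z.1 := inferInstance
    exact dfn_and (hP := h7) (hQ := dfn_or (hP := h6) (hQ := dfn_and (hP := h8) (hQ := h5)))
  have h9 : Dfn M fun z : MorassNode.{u} × MorassNode.{u} => d.Att z.1.2 (d.pos z.2) :=
    h4.comp (dfn_pair (F := fun z : MorassNode.{u} × MorassNode.{u} => z.1.2) (G := fun z => d.pos z.2))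
  have h10 : Dfn M fun z : MorassNode.{u} × MorassNode.{u} => d.UMem z.1 := h1.comp dfn_fst'
  have h11 : Dfn M fun z : MorassNode.{u} × MorassNode.{u} => d.UMem z.2 := h1.comp dfn_snd'
  exact (inferInstance : Dfn M fun z : MorassNode.{u} × MorassNode.{u} => d.UMem z.1 ∧ d.UMem z.2 ∧ z.1.1 < z.2.1 ∧
    ((d.l < z.1.1 ∧ z.1.2 = d.pos z.2) ∨ (z.1.1 = d.l ∧ d.Att z.1.2 (d.pos z.2))))

theorem dfn_upperMap [hl : InM M d.l] (hS : Dfn M fun ξ => ξ ∈ d.S) (hu : Dfn M d.u) (hg : Dfn M d.g) :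
    Dfn M fun z : (MorassNode.{u} × MorassNode.{u}) × Ordinal.{u} => d.upper.π z.1.1 z.1.2 z.2 := by
  classical
  have h2 : Dfn M d.pos := dfn_pos hS
  have h3 : Dfn M fun z : Ordinal.{u} × Ordinal.{u} => d.emb z.1 z.2 :=
    (inferInstance : Dfn M fun z : Ordinal.{u} × Ordinal.{u} => if z.1 = κ then d.u z.2 else z.2)
  have h4 : Dfn M fun z : (MorassNode.{u} × MorassNode.{u}) × Ordinal.{u} => d.base z.1.1 (d.pos z.1.2) z.2 :=
    (inferInstance : Dfn M fun z : (MorassNode.{u} × MorassNode.{u}) × Ordinal.{u} =>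
      if d.l < z.1.1.1 then z.2 else if z.2 = z.1.1.2 then d.pos z.1.2 else d.g z.2)
  exact h3.comp (dfn_pair (F := fun z : (MorassNode.{u} × MorassNode.{u}) × Ordinal.{u} => z.1.2.1) (hG := h4))

end ExtensionData

/-- An element of `S` below a limit has its successor in `S` below that limit, so the collapse has
no last value there. -/
theorem ordCollapse_limit {S : Set Ordinal.{u}} (h0 : 0 ∈ S) (hs : ∀ β, β ∈ S → β + 1 ∈ S) {ξ : Ordinal.{u}}
    (hξ : Order.IsSuccLimit ξ) : Order.IsSuccLimit (ordCollapse S ξ) := by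
  obtain ⟨h1, h2⟩ := isSuccLimit_iff'.1 hξ
  refine isSuccLimit_iff'.2 ⟨?_, fun β hβ => ?_⟩
  · exact (bot_lt_of_lt (ordCollapse_lt (bot_lt_iff_ne_bot.2 h1) h0)).ne'
  · obtain ⟨ν, h3, h4, h5⟩ := lt_ordCollapse.1 hβ
    refine lt_ordCollapse.2 ⟨ν + 1, h2 ν h3, hs ν h4, ?_⟩
    rw [ordCollapse_succ h4]
    gcongr

/-! ### Extending a condition to a given last level and top -/

section
variable {M : Set ZFSet.{u}} [hM : Fact (IsTransitiveModelZFCMinus M)]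
variable {κ : Ordinal.{u}} {K : Set Ordinal.{u}} {p : MorassData.{u}} {S : Set Ordinal.{u}} {Λ : Ordinal.{u}}
attribute [local instance] dfn_app dfn_app₂

namespace MorassData

theorem IsCondition.isSloop_top (hp : p.IsCondition κ K) {γ : Ordinal.{u}} {f : Ordinal.{u} → Ordinal.{u}}
    (hf : f '' Iio γ = p.top κ) (hf' : ∀ ν < γ, p.Lt (p.lam κ, ν) (κ, f ν)) {ν : Ordinal.{u}} (hν : ν < γ) :
    IsSloop f ν :=
  (hp.m1 _ _ (hf' ν hν)).1.congr fun _ hξ => (hp.map_top hf hf' hν hξ).symm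

/-- A condition can be extended to a condition with prescribed last level `Λ` and level `κ`. -/
theorem IsCondition.exists_extension (hκ : IsRegularUncountableIn M κ) (hpM : InM M p) (hp : p.IsCondition κ K)
    (hl : p.lam κ < Λ) (hΛ : Λ < κ) (hS : Dfn M fun ξ => ξ ∈ S) (hSK : ∀ β ∈ S, β ∈ K) (hpS : p.top κ ⊆ S)
    (hsucc : ∀ β, β ∈ S ↔ β + 1 ∈ S) (hc : ∀ ξ ∈ S, ordCollapse S ξ ≤ limRank Λ)
    (hset : ∃ s ∈ M, ∀ ξ ∈ S, ξ.toZFSet ∈ s) :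
    ∃ q, InM M q ∧ q.IsCondition κ K ∧ p.Extends κ q ∧ q.lam κ = Λ ∧ q.theta Λ = limRank Λ + 1 ∧ q.top κ = S := by
  have hκM : InM M κ := ⟨hκ.1⟩
  obtain ⟨s, hs, hSs⟩ := hset
  obtain ⟨γ, hγ, f, hfm, hf, hf'⟩ := hp.top_enum
  have hθκ := (hp.leftAligned _ le_rfl).2.1
  have hfS : ∀ ν < γ, f ν ∈ S := fun ν hν => hpS (hf ▸ mem_image_of_mem f hν)
  have hγ0 : 0 < γ := by
    obtain ⟨ν, hν, -⟩ : (0 : Ordinal.{u}) ∈ f '' Iio γ := hf ▸ hp.top_zero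
    exact bot_lt_of_lt hν
  have hsl : ∀ ν < γ, IsSloop f ν := fun ν hν => hp.isSloop_top hf hf' hν
  -- The enumeration `f` is an arbitrary function beyond `γ`. `F` reads its values off the tree
  -- order of `p`, and is therefore definable.
  let F : Ordinal.{u} → Ordinal.{u} := fun ν => sInf {β | p.Lt (p.lam κ, ν) (κ, β)}
  have hlM : InM M (p.lam κ) := dfn_lam_const.inM p hpM
  have hF : Dfn M F := dfn_sInf (R := fun ν β => p.Lt (p.lam κ, ν) (κ, β))
    fun ν β _ h => (inM_prod.1 (h.inM hpM).2).2
  have hFf : ∀ ν < γ, F ν = f ν := fun ν hν => by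
    have : {β | p.Lt (p.lam κ, ν) (κ, β)} = {f ν} := by
      ext β
      refine ⟨fun h => ?_, by rintro rfl; exact hf' ν hν⟩
      have h1 : β ∈ f '' Iio γ := hf ▸ (hp.lt_mem h).2
      obtain ⟨ν', hν', rfl⟩ := h1
      rw [hp.pred_unique h (hf' ν' hν')]
      rfl
    exact (congrArg sInf this).trans (csInf_singleton _)
  have hcM : Dfn M (ordCollapse S) := dfn_ordCollapse hS
  let v : Ordinal.{u} → Ordinal.{u} := fun ν => sInf {ξ | ξ ∈ S ∧ ordCollapse S ξ = ν}
  have hv : Dfn M v := by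
    have h1 : Dfn M fun z : Ordinal.{u} × Ordinal.{u} => z.2 ∈ S := hS.comp dfn_snd'
    exact dfn_sInf (R := fun ν ξ => ξ ∈ S ∧ ordCollapse S ξ = ν) fun ν ξ _ h => ⟨mem_trans_M hs (hSs ξ h.1)⟩
  have hvc : ∀ ξ ∈ S, v (ordCollapse S ξ) = ξ := fun ξ hξ => by
    have : {ζ | ζ ∈ S ∧ ordCollapse S ζ = ordCollapse S ξ} = {ξ} := by
      ext ζ
      exact ⟨fun h => (ordCollapse_strictMonoOn S).injOn h.1 hξ h.2, by rintro rfl; exact ⟨hξ, rfl⟩⟩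
    exact (congrArg sInf this).trans (csInf_singleton _)
  have hf0 : f 0 = 0 := (hsl 0 hγ0).zero
  -- The node `⟨λ, ν⟩` must end up below `⟨κ, f ν⟩`, whose position in the new top is the collapse
  -- of `f ν`; this dictates `g`. The function `v` is the inverse of the collapse.
  let d : ExtensionData κ K :=
    { l := p.lam κ
      L := Λ
      θ := p.theta (p.lam κ)
      S := S
      N := fun ν => ν < γ
      u := v
      g := fun ν => ordCollapse S (F ν)
      l_lt := hl
      L_lt := hΛ
      θ_pos := (hp.leftAligned _ le_rfl).1
      θ_lt := hθκ
      succ_lt := fun α hα => hκ.succ_lt hα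
      S_sub := hSK
      zero_mem := hpS hp.top_zero
      succ_mem := hsucc
      u_collapse := hvc
      collapse_le := hc
      N_down := fun ν hν μ hμ => hμ.trans hν
      g_zero := by rw [hFf 0 hγ0, hf0, ordCollapse_zero]
      g_succ := fun ν hν => by
        have h1 : ν < γ := (lt_add_one ν).trans hν
        rw [hFf _ hν, hFf ν h1, (hsl _ hν).succ ν (lt_add_one ν), ordCollapse_succ (hfS ν h1)]
      g_limit := fun ν hν hl => by
        rw [hFf ν hν]
        exact ordCollapse_limit (hpS hp.top_zero) (fun β => (hsucc β).1) ((hsl ν hν).limit ν le_rfl hl)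
      g_mono := fun ν hν μ hμ => by
        have h1 := hμ.trans hν
        rw [hFf ν hν, hFf μ h1]
        exact ordCollapse_lt ((hsl ν hν).strictMono ν le_rfl μ hμ) (hfS μ h1) }
  have hU : d.upper.IsUpper κ K (p.lam κ) Λ := d.isUpper
  have hγM : InM M γ := inM_of_lt (hγ.trans_lt hθκ) hκM
  have i1 : InM M d.l := hlM
  have i2 : InM M d.L := inM_of_lt hΛ hκM
  have i3 : InM M d.θ := inM_of_lt hθκ hκM
  have hN : Dfn M d.N := (inferInstance : Dfn M fun ν : Ordinal.{u} => ν < γ)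
  have hg : Dfn M d.g := (inferInstance : Dfn M fun ν : Ordinal.{u} => ordCollapse S (F ν))
  have hsM : InM M s := ⟨hs⟩
  have hlow : ∀ β, d.UMem (p.lam κ, β) ↔ β < p.theta (p.lam κ) := fun β => by
    refine ⟨fun h => ?_, fun h => .inl ⟨rfl, h⟩⟩
    rcases h with h | h | h
    · exact h.2
    · exact absurd h.1 (lt_irrefl _)
    · exact absurd h.1 hp.lam_lt.ne
  have hbU : ∀ β, p.Mem (p.lam κ, β) ↔ d.upper.Mem (p.lam κ, β) := fun β => by
    rw [hp.mem_lam]; exact (hlow β).symm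
  have hmemΛ : ∀ β, d.UMem (Λ, β) ↔ β < limRank Λ + 1 := fun β => by
    rw [Order.lt_add_one_iff]
    refine ⟨fun h => ?_, fun h => .inr (.inl ⟨hl, le_rfl, h⟩)⟩
    rcases h with h | h | h
    · exact absurd h.1 hl.ne'
    · exact h.2.2
    · exact absurd h.1 hΛ.ne
  have hmemκ : ∀ β, d.UMem (κ, β) ↔ β ∈ S := fun β => by
    refine ⟨fun h => ?_, fun h => .inr (.inr ⟨rfl, h⟩)⟩
    rcases h with h | h | h
    · exact absurd h.1 hp.lam_lt.ne'
    · exact absurd h.2.1 (not_le.2 hΛ)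
    · exact h.2
  obtain ⟨q, hqM, hq⟩ := exists_glue hpM hp hU (ExtensionData.dfn_UMem hS) (ExtensionData.dfn_upperLt hS hN hg)
    (ExtensionData.dfn_upperMap hS hv hg) ⟨ZFSet.prod (κ + 1).toZFSet (κ.toZFSet ∪ s),
      ((dfn_prod (A := fun _ : Ordinal.{u} => (κ + 1).toZFSet) (B := fun _ => κ.toZFSet ∪ s)).inM κ hκM).1,
      fun x hx => by
        refine ZFSet.pair_mem_prod.2 ⟨Ordinal.toZFSet_mem_toZFSet_iff.2 (Order.lt_add_one_iff.2
          (ExtensionData.UMem.le_card hx)), ZFSet.mem_union.2 ?_⟩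
        rcases hx with h | h | h
        · exact .inl (Ordinal.toZFSet_mem_toZFSet_iff.2 (h.2.trans hθκ))
        · exact .inl (Ordinal.toZFSet_mem_toZFSet_iff.2 ((h.2.2.trans (limRank_le _)).trans_lt (h.2.1.trans_lt hΛ)))
        · exact .inr (hSs _ h.2)⟩
  refine ⟨q, hqM, hq.isCondition hp hU hbU, hq.extends hp hU hbU hf hf' fun ν hν => ⟨⟨(hlow ν).2 (hν.trans_le hγ),
    (hmemκ _).2 (hfS ν hν), hp.lam_lt, .inr ⟨rfl, hν, .inl ?_⟩⟩, fun ξ hξ => ?_⟩, hq.lam hU, ?_, ?_⟩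
  · rw [ExtensionData.pos_top]
    exact congrArg _ (hFf ν hν).symm
  · have h1 : d.base (p.lam κ, ν) (d.pos (κ, f ν)) ξ = ordCollapse S (f ξ) := by
      rcases hξ.lt_or_eq with h2 | rfl
      · exact (ExtensionData.base_low rfl h2).trans (congrArg _ (hFf ξ (h2.trans hν)))
      · refine ((if_neg (lt_irrefl _)).trans (if_pos rfl)).trans (ExtensionData.pos_top _)
    change d.emb κ (d.base (p.lam κ, ν) (d.pos (κ, f ν)) ξ) = f ξ
    rw [h1, ExtensionData.emb_top]
    exact hvc _ (hfS ξ (hξ.trans_lt hν))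
  · exact theta_eq fun β => (hq.mem_high hbU (x := (Λ, β)) hl.le).trans (hmemΛ β)
  · ext β
    exact (hq.mem_high hbU (x := (κ, β)) hp.lam_lt.le).trans (hmemκ β)

end MorassData
end

/-! ### Any two conditions have twin extensions -/

section
variable {M : Set ZFSet.{u}} [hM : Fact (IsTransitiveModelZFCMinus M)]
variable {κ : Ordinal.{u}} {K : Set Ordinal.{u}} {p q : MorassData.{u}} {z A : ZFSet.{u}}
attribute [local instance] dfn_app dfn_app₂

/-- The set of the von Neumann ordinals at level `κ` of `p`. -/
def topSet (κ : Ordinal.{u}) (p : MorassData.{u}) : ZFSet.{u} :=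
  ZFSet.sep (fun z => ZFSet.pair κ.toZFSet z ∈ p.carrier) (ZFSet.sUnion (ZFSet.sUnion p.carrier))

theorem mem_topSet (hp : p.WellFormed) : z ∈ topSet κ p ↔ ∃ β ∈ p.top κ, z = β.toZFSet := by
  rw [topSet, ZFSet.mem_sep]
  constructor
  · rintro ⟨-, h⟩
    obtain ⟨⟨α, β⟩, h1⟩ := hp.carrier_nodes _ h
    obtain ⟨h2, rfl⟩ := ZFSet.pair_injective h1
    obtain rfl := Ordinal.toZFSet_injective h2
    exact ⟨β, h, rfl⟩
  · rintro ⟨β, h, rfl⟩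
    have h' : ZFSet.pair κ.toZFSet β.toZFSet ∈ p.carrier := h
    exact ⟨ZFSet.mem_sUnion.2 ⟨_, ZFSet.mem_sUnion.2 ⟨_, h', ZFSet.mem_pair.2 (.inr rfl)⟩,
      ZFSet.mem_pair.2 (.inr rfl)⟩, h'⟩

instance dfn_topSet [hκ : InM M κ] : Dfn M (topSet κ) :=
  (inferInstance : Dfn M fun p : MorassData.{u} => ZFSet.sep (fun z => ZFSet.pair κ.toZFSet z ∈ p.carrier)
    (ZFSet.sUnion (ZFSet.sUnion p.carrier)))

theorem smallIn_topSet (hκ : IsRegularUncountableIn M κ) (hpM : InM M p) (hp : p.IsCondition κ K) :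
    SmallIn M κ (topSet κ p) := by
  have hκM : InM M κ := ⟨hκ.1⟩
  have h1 : Dfn M fun z : ZFSet.{u} => ZFSet.pair κ.toZFSet z :=
    dfn_mkpair (F := fun _ => κ.toZFSet) (G := fun z => z)
  exact (hp.smallIn_carrier hκ hpM).pullback (dfn_topSet.inM p hpM).1 h1
    (fun x _ y _ h => (ZFSet.pair_injective h).2) fun x hx => (ZFSet.mem_sep.1 hx).2

/-- A small set of ordinals has order type below `κ`: otherwise its collapse takes every value below
`κ` and, truncated to these, is an unbounded function from a small set to `κ`. -/
theorem SmallIn.exists_collapse_bound (hκ : IsRegularUncountableIn M κ) (hA : SmallIn M κ A) {S : Set Ordinal.{u}}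
    (hS : Dfn M fun ξ => ξ ∈ S) (hSA : ∀ ξ, ξ ∈ S ↔ ξ.toZFSet ∈ A) : ∃ e < κ, ∀ ξ ∈ S, ordCollapse S ξ < e := by
  classical
  have hκM : InM M κ := ⟨hκ.1⟩
  have hc : Dfn M (ordCollapse S) := dfn_ordCollapse hS
  have ho : Dfn M ordOf.{u} := dfn_ordOf
  let F : ZFSet.{u} → Ordinal.{u} := fun x => if ordCollapse S (ordOf x) < κ then ordCollapse S (ordOf x) else 0
  have hF : Dfn M F := dfn_ite (c := fun x => ordCollapse S (ordOf x) < κ)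
  obtain ⟨γ, hγ, h1⟩ := hA.exists_bound hκ hF fun x _ => by
    change (if _ then _ else _) < κ
    split_ifs with h2
    exacts [h2, hκ.pos]
  refine ⟨γ, hγ, fun ξ hξ => not_le.1 fun h2 => ?_⟩
  obtain ⟨ζ, hζ, h3⟩ : ∃ ζ ∈ S, ordCollapse S ζ = γ := by
    rcases h2.lt_or_eq with h2 | h2
    · obtain ⟨ν, -, h4, h5⟩ := exists_ordCollapse_eq h2
      exact ⟨ν, h4, h5⟩
    · exact ⟨ξ, hξ, h2.symm⟩
  have h5 := h1 _ ((hSA ζ).1 hζ)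
  change (if _ then _ else _) < γ at h5
  rw [ordOf_toZFSet, h3, if_pos hγ] at h5
  exact lt_irrefl _ h5

open MorassData in
/-- Any two conditions have extensions which are twins. -/
theorem exists_twins (hκ : IsRegularUncountableIn M κ) (hpM : InM M p) (hqM : InM M q) (hp : p.IsCondition κ K)
    (hq : q.IsCondition κ K) : ∃ a b, InM M a ∧ InM M b ∧ a.IsCondition κ K ∧ b.IsCondition κ K ∧
      p.Extends κ a ∧ q.Extends κ b ∧ Twins κ a b := by
  have hκM : InM M κ := ⟨hκ.1⟩
  let S : Set Ordinal.{u} := p.top κ ∪ q.top κ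
  have hA := (smallIn_topSet hκ hpM hp).union hκ (smallIn_topSet hκ hqM hq)
  have hSA : ∀ ξ, ξ ∈ S ↔ ξ.toZFSet ∈ topSet κ p ∪ topSet κ q := fun ξ => by
    have h1 : ∀ r : MorassData.{u}, r.WellFormed → (ξ.toZFSet ∈ topSet κ r ↔ ξ ∈ r.top κ) := fun r hr => by
      rw [mem_topSet hr]
      refine ⟨?_, fun h => ⟨ξ, h, rfl⟩⟩
      rintro ⟨β, h, h'⟩
      rwa [Ordinal.toZFSet_injective h']
    rw [ZFSet.mem_union, h1 _ hp.wellFormed, h1 _ hq.wellFormed]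
    rfl
  have hAM : InM M (topSet κ p ∪ topSet κ q) := ⟨hA.1⟩
  have hS : Dfn M fun ξ => ξ ∈ S :=
    (dfn_mem (F := fun ξ : Ordinal.{u} => ξ.toZFSet) (hF := dfn_toZFSet (F := fun ξ => ξ))
      (G := fun _ => topSet κ p ∪ topSet κ q)).congr fun ξ _ => propext (hSA ξ)
  obtain ⟨e, he, hSe⟩ := hA.exists_collapse_bound hκ hS hSA
  -- The rank of `Λ` bounds the collapse of the joint top, so that level `Λ` has a node for each
  -- element of `S`. Both extensions then have last level `Λ`, of length `limRank Λ + 1`, and top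
  -- `S`.
  obtain ⟨Λ, hΛ, h1, h2⟩ := exists_limRank_ge hκ e he _ (max_lt hp.lam_lt hq.lam_lt)
  have hK : ∀ r : MorassData.{u}, r.IsCondition κ K → ∀ β ∈ r.top κ, β ∈ K := fun r hr β hβ => by
    rcases hr.nodes _ hβ with h | h
    · exact absurd h.1 (not_le.2 hr.lam_lt)
    · exact h.2
  have hSK : ∀ β ∈ S, β ∈ K := fun β hβ => hβ.elim (hK p hp β) (hK q hq β)
  have hsucc : ∀ β, β ∈ S ↔ β + 1 ∈ S := fun β => or_congr (hp.top_succ β) (hq.top_succ β)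
  have hc : ∀ ξ ∈ S, ordCollapse S ξ ≤ limRank Λ := fun ξ hξ => (hSe ξ hξ).le.trans h2
  have hset : ∃ s ∈ M, ∀ ξ ∈ S, ξ.toZFSet ∈ s := ⟨_, hA.1, fun ξ => (hSA ξ).1⟩
  obtain ⟨a, haM, ha, hpa, h3, h4, h5⟩ := hp.exists_extension hκ hpM ((le_max_left _ _).trans_lt h1) hΛ hS hSK
    subset_union_left hsucc hc hset
  obtain ⟨b, hbM, hb, hqb, h3', h4', h5'⟩ := hq.exists_extension hκ hqM ((le_max_right _ _).trans_lt h1) hΛ hS hSK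
    subset_union_right hsucc hc hset
  exact ⟨a, b, haM, hbM, ha, hb, hpa, hqb, h3.trans h3'.symm, by rw [h3, h4, h4'], h5.trans h5'.symm⟩

end

/-! ### Cutting off nodes of level `κ` -/

namespace MorassData
variable {κ : Ordinal.{u}} {K C : Set Ordinal.{u}} {p a b r r' s s' : MorassData.{u}}

/-- `r'` results from `r` by removing the nodes `⟨κ, β⟩` with `β ∉ C`. -/
structure IsCut (κ : Ordinal.{u}) (C : Set Ordinal.{u}) (r r' : MorassData.{u}) : Prop where
  mem : ∀ x, r'.Mem x ↔ r.Mem x ∧ (x.1 = κ → x.2 ∈ C)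
  lt : ∀ x y, r'.Lt x y ↔ r.Lt x y ∧ (y.1 = κ → y.2 ∈ C)
  maps : ∀ x y, r'.Lt x y → ∀ ν ≤ x.2, r'.π x y ν = r.π x y ν

/-- The requirements on the cut of a condition at its last level and at the level `κ`. -/
theorem IsCondition.isUpper_cut (hr : r.IsCondition κ K) (h0 : 0 ∈ C) (hC : ∀ β ∈ C, ∀ γ ≤ β, γ ∈ C)
    (hC' : ∀ β ∈ C, β + 1 ∈ C) :
    (PreMorass.mk (fun x => r.lam κ ≤ x.1 ∧ r.Mem x ∧ (x.1 = κ → x.2 ∈ C))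
      (fun x y => r.lam κ ≤ x.1 ∧ r.Lt x y ∧ (y.1 = κ → y.2 ∈ C)) r.π).IsUpper κ K (r.lam κ) (r.lam κ) := by
  have hne : ∀ {x y}, r.Lt x y → x.1 ≠ κ := fun h => ((hr.level_le_of_lt h).trans_lt hr.lam_lt).ne
  refine
    { lt_mem := fun x y h => ⟨⟨h.1, (hr.lt_mem h.2.1).1, fun e => absurd e (hne h.2.1)⟩,
        h.1.trans (hr.monotone _ _ h.2.1).le, (hr.lt_mem h.2.1).2, h.2.2⟩
      le_level := fun x h => h.1
      le := le_rfl
      lt_card := hr.lam_lt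
      nodes := fun x h => hr.nodes x h.2.1
      trans := fun x y z h h' => ⟨h.1, hr.trans h.2.1 h'.2.1, h'.2.2⟩
      linear := ?_
      leftAligned := ?_
      top_zero := ⟨hr.lam_lt.le, hr.top_zero, fun _ => h0⟩
      top_succ := ?_
      top_enum := ?_
      monotone := fun x y h => hr.monotone _ _ h.2.1
      commutative := fun x y z h h' => hr.commutative x y z h.2.1 h'.2.1
      m1 := fun x y h => hr.m1 x y h.2.1
      m2 := fun x y h ν hν => ⟨⟨h.1, (hr.m2 x y h.2.1 ν hν).1, fun e => hC _ (h.2.2 e) _ (hr.map_le h.2.1 hν.le)⟩,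
        (hr.m2 x y h.2.1 ν hν).2⟩
      m3 := ?_
      m4 := fun y _ h h' => absurd h (not_lt.2 h')
      m5 := ?_
      m6 := fun x y h h' => absurd ((hr.monotone _ _ h.1.2.1).trans_le h') (not_lt.2 h.1.1)
      m7 := fun x y h h' => absurd ((hr.monotone _ _ h.1.2.1).trans_le h') (not_lt.2 h.1.1) }
  · intro x y z h h'
    rcases hr.linear h.2.1 h'.2.1 with h1 | h1 | h1
    exacts [.inl h1, .inr (.inl ⟨h.1, h1, fun e => absurd e (hne h'.2.1)⟩),
      .inr (.inr ⟨h'.1, h1, fun e => absurd e (hne h.2.1)⟩)]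
  · intro α h1 h2
    obtain ⟨h3, h4, h5⟩ := hr.leftAligned α h2
    exact ⟨_, h3, h4, fun β => ⟨fun h => (h5 β).1 h.2.1,
      fun h => ⟨h1, (h5 β).2 h, fun e => absurd e (h2.trans_lt hr.lam_lt).ne⟩⟩⟩
  · exact fun β => and_congr_right fun _ => and_congr (hr.top_succ β)
      ⟨fun h _ => hC' _ (h rfl), fun h _ => hC _ (h rfl) _ (lt_add_one β).le⟩
  · obtain ⟨γ, -, f, hf, hf', hl⟩ := hr.top_enum
    -- As `C` is an initial segment, the new enumeration is the old one up to its first value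
    -- outside `C`, or up to `γ` if there is none.
    have h1 : ∀ ν, ν < sInf {ν | ν < γ → f ν ∉ C} ↔ ν < γ ∧ f ν ∈ C := fun ν => by
      constructor
      · intro h
        have h2 := notMem_of_lt_csInf h (OrderBot.bddBelow _)
        rw [mem_ofPred_eq, Classical.not_imp, not_not] at h2
        exact h2
      · rintro ⟨h2, h3⟩
        refine not_le.1 fun h4 => ?_
        have h5 := csInf_mem (s := {ν | ν < γ → f ν ∉ C}) ⟨γ, fun h => absurd h (lt_irrefl _)⟩
        exact h5 (h4.trans_lt h2) (hC _ h3 _ (hf.monotoneOn (h4.trans_lt h2) h2 h4))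
    refine ⟨_, f, fun x hx y hy h => hf ((h1 x).1 hx).1 ((h1 y).1 hy).1 h, ?_, fun ν hν =>
      ⟨le_rfl, hl ν ((h1 ν).1 hν).1, fun _ => ((h1 ν).1 hν).2⟩⟩
    ext β
    constructor
    · rintro ⟨ν, hν, rfl⟩
      refine ⟨hr.lam_lt.le, ?_, fun _ => ((h1 ν).1 hν).2⟩
      change f ν ∈ r.top κ
      rw [← hf']
      exact mem_image_of_mem f ((h1 ν).1 hν).1
    · rintro ⟨-, h, h2⟩
      have h' : β ∈ f '' Iio γ := hf' ▸ h
      obtain ⟨ν, hν, rfl⟩ := h'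
      exact ⟨ν, (h1 ν).2 ⟨hν, h2 rfl⟩, rfl⟩
  · intro y hy γ hγ hl H
    obtain ⟨x, h1, h2, -⟩ := H _ hl
    exact absurd h2 (not_lt.2 (hr.level_le_of_lt h1.2.1))
  · intro y hy hl H
    obtain ⟨x, h1, h2⟩ := H _ hl
    exact absurd h2 (not_lt.2 (hr.level_le_of_lt h1.2.1))

theorem IsCut.lam_eq (h : IsCut κ C r r') : r'.lam κ = r.lam κ := by
  unfold lam
  congr 1
  ext α
  refine and_congr_right fun hα => exists_congr fun β => ?_
  rw [h.mem]
  exact and_iff_left fun e => absurd e hα.ne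

theorem IsCut.top_subset (h : IsCut κ C r r') : r'.top κ ⊆ C := fun β hβ => ((h.mem (κ, β)).1 hβ).2 rfl

theorem IsCut.extends (h : IsCut κ C r r') (hr : r.IsCondition κ K) : r'.Extends κ r where
  subset x hx := ((h.mem x).1 hx).1
  nodes_eq x hx _ := by
    rw [h.mem]
    exact and_iff_left fun e => absurd (h.lam_eq ▸ hx) (not_le.2 (e ▸ hr.lam_lt))
  lt_eq x y := by
    rw [h.lt, h.mem, h.mem]
    refine ⟨fun h1 => ⟨⟨(hr.lt_mem h1.1).1, fun e => ?_⟩, ⟨(hr.lt_mem h1.1).2, h1.2⟩, h1.1⟩, fun h1 => ⟨h1.2.2, h1.2.1.2⟩⟩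
    exact absurd (hr.level_le_of_lt h1.1) (not_le.2 (e ▸ hr.lam_lt))
  maps_eq x y hxy ν hν := h.maps x y hxy ν hν
  mangal := h.lam_eq ▸ (Extends.refl hr).mangal

/-- An extension of `a` may be cut without ceasing to extend `a`, as long as the top of `a` is kept.
-/
theorem Extends.cut (H : a.Extends κ r) (h : IsCut κ C r r') (ha : a.IsCondition κ K) (haC : a.top κ ⊆ C) :
    a.Extends κ r' where
  subset x hx := (h.mem x).2 ⟨H.subset x hx, fun e => haC (by
    obtain ⟨x1, x2⟩ := x
    obtain rfl : x1 = κ := e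
    exact hx)⟩
  nodes_eq x hx hx' := by
    rw [h.mem, H.nodes_eq x hx hx']
    exact (and_iff_left fun e : x.1 = κ => absurd hx (not_le.2 (e ▸ ha.lam_lt))).symm
  lt_eq x y := by
    rw [h.lt, H.lt_eq]
    refine and_congr_right fun h1 => and_congr_right fun h2 => (and_iff_left fun e => haC ?_).symm
    obtain ⟨y1, y2⟩ := y
    obtain rfl : y1 = κ := e
    exact h2
  maps_eq x y hxy ν hν := by
    have h1 : r'.Lt x y := (h.lt x y).2 ⟨H.lt hxy, fun e => haC (by
      obtain ⟨y1, y2⟩ := y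
      obtain rfl : y1 = κ := e
      exact (ha.lt_mem hxy).2)⟩
    rw [H.maps_eq x y hxy ν hν, h.maps x y h1 ν hν]
  mangal := by
    refine ⟨h.lam_eq ▸ H.mangal.1, fun x y hxy h1 h2 => ?_⟩
    obtain ⟨z, h3, h4, h5⟩ := H.mangal.2 x y ((h.lt x y).1 hxy).1 h1 h2
    exact ⟨z, h3, (h.lt x z).2 ⟨h4, fun e => absurd (h3.symm.trans e) ha.lam_lt.ne⟩,
      (h.lt z y).2 ⟨h5, ((h.lt x y).1 hxy).2⟩⟩

theorem IsSwap.cut (H : IsSwap κ a b r s) (hab : Twins κ a b) (hr : IsCut κ C r r') (hs : IsCut κ C s s')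
    (ha : a.IsCondition κ K) (hb : b.IsCondition κ K) (haC : a.top κ ⊆ C) : IsSwap κ a b r' s' where
  left := H.left.cut hr ha haC
  right := H.right.cut hs hb (hab.top_eq ▸ haC)
  mem x hx := by rw [hr.mem, hs.mem, H.mem x hx]
  lt x y hx := by rw [hr.lt, hs.lt, H.lt x y hx]
  maps x y hxy hx ν hν := by
    have h1 := ((hr.lt x y).1 hxy)
    rw [hr.maps x y hxy ν hν, H.maps x y h1.1 hx ν hν, hs.maps x y ((hs.lt x y).2 ⟨(H.lt x y hx).1 h1.1, h1.2⟩) ν hν]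

end MorassData

section
variable {M : Set ZFSet.{u}} [hM : Fact (IsTransitiveModelZFCMinus M)]
variable {κ : Ordinal.{u}} [hκ : InM M κ] {K C : Set Ordinal.{u}} {a b r : MorassData.{u}}
attribute [local instance] dfn_app dfn_app₂

-- The condition is glued to its own levels `λ` and `κ`, the latter restricted to `C`. That `C` is
-- an initial segment is needed for M.2; that it contains `0` and is closed under successors is
-- needed for the axioms on level `κ`.
open MorassData in
theorem exists_isCut (hrM : InM M r) (hr : r.IsCondition κ K) (hCM : Dfn M fun β => β ∈ C) (h0 : 0 ∈ C)
    (hC : ∀ β ∈ C, ∀ γ ≤ β, γ ∈ C) (hC' : ∀ β ∈ C, β + 1 ∈ C) :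
    ∃ r', InM M r' ∧ r'.IsCondition κ K ∧ IsCut κ C r r' := by
  have hlM : InM M (r.lam κ) := dfn_lam_const.inM r hrM
  have hU := hr.isUpper_cut h0 hC hC'
  have h1 : Dfn M fun x : MorassNode.{u} => x.1 = κ → x.2 ∈ C :=
    dfn_imp (hP := inferInstance) (hQ := hCM.comp dfn_snd')
  have h2 : Dfn M fun x : MorassNode.{u} × MorassNode.{u} => x.2.1 = κ → x.2.2 ∈ C :=
    h1.comp dfn_snd'
  have hbU : ∀ β, r.Mem (r.lam κ, β) ↔ r.lam κ ≤ r.lam κ ∧ r.Mem (r.lam κ, β) ∧ (r.lam κ = κ → β ∈ C) :=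
    fun β => ⟨fun h => ⟨le_rfl, h, fun e => absurd e hr.lam_lt.ne⟩, fun h => h.2.1⟩
  obtain ⟨r', hr'M, hr'⟩ := exists_glue hrM hr hU
    (inferInstanceAs (Dfn M fun x : MorassNode.{u} => r.lam κ ≤ x.1 ∧ r.Mem x ∧ (x.1 = κ → x.2 ∈ C)))
    (inferInstanceAs (Dfn M fun x : MorassNode.{u} × MorassNode.{u} =>
      r.lam κ ≤ x.1.1 ∧ r.Lt x.1 x.2 ∧ (x.2.1 = κ → x.2.2 ∈ C)))
    (by exact inferInstance) ⟨r.carrier, (inM_morass.1 hrM).1, fun x hx => hx.2.1⟩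
  have hmap : ∀ x y, r'.Lt x y → ∀ ν ≤ x.2, r'.π x y ν = r.π x y ν := fun x y hxy ν hν => by
    rcases (hr'.lt x y).1 hxy with h3 | h3 | ⟨n, h3, h4⟩
    · exact hr'.π_low x y h3.1 h3.2 ν hν
    · exact hr'.π_high x y h3 ν hν
    · rw [hr'.π_mix x y n h3 h4 ν hν]
      exact hr.commutative _ _ _ h3 h4.2.1 ν hν
  refine ⟨r', hr'M, hr'.isCondition hr hU hbU, fun x => ?_, fun x y => ?_, hmap⟩
  · rw [hr'.mem]
    constructor
    · rintro (h3 | h3)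
      · exact ⟨h3.2, fun e => absurd h3.1 (not_le.2 (e ▸ hr.lam_lt))⟩
      · exact h3.2
    · intro h3
      rcases le_total (r.lam κ) x.1 with h4 | h4
      exacts [.inr ⟨h4, h3⟩, .inl ⟨h4, h3.1⟩]
  · rw [hr'.lt]
    constructor
    · rintro (h3 | h3 | ⟨n, h3, h4⟩)
      · exact ⟨h3.2, fun e => absurd h3.1 (not_le.2 (e ▸ hr.lam_lt))⟩
      · exact h3.2
      · exact ⟨hr.trans h3 h4.2.1, h4.2.2⟩
    · intro h3
      rcases le_or_gt y.1 (r.lam κ) with h4 | h4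
      · exact .inl ⟨h4, h3.1⟩
      · obtain ⟨ν, β, rfl, h5⟩ := hr.exists_top (hr.lt_mem h3.1).2 h4
        rcases (hr.lt_top_iff h5).1 h3.1 with rfl | h6
        · exact .inr (.inl ⟨le_rfl, h3⟩)
        · exact .inr (.inr ⟨ν, h6, le_rfl, h5, h3.2⟩)

end

/-! ### The forcing and its order in terms of morass data -/

open MorassData

theorem MorassData.code_ne_empty (p : MorassData.{u}) : p.code ≠ ∅ := fun h => by
  have h1 : ({p.carrier} : ZFSet.{u}) ∈ p.code := ZFSet.mem_pair.2 (.inl rfl)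
  rw [h] at h1
  exact ZFSet.notMem_empty _ h1

theorem MorassData.code_inj {p q : MorassData.{u}} (h : p.code = q.code) : p = q := code_injective h

/-- `r` is a morass condition of `M`. -/
def IsCondIn (M : Set ZFSet.{u}) (κ : Ordinal.{u}) (r : MorassData.{u}) : Prop :=
  InM M r ∧ r.IsCondition κ (succCardIn M κ)

section
variable {M : Set ZFSet.{u}} {κ : Ordinal.{u}} {p q r : MorassData.{u}} {z w t : ZFSet.{u}}

theorem code_mem_mangroveForcing : p.code ∈ mangroveForcing M κ ↔ IsCondIn M κ p := by
  constructor
  · rintro ⟨h, h1 | ⟨q, h1, h2⟩⟩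
    · exact absurd h1 p.code_ne_empty
    · obtain rfl := code_inj h2
      exact ⟨⟨h⟩, h1⟩
  · exact fun h => ⟨h.1.1, .inr ⟨p, h.2, rfl⟩⟩

theorem mem_mangroveForcing_cases (h : z ∈ mangroveForcing M κ) : z = ∅ ∨ ∃ p, IsCondIn M κ p ∧ z = p.code := by
  obtain ⟨h, h1 | ⟨q, h1, rfl⟩⟩ := h
  exacts [.inl h1, .inr ⟨q, ⟨⟨h⟩, h1⟩, rfl⟩]

theorem mangroveLE_code : mangroveLE κ q.code p.code ↔ p.Extends κ q := by
  constructor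
  · rintro (h | ⟨q', p', h1, h2, h3⟩)
    · exact absurd h p.code_ne_empty
    · obtain rfl := code_inj h1
      obtain rfl := code_inj h2
      exact h3
  · exact fun h => .inr ⟨q, p, rfl, rfl, h⟩

theorem exists_of_mangroveLE_code (hz : z ∈ mangroveForcing M κ) (h : mangroveLE κ z p.code) :
    ∃ q, IsCondIn M κ q ∧ z = q.code ∧ p.Extends κ q := by
  rcases mem_mangroveForcing_cases hz with rfl | ⟨q, hq, rfl⟩
  · rcases h with h | ⟨q', p', h1, h2, h3⟩
    · exact absurd h p.code_ne_empty
    · exact absurd h1.symm q'.code_ne_empty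
  · exact ⟨q, hq, rfl, mangroveLE_code.1 h⟩

theorem mangroveLE_trans (hz : z ∈ mangroveForcing M κ) (hw : w ∈ mangroveForcing M κ) (ht : t ∈ mangroveForcing M κ)
    (h : mangroveLE κ z w) (h' : mangroveLE κ w t) : mangroveLE κ z t := by
  rcases mem_mangroveForcing_cases ht with rfl | ⟨p, hp, rfl⟩
  · exact .inl rfl
  · obtain ⟨q, hq, rfl, hpq⟩ := exists_of_mangroveLE_code hw h'
    obtain ⟨r, hr, rfl, hqr⟩ := exists_of_mangroveLE_code hz h
    exact mangroveLE_code.2 (hpq.trans hqr hp.2 hq.2 hr.2)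

end

/-! ### Definability of exchange and twins -/

section Definability
variable {M : Set ZFSet.{u}} [hM : Fact (IsTransitiveModelZFCMinus M)]
variable {X : Type*} [Coded.{u} X] [hX : CodedIn M X]
variable {κ : Ordinal.{u}} [hκ : InM M κ]
attribute [local instance] dfn_app dfn_app₂

instance dfn_isCondIn {P : X → MorassData.{u}} [hP : Dfn M P] : Dfn M fun x => IsCondIn M κ (P x) := by
  have h1 : Dfn M fun p : MorassData.{u} => p.IsCondition κ (succCardIn M κ) := dfn_isCondition dfn_succCardIn
  have h2 : Dfn M fun p : MorassData.{u} => IsCondIn M κ p :=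
    h1.congr fun p hp => propext ⟨fun h => h.2, fun h => ⟨hp, h⟩⟩
  exact h2.comp hP

theorem dfn_isSwap {a b : MorassData.{u}} [ha : InM M a] [hb : InM M b] :
    Dfn M fun z : MorassData.{u} × MorassData.{u} => IsSwap κ a b z.1 z.2 := by
  have hl : InM M (a.lam κ) := dfn_lam_const.inM a ha
  have e1 : Dfn M fun z : MorassData.{u} × MorassData.{u} => a.Extends κ z.1 :=
    dfn_extends' (P := fun _ => a)
  have e2 : Dfn M fun z : MorassData.{u} × MorassData.{u} => b.Extends κ z.2 :=
    dfn_extends' (P := fun _ => b)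
  have h1 : Dfn M fun z : MorassData.{u} × MorassData.{u} => ∀ x : MorassNode.{u}, InM M x →
      (a.lam κ ≤ x.1 → (z.1.Mem x ↔ z.2.Mem x)) := inferInstance
  have h2 : Dfn M fun z : MorassData.{u} × MorassData.{u} => ∀ x : MorassNode.{u}, InM M x →
      ∀ y : MorassNode.{u}, InM M y → (a.lam κ ≤ x.1 → (z.1.Lt x y ↔ z.2.Lt x y)) := inferInstance
  have h3 : Dfn M fun z : MorassData.{u} × MorassData.{u} => ∀ x : MorassNode.{u}, InM M x →
      ∀ y : MorassNode.{u}, InM M y → (z.1.Lt x y → a.lam κ ≤ x.1 → ∀ ν, ν ≤ x.2 → z.1.π x y ν = z.2.π x y ν) :=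
    inferInstance
  refine (dfn_and (hP := e1) (hQ := dfn_and (hP := e2) (hQ := dfn_and (hP := h1) (hQ := dfn_and (hP := h2)
    (hQ := h3))))).congr fun z hz => propext ⟨fun h => ⟨h.left, h.right, fun x _ => h.mem x, fun x _ y _ => h.lt x y,
      fun x _ y _ => h.maps x y⟩, ?_⟩
  rintro ⟨h1, h2, h3, h4, h5⟩
  obtain ⟨z1, z2⟩ := inM_prod.1 hz
  refine ⟨h1, h2, fun x hx => ⟨fun h => (h3 x (h.inM z1) hx).1 h, fun h => (h3 x (h.inM z2) hx).2 h⟩, fun x y hx =>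
    ⟨fun h => (h4 x (h.inM z1).1 y (h.inM z1).2 hx).1 h, fun h => (h4 x (h.inM z2).1 y (h.inM z2).2 hx).2 h⟩,
    fun x y h => h5 x (h.inM z1).1 y (h.inM z1).2 h⟩

theorem dfn_twins : Dfn M fun z : MorassData.{u} × MorassData.{u} => Twins κ z.1 z.2 := by
  have h1 : Dfn M fun z : MorassData.{u} × MorassData.{u} => ∀ β : Ordinal.{u}, InM M β →
      (z.1.Mem (κ, β) ↔ z.2.Mem (κ, β)) := inferInstance
  have h2 : Dfn M fun z : MorassData.{u} × MorassData.{u} =>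
    z.1.lam κ = z.2.lam κ ∧ z.1.theta (z.1.lam κ) = z.2.theta (z.1.lam κ) := inferInstance
  refine (dfn_and (hP := h2) (hQ := h1)).congr fun z hz => propext ⟨fun h => ⟨⟨h.lam_eq, h.theta_eq⟩, fun β _ =>
    Set.ext_iff.1 h.top_eq β⟩, fun h => ⟨h.1.1, h.1.2, Set.ext fun β => ?_⟩⟩
  obtain ⟨z1, z2⟩ := inM_prod.1 hz
  exact ⟨fun h' => (h.2 β (inM_prod.1 (Mem.inM h' z1)).2).1 h', fun h' => (h.2 β (inM_prod.1 (Mem.inM h' z2)).2).2 h'⟩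

end Definability

/-! ### The image of a generic filter under the exchange -/

/-- The image of a filter containing `a` under the isomorphism between the conditions below `a` and below `b`. -/
def swapFilter (M : Set ZFSet.{u}) (κ : Ordinal.{u}) (a b : MorassData.{u}) (G : Set ZFSet.{u}) : Set ZFSet.{u} :=
  {z | z ∈ mangroveForcing M κ ∧ ∃ r s, IsCondIn M κ r ∧ IsCondIn M κ s ∧ r.code ∈ G ∧ IsSwap κ a b r s ∧
    mangroveLE κ s.code z}

section Swap
variable {M : Set ZFSet.{u}} [hM : Fact (IsTransitiveModelZFCMinus M)]
variable {κ : Ordinal.{u}} [hκ : InM M κ] {a b r s : MorassData.{u}} {G : Set ZFSet.{u}} {z : ZFSet.{u}}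
attribute [local instance] dfn_app dfn_app₂

theorem IsCondIn.exists_isSwap (ha : IsCondIn M κ a) (hb : IsCondIn M κ b) (hab : Twins κ a b)
    (hr : IsCondIn M κ r) (har : a.Extends κ r) : ∃ s, IsCondIn M κ s ∧ IsSwap κ a b r s := by
  obtain ⟨s, h1, h2, h3⟩ := _root_.exists_isSwap ha.1 hb.1 hr.1 ha.2 hb.2 hr.2 hab har
  exact ⟨s, ⟨h1, h2⟩, h3⟩

theorem code_mem_swapFilter (hr : IsCondIn M κ r) (hs : IsCondIn M κ s) (hrG : r.code ∈ G) (h : IsSwap κ a b r s) :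
    s.code ∈ swapFilter M κ a b G :=
  ⟨code_mem_mangroveForcing.2 hs, r, s, hr, hs, hrG, h, mangroveLE_code.2 (Extends.refl hs.2)⟩

variable (hG : IsGeneric M (mangroveForcing M κ) (mangroveLE κ) G)
include hG

theorem exists_le_of_mem (haG : a.code ∈ G) (hz : z ∈ G) :
    ∃ r, IsCondIn M κ r ∧ r.code ∈ G ∧ a.Extends κ r ∧ mangroveLE κ r.code z := by
  obtain ⟨t, ht, h1, h2⟩ := hG.directed _ haG z hz
  obtain ⟨r, hr, rfl, h3⟩ := exists_of_mangroveLE_code (hG.subset ht) h1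
  exact ⟨r, hr, ht, h3, h2⟩

theorem code_mem_of_extends (hr : r.code ∈ G) (hs : IsCondIn M κ s) (h : s.Extends κ r) : s.code ∈ G :=
  hG.upward _ hr _ (code_mem_mangroveForcing.2 hs) (mangroveLE_code.2 h)

variable (ha : IsCondIn M κ a) (hb : IsCondIn M κ b) (hab : Twins κ a b) (haG : a.code ∈ G)
include ha hb hab haG

theorem target_mem_swapFilter : b.code ∈ swapFilter M κ a b G := by
  obtain ⟨s, hs, h⟩ := ha.exists_isSwap hb hab ha (Extends.refl ha.2)
  exact ⟨code_mem_mangroveForcing.2 hb, a, s, ha, hs, haG, h, mangroveLE_code.2 h.right⟩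

/-- Directedness comes from the fact that the exchange preserves the order. Given a dense class `D`,
consider the conditions below `a` whose image lies in `D` together with those incompatible with `a`.
This is a dense class of `M`, and `G`, which contains `a`, cannot meet it in a condition of the
second kind. -/
theorem isGeneric_swapFilter : IsGeneric M (mangroveForcing M κ) (mangroveLE κ) (swapFilter M κ a b G) where
  subset z hz := hz.1
  nonempty := ⟨_, target_mem_swapFilter hG ha hb hab haG⟩
  upward z hz w hw hzw := by
    obtain ⟨hz, r, s, hr, hs, hrG, h, h'⟩ := hz
    exact ⟨hw, r, s, hr, hs, hrG, h, mangroveLE_trans (code_mem_mangroveForcing.2 hs) hz hw h' hzw⟩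
  directed z hz w hw := by
    obtain ⟨hz, r, s, hr, hs, hrG, h, h'⟩ := hz
    obtain ⟨hw, r₁, s₁, hr₁, hs₁, hrG₁, h₁, h₁'⟩ := hw
    obtain ⟨t, ht, h2, h3⟩ := hG.directed _ hrG _ hrG₁
    obtain ⟨r₂, hr₂, rfl, h4⟩ := exists_of_mangroveLE_code (hG.subset ht) h2
    have h5 := mangroveLE_code.1 h3
    obtain ⟨s₂, hs₂, h₂⟩ := ha.exists_isSwap hb hab hr₂ (h.left.trans h4 ha.2 hr.2 hr₂.2)
    have hs₂' := code_mem_mangroveForcing.2 hs₂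
    exact ⟨_, code_mem_swapFilter hr₂ hs₂ ht h₂,
      mangroveLE_trans hs₂' (code_mem_mangroveForcing.2 hs) hz
        (mangroveLE_code.2 (h.extends hab hb.2 hr.2 hs.2 hr₂.2 hs₂.2 h₂ h4)) h',
      mangroveLE_trans hs₂' (code_mem_mangroveForcing.2 hs₁) hw
        (mangroveLE_code.2 (h₁.extends hab hb.2 hr₁.2 hs₁.2 hr₂.2 hs₂.2 h₂ h5)) h₁'⟩
  generic D hD hDd := by
    have hDM : Dfn M fun z => z ∈ D := dfn_of_isClassOf hD
    have haM := ha.1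
    have hbM := hb.1
    have hsw : Dfn M fun z : MorassData.{u} × MorassData.{u} => IsSwap κ a b z.1 z.2 := dfn_isSwap
    have d0 : Dfn M fun r : MorassData.{u} => a.Extends κ r := dfn_extends' (P := fun _ => a) (Q := fun r => r)
    have d1 : Dfn M fun r : MorassData.{u} => ∃ s : MorassData.{u}, InM M s ∧ (IsCondIn M κ s ∧ IsSwap κ a b r s ∧
        s.code ∈ D) := by
      have d2 : Dfn M fun z : MorassData.{u} × MorassData.{u} => z.2.code ∈ D :=
        hDM.comp (dfn_morassCode (P := fun z : MorassData.{u} × MorassData.{u} => z.2))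
      infer_instance
    have d3 : Dfn M fun r : MorassData.{u} => ∀ t : MorassData.{u}, InM M t → (IsCondIn M κ t →
        ¬ (r.Extends κ t ∧ a.Extends κ t)) := by
      have d4 : Dfn M fun z : MorassData.{u} × MorassData.{u} => a.Extends κ z.2 := d0.comp dfn_snd'
      infer_instance
    have dE : Dfn M fun z : ZFSet.{u} => ∃ r : MorassData.{u}, InM M r ∧ (z = r.code ∧ IsCondIn M κ r ∧
        ((a.Extends κ r ∧ ∃ s : MorassData.{u}, InM M s ∧ (IsCondIn M κ s ∧ IsSwap κ a b r s ∧ s.code ∈ D)) ∨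
          ∀ t : MorassData.{u}, InM M t → (IsCondIn M κ t → ¬ (r.Extends κ t ∧ a.Extends κ t)))) := by
      have d5 := d0.comp (dfn_snd' (M := M) (X := ZFSet.{u}) (Y := MorassData.{u}))
      have d6 := d1.comp (dfn_snd' (M := M) (X := ZFSet.{u}) (Y := MorassData.{u}))
      have d7 := d3.comp (dfn_snd' (M := M) (X := ZFSet.{u}) (Y := MorassData.{u}))
      infer_instance
    obtain ⟨e, he, heE⟩ := hG.generic _ (isClassOf_of_dfn dE) ⟨by
      rintro z ⟨-, r, -, rfl, hr, -⟩
      exact code_mem_mangroveForcing.2 hr, fun z hz => by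
      have key : ∀ q, IsCondIn M κ q → ∃ r, IsCondIn M κ r ∧ q.Extends κ r ∧
          ((a.Extends κ r ∧ ∃ s : MorassData.{u}, InM M s ∧ (IsCondIn M κ s ∧ IsSwap κ a b r s ∧ s.code ∈ D)) ∨
          ∀ t : MorassData.{u}, InM M t → (IsCondIn M κ t → ¬ (r.Extends κ t ∧ a.Extends κ t))) := by
        intro q hq
        by_cases h1 : ∃ t, IsCondIn M κ t ∧ q.Extends κ t ∧ a.Extends κ t
        · obtain ⟨t, ht, hqt, hat⟩ := h1
          obtain ⟨s, hs, h⟩ := ha.exists_isSwap hb hab ht hat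
          obtain ⟨d, hd, hds⟩ := hDd.2 _ (code_mem_mangroveForcing.2 hs)
          obtain ⟨s₁, hs₁, rfl, hss⟩ := exists_of_mangroveLE_code (hDd.1 hd) hds
          -- A condition of `D` below the image of `t` is exchanged back; the order being preserved,
          -- the result `r` is below `t`.
          obtain ⟨r, hr, h'⟩ := hb.exists_isSwap ha hab.symm hs₁ (h.right.trans hss hb.2 hs.2 hs₁.2)
          have h2 := (h.symm hab).extends hab.symm ha.2 hs.2 ht.2 hs₁.2 hr.2 h' hss
          exact ⟨r, hr, hqt.trans h2 hq.2 ht.2 hr.2, .inl ⟨h'.right, s₁, hs₁.1, hs₁, h'.symm hab.symm, hd⟩⟩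
        · exact ⟨q, hq, Extends.refl hq.2, .inr fun t _ ht h => h1 ⟨t, ht, h⟩⟩
      rcases mem_mangroveForcing_cases hz with rfl | ⟨q, hq, rfl⟩
      · obtain ⟨r, hr, -, h⟩ := key a ha
        exact ⟨r.code, ⟨hr.1.1, r, hr.1, rfl, hr, h⟩, .inl rfl⟩
      · obtain ⟨r, hr, h', h⟩ := key q hq
        exact ⟨r.code, ⟨hr.1.1, r, hr.1, rfl, hr, h⟩, mangroveLE_code.2 h'⟩⟩
    obtain ⟨-, r, -, rfl, hr, ⟨-, s, -, hs, h, hsD⟩ | h⟩ := heE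
    · exact ⟨s.code, code_mem_swapFilter hr hs he h, hsD⟩
    · obtain ⟨t, ht, htG, h1, h2⟩ := exists_le_of_mem hG haG he
      exact absurd ⟨mangroveLE_code.1 h2, h1⟩ (h t ht.1 ht)

/-- The relation `IsSwap` is symmetric for twins and respects the order, so exchanging twice leads
to conditions weaker than elements of `G`. By this lemma one inclusion between the generic
extensions is enough. -/
theorem swapFilter_swapFilter : swapFilter M κ b a (swapFilter M κ a b G) = G := by
  ext z
  constructor
  · rintro ⟨hz, s, r, hs, hr, ⟨-, r₁, s₁, hr₁, hs₁, hrG, h₁, hle⟩, h, hrz⟩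
    have h1 := h.extends hab.symm ha.2 hs.2 hr.2 hs₁.2 hr₁.2 (h₁.symm hab) (mangroveLE_code.1 hle)
    exact hG.upward _ (code_mem_of_extends hG hrG hr h1) _ hz hrz
  · intro hz
    obtain ⟨r, hr, hrG, har, hrz⟩ := exists_le_of_mem hG haG hz
    obtain ⟨s, hs, h⟩ := ha.exists_isSwap hb hab hr har
    exact ⟨hG.subset hz, s, r, hs, hr, code_mem_swapFilter hr hs hrG h, h.symm hab, hrz⟩

end Swap

open MorassData

/-! ### Check names -/

section Names
variable {M : Set ZFSet.{u}} [hM : Fact (IsTransitiveModelZFCMinus M)] {G : Set ZFSet.{u}}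
attribute [local instance] dfn_app dfn_app₂

theorem exists_dfn_rec {X Y : Type*} [Coded.{u} X] [CodedIn M X] [Coded.{u} Y] [CodedIn M Y]
    (P : X → ZFSet.{u}) [hP : Dfn M P] (ρ : X → Ordinal.{u})
    (hρ : ∀ x y, Coded.code y ∈ P x → ρ y < ρ x) (F : X → ZFSet.{u} → Y)
    [hF : Dfn M fun z : X × ZFSet.{u} => F z.1 z.2] :
    ∃ G : X → Y, Dfn M G ∧ ∀ x, G x = F x (img (fun y : X => Coded.code (y, G y)) (P x)) := by
  let body : ∀ x, (∀ y, ρ y < ρ x → Y) → Y := fun x ih => F x (ZFSet.range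
    fun z : {z : P x // ∃ y : X, Coded.code y = (z : ZFSet.{u})} => Coded.code (z.2.choose,
      ih z.2.choose (hρ x _ (by rw [z.2.choose_spec]; exact z.1.2))))
  let G : X → Y := (InvImage.wf ρ (wellFounded_lt (α := Ordinal.{u}))).fix body
  have hG : ∀ x, G x = F x (img (fun y : X => Coded.code (y, G y)) (P x)) := fun x =>
    (InvImage.wf ρ (wellFounded_lt (α := Ordinal.{u}))).fix_eq body x
  exact ⟨G, dfn_rec P ρ hρ F G hG, hG⟩

/-- The name of `x` consists of the pairs of the names of its elements with the maximum `∅` of the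
forcing, and its value is `x` by induction. -/
theorem subset_genericExtension (hG : ∅ ∈ G) : M ⊆ genericExtension M G := by
  have h1 : Dfn M fun z : ZFSet.{u} × ZFSet.{u} => img (fun w : ZFSet.{u} × ZFSet.{u} => ZFSet.pair w.2 ∅) z.2 := by
    have h2 : Dfn M fun w : (ZFSet.{u} × ZFSet.{u}) × (ZFSet.{u} × ZFSet.{u}) => ZFSet.pair w.2.2 ∅ := inferInstance
    exact dfn_img (A := fun z : ZFSet.{u} × ZFSet.{u} => z.2)
      (F := fun (_ : ZFSet.{u} × ZFSet.{u}) (w : ZFSet.{u} × ZFSet.{u}) => ZFSet.pair w.2 ∅)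
  obtain ⟨c, hc, hcx⟩ := exists_dfn_rec (fun x : ZFSet.{u} => x) ZFSet.rank (fun x y h => ZFSet.rank_lt_of_mem h)
    (fun _ g => img (fun w : ZFSet.{u} × ZFSet.{u} => ZFSet.pair w.2 ∅) g) (hF := h1)
  have hmem : ∀ x τ q, ZFSet.pair τ q ∈ c x ↔ ∃ y ∈ x, τ = c y ∧ q = ∅ := by
    intro x τ q
    rw [hcx, mem_img]
    constructor
    · rintro ⟨w, h, h'⟩
      obtain ⟨y, h3, h4⟩ := mem_img.1 h
      obtain rfl := code_injective h4
      obtain ⟨h5, h6⟩ := ZFSet.pair_injective h'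
      exact ⟨y, h3, h5, h6⟩
    · rintro ⟨y, hy, rfl, rfl⟩
      exact ⟨(y, c y), mem_img.2 ⟨y, hy, rfl⟩, rfl⟩
  have hval : ∀ x, nameVal G (c x) = x := by
    intro x
    induction x using ZFSet.inductionOn with
    | _ x ih =>
      ext y
      rw [mem_nameVal]
      constructor
      · rintro ⟨σ, q, hq, h, rfl⟩
        obtain ⟨z, hz, rfl, -⟩ := (hmem _ _ _).1 h
        rwa [ih z hz]
      · exact fun hy => ⟨c y, ∅, hG, (hmem _ _ _).2 ⟨y, hy, rfl, rfl⟩, (ih y hy).symm⟩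
  exact fun x hx => ⟨c x, (hc.inM x ⟨hx⟩).1, hval x⟩

end Names

/-! ### Translation of names and equality of the generic extensions -/

/-- The conditions `r` that replace `s` in the names for the filter `G` when passing from the filter
`swapFilter M κ a b G` to `G`. -/
def Replaces (M : Set ZFSet.{u}) (κ : Ordinal.{u}) (a b : MorassData.{u}) (r s : ZFSet.{u}) : Prop :=
  (s = ∅ ∧ r = a.code) ∨ ∃ R : MorassData.{u}, InM M R ∧ ∃ S : MorassData.{u}, InM M S ∧ ∃ S' : MorassData.{u},
    InM M S' ∧ (IsCondIn M κ R ∧ IsCondIn M κ S ∧ IsCondIn M κ S' ∧ r = R.code ∧ s = S.code ∧ IsSwap κ a b R S' ∧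
      S.Extends κ S' ∧ ∀ β : Ordinal.{u}, InM M β → (R.Mem (κ, β) → ∃ γ : Ordinal.{u}, InM M γ ∧
        (β ≤ γ ∧ (a.Mem (κ, γ) ∨ S.Mem (κ, γ)))))

section Names
variable {M : Set ZFSet.{u}} [hM : Fact (IsTransitiveModelZFCMinus M)]
variable {κ : Ordinal.{u}} {a b : MorassData.{u}} {G : Set ZFSet.{u}} {r s : ZFSet.{u}}
attribute [local instance] dfn_app dfn_app₂

theorem dfn_replaces [hκ : InM M κ] [haM : InM M a] [hbM : InM M b] :
    Dfn M fun z : ZFSet.{u} × ZFSet.{u} => Replaces M κ a b z.1 z.2 := by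
  have h1 : Dfn M fun z : MorassData.{u} × MorassData.{u} => IsSwap κ a b z.1 z.2 := dfn_isSwap
  have h2 : Dfn M fun z : MorassData.{u} × MorassData.{u} => ∀ β : Ordinal.{u}, InM M β → (z.1.Mem (κ, β) →
      ∃ γ : Ordinal.{u}, InM M γ ∧ (β ≤ γ ∧ (a.Mem (κ, γ) ∨ z.2.Mem (κ, γ)))) := by
    have h3 : Dfn M fun w : ((MorassData.{u} × MorassData.{u}) × Ordinal.{u}) × Ordinal.{u} => a.Mem (κ, w.2) :=
      dfn_Mem_const.comp (dfn_pair (F := fun _ : ((MorassData.{u} × MorassData.{u}) × Ordinal.{u}) × Ordinal.{u} => κ)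
        (G := fun w => w.2))
    infer_instance
  have h5 : Dfn M fun z : (((ZFSet.{u} × ZFSet.{u}) × MorassData.{u}) × MorassData.{u}) × MorassData.{u} =>
      ∀ β : Ordinal.{u}, InM M β → (z.1.1.2.Mem (κ, β) →
      ∃ γ : Ordinal.{u}, InM M γ ∧ (β ≤ γ ∧ (a.Mem (κ, γ) ∨ z.1.2.Mem (κ, γ)))) :=
    h2.comp (G := fun z : (((ZFSet.{u} × ZFSet.{u}) × MorassData.{u}) × MorassData.{u}) × MorassData.{u} =>
      (z.1.1.2, z.1.2)) inferInstance
  unfold Replaces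
  infer_instance

/-- This is the purpose of the bound on level `κ` in `Replaces`: without it the replacing conditions
might form a proper class, and translated names would not be sets. -/
theorem exists_replaces_set (hκ : IsRegularUncountableIn M κ) (hpow : ∀ α < κ, HasPowersetIn M α.toZFSet)
    (ha : IsCondIn M κ a) (hb : IsCondIn M κ b) (hs : s ∈ M) : ∃ w ∈ M, ∀ r, r ∈ w ↔ Replaces M κ a b r s := by
  have hκM : InM M κ := ⟨hκ.1⟩
  have haM := ha.1
  have hbM := hb.1
  have hsM : InM M s := ⟨hs⟩
  by_cases h0 : s = ∅
  · refine ⟨{a.code}, singleton_mem_M ha.1.1, fun r => ?_⟩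
    rw [ZFSet.mem_singleton]
    refine ⟨fun h => .inl ⟨h0, h⟩, ?_⟩
    rintro (h | ⟨R, -, S, -, S', -, -, -, -, -, h, -⟩)
    exacts [h.2, absurd (h.symm.trans h0) S.code_ne_empty]
  by_cases h1 : ∃ S, IsCondIn M κ S ∧ s = S.code
  · obtain ⟨S, hS, rfl⟩ := h1
    have hA := (smallIn_topSet hκ ha.1 ha.2).union hκ (smallIn_topSet hκ hS.1 hS.2)
    have hK : ∀ p : MorassData.{u}, IsCondIn M κ p → ∀ β ∈ p.top κ, β ∈ succCardIn M κ := fun p hp β hβ => by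
      rcases hp.2.nodes _ hβ with h | h
      · exact absurd h.1 (not_le.2 hp.2.lam_lt)
      · exact h.2
    obtain ⟨W, hW, h2⟩ := exists_bounded_conditions (K := succCardIn M κ) hκ hpow hA fun z hz => by
      rcases ZFSet.mem_union.1 hz with h | h
      · obtain ⟨β, h3, rfl⟩ := (mem_topSet ha.2.wellFormed).1 h
        exact ⟨β, hK a ha β h3, rfl⟩
      · obtain ⟨β, h3, rfl⟩ := (mem_topSet hS.2.wellFormed).1 h
        exact ⟨β, hK S hS β h3, rfl⟩
    have h3 : Dfn M fun r : ZFSet.{u} => Replaces M κ a b r S.code :=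
      dfn_replaces.comp (dfn_pair (F := fun r : ZFSet.{u} => r) (G := fun _ => S.code))
    refine ⟨_, sep_mem_M h3 hW, fun r => ?_⟩
    rw [ZFSet.mem_sep]
    refine and_iff_right_of_imp ?_
    rintro (h | ⟨R, -, S₁, -, S', -, hR, -, -, rfl, h, -, -, h4⟩)
    · exact absurd h.1 S.code_ne_empty
    obtain rfl := code_inj h
    refine h2 R hR.1 hR.2 fun β hβ => ?_
    obtain ⟨γ, -, h5, h6⟩ := h4 β (inM_prod.1 (Mem.inM hβ hR.1)).2 hβ
    -- `exists_bounded_conditions` asks for a strict bound, available because tops are closed under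
    -- successors.
    refine ⟨γ + 1, ?_, Order.lt_add_one_iff.2 h5⟩
    rw [ZFSet.mem_union]
    rcases h6 with h6 | h6
    · exact .inl ((mem_topSet ha.2.wellFormed).2 ⟨_, (ha.2.top_succ γ).1 h6, rfl⟩)
    · exact .inr ((mem_topSet hS.2.wellFormed).2 ⟨_, (hS.2.top_succ γ).1 h6, rfl⟩)
  · refine ⟨∅, empty_mem_M, fun r => ⟨fun h => absurd h (ZFSet.notMem_empty _), ?_⟩⟩
    rintro (h | ⟨R, -, S, -, S', -, -, hS, -, -, h, -⟩)
    exacts [absurd h.1 h0, absurd ⟨S, hS, h⟩ h1]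

variable (hG : IsGeneric M (mangroveForcing M κ) (mangroveLE κ) G)
include hG

theorem empty_mem_of_isGeneric : ∅ ∈ G := by
  obtain ⟨z, hz⟩ := hG.nonempty
  exact hG.upward z hz _ ⟨empty_mem_M, .inl rfl⟩ (.inl rfl)

variable [hκM : InM M κ]
variable (ha : IsCondIn M κ a) (hb : IsCondIn M κ b) (hab : Twins κ a b) (haG : a.code ∈ G)
include ha hb hab haG

theorem mem_swapFilter_of_replaces (hr : r ∈ G) (h : Replaces M κ a b r s) : s ∈ swapFilter M κ a b G := by
  rcases h with ⟨rfl, -⟩ | ⟨R, -, S, -, S', -, hR, hS, hS', rfl, rfl, h, h', -⟩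
  · exact empty_mem_of_isGeneric (isGeneric_swapFilter hG ha hb hab haG)
  · exact ⟨code_mem_mangroveForcing.2 hS, R, S', hR, hS', hr, h, mangroveLE_code.2 h'⟩

/-- The condition `R` in `G` that witnesses membership may have nodes of level `κ` beyond the tops
of `a` and `S`. Cutting it at the initial segment `C` generated by these tops weakens it, so that it
stays in `G`. The same cut applied to its image keeps it below `S`, and the two cuts still
correspond under the exchange. -/
theorem exists_replaces (hs : s ∈ swapFilter M κ a b G) : ∃ r ∈ G, Replaces M κ a b r s := by
  obtain ⟨hs, R, S', hR, hS', hRG, h, hle⟩ := hs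
  rcases mem_mangroveForcing_cases hs with rfl | ⟨S, hS, rfl⟩
  · exact ⟨a.code, haG, .inl ⟨rfl, rfl⟩⟩
  have haM := ha.1
  have hSM := hS.1
  have hin : ∀ p : MorassData.{u}, InM M p → ∀ γ, p.Mem (κ, γ) → InM M γ := fun p hp γ h => (inM_prod.1 (h.inM hp)).2
  let C : Set Ordinal.{u} := {β | ∃ γ, β ≤ γ ∧ (a.Mem (κ, γ) ∨ S.Mem (κ, γ))}
  have hC : Dfn M fun β => β ∈ C := by
    have h1 : ∀ p : MorassData.{u}, InM M p → Dfn M fun z : Ordinal.{u} × Ordinal.{u} => p.Mem (κ, z.2) := fun p hp =>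
      dfn_Mem_const.comp (dfn_pair (F := fun _ : Ordinal.{u} × Ordinal.{u} => κ) (G := fun w => w.2))
    have h2 := h1 a haM
    have h3 := h1 S hSM
    exact dfn_ex (R := fun β γ : Ordinal.{u} => β ≤ γ ∧ (a.Mem (κ, γ) ∨ S.Mem (κ, γ))) inferInstance
      fun β γ _ h => h.2.elim (hin a haM γ) (hin S hSM γ)
  have hC0 : 0 ∈ C := ⟨0, le_rfl, .inl ha.2.top_zero⟩
  have hCd : ∀ β ∈ C, ∀ γ ≤ β, γ ∈ C := fun β ⟨δ, h1, h2⟩ γ hγ => ⟨δ, hγ.trans h1, h2⟩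
  have hCs : ∀ β ∈ C, β + 1 ∈ C := fun β ⟨δ, h1, h2⟩ => ⟨δ + 1, by gcongr,
    h2.imp (ha.2.top_succ δ).1 (hS.2.top_succ δ).1⟩
  obtain ⟨R₁, h1, h2, hRR⟩ := exists_isCut hR.1 hR.2 hC hC0 hCd hCs
  obtain ⟨S₁, h3, h4, hSS⟩ := exists_isCut hS'.1 hS'.2 hC hC0 hCd hCs
  refine ⟨R₁.code, code_mem_of_extends hG hRG ⟨h1, h2⟩ (hRR.extends hR.2), .inr ⟨R₁, h1, S, hS.1, S₁, h3, ⟨h1, h2⟩, hS,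
    ⟨h3, h4⟩, rfl, rfl, h.cut hab hRR hSS ha.2 hb.2 fun β hβ => ⟨β, le_rfl, .inl hβ⟩,
    (mangroveLE_code.1 hle).cut hSS hS.2 fun β hβ => ⟨β, le_rfl, .inr hβ⟩, fun β _ hβ => ?_⟩⟩
  obtain ⟨γ, h5, h6⟩ := hRR.top_subset hβ
  exact ⟨γ, h6.elim (hin a haM γ) (hin S hSM γ), h5, h6⟩

/-- A name `x` is translated to the set `T x` of all `⟨T σ, r⟩` such that `⟨σ, s⟩ ∈ x` and `r`
replaces `s`. A condition `s` belongs to the new filter exactly if some `r ∈ G` replaces it, so `G`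
evaluates `T x` as the new filter evaluates `x`. -/
theorem genericExtension_swapFilter_subset (hκ : IsRegularUncountableIn M κ)
    (hpow : ∀ α < κ, HasPowersetIn M α.toZFSet) :
    genericExtension M (swapFilter M κ a b G) ⊆ genericExtension M G := by
  have haM := ha.1
  have hbM := hb.1
  have hex : ∀ s, ∃ w, s ∈ M → w ∈ M ∧ ∀ r, r ∈ w ↔ Replaces M κ a b r s := fun s => by
    by_cases hs : s ∈ M
    · obtain ⟨w, h1, h2⟩ := exists_replaces_set hκ hpow ha hb hs
      exact ⟨w, fun _ => ⟨h1, h2⟩⟩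
    · exact ⟨∅, fun h => absurd h hs⟩
  choose W hW using hex
  have hWM : Dfn M W := dfn_set_of_ext (R := fun s r => Replaces M κ a b r s)
    (dfn_replaces.comp (dfn_pair (F := fun z : ZFSet.{u} × ZFSet.{u} => z.2) (G := fun z => z.1)))
    (fun s hs => (hW s hs.1).1) fun s r hs _ => (hW s hs.1).2 r
  -- The names occurring in `x`, along which the recursion runs.
  let P : ZFSet.{u} → ZFSet.{u} := fun x =>
    ZFSet.sep (fun σ => ∃ s, InM M s ∧ ZFSet.pair σ s ∈ x) (ZFSet.sUnion (ZFSet.sUnion x))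
  have hP : Dfn M P := dfn_sep (A := fun x => ZFSet.sUnion (ZFSet.sUnion x))
    (R := fun x σ => ∃ s, InM M s ∧ ZFSet.pair σ s ∈ x)
    (hA := dfn_sUnion (A := fun x => ZFSet.sUnion x) (hA := dfn_sUnion (A := fun x => x)))
  -- `g` stands for the graph of `T` on the names occurring in `x`. The product only serves as a set
  -- from which to separate.
  let F : ZFSet.{u} → ZFSet.{u} → ZFSet.{u} := fun x g =>
    ZFSet.sep (fun w => ∃ σ : ZFSet.{u}, InM M σ ∧ ∃ τ : ZFSet.{u}, InM M τ ∧ ∃ s : ZFSet.{u}, InM M s ∧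
      ∃ r : ZFSet.{u}, InM M r ∧ (w = ZFSet.pair τ r ∧ ZFSet.pair σ s ∈ x ∧ ZFSet.pair σ τ ∈ g ∧ r ∈ W s))
      (ZFSet.prod (ZFSet.sUnion (ZFSet.sUnion g)) (ZFSet.sUnion (img W (ZFSet.sUnion (ZFSet.sUnion x)))))
  have hF : Dfn M fun z : ZFSet.{u} × ZFSet.{u} => F z.1 z.2 := by
    have h1 : Dfn M fun w : (((((ZFSet.{u} × ZFSet.{u}) × ZFSet.{u}) × ZFSet.{u}) × ZFSet.{u}) × ZFSet.{u}) × ZFSet.{u} =>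
      w.2 ∈ W w.1.2 := inferInstance
    have h2 : Dfn M fun z : ZFSet.{u} × ZFSet.{u} => img W (ZFSet.sUnion (ZFSet.sUnion z.1)) :=
      dfn_img (A := fun z : ZFSet.{u} × ZFSet.{u} => ZFSet.sUnion (ZFSet.sUnion z.1)) (F := fun _ => W)
        (hF := hWM.comp dfn_snd')
    exact (inferInstance : Dfn M fun z : ZFSet.{u} × ZFSet.{u} => ZFSet.sep (fun w => ∃ σ : ZFSet.{u}, InM M σ ∧
      ∃ τ : ZFSet.{u}, InM M τ ∧ ∃ s : ZFSet.{u}, InM M s ∧ ∃ r : ZFSet.{u}, InM M r ∧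
        (w = ZFSet.pair τ r ∧ ZFSet.pair σ s ∈ z.1 ∧ ZFSet.pair σ τ ∈ z.2 ∧ r ∈ W s))
      (ZFSet.prod (ZFSet.sUnion (ZFSet.sUnion z.2)) (ZFSet.sUnion (img W (ZFSet.sUnion (ZFSet.sUnion z.1))))))
  obtain ⟨T, hT, hTx⟩ := exists_dfn_rec (M := M) P ZFSet.rank (fun x y h => by
    obtain ⟨-, s, -, h1⟩ := ZFSet.mem_sep.1 h
    exact rank_lt_of_pair_mem h1) F
  have hfst : ∀ {u v w : ZFSet.{u}}, ZFSet.pair u v ∈ w → u ∈ ZFSet.sUnion (ZFSet.sUnion w) ∧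
      v ∈ ZFSet.sUnion (ZFSet.sUnion w) := fun {u v w} h => by
    have h1 : ({u, v} : ZFSet.{u}) ∈ ZFSet.sUnion w := ZFSet.mem_sUnion.2 ⟨_, h, ZFSet.mem_pair.2 (.inr rfl)⟩
    exact ⟨ZFSet.mem_sUnion.2 ⟨_, h1, ZFSet.mem_pair.2 (.inl rfl)⟩,
      ZFSet.mem_sUnion.2 ⟨_, h1, ZFSet.mem_pair.2 (.inr rfl)⟩⟩
  have hmem : ∀ x ∈ M, ∀ τ r, ZFSet.pair τ r ∈ T x ↔
      ∃ σ s, ZFSet.pair σ s ∈ x ∧ τ = T σ ∧ Replaces M κ a b r s := by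
    intro x hx τ r
    rw [hTx, ZFSet.mem_sep]
    constructor
    · rintro ⟨-, σ, hσ, τ', -, s, hs, r', -, h1, h2, h3, h4⟩
      obtain ⟨rfl, rfl⟩ := ZFSet.pair_injective h1
      obtain ⟨y, -, h5⟩ := mem_img.1 h3
      obtain ⟨rfl, rfl⟩ := ZFSet.pair_injective h5
      exact ⟨_, s, h2, rfl, ((hW s hs.1).2 _).1 h4⟩
    · rintro ⟨σ, s, h1, rfl, h2⟩
      have h3 := pair_mem_M_iff.1 (mem_trans_M hx h1)
      have h4 := (hW s h3.2).1
      have h5 := ((hW s h3.2).2 r).2 h2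
      have h6 : ZFSet.pair σ (T σ) ∈ img (fun y : ZFSet.{u} => Coded.code (y, T y)) (P x) :=
        mem_img.2 ⟨σ, ZFSet.mem_sep.2 ⟨(hfst h1).1, s, ⟨h3.2⟩, h1⟩, rfl⟩
      exact ⟨ZFSet.pair_mem_prod.2 ⟨(hfst h6).2, ZFSet.mem_sUnion.2 ⟨_, mem_img.2 ⟨s, (hfst h1).2, rfl⟩, h5⟩⟩,
        σ, ⟨h3.1⟩, T σ, hT.inM σ ⟨h3.1⟩, s, ⟨h3.2⟩, r, ⟨mem_trans_M h4 h5⟩, rfl, h1, h6, h5⟩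
  have hval : ∀ ρ : Ordinal.{u}, ∀ x ∈ M, x.rank = ρ → nameVal G (T x) = nameVal (swapFilter M κ a b G) x := by
    intro ρ
    induction ρ using WellFoundedLT.induction with
    | ind ρ ih =>
      rintro x hx rfl
      ext y
      rw [mem_nameVal, mem_nameVal]
      constructor
      · rintro ⟨τ, r, hr, h, rfl⟩
        obtain ⟨σ, s, h1, rfl, h2⟩ := (hmem x hx _ _).1 h
        exact ⟨σ, s, mem_swapFilter_of_replaces hG ha hb hab haG hr h2, h1,
          ih _ (rank_lt_of_pair_mem h1) σ (pair_mem_M_iff.1 (mem_trans_M hx h1)).1 rfl⟩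
      · rintro ⟨σ, s, hs, h, rfl⟩
        obtain ⟨r, hr, h2⟩ := exists_replaces hG ha hb hab haG hs
        exact ⟨T σ, r, hr, (hmem x hx _ _).2 ⟨σ, s, h, rfl, h2⟩,
          (ih _ (rank_lt_of_pair_mem h) σ (pair_mem_M_iff.1 (mem_trans_M hx h)).1 rfl).symm⟩
  rintro _ ⟨x, hx, rfl⟩
  exact ⟨T x, (hT.inM x ⟨hx⟩).1, hval _ x hx rfl⟩

theorem genericExtension_swapFilter (hκ : IsRegularUncountableIn M κ)
    (hpow : ∀ α < κ, HasPowersetIn M α.toZFSet) :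
    genericExtension M (swapFilter M κ a b G) = genericExtension M G := by
  refine (genericExtension_swapFilter_subset hG ha hb hab haG hκ hpow).antisymm ?_
  have h := genericExtension_swapFilter_subset (isGeneric_swapFilter hG ha hb hab haG) hb ha hab.symm
    (target_mem_swapFilter hG ha hb hab haG) hκ hpow
  rwa [swapFilter_swapFilter hG ha hb hab haG] at h

end Names

/-! ### Choice of the twins and conclusion -/

section
variable {M : Set ZFSet.{u}} [hM : Fact (IsTransitiveModelZFCMinus M)] {κ : Ordinal.{u}} {p : MorassData.{u}}
  {G : Set ZFSet.{u}}
attribute [local instance] dfn_app dfn_app₂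

/-- Some element of `G` has a twin which extends `p`. -/
theorem exists_twin_mem (hκ : IsRegularUncountableIn M κ) (hG : IsGeneric M (mangroveForcing M κ) (mangroveLE κ) G)
    (hp : IsCondIn M κ p) :
    ∃ a b, IsCondIn M κ a ∧ IsCondIn M κ b ∧ a.code ∈ G ∧ p.Extends κ b ∧ Twins κ a b := by
  have hκM : InM M κ := ⟨hκ.1⟩
  have hpM := hp.1
  have h1 : Dfn M fun z : MorassData.{u} × MorassData.{u} => Twins κ z.1 z.2 := dfn_twins
  have h2 : Dfn M fun z : (ZFSet.{u} × MorassData.{u}) × MorassData.{u} => p.Extends κ z.2 :=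
    dfn_extends' (P := fun _ => p)
  have h3 : Dfn M fun z : ZFSet.{u} => ∃ a : MorassData.{u}, InM M a ∧ ∃ b : MorassData.{u}, InM M b ∧
    (z = a.code ∧ IsCondIn M κ a ∧ IsCondIn M κ b ∧ p.Extends κ b ∧ Twins κ a b) := inferInstance
  -- The conditions that have a twin below `p` form a class of `M`, dense by `exists_twins`.
  obtain ⟨z, hz, -, a, -, b, -, rfl, ha, hb, h⟩ := hG.generic _ (isClassOf_of_dfn h3) ⟨by
    rintro z ⟨-, a, -, b, -, rfl, ha, -⟩
    exact code_mem_mangroveForcing.2 ha, fun z hz => by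
    have key : ∀ q, IsCondIn M κ q → ∃ a b, IsCondIn M κ a ∧ IsCondIn M κ b ∧ q.Extends κ a ∧ p.Extends κ b ∧
        Twins κ a b := fun q hq => by
      obtain ⟨a, b, h1, h2, h3, h4, h5⟩ := exists_twins hκ hq.1 hp.1 hq.2 hp.2
      exact ⟨a, b, ⟨h1, h3⟩, ⟨h2, h4⟩, h5⟩
    rcases mem_mangroveForcing_cases hz with rfl | ⟨q, hq, rfl⟩
    · obtain ⟨a, b, ha, hb, -, h⟩ := key p hp
      exact ⟨a.code, ⟨ha.1.1, a, ha.1, b, hb.1, rfl, ha, hb, h⟩, .inl rfl⟩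
    · obtain ⟨a, b, ha, hb, h', h⟩ := key q hq
      exact ⟨a.code, ⟨ha.1.1, a, ha.1, b, hb.1, rfl, ha, hb, h⟩, mangroveLE_code.2 h'⟩⟩
  exact ⟨a, b, ha, hb, hz, h⟩

end

theorem mainTheorem5 (M : Set ZFSet.{u}) (hM : IsTransitiveModelZFCMinus M)
    (κ : Ordinal.{u}) (hκ : IsRegularUncountableIn M κ)
    (hpow : ∀ α < κ, HasPowersetIn M α.toZFSet)
    (G : Set ZFSet.{u}) (hG : IsGeneric M (mangroveForcing M κ) (mangroveLE κ) G)
    (p : ZFSet.{u}) (hp : p ∈ mangroveForcing M κ) :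
    ∃ G' : Set ZFSet.{u}, G' ⊆ genericExtension M G ∧
      IsGeneric M (mangroveForcing M κ) (mangroveLE κ) G' ∧
      p ∈ G' ∧
      genericExtension M G' = genericExtension M G := by
  have : Fact (IsTransitiveModelZFCMinus M) := ⟨hM⟩
  have : InM M κ := ⟨hκ.1⟩
  -- Any filter on the forcing consists of elements of `M`, hence is contained in every generic
  -- extension of `M`.
  have hMG : mangroveForcing M κ ⊆ genericExtension M G := fun z hz =>
    subset_genericExtension (empty_mem_of_isGeneric hG) hz.1
  rcases mem_mangroveForcing_cases hp with rfl | ⟨q, hq, rfl⟩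
  · exact ⟨G, hG.subset.trans hMG, hG, empty_mem_of_isGeneric hG, rfl⟩
  · obtain ⟨a, b, ha, hb, haG, hqb, hab⟩ := exists_twin_mem hκ hG hq
    have hG' := isGeneric_swapFilter hG ha hb hab haG
    exact ⟨_, hG'.subset.trans hMG, hG',
      code_mem_of_extends hG' (target_mem_swapFilter hG ha hb hab haG) hq hqb,
      genericExtension_swapFilter hG ha hb hab haG hκ hpow⟩
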